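/- Let $q\in\mathbb C$ be a root of unity with $\delta=q+q^{-1}\ge 0$, let $l$ be the least positive integer with $q^{2l}=1$, and assume $l\ge 2$. Let $TL_\infty=TL_\infty(\delta)=\bigcup_n TL_n$ be the infinite Temperley–Lieb algebra over $\mathbb C$, with generators $e_i$ ($i\ge1$) and relations $e_i^2=\delta e_i$, $e_ie_{i\pm1}e_i=e_i$, $e_ie_j=e_je_i$ for $|i-j|>1$; $TL_n$ is generated by $e_1,\dots,e_{n-1}$, and $J(TL_n)$ is its Jacobson radical. Let $\dagger$ be the linear reflection of diagrams about a horizontal line and $*$ its conjugate linear version. *Matrix decomposition.* The Bratteli diagram of the irreducibles has, from a vertex of level $n$ with $m=n-2p$ through strands, one edge to the vertex of level $n+1$ with $m+1$ through strands; if $m\ge1$, then $0$, $2$ or $1$ edges to the one with $m-1$ through strands, according as $l\mid m+1$, $l\mid m$, or neither; and one edge to the one with $m+1-2l$ through strands if $l\mid m+2$ and $m+1\ge 2l$. A system of fusion rules consists of elements $P_m\in TL_m$ with $P_0=P_1=1$, and, for each edge $\epsilon$ from $m$ to $j$ through strands, a combination $F_\epsilon$ of diagrams from $j$ to $m+1$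 strands with real or with purely imaginary coefficients, such that $F_\epsilon=P_{m+1}$ for the edge to $m+1$, $F_\epsilon P_j=F_\epsilon$, $F_\epsilon^\dagger F_{\epsilon}=P_j$, $F_\epsilon^\dagger F_{\epsilon'}=0$ for distinct edges $\epsilon,\epsilon'$ leaving $m$, and $\sum_\epsilon F_\epsilon F_\epsilon^\dagger=P_m\otimes 1$. Composing fusion rules along a path $\pi$ from the vertex of level $1$ to level $n$ gives a half diagram $F_\pi$; for two paths $\pi,\sigma$ with the same end put $v_{\pi\sigma}=F_\pi F_\sigma^\dagger\in TL_n$, and let $TL_n^S$ be the subalgebra generated by the $v_{\pi\sigma}$ of level $n$. Systems of fusion rules exist, and for each of them the following holds. 1. For every $n\ge 1$ the $v_{\pi\sigma}$ of level $n$ are a basis of $TL_n^S$ and multiply as matrix units, $TL_n=TL_n^S\oplus J(TL_n)$, $TL_n^S\subset TL_{n+1}^S$, and $v_{\pi\sigma}^*=\pm v_{\sigma\pi}$. 2. There is a unique conjugate linear map $\diamond$ on $\bigcup_n TL_n^S$ with $v_{\pi\sigma}^\diamond=v_{\sigma\pi}$ for all $\pi,\sigma$. It is an involution: $s^{\diamond\diamond}=s$,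 $(st)^\diamond=t^\diamond s^\diamond$. If $l=2$ (i.e. $\delta=0$), then $\bigcup_nTL_n^S=TL_\infty$. 3. For $y\in TL_\infty$ and $n$ with $y\in TL_n$ let $y_n$ be the component of $y$ in $TL_n^S$. For a trace $\chi$ put $\chi(xy^\diamond):=\lim_n\chi(x\,y_n^\diamond)$ when the limit exists, and call $\chi$ positive with respect to $\diamond$ if $\chi(xx^\diamond)$ exists and is $>0$ for all $0\ne x\in TL_\infty$. For $\gamma\in\mathbb R$ let $c_0=c_1=1$, $c_{n}=c_{n-1}-\gamma c_{n-2}$, and, with $j=(n+1)\bmod l\in\{0,\dots,l-1\}$, let $\lambda_n=c_n$ if $j=0$ or $2j>n$, and $\lambda_n=c_n+\gamma^jc_{n-2j}$ otherwise. For every $\gamma\in\mathbb R$ there is exactly one normalized trace $\chi_\gamma$ on $TL_\infty$ such that $\chi_\gamma(v_{\pi\pi})=\gamma^p\lambda_{n-2p}$ for all paths $\pi$ that end at level $n$ with $n-2p$ through strands. The extreme points of the set of normalized traces that are positive with respect to $\diamond$ are exactly the $\chi_\gamma$ with $0<\gamma\le\frac14$; moreover, for real $\gamma$, $\chi_\gamma$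 is positive with respect to $\diamond$ if and only if $0<\gamma\le\frac14$. 4. Let $0<\gamma\le\frac14$ and $\chi=\chi_\gamma$. Then $(x,y)=\chi(xy^\diamond)$ exists for all $x,y\in TL_\infty$ and is a positive definite inner product; let $\mathcal H$ be the Hilbert space completion of $TL_\infty$. The map $\diamond$ extends from $\bigcup_nTL_n^S$ to an isometric conjugate linear involution of $\mathcal H$, which contains $TL_\infty$. Every $x\in J(TL_n)$ is in $\mathcal H$ the sum of a convergent series $x=\sum_{k\ge0}x_k$ with $x_k\in TL_{n+k+1}^S$ and $x-\sum_{i<k}x_i\in J(TL_{n+k})$ for all $k$, and $x^\diamond=\sum_k x_k^\diamond$ in $\mathcal H$. -/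

import Mathlib

open Filter Topology

namespace TemperleyLieb

/-! ## The infinite Temperley-Lieb algebra -/

/-- The defining relations; the generator `i : ℕ` is the one acting on the strands `i`, `i + 1`
(strands are numbered from `0`), usually written `e_{i+1}`. -/
inductive TLRel (δ : ℝ) : FreeAlgebra ℂ ℕ → FreeAlgebra ℂ ℕ → Prop
  | sq (i : ℕ) : TLRel δ (FreeAlgebra.ι ℂ i * FreeAlgebra.ι ℂ i)
      (algebraMap ℂ _ (δ : ℂ) * FreeAlgebra.ι ℂ i)
  | up (i : ℕ) : TLRel δ
      (FreeAlgebra.ι ℂ i * FreeAlgebra.ι ℂ (i + 1) * FreeAlgebra.ι ℂ i) (FreeAlgebra.ι ℂ i)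
  | down (i : ℕ) : TLRel δ
      (FreeAlgebra.ι ℂ (i + 1) * FreeAlgebra.ι ℂ i * FreeAlgebra.ι ℂ (i + 1))
      (FreeAlgebra.ι ℂ (i + 1))
  | comm (i j : ℕ) (h : i + 2 ≤ j) : TLRel δ
      (FreeAlgebra.ι ℂ i * FreeAlgebra.ι ℂ j) (FreeAlgebra.ι ℂ j * FreeAlgebra.ι ℂ i)

/-- The infinite Temperley-Lieb algebra `TL_∞(δ)` over `ℂ`. -/
abbrev TL (δ : ℝ) : Type := RingQuot (TLRel δ)

/-- The generators of `TL_∞(δ)`. -/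
noncomputable def TL.e (δ : ℝ) (i : ℕ) : TL δ :=
  RingQuot.mkAlgHom ℂ (TLRel δ) (FreeAlgebra.ι ℂ i)

/-- `TL_n(δ)`, as the subalgebra of `TL_∞(δ)` generated by the `n - 1` generators that act on
the first `n` strands. -/
noncomputable def TL.fin (δ : ℝ) (n : ℕ) : Subalgebra ℂ (TL δ) :=
  Algebra.adjoin ℂ {x | ∃ i : ℕ, i + 1 < n ∧ x = TL.e δ i}

/-- The Jacobson radical `J(TL_n(δ))`, viewed inside `TL_∞(δ)`. -/
def TL.rad (δ : ℝ) (n : ℕ) : Set (TL δ) :=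
  {x | ∃ h : x ∈ TL.fin δ n, (⟨x, h⟩ : TL.fin δ n) ∈ Ring.jacobson (TL.fin δ n)}

/-! ## Complex conjugation of coefficients -/

/-- The ring `A` with the `ℂ`-algebra structure twisted by complex conjugation. -/
def Twist (A : Type) : Type := A

instance (A : Type) [Ring A] : Ring (Twist A) := inferInstanceAs (Ring A)

noncomputable instance (A : Type) [Ring A] [Algebra ℂ A] : Algebra ℂ (Twist A) :=
  RingHom.toAlgebra' ((algebraMap ℂ A).comp (starRingEnd ℂ) : ℂ →+* A)
    (fun c x => Algebra.commutes (R := ℂ) (A := A) (starRingEnd ℂ c) x)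

theorem twist_algebraMap_real (A : Type) [Ring A] [Algebra ℂ A] (δ : ℝ) :
    algebraMap ℂ (Twist A) (δ : ℂ) = (algebraMap ℂ A (δ : ℂ) : A) := by
  change algebraMap ℂ A (starRingEnd ℂ (δ : ℂ)) = _
  rw [Complex.conj_ofReal]

/-! ## Diagrams with different numbers of strands at the top and at the bottom -/

/-- Elementary diagrams: `cup i` inserts a cup whose two ends are the strands `i`, `i + 1` of
the result, `cap i` joins the strands `i`, `i + 1`. -/
inductive CupCap : Type
  | cup (i : ℕ) : CupCap
  | cap (i : ℕ) : CupCap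

/-- The inclusion of the elementary diagram `cup i` in the free algebra. -/
noncomputable abbrev fcup (i : ℕ) : FreeAlgebra ℂ CupCap := FreeAlgebra.ι ℂ (CupCap.cup i)

/-- The inclusion of the elementary diagram `cap i` in the free algebra. -/
noncomputable abbrev fcap (i : ℕ) : FreeAlgebra ℂ CupCap := FreeAlgebra.ι ℂ (CupCap.cap i)

/-- Planar isotopy of diagrams, and removal of a closed circle at the price of a factor `δ`.
A product `x * y` is the diagram `x` placed on top of `y`. -/
inductive DiagramRel (δ : ℝ) : FreeAlgebra ℂ CupCap → FreeAlgebra ℂ CupCap → Prop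
  | loop (i : ℕ) : DiagramRel δ (fcap i * fcup i) (algebraMap ℂ _ (δ : ℂ))
  | zig (i : ℕ) : DiagramRel δ (fcap i * fcup (i + 1)) 1
  | zag (i : ℕ) : DiagramRel δ (fcap (i + 1) * fcup i) 1
  | left (i j : ℕ) (h : i ≤ j) : DiagramRel δ (fcap i * fcup (j + 2)) (fcup j * fcap i)
  | right (i j : ℕ) (h : i ≤ j) : DiagramRel δ (fcap (j + 2) * fcup i) (fcup i * fcap j)
  | cups (i j : ℕ) (h : i ≤ j) : DiagramRel δ (fcup i * fcup j) (fcup (j + 2) * fcup i)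
  | caps (i j : ℕ) (h : i ≤ j) : DiagramRel δ (fcap j * fcap i) (fcap i * fcap (j + 2))

/-- The algebra of all Temperley-Lieb diagrams from `m` strands (bottom) to `n` strands (top),
for all `m` and `n`, where a diagram is identified with the diagrams that are obtained from it
by adding vertical strands on the right. -/
abbrev Diagram (δ : ℝ) : Type := RingQuot (DiagramRel δ)

/-- The diagram that inserts a cup. -/
noncomputable def cup (δ : ℝ) (i : ℕ) : Diagram δ := RingQuot.mkAlgHom ℂ (DiagramRel δ) (fcup i)

/-- The diagram that inserts a cap. -/
noncomputable def cap (δ : ℝ) (i : ℕ) : Diagram δ := RingQuot.mkAlgHom ℂ (DiagramRel δ) (fcap i)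

section relations
variable (δ : ℝ)

theorem cap_cup_loop (i : ℕ) : cap δ i * cup δ i = algebraMap ℂ _ (δ : ℂ) := by
  simpa [cup, cap] using RingQuot.mkAlgHom_rel ℂ (DiagramRel.loop (δ := δ) i)

theorem cap_cup_zig (i : ℕ) : cap δ i * cup δ (i + 1) = 1 := by
  simpa [cup, cap] using RingQuot.mkAlgHom_rel ℂ (DiagramRel.zig (δ := δ) i)

theorem cap_cup_zag (i : ℕ) : cap δ (i + 1) * cup δ i = 1 := by
  simpa [cup, cap] using RingQuot.mkAlgHom_rel ℂ (DiagramRel.zag (δ := δ) i)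

theorem cap_cup_left {i j : ℕ} (h : i ≤ j) : cap δ i * cup δ (j + 2) = cup δ j * cap δ i := by
  simpa [cup, cap] using RingQuot.mkAlgHom_rel ℂ (DiagramRel.left (δ := δ) i j h)

theorem cap_cup_right {i j : ℕ} (h : i ≤ j) : cap δ (j + 2) * cup δ i = cup δ i * cap δ j := by
  simpa [cup, cap] using RingQuot.mkAlgHom_rel ℂ (DiagramRel.right (δ := δ) i j h)

theorem cup_cup {i j : ℕ} (h : i ≤ j) : cup δ i * cup δ j = cup δ (j + 2) * cup δ i := by
  simpa [cup, cap] using RingQuot.mkAlgHom_rel ℂ (DiagramRel.cups (δ := δ) i j h)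

theorem cap_cap {i j : ℕ} (h : i ≤ j) : cap δ j * cap δ i = cap δ i * cap δ (j + 2) := by
  simpa [cup, cap] using RingQuot.mkAlgHom_rel ℂ (DiagramRel.caps (δ := δ) i j h)

end relations

/-- The realization of `TL_∞(δ)` by diagrams: the `i`-th generator is a cap followed by a cup. -/
noncomputable def toDiagram (δ : ℝ) : TL δ →ₐ[ℂ] Diagram δ :=
  RingQuot.liftAlgHom ℂ ⟨FreeAlgebra.lift ℂ (fun i => cup δ i * cap δ i), by
    have key : ∀ a b c d : Diagram δ, a * b * (c * d) = a * (b * c) * d := by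
      intro a b c d; simp only [mul_assoc]
    intro x y h
    cases h with
    | sq i =>
      simp only [map_mul, FreeAlgebra.lift_ι_apply, AlgHom.commutes]
      rw [key, cap_cup_loop, ← Algebra.commutes, mul_assoc]
    | up i =>
      simp only [map_mul, FreeAlgebra.lift_ι_apply]
      rw [key (cup δ i), cap_cup_zig, mul_one, key (cup δ i), cap_cup_zag, mul_one]
    | down i =>
      simp only [map_mul, FreeAlgebra.lift_ι_apply]
      rw [key (cup δ (i + 1)), cap_cup_zag, mul_one, key (cup δ (i + 1)), cap_cup_zig, mul_one]
    | comm i j hij =>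
      obtain ⟨k, rfl⟩ := Nat.exists_eq_add_of_le hij
      have hk : i + 2 + k = (i + k) + 2 := by omega
      have hle : i ≤ i + k := by omega
      simp only [map_mul, FreeAlgebra.lift_ι_apply]
      rw [hk, key, cap_cup_left δ hle, key, cap_cup_right δ hle, ← mul_assoc (cup δ i),
        cup_cup δ hle, mul_assoc, mul_assoc, ← cap_cap δ hle]
      simp only [mul_assoc]⟩

/-- The reflection `†` of diagrams about a horizontal line, as an algebra homomorphism to the
opposite algebra. -/
noncomputable def daggerHom (δ : ℝ) : Diagram δ →ₐ[ℂ] (Diagram δ)ᵐᵒᵖ :=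
  RingQuot.liftAlgHom ℂ ⟨FreeAlgebra.lift ℂ (fun g => match g with
      | CupCap.cup i => MulOpposite.op (cap δ i)
      | CupCap.cap i => MulOpposite.op (cup δ i)), by
    intro x y h
    cases h with
    | loop i =>
      simp only [map_mul, FreeAlgebra.lift_ι_apply, AlgHom.commutes, ← MulOpposite.op_mul,
        cap_cup_loop]
      rfl
    | zig i =>
      simp only [map_mul, FreeAlgebra.lift_ι_apply, ← MulOpposite.op_mul, cap_cup_zag,
        MulOpposite.op_one, map_one]
    | zag i =>
      simp only [map_mul, FreeAlgebra.lift_ι_apply, ← MulOpposite.op_mul, cap_cup_zig,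
        MulOpposite.op_one, map_one]
    | left i j h =>
      simp only [map_mul, FreeAlgebra.lift_ι_apply, ← MulOpposite.op_mul, cap_cup_right δ h]
    | right i j h =>
      simp only [map_mul, FreeAlgebra.lift_ι_apply, ← MulOpposite.op_mul, cap_cup_left δ h]
    | cups i j h =>
      simp only [map_mul, FreeAlgebra.lift_ι_apply, ← MulOpposite.op_mul, cap_cap δ h]
    | caps i j h =>
      simp only [map_mul, FreeAlgebra.lift_ι_apply, ← MulOpposite.op_mul, cup_cup δ h]⟩

/-- The (complex linear) reflection `†` of diagrams about a horizontal line. -/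
noncomputable def dagger {δ : ℝ} (x : Diagram δ) : Diagram δ := (daggerHom δ x).unop

/-- Complex conjugation of the coefficients of diagrams, as an algebra homomorphism to the
twisted algebra. -/
noncomputable def conjHom (δ : ℝ) : Diagram δ →ₐ[ℂ] Twist (Diagram δ) :=
  RingQuot.liftAlgHom ℂ ⟨FreeAlgebra.lift ℂ (fun g => match g with
      | CupCap.cup i => (cup δ i : Twist (Diagram δ))
      | CupCap.cap i => (cap δ i : Twist (Diagram δ))), by
    intro x y h
    cases h with
    | loop i =>
      simp only [map_mul, FreeAlgebra.lift_ι_apply, AlgHom.commutes]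
      exact (cap_cup_loop δ i).trans (twist_algebraMap_real _ δ).symm
    | zig i =>
      simp only [map_mul, FreeAlgebra.lift_ι_apply, map_one]
      exact cap_cup_zig δ i
    | zag i =>
      simp only [map_mul, FreeAlgebra.lift_ι_apply, map_one]
      exact cap_cup_zag δ i
    | left i j h =>
      simp only [map_mul, FreeAlgebra.lift_ι_apply]
      exact cap_cup_left δ h
    | right i j h =>
      simp only [map_mul, FreeAlgebra.lift_ι_apply]
      exact cap_cup_right δ h
    | cups i j h =>
      simp only [map_mul, FreeAlgebra.lift_ι_apply]
      exact cup_cup δ h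
    | caps i j h =>
      simp only [map_mul, FreeAlgebra.lift_ι_apply]
      exact cap_cap δ h⟩

/-- The conjugate linear map that fixes all diagrams. -/
noncomputable def conj {δ : ℝ} (x : Diagram δ) : Diagram δ := conjHom δ x

/-- The involution `*`, the conjugate linear extension of the reflection `†` of diagrams. -/
noncomputable def adjoint {δ : ℝ} (x : Diagram δ) : Diagram δ := dagger (conj x)

/-- The diagrams from `a` strands at the bottom to `b` strands at the top. -/
inductive IsDiagram (δ : ℝ) : ℕ → ℕ → Diagram δ → Prop
  | one (a : ℕ) : IsDiagram δ a a 1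
  | cup {a b : ℕ} {x : Diagram δ} (i : ℕ) (hi : i ≤ b) (hx : IsDiagram δ a b x) :
      IsDiagram δ a (b + 2) (TemperleyLieb.cup δ i * x)
  | cap {a b : ℕ} {x : Diagram δ} (i : ℕ) (hi : i ≤ b) (hx : IsDiagram δ a (b + 2) x) :
      IsDiagram δ a b (TemperleyLieb.cap δ i * x)

/-- The space spanned by the diagrams from `a` strands at the bottom to `b` strands at the top. -/
noncomputable def diagrams (δ : ℝ) (a b : ℕ) : Submodule ℂ (Diagram δ) :=
  Submodule.span ℂ {x | IsDiagram δ a b x}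

/-! ## The Bratteli diagram at a root of unity, and fusion rules -/

/-- The number of edges of the Bratteli diagram of irreducibles from a vertex `(n, p)` with
`n - 2p = m` through strands to the vertex of level `n + 1` with `j` through strands, for
`l ≥ 2` minimal with `q ^ (2 * l) = 1`. The vertex is critical if `l ∣ m + 1`. -/
def edges (l m j : ℕ) : ℕ :=
  if j = m + 1 then 1
  else if j + 1 = m then (if l ∣ m + 1 then 0 else if l ∣ m then 2 else 1)
  else if j + 2 * l = m + 1 ∧ l ∣ j + 1 then 1
  else 0

/-- Paths on the Bratteli diagram from the vertex `(1, 0)` to the vertex of level `n` with `m`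
through strands. -/
inductive Path (l : ℕ) : ℕ → ℕ → Type
  | base : Path l 1 1
  | step {n m : ℕ} (π : Path l n m) (j : ℕ) (k : Fin (edges l m j)) : Path l (n + 1) j

/-- A system of fusion rules. `P m` is the minimal idempotent of `TL_m` which belongs to the
projective cover of the trivial representation, and `F m j k` is the half diagram, from `j` to
`m + 1` strands, which describes how the vertex with `j` through strands is included, along the
`k`-th edge, in the vertex with `m` through strands and one more strand. The same rules are used
at all vertices with the same number of through strands. The half diagrams are orthonormal with
respect to the transpose `†`, and have real or purely imaginary coefficients. -/
structure FusionRules (δ : ℝ) (l : ℕ) where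
  P : ℕ → Diagram δ
  F : (m j : ℕ) → Fin (edges l m j) → Diagram δ
  P_zero : P 0 = 1
  P_one : P 1 = 1
  F_mem : ∀ m j k, F m j k ∈ diagrams δ j (m + 1)
  F_up : ∀ m k, F m (m + 1) k = P (m + 1)
  F_mul_P : ∀ m j k, F m j k * P j = F m j k
  F_norm : ∀ m j k, dagger (F m j k) * F m j k = P j
  F_orth : ∀ m j j' k k', (⟨j, k⟩ : Σ i, Fin (edges l m i)) ≠ ⟨j', k'⟩ →
    dagger (F m j k) * F m j' k' = 0
  F_sum : ∀ m, ∑ j ∈ Finset.range (m + 2), ∑ k, F m j k * dagger (F m j k) = P m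
  F_conj : ∀ m j k, conj (F m j k) = F m j k ∨ conj (F m j k) = -F m j k

/-! ## Traces -/

/-- Normalized traces on `TL_∞`. -/
def IsNormalizedTrace {δ : ℝ} (χ : TL δ →ₗ[ℂ] ℂ) : Prop :=
  χ 1 = 1 ∧ ∀ a b, χ (a * b) = χ (b * a)

/-- The coefficients `c_{n,0}` of the generic extremal traces. -/
def genericCoeff (γ : ℝ) : ℕ → ℝ
  | 0 => 1
  | 1 => 1
  | n + 2 => genericCoeff γ (n + 1) - γ * genericCoeff γ n

/-- The coefficients `λ_{n,0}` of the traces at a root of unity. -/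
def rootCoeff (l : ℕ) (γ : ℝ) (n : ℕ) : ℝ :=
  if l ∣ n + 1 then genericCoeff γ n
  else genericCoeff γ n +
    if 2 * ((n + 1) % l) ≤ n then
      γ ^ ((n + 1) % l) * genericCoeff γ (n - 2 * ((n + 1) % l))
    else 0

namespace FusionRules

variable {δ : ℝ} {l : ℕ} (R : FusionRules δ l)

/-- The half diagram of a path, obtained by composing the fusion rules along the path. -/
noncomputable def vec : {n m : ℕ} → Path l n m → Diagram δ
  | _, _, Path.base => 1
  | _, _, Path.step (m := m) π j k => vec π * R.F m j k

/-- The matrix element `v_{π,σ}` of `TL_n`: the element with diagram `vec π * (vec σ)†`. -/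
noncomputable def unit {n m : ℕ} (π σ : Path l n m) : TL δ :=
  Function.invFun (toDiagram δ) (R.vec π * dagger (R.vec σ))

/-- The semisimplification `TL_n^S`, realized in `TL_n` as the algebra of the matrix elements of
level `n`. -/
noncomputable def semisimple (n : ℕ) : Subalgebra ℂ (TL δ) :=
  Algebra.adjoin ℂ {x | ∃ (m : ℕ) (π σ : Path l n m), x = R.unit π σ}

/-- The union of the algebras `TL_n^S`. -/
noncomputable def union : Subalgebra ℂ (TL δ) := ⨆ n, R.semisimple n

theorem unit_mem {n m : ℕ} (π σ : Path l n m) : R.unit π σ ∈ R.union :=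
  (le_iSup R.semisimple n) (Algebra.subset_adjoin ⟨m, π, σ, rfl⟩)

/-- The matrix elements of level `n` are the matrix units of a semisimple subalgebra `TL_n^S` of
`TL_n` which is a complement of the Jacobson radical, these subalgebras increase with `n`, and
on the matrix elements the involution `*` is the transpose up to sign. -/
structure IsMatrixDecomposition : Prop where
  toDiagram_unit : ∀ {n m : ℕ} (π σ : Path l n m),
    toDiagram δ (R.unit π σ) = R.vec π * dagger (R.vec σ)
  linearIndependent : ∀ n : ℕ, LinearIndependent ℂ
    (fun i : (Σ m : ℕ, Path l n m × Path l n m) => R.unit i.2.1 i.2.2)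
  span : ∀ n : ℕ, 1 ≤ n → Subalgebra.toSubmodule (R.semisimple n) =
    Submodule.span ℂ {x | ∃ (m : ℕ) (π σ : Path l n m), x = R.unit π σ}
  unit_mul_same : ∀ {n m : ℕ} (π σ τ : Path l n m), R.unit π σ * R.unit σ τ = R.unit π τ
  unit_mul_ne : ∀ {n m m' : ℕ} (π σ : Path l n m) (σ' τ : Path l n m'),
    (⟨m, σ⟩ : Σ i, Path l n i) ≠ ⟨m', σ'⟩ → R.unit π σ * R.unit σ' τ = 0
  le_fin : ∀ n, R.semisimple n ≤ TL.fin δ n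
  le_succ : ∀ n, R.semisimple n ≤ R.semisimple (n + 1)
  complement : ∀ n, ∀ x ∈ TL.fin δ n, ∃! s, s ∈ R.semisimple n ∧ x - s ∈ TL.rad δ n
  star_unit : ∀ {n m : ℕ} (π σ : Path l n m),
    adjoint (toDiagram δ (R.unit π σ)) = toDiagram δ (R.unit σ π) ∨
    adjoint (toDiagram δ (R.unit π σ)) = -toDiagram δ (R.unit σ π)

open Classical in
/-- The component of `x ∈ TL_n` in `TL_n^S`, along the decomposition `TL_n^S ⊕ J(TL_n)`. It is
only used for `n` so large that `x ∈ TL_n`. -/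
noncomputable def part (n : ℕ) (x : TL δ) : R.union :=
  if h : ∃ s : R.union, (s : TL δ) ∈ R.semisimple n ∧ x - (s : TL δ) ∈ TL.rad δ n then
    h.choose
  else 0

/-- `D` is the corrected involution `◇` on the union of the `TL_n^S`: the conjugate linear map
which transposes the matrix elements. -/
def IsDiamond (D : R.union →ₗ⋆[ℂ] R.union) : Prop :=
  ∀ {n m : ℕ} (π σ : Path l n m), D ⟨R.unit π σ, R.unit_mem π σ⟩ = ⟨R.unit σ π, R.unit_mem σ π⟩

/-- Positivity of a trace on `TL_∞` with respect to `◇`: `χ (a a^◇)` converges and is positive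
for all `a ≠ 0`. Here `a^◇` is the limit of the `◇`-images of the components of `a` in the
`TL_n^S`. -/
def IsPositive (D : R.union →ₗ⋆[ℂ] R.union) (χ : TL δ →ₗ[ℂ] ℂ) : Prop :=
  ∀ a : TL δ, a ≠ 0 → ∃ r : ℝ, 0 < r ∧
    Tendsto (fun n => χ (a * (D (R.part n a) : TL δ))) atTop (𝓝 (r : ℂ))

/-- The trace `χ_{∞,l}` with parameter `γ`: its coefficient at the vertex `(n, p)` of the
Bratteli diagram of irreducibles is `λ_{n,p} = γ ^ p * λ_{n-2p,0}`. -/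
def HasParameter (γ : ℝ) (χ : TL δ →ₗ[ℂ] ℂ) : Prop :=
  ∀ {n m : ℕ} (π : Path l n m),
    χ (R.unit π π) = ((γ ^ ((n - m) / 2) * rootCoeff l γ m : ℝ) : ℂ)

end FusionRules

end TemperleyLieb

namespace TemperleyLieb

section basics
variable {δ : ℝ}

theorem Diagram.induction {p : Diagram δ → Prop} (scalar : ∀ c : ℂ, p (algebraMap ℂ _ c))
    (hcup : ∀ i, p (cup δ i)) (hcap : ∀ i, p (cap δ i))
    (mul : ∀ x y, p x → p y → p (x * y)) (add : ∀ x y, p x → p y → p (x + y))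
    (x : Diagram δ) : p x := by
  obtain ⟨x, rfl⟩ := RingQuot.mkAlgHom_surjective ℂ (DiagramRel δ) x
  induction x using FreeAlgebra.induction with
  | grade0 r => rw [AlgHom.commutes]; exact scalar r
  | grade1 g => cases g with
    | cup i => exact hcup i
    | cap i => exact hcap i
  | mul a b ha hb => rw [map_mul]; exact mul _ _ ha hb
  | add a b ha hb => rw [map_add]; exact add _ _ ha hb

theorem TL.induction {p : TL δ → Prop} (scalar : ∀ c : ℂ, p (algebraMap ℂ _ c))
    (gen : ∀ i, p (TL.e δ i))
    (mul : ∀ x y, p x → p y → p (x * y)) (add : ∀ x y, p x → p y → p (x + y))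
    (x : TL δ) : p x := by
  obtain ⟨x, rfl⟩ := RingQuot.mkAlgHom_surjective ℂ (TLRel δ) x
  induction x using FreeAlgebra.induction with
  | grade0 r => rw [AlgHom.commutes]; exact scalar r
  | grade1 g => exact gen g
  | mul a b ha hb => rw [map_mul]; exact mul _ _ ha hb
  | add a b ha hb => rw [map_add]; exact add _ _ ha hb

@[simp] theorem toDiagram_e (i : ℕ) : toDiagram δ (TL.e δ i) = cup δ i * cap δ i := by
  simp [toDiagram, TL.e, RingQuot.liftAlgHom_mkAlgHom_apply]

@[simp] theorem dagger_cup (i : ℕ) : dagger (cup δ i) = cap δ i := by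
  simp [dagger, daggerHom, cup, RingQuot.liftAlgHom_mkAlgHom_apply]

@[simp] theorem dagger_cap (i : ℕ) : dagger (cap δ i) = cup δ i := by
  simp [dagger, daggerHom, cap, RingQuot.liftAlgHom_mkAlgHom_apply]

@[simp] theorem dagger_mul (x y : Diagram δ) : dagger (x * y) = dagger y * dagger x := by
  simp [dagger]

@[simp] theorem dagger_one : dagger (1 : Diagram δ) = 1 := by simp [dagger]

@[simp] theorem dagger_zero : dagger (0 : Diagram δ) = 0 := by simp [dagger]

@[simp] theorem dagger_add (x y : Diagram δ) : dagger (x + y) = dagger x + dagger y := by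
  simp [dagger]

@[simp] theorem dagger_sub (x y : Diagram δ) : dagger (x - y) = dagger x - dagger y := by
  simp [dagger]

@[simp] theorem dagger_smul (c : ℂ) (x : Diagram δ) : dagger (c • x) = c • dagger x := by
  simp [dagger]

@[simp] theorem dagger_algebraMap (c : ℂ) :
    dagger (algebraMap ℂ (Diagram δ) c) = algebraMap ℂ _ c := by
  rw [Algebra.algebraMap_eq_smul_one, dagger_smul, dagger_one]

@[simp] theorem dagger_dagger (x : Diagram δ) : dagger (dagger x) = x := by
  induction x using Diagram.induction with
  | scalar c => simp
  | hcup i => simp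
  | hcap i => simp
  | mul x y hx hy => simp [hx, hy]
  | add x y hx hy => simp [hx, hy]

@[simp] theorem conj_cup (i : ℕ) : conj (cup δ i) = cup δ i := by
  simp [conj, conjHom, cup, RingQuot.liftAlgHom_mkAlgHom_apply]

@[simp] theorem conj_cap (i : ℕ) : conj (cap δ i) = cap δ i := by
  simp [conj, conjHom, cap, RingQuot.liftAlgHom_mkAlgHom_apply]

@[simp] theorem conj_mul (x y : Diagram δ) : conj (x * y) = conj x * conj y :=
  map_mul (conjHom δ) x y

@[simp] theorem conj_add (x y : Diagram δ) : conj (x + y) = conj x + conj y :=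
  map_add (conjHom δ) x y

@[simp] theorem conj_sub (x y : Diagram δ) : conj (x - y) = conj x - conj y :=
  map_sub (conjHom δ) x y

@[simp] theorem conj_one : conj (1 : Diagram δ) = 1 := map_one (conjHom δ)

@[simp] theorem conj_zero : conj (0 : Diagram δ) = 0 := map_zero (conjHom δ)

@[simp] theorem conj_algebraMap (c : ℂ) :
    conj (algebraMap ℂ (Diagram δ) c) = algebraMap ℂ _ (starRingEnd ℂ c) :=
  (conjHom δ).commutes c

@[simp] theorem conj_smul (c : ℂ) (x : Diagram δ) :
    conj (c • x) = starRingEnd ℂ c • conj x := by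
  rw [Algebra.smul_def, conj_mul, conj_algebraMap, ← Algebra.smul_def]

theorem conj_dagger (x : Diagram δ) : conj (dagger x) = dagger (conj x) := by
  induction x using Diagram.induction with
  | scalar c => simp
  | hcup i => simp
  | hcap i => simp
  | mul x y hx hy => simp [hx, hy]
  | add x y hx hy => simp [hx, hy]

/-! ### The spaces of diagrams -/

theorem IsDiagram.mul {a b c : ℕ} {x y : Diagram δ} (hx : IsDiagram δ b c x)
    (hy : IsDiagram δ a b y) : IsDiagram δ a c (x * y) := by
  induction hx with
  | one => simpa
  | cup i hi _ ih => rw [mul_assoc]; exact .cup i hi ih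
  | cap i hi _ ih => rw [mul_assoc]; exact .cap i hi ih

theorem isDiagram_cup {a i : ℕ} (hi : i ≤ a) : IsDiagram δ a (a + 2) (cup δ i) := by
  simpa using IsDiagram.cup i hi (IsDiagram.one (δ := δ) a)

theorem isDiagram_cap {a i : ℕ} (hi : i ≤ a) : IsDiagram δ (a + 2) a (cap δ i) := by
  simpa using IsDiagram.cap i hi (IsDiagram.one (δ := δ) (a + 2))

theorem IsDiagram.dagger {a b : ℕ} {x : Diagram δ} (hx : IsDiagram δ a b x) :
    IsDiagram δ b a (dagger x) := by
  induction hx with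
  | one => simpa using IsDiagram.one _
  | cup i hi _ ih => simpa using ih.mul (isDiagram_cap hi)
  | cap i hi _ ih => simpa using ih.mul (isDiagram_cup hi)

theorem IsDiagram.shift {a b : ℕ} {x : Diagram δ} (hx : IsDiagram δ a b x) (c : ℕ) :
    IsDiagram δ (a + c) (b + c) x := by
  induction hx with
  | one => exact .one _
  | @cup b x i hi _ ih => rw [Nat.add_right_comm]; exact .cup i (by omega) ih
  | @cap b x i hi _ ih => rw [Nat.add_right_comm] at ih; exact .cap i (by omega) ih

theorem diagrams_induction {a b : ℕ} {p : Diagram δ → Prop} {x : Diagram δ}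
    (hx : x ∈ diagrams δ a b) (mem : ∀ x, IsDiagram δ a b x → p x) (zero : p 0)
    (add : ∀ x y, p x → p y → p (x + y)) (smul : ∀ (c : ℂ) x, p x → p (c • x)) : p x :=
  Submodule.span_induction (p := fun x _ => p x) mem zero (fun x y _ _ => add x y)
    (fun c x _ => smul c x) hx

theorem mul_mem_diagrams {a b c : ℕ} {x y : Diagram δ} (hx : x ∈ diagrams δ b c)
    (hy : y ∈ diagrams δ a b) : x * y ∈ diagrams δ a c := by
  refine diagrams_induction (p := fun x => x * y ∈ diagrams δ a c) hx (fun x hx => ?_) (by simp)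
    (fun x x' h h' => by rw [add_mul]; exact add_mem h h')
    (fun c x h => by rw [smul_mul_assoc]; exact Submodule.smul_mem _ _ h)
  exact diagrams_induction (p := fun y => x * y ∈ diagrams δ a c) hy (fun y hy => Submodule.subset_span (hx.mul hy)) (by simp)
    (fun x x' h h' => by rw [mul_add]; exact add_mem h h')
    (fun c x h => by rw [mul_smul_comm]; exact Submodule.smul_mem _ _ h)

theorem one_mem_diagrams (a : ℕ) : (1 : Diagram δ) ∈ diagrams δ a a :=
  Submodule.subset_span (.one a)

theorem cup_mem_diagrams {a b i : ℕ} (hi : i ≤ a) (hb : b = a + 2) :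
    cup δ i ∈ diagrams δ a b := by
  subst hb; exact Submodule.subset_span (isDiagram_cup hi)

theorem cap_mem_diagrams {a b i : ℕ} (hi : i ≤ a) (hb : b = a + 2) :
    cap δ i ∈ diagrams δ b a := by
  subst hb; exact Submodule.subset_span (isDiagram_cap hi)

theorem dagger_mem_diagrams {a b : ℕ} {x : Diagram δ} (hx : x ∈ diagrams δ a b) :
    dagger x ∈ diagrams δ b a :=
  diagrams_induction (p := fun x => dagger x ∈ diagrams δ b a) hx
    (fun _ hx => Submodule.subset_span hx.dagger)
    (by simp) (fun _ _ h h' => by rw [dagger_add]; exact add_mem h h')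
    (fun c _ h => by rw [dagger_smul]; exact Submodule.smul_mem _ _ h)

theorem diagrams_shift {a b : ℕ} (c : ℕ) {x : Diagram δ} (hx : x ∈ diagrams δ a b) :
    x ∈ diagrams δ (a + c) (b + c) :=
  Submodule.span_mono (fun _ hx => IsDiagram.shift hx c) hx

theorem diagrams_mono {a b a' b' : ℕ} {x : Diagram δ} (hx : x ∈ diagrams δ a b)
    (h : a ≤ a') (h' : a' + b = b' + a) : x ∈ diagrams δ a' b' := by
  obtain ⟨c, rfl⟩ := Nat.exists_eq_add_of_le h
  obtain rfl : b' = b + c := by omega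
  exact diagrams_shift c hx

theorem e_mem_diagrams {n i : ℕ} (hi : i + 2 ≤ n) : cup δ i * cap δ i ∈ diagrams δ n n := by
  obtain ⟨k, rfl⟩ : ∃ k, n = k + 2 := ⟨n - 2, by omega⟩
  exact mul_mem_diagrams (cup_mem_diagrams (a := k) (by omega) rfl)
    (cap_mem_diagrams (by omega) rfl)

theorem IsDiagram.commute {a b : ℕ} {x : Diagram δ} (hx : IsDiagram δ a b x) (j : ℕ) :
    TemperleyLieb.cup δ (b + j) * x = x * TemperleyLieb.cup δ (a + j) ∧
    TemperleyLieb.cap δ (b + j) * x = x * TemperleyLieb.cap δ (a + j) := by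
  induction hx generalizing j with
  | one => simp
  | @cup b x i hi _ ih =>
    have h1 := cup_cup δ (show i ≤ b + j by omega)
    have h2 := cap_cup_right δ (show i ≤ b + j by omega)
    rw [show b + 2 + j = b + j + 2 by ring]
    constructor
    · rw [← mul_assoc, ← h1, mul_assoc, (ih j).1, mul_assoc]
    · rw [← mul_assoc, h2, mul_assoc, (ih j).2, mul_assoc]
  | @cap b x i hi _ ih =>
    have h1 := cap_cup_left δ (show i ≤ b + j by omega)
    have h2 := cap_cap δ (show i ≤ b + j by omega)
    have := ih j
    rw [show b + 2 + j = b + j + 2 by ring] at this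
    constructor
    · rw [← mul_assoc, ← h1, mul_assoc, this.1, mul_assoc]
    · rw [← mul_assoc, h2, mul_assoc, this.2, mul_assoc]

theorem cup_mul_of_mem {a b : ℕ} {x : Diagram δ} (hx : x ∈ diagrams δ a b) (j : ℕ) :
    cup δ (b + j) * x = x * cup δ (a + j) :=
  diagrams_induction (p := fun x => cup δ (b + j) * x = x * cup δ (a + j)) hx
    (fun _ hx => (hx.commute j).1) (by simp)
    (fun _ _ h h' => by rw [mul_add, add_mul, h, h'])
    (fun c _ h => by rw [mul_smul_comm, smul_mul_assoc, h])

theorem cap_mul_of_mem {a b : ℕ} {x : Diagram δ} (hx : x ∈ diagrams δ a b) (j : ℕ) :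
    cap δ (b + j) * x = x * cap δ (a + j) :=
  diagrams_induction (p := fun x => cap δ (b + j) * x = x * cap δ (a + j)) hx
    (fun _ hx => (hx.commute j).2) (by simp)
    (fun _ _ h h' => by rw [mul_add, add_mul, h, h'])
    (fun c _ h => by rw [mul_smul_comm, smul_mul_assoc, h])

/-- Commutation of a diagram on `n` strands with a cup to the right of them. -/
theorem cup_comm {n i : ℕ} {x : Diagram δ} (hx : x ∈ diagrams δ n n) (h : n ≤ i) :
    cup δ i * x = x * cup δ i := by
  obtain ⟨j, rfl⟩ := Nat.exists_eq_add_of_le h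
  exact cup_mul_of_mem hx j

/-- Commutation of a diagram on `n` strands with a cap to the right of them. -/
theorem cap_comm {n i : ℕ} {x : Diagram δ} (hx : x ∈ diagrams δ n n) (h : n ≤ i) :
    cap δ i * x = x * cap δ i := by
  obtain ⟨j, rfl⟩ := Nat.exists_eq_add_of_le h
  exact cap_mul_of_mem hx j

/-- Diagrams without caps. -/
inductive IsCupDiagram (δ : ℝ) (a : ℕ) : ℕ → Diagram δ → Prop
  | one : IsCupDiagram δ a a 1
  | cup {b : ℕ} {x : Diagram δ} (i : ℕ) (hi : i ≤ b) (hx : IsCupDiagram δ a b x) :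
      IsCupDiagram δ a (b + 2) (TemperleyLieb.cup δ i * x)

/-- The combinations of diagrams which start with a cap. -/
def capped (δ : ℝ) (a b : ℕ) : Submodule ℂ (Diagram δ) :=
  Submodule.span ℂ {x | ∃ (i : ℕ) (y : Diagram δ), i + 2 ≤ a ∧ y ∈ diagrams δ (a - 2) b ∧
    x = y * cap δ i}

/-- The combinations of diagrams without caps. -/
def cupDiagrams (δ : ℝ) (a b : ℕ) : Submodule ℂ (Diagram δ) :=
  Submodule.span ℂ {x | IsCupDiagram δ a b x}

theorem mul_mem_capped {a b c : ℕ} {x y : Diagram δ} (hx : x ∈ diagrams δ b c)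
    (hy : y ∈ capped δ a b) : x * y ∈ capped δ a c := by
  refine Submodule.span_induction (p := fun y _ => x * y ∈ capped δ a c) ?_ (by simp)
    (fun _ _ _ _ h h' => by rw [mul_add]; exact add_mem h h')
    (fun c _ _ h => by rw [mul_smul_comm]; exact Submodule.smul_mem _ _ h) hy
  rintro _ ⟨i, z, hi, hz, rfl⟩
  exact Submodule.subset_span ⟨i, x * z, hi, mul_mem_diagrams hx hz, (mul_assoc _ _ _).symm⟩

theorem cup_mul_mem_sup {a b i : ℕ} (hi : i ≤ b) {x : Diagram δ}
    (hx : x ∈ capped δ a b ⊔ cupDiagrams δ a b) :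
    cup δ i * x ∈ capped δ a (b + 2) ⊔ cupDiagrams δ a (b + 2) := by
  obtain ⟨y, hy, z, hz, rfl⟩ := Submodule.mem_sup.1 hx
  rw [mul_add]
  refine add_mem (Submodule.mem_sup_left (mul_mem_capped (cup_mem_diagrams hi rfl) hy))
    (Submodule.mem_sup_right ?_)
  refine Submodule.span_induction (p := fun y _ => cup δ i * y ∈ cupDiagrams δ a (b + 2)) ?_
    (by simp) (fun _ _ _ _ h h' => by rw [mul_add]; exact add_mem h h')
    (fun c _ _ h => by rw [mul_smul_comm]; exact Submodule.smul_mem _ _ h) hz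
  exact fun y hy => Submodule.subset_span (.cup i hi hy)

theorem cap_mul_cupDiagram {a c : ℕ} {x : Diagram δ} (hx : IsCupDiagram δ a c x) :
    ∀ (b i : ℕ), c = b + 2 → i ≤ b → cap δ i * x ∈ capped δ a b ⊔ cupDiagrams δ a b := by
  induction hx with
  | one =>
    intro b i hb hi
    subst hb
    refine Submodule.mem_sup_left (Submodule.subset_span ⟨i, 1, by omega, ?_, by simp⟩)
    exact one_mem_diagrams b
  | @cup c x j hj hx ih =>
    intro b i hb hi
    obtain rfl : c = b := by omega
    have base : x ∈ capped δ a c ⊔ cupDiagrams δ a c :=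
      Submodule.mem_sup_right (Submodule.subset_span hx)
    rw [← mul_assoc]
    rcases Nat.lt_trichotomy i j with h | h | h
    · rcases Nat.eq_or_lt_of_le (Nat.succ_le_of_lt h) with h | h
      · subst h; simpa [cap_cup_zig] using base
      · obtain ⟨k, rfl⟩ : ∃ k, j = k + 2 := ⟨j - 2, by omega⟩
        obtain ⟨d, rfl⟩ : ∃ d, c = d + 2 := ⟨c - 2, by omega⟩
        rw [cap_cup_left δ (by omega), mul_assoc]
        exact cup_mul_mem_sup (by omega) (ih d i rfl (by omega))
    · subst h
      rw [cap_cup_loop, ← Algebra.smul_def]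
      exact Submodule.smul_mem _ _ base
    · rcases Nat.eq_or_lt_of_le (Nat.succ_le_of_lt h) with h | h
      · subst h; simpa [cap_cup_zag] using base
      · obtain ⟨k, rfl⟩ : ∃ k, i = k + 2 := ⟨i - 2, by omega⟩
        obtain ⟨d, rfl⟩ : ∃ d, c = d + 2 := ⟨c - 2, by omega⟩
        rw [cap_cup_right δ (by omega), mul_assoc]
        exact cup_mul_mem_sup (by omega) (ih d k rfl (by omega))

theorem diagrams_le_sup (a b : ℕ) : diagrams δ a b ≤ capped δ a b ⊔ cupDiagrams δ a b := by
  refine Submodule.span_le.2 fun x hx => ?_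
  change IsDiagram δ a b x at hx
  change x ∈ capped δ a b ⊔ cupDiagrams δ a b
  induction hx with
  | one => exact Submodule.mem_sup_right (Submodule.subset_span .one)
  | cup i hi _ ih => exact cup_mul_mem_sup hi ih
  | @cap b x i hi _ ih =>
    obtain ⟨y, hy, z, hz, rfl⟩ := Submodule.mem_sup.1 ih
    rw [mul_add]
    refine add_mem (Submodule.mem_sup_left (mul_mem_capped (cap_mem_diagrams hi rfl) hy)) ?_
    refine Submodule.span_induction
      (p := fun y _ => cap δ i * y ∈ capped δ a b ⊔ cupDiagrams δ a b) ?_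
      (by simp) (fun _ _ _ _ h h' => by rw [mul_add]; exact add_mem h h')
      (fun c _ _ h => by rw [mul_smul_comm]; exact Submodule.smul_mem _ _ h) hz
    exact fun y hy => cap_mul_cupDiagram hy b i rfl hi

theorem IsCupDiagram.le {a b : ℕ} {x : Diagram δ} (hx : IsCupDiagram δ a b x) :
    a ≤ b ∧ (a = b → x = 1) := by
  induction hx with
  | one => simp
  | cup i hi _ ih => exact ⟨by omega, fun h => by omega⟩

theorem mem_capped_of_lt {a b : ℕ} (h : b < a) {x : Diagram δ} (hx : x ∈ diagrams δ a b) :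
    x ∈ capped δ a b := by
  obtain ⟨y, hy, z, hz, rfl⟩ := Submodule.mem_sup.1 (diagrams_le_sup a b hx)
  have : cupDiagrams δ a b = ⊥ := by
    rw [cupDiagrams, Submodule.span_eq_bot]
    intro x hx
    have := IsCupDiagram.le hx
    omega
  rw [this, Submodule.mem_bot] at hz
  simpa [hz] using hy

theorem exists_smul_one_add_capped {n : ℕ} {x : Diagram δ} (hx : x ∈ diagrams δ n n) :
    ∃ c : ℂ, ∃ y ∈ capped δ n n, x = c • 1 + y := by
  obtain ⟨y, hy, z, hz, rfl⟩ := Submodule.mem_sup.1 (diagrams_le_sup n n hx)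
  have : cupDiagrams δ n n ≤ Submodule.span ℂ {1} :=
    Submodule.span_mono fun x hx => (IsCupDiagram.le hx).2 rfl
  obtain ⟨c, rfl⟩ := Submodule.mem_span_singleton.1 (this hz)
  exact ⟨c, y, hy, add_comm _ _⟩

/-- Induction on the first cap, for diagrams which decrease the number of strands. -/
theorem capped_induction {a b : ℕ} {p : Diagram δ → Prop} {x : Diagram δ}
    (hx : x ∈ capped δ a b)
    (mem : ∀ i y, i + 2 ≤ a → y ∈ diagrams δ (a - 2) b → p (y * cap δ i)) (zero : p 0)
    (add : ∀ x y, p x → p y → p (x + y)) (smul : ∀ (c : ℂ) x, p x → p (c • x)) : p x :=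
  Submodule.span_induction (p := fun x _ => p x)
    (by rintro _ ⟨i, y, hi, hy, rfl⟩; exact mem i y hi hy) zero (fun x y _ _ => add x y)
    (fun c x _ => smul c x) hx

/-! ### The Temperley-Lieb algebras as algebras of diagrams -/

theorem toDiagram_mem {n : ℕ} {x : TL δ} (hx : x ∈ TL.fin δ n) :
    toDiagram δ x ∈ diagrams δ n n := by
  induction hx using Algebra.adjoin_induction with
  | mem x hx =>
    obtain ⟨i, hi, rfl⟩ := hx
    rw [toDiagram_e]; exact e_mem_diagrams (by omega)
  | algebraMap c =>
    rw [AlgHom.commutes, Algebra.algebraMap_eq_smul_one]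
    exact Submodule.smul_mem _ _ (one_mem_diagrams n)
  | add x y _ _ h h' => rw [map_add]; exact add_mem h h'
  | mul x y _ _ h h' => rw [map_mul]; exact mul_mem_diagrams h h'

/-- The image of `TL_n` in the algebra of diagrams. -/
noncomputable def finImage (δ : ℝ) (n : ℕ) : Subalgebra ℂ (Diagram δ) :=
  (TL.fin δ n).map (toDiagram δ)

theorem e_mem_finImage {n i : ℕ} (hi : i + 2 ≤ n) : cup δ i * cap δ i ∈ finImage δ n :=
  ⟨TL.e δ i, Algebra.subset_adjoin ⟨i, by omega, rfl⟩, toDiagram_e i⟩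

theorem finImage_induction {n : ℕ} {p : Diagram δ → Prop} {x : Diagram δ}
    (hx : x ∈ finImage δ n) (one : p 1) (gen : ∀ i, i + 2 ≤ n → p (cup δ i * cap δ i))
    (mul : ∀ x y, p x → p y → p (x * y))
    (add : ∀ x y, p x → p y → p (x + y)) (smul : ∀ (c : ℂ) x, p x → p (c • x)) : p x := by
  obtain ⟨x, hx, rfl⟩ := hx
  change p (toDiagram δ x)
  induction hx using Algebra.adjoin_induction with
  | mem x hx => obtain ⟨i, hi, rfl⟩ := hx; rw [toDiagram_e]; exact gen i (by omega)
  | algebraMap c => rw [AlgHom.commutes, Algebra.algebraMap_eq_smul_one]; exact smul _ _ one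
  | add x y _ _ h h' => rw [map_add]; exact add _ _ h h'
  | mul x y _ _ h h' => rw [map_mul]; exact mul _ _ h h'

theorem cup_mul_e {n i k : ℕ} (hi : i ≤ n) (hk : k + 2 ≤ n) :
    ∃ y ∈ finImage δ (n + 2), cup δ i * (cup δ k * cap δ k) = y * cup δ i := by
  rcases Nat.lt_or_ge k i with h | h
  · rcases Nat.eq_or_lt_of_le (Nat.succ_le_of_lt h) with h | h
    · subst h
      refine ⟨_, mul_mem (mul_mem (e_mem_finImage (i := k + 1) (by omega))
        (e_mem_finImage (i := k) (by omega))) (e_mem_finImage (i := k + 2) (by omega)), ?_⟩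
      have h1 : cup δ (k + 1) = cup δ (k + 1) * cap δ (k + 1) * cup δ (k + 2) := by
        rw [mul_assoc, cap_cup_zig, mul_one]
      have h2 : cup δ (k + 2) = cup δ (k + 2) * cap δ (k + 2) * cup δ (k + 1) := by
        rw [mul_assoc, cap_cup_zag, mul_one]
      have hc : cup δ (k + 2) * (cup δ k * cap δ k) = cup δ k * cap δ k * cup δ (k + 2) := by
        have := cup_mul_of_mem (e_mem_diagrams (δ := δ) (n := k + 2) (i := k) le_rfl) 0
        simpa using this
      calc cup δ k.succ * (cup δ k * cap δ k)
          = cup δ (k + 1) * cap δ (k + 1) * (cup δ (k + 2) * (cup δ k * cap δ k)) := by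
            rw [← mul_assoc (cup δ (k + 1) * cap δ (k + 1)), ← h1]
        _ = _ := by
            conv_lhs => rw [hc, h2]
            simp only [mul_assoc]
    · obtain ⟨j, rfl⟩ : ∃ j, i = k + j + 2 := ⟨i - k - 2, by omega⟩
      refine ⟨_, e_mem_finImage (i := k) (by omega), ?_⟩
      have := cup_mul_of_mem (e_mem_diagrams (δ := δ) (n := k + 2) (i := k) le_rfl) j
      rw [show k + j + 2 = k + 2 + j by ring, this]
  · refine ⟨_, e_mem_finImage (i := k + 2) (by omega), ?_⟩
    rw [← mul_assoc, cup_cup δ h, mul_assoc, mul_assoc, cap_cup_right δ h]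

theorem cup_mul_finImage {n i : ℕ} (hi : i ≤ n) {x : Diagram δ} (hx : x ∈ finImage δ n) :
    ∃ y ∈ finImage δ (n + 2), cup δ i * x = y * cup δ i := by
  refine finImage_induction (p := fun x => ∃ y ∈ finImage δ (n + 2), cup δ i * x = y * cup δ i)
    hx ⟨1, one_mem _, by simp⟩ (fun k hk => cup_mul_e hi hk) ?_ ?_ ?_
  · rintro x y ⟨x', hx', h⟩ ⟨y', hy', h'⟩
    exact ⟨x' * y', mul_mem hx' hy', by rw [← mul_assoc, h, mul_assoc, h', mul_assoc]⟩
  · rintro x y ⟨x', hx', h⟩ ⟨y', hy', h'⟩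
    exact ⟨x' + y', add_mem hx' hy', by rw [mul_add, h, h', add_mul]⟩
  · rintro c x ⟨x', hx', h⟩
    exact ⟨c • x', Subalgebra.smul_mem _ hx' c, by rw [mul_smul_comm, h, smul_mul_assoc]⟩

theorem cup_mul_cap_mem_finImage {n i j : ℕ} (hi : i ≤ n) (hj : j ≤ n) :
    cup δ i * cap δ j ∈ finImage δ (n + 2) := by
  have up : ∀ d i, i + d ≤ n → cup δ i * cap δ (i + d) ∈ finImage δ (n + 2) := by
    intro d
    induction d with
    | zero => exact fun i hi => e_mem_finImage (by omega)
    | succ d ih =>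
      intro i hi
      have h1 : cup δ i = cup δ i * cap δ i * cup δ (i + 1) := by
        rw [mul_assoc, cap_cup_zig, mul_one]
      rw [h1, mul_assoc, show i + (d + 1) = i + 1 + d by ring]
      exact mul_mem (e_mem_finImage (by omega)) (ih _ (by omega))
  have down : ∀ d j, j + d ≤ n → cup δ (j + d) * cap δ j ∈ finImage δ (n + 2) := by
    intro d
    induction d with
    | zero => exact fun i hi => e_mem_finImage (by omega)
    | succ d ih =>
      intro i hi
      have h1 : cup δ (i + d + 1) = cup δ (i + d + 1) * cap δ (i + d + 1) * cup δ (i + d) := by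
        rw [mul_assoc, cap_cup_zag, mul_one]
      rw [← add_assoc, h1, mul_assoc]
      exact mul_mem (e_mem_finImage (by omega)) (ih _ (by omega))
  rcases le_total i j with h | h
  · obtain ⟨d, rfl⟩ := Nat.exists_eq_add_of_le h; exact up d i hj
  · obtain ⟨d, rfl⟩ := Nat.exists_eq_add_of_le h; exact down d j hi

theorem mem_finImage_of_mem {n : ℕ} {x : Diagram δ} (hx : x ∈ diagrams δ n n) :
    x ∈ finImage δ n := by
  induction n using Nat.strong_induction_on generalizing x with
  | _ n ih =>
    obtain ⟨c, y, hy, rfl⟩ := exists_smul_one_add_capped hx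
    refine add_mem (Subalgebra.smul_mem _ (one_mem _) c) ?_
    refine capped_induction hy (fun i y hi hy => ?_) (zero_mem _) (fun _ _ => add_mem)
      (fun c x h => Subalgebra.smul_mem _ h c)
    obtain ⟨k, rfl⟩ : ∃ k, n = k + 2 := ⟨n - 2, by omega⟩
    have hy' : dagger y ∈ capped δ (k + 2) k := 
      mem_capped_of_lt (by omega) (dagger_mem_diagrams (by simpa using hy))
    have : ∀ z ∈ capped δ (k + 2) k, dagger z * cap δ i ∈ finImage δ (k + 2) := by
      intro z hz
      refine capped_induction (p := fun z => dagger z * cap δ i ∈ finImage δ (k + 2)) hz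
        (fun j w hj hw => ?_) (by simp) (fun _ _ h h' => ?_) (fun c x h => ?_)
      · have hw' := ih k (by omega) (dagger_mem_diagrams (by simpa using hw))
        obtain ⟨v, hv, h⟩ := cup_mul_finImage (i := j) (n := k) (by omega) hw'
        rw [dagger_mul, dagger_cap, h, mul_assoc]
        exact mul_mem hv (cup_mul_cap_mem_finImage (by omega) (by omega))
      · rw [dagger_add, add_mul]; exact add_mem h h'
      · rw [dagger_smul, smul_mul_assoc]; exact Subalgebra.smul_mem _ h c
    simpa using this _ hy'

theorem exists_toDiagram_eq {n : ℕ} {x : Diagram δ} (hx : x ∈ diagrams δ n n) :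
    ∃ y ∈ TL.fin δ n, toDiagram δ y = x := mem_finImage_of_mem hx

theorem TL.fin_mono {m n : ℕ} (h : m ≤ n) : TL.fin δ m ≤ TL.fin δ n :=
  Algebra.adjoin_mono fun _ ⟨i, hi, hx⟩ => ⟨i, by omega, hx⟩

theorem TL.exists_mem_fin (x : TL δ) : ∃ n, x ∈ TL.fin δ n := by
  induction x using TL.induction with
  | scalar c => exact ⟨0, Subalgebra.algebraMap_mem _ c⟩
  | gen i => exact ⟨i + 2, Algebra.subset_adjoin ⟨i, by omega, rfl⟩⟩
  | mul x y hx hy =>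
    obtain ⟨m, hm⟩ := hx
    obtain ⟨n, hn⟩ := hy
    exact ⟨max m n, mul_mem (TL.fin_mono (le_max_left _ _) hm) (TL.fin_mono (le_max_right _ _) hn)⟩
  | add x y hx hy =>
    obtain ⟨m, hm⟩ := hx
    obtain ⟨n, hn⟩ := hy
    exact ⟨max m n, add_mem (TL.fin_mono (le_max_left _ _) hm) (TL.fin_mono (le_max_right _ _) hn)⟩

end basics
end TemperleyLieb

namespace TemperleyLieb

/-! ### The representation on spin chains -/

section spin

/-- Insertion of two entries into a sequence. -/
def ins (i : ℕ) (a b : Bool) (s : ℕ → Bool) : ℕ → Bool := fun n =>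
  if n < i then s n else if n = i then a else if n = i + 1 then b else s (n - 2)

/-- Deletion of two entries from a sequence. -/
def del (i : ℕ) (s : ℕ → Bool) : ℕ → Bool := fun n => if n < i then s n else s (n + 2)

theorem ins_lt {i n : ℕ} (a b : Bool) (s : ℕ → Bool) (h : n < i) : ins i a b s n = s n := by
  simp [ins, h]

theorem ins_self (i : ℕ) (a b : Bool) (s : ℕ → Bool) : ins i a b s i = a := by simp [ins]

theorem ins_succ (i : ℕ) (a b : Bool) (s : ℕ → Bool) : ins i a b s (i + 1) = b := by simp [ins]

theorem ins_ge {i n : ℕ} (a b : Bool) (s : ℕ → Bool) (h : i ≤ n) :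
    ins i a b s (n + 2) = s n := by
  have h1 : ¬ n + 2 < i := by omega
  have h2 : n + 2 ≠ i := by omega
  have h3 : n + 2 ≠ i + 1 := by omega
  simp [ins, h1, h2, h3]

theorem del_lt {i n : ℕ} (s : ℕ → Bool) (h : n < i) : del i s n = s n := by simp [del, h]

theorem del_ge {i n : ℕ} (s : ℕ → Bool) (h : i ≤ n) : del i s n = s (n + 2) := by
  simp [del, not_lt.2 h]

theorem seq_cases {p : ℕ → Prop} (i : ℕ) (lt : ∀ n, n < i → p n) (self : p i) (succ : p (i + 1))
    (ge : ∀ n, i ≤ n → p (n + 2)) (n : ℕ) : p n := by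
  rcases Nat.lt_or_ge n i with h | h
  · exact lt n h
  · rcases Nat.eq_or_lt_of_le h with h | h
    · exact h ▸ self
    · rcases Nat.eq_or_lt_of_le (Nat.succ_le_of_lt h) with h | h
      · exact h ▸ succ
      · obtain ⟨k, rfl⟩ : ∃ k, n = k + 2 := ⟨n - 2, by omega⟩
        exact ge k (by omega)

theorem del_ins (i : ℕ) (a b : Bool) (s : ℕ → Bool) : del i (ins i a b s) = s := by
  funext n
  grind [ins, del]

theorem ins_del (i : ℕ) (s : ℕ → Bool) : ins i (s i) (s (i + 1)) (del i s) = s := by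
  funext n
  grind [ins, del]

theorem del_succ_ins (i : ℕ) (a b : Bool) (s : ℕ → Bool) (h : s i = a) :
    del (i + 1) (ins i a b s) = s := by
  funext n
  grind [ins, del]

theorem del_ins_succ (i : ℕ) (a b : Bool) (s : ℕ → Bool) (h : s i = b) :
    del i (ins (i + 1) a b s) = s := by
  funext n
  grind [ins, del]

theorem del_ins_of_le {i j : ℕ} (h : i ≤ j) (a b : Bool) (s : ℕ → Bool) :
    del (j + 2) (ins i a b s) = ins i a b (del j s) := by
  funext n
  grind [ins, del]

theorem del_ins_of_ge {i j : ℕ} (h : i ≤ j) (a b : Bool) (s : ℕ → Bool) :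
    del i (ins (j + 2) a b s) = ins j a b (del i s) := by
  funext n
  grind [ins, del]

theorem del_del {i j : ℕ} (h : i ≤ j) (s : ℕ → Bool) :
    del j (del i s) = del i (del (j + 2) s) := by
  funext n
  simp only [del]
  split_ifs <;> first | rfl | omega

theorem ins_ins {i j : ℕ} (h : i ≤ j) (a b c d : Bool) (s : ℕ → Bool) :
    ins i a b (ins j c d s) = ins (j + 2) c d (ins i a b s) := by
  funext n
  grind (splits := 20) [ins]

theorem exists_loop_parameter (δ : ℝ) : ∃ z : ℂ, z ≠ 0 ∧ z + z⁻¹ = δ := by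
  obtain ⟨w, hw⟩ := IsAlgClosed.exists_pow_nat_eq ((δ : ℂ) ^ 2 / 4 - 1) (n := 2) (by norm_num)
  have h : ((δ : ℂ) / 2 + w) * ((δ : ℂ) / 2 - w) = 1 := by linear_combination -hw
  have h0 : (δ : ℂ) / 2 + w ≠ 0 := left_ne_zero_of_mul (by rw [h]; exact one_ne_zero)
  refine ⟨_, h0, ?_⟩
  rw [inv_eq_of_mul_eq_one_right h]
  ring

/-- A number `z` with `z + z⁻¹ = δ`. -/
noncomputable def loopParam (δ : ℝ) : ℂ := (exists_loop_parameter δ).choose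

theorem loopParam_ne_zero (δ : ℝ) : loopParam δ ≠ 0 := (exists_loop_parameter δ).choose_spec.1

theorem loopParam_add_inv (δ : ℝ) : loopParam δ + (loopParam δ)⁻¹ = δ :=
  (exists_loop_parameter δ).choose_spec.2

/-- The functions on spin configurations. -/
abbrev Spin : Type := (ℕ → Bool) → ℂ

/-- The matrix elements of a cup. -/
noncomputable def cupCoeff (δ : ℝ) : Bool → Bool → ℂ
  | false, true => loopParam δ
  | true, false => 1
  | _, _ => 0

/-- The action of a cup on spin chains. -/
noncomputable def cupOp (δ : ℝ) (i : ℕ) : Module.End ℂ Spin where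
  toFun f s := cupCoeff δ (s i) (s (i + 1)) * f (del i s)
  map_add' f g := by funext s; simp [mul_add]
  map_smul' c f := by funext s; simp; ring

/-- The action of a cap on spin chains. -/
noncomputable def capOp (δ : ℝ) (i : ℕ) : Module.End ℂ Spin where
  toFun f s := f (ins i false true s) + (loopParam δ)⁻¹ * f (ins i true false s)
  map_add' f g := by funext s; simp; ring
  map_smul' c f := by funext s; simp; ring

theorem cupOp_apply (δ : ℝ) (i : ℕ) (f : Spin) (s : ℕ → Bool) :
    cupOp δ i f s = cupCoeff δ (s i) (s (i + 1)) * f (del i s) := rfl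

theorem capOp_apply (δ : ℝ) (i : ℕ) (f : Spin) (s : ℕ → Bool) :
    capOp δ i f s = f (ins i false true s) + (loopParam δ)⁻¹ * f (ins i true false s) := rfl

/-- The representation of diagrams on spin chains. -/
noncomputable def spinRep (δ : ℝ) : Diagram δ →ₐ[ℂ] Module.End ℂ Spin :=
  RingQuot.liftAlgHom ℂ ⟨FreeAlgebra.lift ℂ (fun g => match g with
      | CupCap.cup i => cupOp δ i
      | CupCap.cap i => capOp δ i), by
    have hz := loopParam_ne_zero δ
    intro x y h
    cases h with
    | loop i =>
      ext f s
      simp only [map_mul, FreeAlgebra.lift_ι_apply, AlgHom.commutes, Module.End.mul_apply,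
        capOp_apply, cupOp_apply, ins_self, ins_succ, del_ins, cupCoeff,
        Module.algebraMap_end_apply, Pi.smul_apply, smul_eq_mul, ← loopParam_add_inv]
      ring
    | zig i =>
      ext f s
      simp only [map_mul, FreeAlgebra.lift_ι_apply, map_one, Module.End.mul_apply,
        capOp_apply, cupOp_apply, ins_succ, Module.End.one_apply]
      rw [ins_ge _ _ _ le_rfl, ins_ge _ _ _ le_rfl]
      cases hs : s i
      · rw [del_succ_ins _ _ _ _ hs]; simp [cupCoeff]
      · rw [del_succ_ins _ true _ _ hs]; simp [cupCoeff, hz]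
    | zag i =>
      ext f s
      simp only [map_mul, FreeAlgebra.lift_ι_apply, map_one, Module.End.mul_apply,
        capOp_apply, cupOp_apply, ins_self, Module.End.one_apply]
      rw [ins_lt _ _ _ (Nat.lt_succ_self i), ins_lt _ _ _ (Nat.lt_succ_self i)]
      cases hs : s i
      · rw [del_ins_succ _ _ false _ hs]; simp [cupCoeff, hz]
      · rw [del_ins_succ _ _ true _ hs]; simp [cupCoeff]
    | left i j h =>
      ext f s
      simp only [map_mul, FreeAlgebra.lift_ι_apply, Module.End.mul_apply, capOp_apply,
        cupOp_apply, del_ins_of_le h, show j + 2 + 1 = j + 1 + 2 by rfl,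
        ins_ge _ _ _ h, ins_ge _ _ _ (h.trans (Nat.le_succ j))]
      ring
    | right i j h =>
      ext f s
      simp only [map_mul, FreeAlgebra.lift_ι_apply, Module.End.mul_apply, capOp_apply,
        cupOp_apply, del_ins_of_ge h, ins_lt _ _ _ (show i < j + 2 by omega),
        ins_lt _ _ _ (show i + 1 < j + 2 by omega)]
      ring
    | cups i j h =>
      ext f s
      simp only [map_mul, FreeAlgebra.lift_ι_apply, Module.End.mul_apply,
        cupOp_apply, del_del h, del_lt _ (show i < j + 2 by omega),
        del_lt _ (show i + 1 < j + 2 by omega), del_ge _ h, del_ge _ (h.trans (Nat.le_succ j)),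
        show j + 1 + 2 = j + 2 + 1 by rfl]
      ring
    | caps i j h =>
      ext f s
      simp only [map_mul, FreeAlgebra.lift_ι_apply, Module.End.mul_apply,
        capOp_apply, ins_ins h]
      ring⟩

variable {δ : ℝ}

@[simp] theorem spinRep_cup (i : ℕ) : spinRep δ (cup δ i) = cupOp δ i := by
  simp [spinRep, cup, RingQuot.liftAlgHom_mkAlgHom_apply]

@[simp] theorem spinRep_cap (i : ℕ) : spinRep δ (cap δ i) = capOp δ i := by
  simp [spinRep, cap, RingQuot.liftAlgHom_mkAlgHom_apply]

open Classical in
/-- The indicator function of a spin configuration. -/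
noncomputable def ket (t : ℕ → Bool) : Spin := fun s => if s = t then 1 else 0

/-- The configuration in which all spins are down. -/
def zeroSeq : ℕ → Bool := fun _ => false

/-- The vacuum expectation value. -/
noncomputable def vev (δ : ℝ) : Diagram δ →ₗ[ℂ] ℂ where
  toFun x := spinRep δ x (ket zeroSeq) zeroSeq
  map_add' x y := by simp
  map_smul' c x := by simp

theorem vev_apply (x : Diagram δ) : vev δ x = spinRep δ x (ket zeroSeq) zeroSeq := rfl

@[simp] theorem vev_one : vev δ 1 = 1 := by simp [vev_apply, ket]

theorem ket_ins {i : ℕ} {a b : Bool} (s : ℕ → Bool) (h : a = true ∨ b = true) :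
    ket zeroSeq (ins i a b s) = 0 := by
  rw [ket, if_neg]
  intro h'
  have h1 := congrFun h' i
  have h2 := congrFun h' (i + 1)
  rw [ins_self] at h1
  rw [ins_succ] at h2
  rcases h with h | h <;> simp_all [zeroSeq]

theorem capOp_vac (i : ℕ) : capOp δ i (ket zeroSeq) = 0 := by
  funext s
  rw [capOp_apply, ket_ins _ (by simp), ket_ins _ (by simp)]
  simp

theorem spinRep_vac_of_capped {a b : ℕ} {x : Diagram δ} (hx : x ∈ capped δ a b) :
    spinRep δ x (ket zeroSeq) = 0 := by
  refine capped_induction (p := fun x => spinRep δ x (ket zeroSeq) = 0) hx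
    (fun i y _ _ => ?_) (by simp) (fun x y h h' => ?_) (fun c x h => ?_)
  · rw [map_mul, Module.End.mul_apply, spinRep_cap, capOp_vac, map_zero]
  · rw [map_add, LinearMap.add_apply, h, h', add_zero]
  · rw [map_smul, LinearMap.smul_apply, h, smul_zero]

theorem spinRep_vac_of_lt {a b : ℕ} (h : b < a) {x : Diagram δ} (hx : x ∈ diagrams δ a b) :
    spinRep δ x (ket zeroSeq) = 0 :=
  spinRep_vac_of_capped (mem_capped_of_lt h hx)

theorem vev_capped {a b : ℕ} {x : Diagram δ} (hx : x ∈ capped δ a b) : vev δ x = 0 := by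
  rw [vev_apply, spinRep_vac_of_capped hx]; rfl

theorem eq_vev_add_capped {n : ℕ} {x : Diagram δ} (hx : x ∈ diagrams δ n n) :
    ∃ y ∈ capped δ n n, x = vev δ x • 1 + y := by
  obtain ⟨c, y, hy, rfl⟩ := exists_smul_one_add_capped hx
  refine ⟨y, hy, ?_⟩
  rw [map_add, map_smul, vev_one, vev_capped hy]
  simp

theorem spinRep_vac {n : ℕ} {x : Diagram δ} (hx : x ∈ diagrams δ n n) :
    spinRep δ x (ket zeroSeq) = vev δ x • ket zeroSeq := by
  obtain ⟨y, hy, h⟩ := eq_vev_add_capped hx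
  conv_lhs => rw [h]
  simp [spinRep_vac_of_capped hy]

theorem vev_mul {n : ℕ} (x : Diagram δ) {y : Diagram δ} (hy : y ∈ diagrams δ n n) :
    vev δ (x * y) = vev δ x * vev δ y := by
  rw [vev_apply, map_mul, Module.End.mul_apply, spinRep_vac hy, map_smul, Pi.smul_apply,
    ← vev_apply, smul_eq_mul, mul_comm]

theorem vev_mul_of_lt {a b : ℕ} (h : b < a) (x : Diagram δ) {y : Diagram δ}
    (hy : y ∈ diagrams δ a b) : vev δ (x * y) = 0 := by
  rw [vev_apply, map_mul, Module.End.mul_apply, spinRep_vac_of_lt h hy, map_zero]; rfl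

theorem vev_cup_mul (i : ℕ) (x : Diagram δ) : vev δ (cup δ i * x) = 0 := by
  rw [vev_apply, map_mul, Module.End.mul_apply, spinRep_cup, cupOp_apply]
  simp [zeroSeq, cupCoeff]

theorem vev_dagger_capped_mul {a b : ℕ} {y : Diagram δ} (hy : y ∈ capped δ a b)
    (x : Diagram δ) : vev δ (dagger y * x) = 0 := by
  refine capped_induction (p := fun y => vev δ (dagger y * x) = 0) hy
    (fun i y _ _ => ?_) (by simp) (fun x y h h' => ?_) (fun c x h => ?_)
  · rw [dagger_mul, dagger_cap, mul_assoc, vev_cup_mul]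
  · rw [dagger_add, add_mul, map_add, h, h', add_zero]
  · rw [dagger_smul, smul_mul_assoc, map_smul, h, smul_zero]

theorem vev_lt_mul {a b : ℕ} (h : a < b) (x : Diagram δ) {y : Diagram δ}
    (hy : y ∈ diagrams δ a b) : vev δ (y * x) = 0 := by
  have := vev_dagger_capped_mul (mem_capped_of_lt h (dagger_mem_diagrams hy)) x
  rwa [dagger_dagger] at this

theorem vev_dagger {n : ℕ} {x : Diagram δ} (hx : x ∈ diagrams δ n n) :
    vev δ (dagger x) = vev δ x := by
  obtain ⟨y, hy, h⟩ := eq_vev_add_capped hx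
  have := vev_dagger_capped_mul hy 1
  rw [mul_one] at this
  rw [h, dagger_add, dagger_smul, dagger_one, map_add, this, map_add, vev_capped hy]

/-! ### Locality -/

theorem spinRep_tail {a b : ℕ} {x : Diagram δ} (hx : x ∈ diagrams δ a b) (t : ℕ → Bool) :
    ∀ s : ℕ → Bool, spinRep δ x (ket t) s ≠ 0 → ∀ k, s (b + k) = t (a + k) := by
  have key : ∀ x, IsDiagram δ a b x → ∀ s : ℕ → Bool, (¬ ∀ k, s (b + k) = t (a + k)) →
      spinRep δ x (ket t) s = 0 := by
    clear hx
    intro x hx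
    induction hx with
    | one =>
      intro s hs
      simp only [map_one, Module.End.one_apply, ket]
      rw [if_neg]; rintro rfl; exact hs fun _ => rfl
    | @cup b x i hi _ ih =>
      intro s hs
      rw [map_mul, Module.End.mul_apply, spinRep_cup, cupOp_apply, ih, mul_zero]
      contrapose! hs
      intro k
      rw [← hs k, del_ge _ (by omega), add_right_comm]
    | @cap b x i hi _ ih =>
      intro s hs
      rw [map_mul, Module.End.mul_apply, spinRep_cap, capOp_apply, ih, ih, mul_zero, add_zero]
      all_goals
        contrapose! hs
        intro k
        rw [← hs k, add_right_comm, ins_ge _ _ _ (by omega)]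
  intro s hs
  by_contra hk
  refine hs (diagrams_induction (p := fun x => spinRep δ x (ket t) s = 0) hx
    (fun x hx => key x hx s hk) (by simp) (fun x y h h' => ?_) (fun c x h => ?_))
  · rw [map_add, LinearMap.add_apply, Pi.add_apply, h, h', add_zero]
  · rw [map_smul, LinearMap.smul_apply, Pi.smul_apply, h, smul_zero]

theorem spinRep_local {a b : ℕ} {x : Diagram δ} (hx : x ∈ diagrams δ a b) {t t' : ℕ → Bool}
    (ht : ∀ i < a, t i = t' i) {s s' : ℕ → Bool} (hs : ∀ i < b, s i = s' i)
    (h : ∀ k, s (b + k) = t (a + k)) (h' : ∀ k, s' (b + k) = t' (a + k)) :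
    spinRep δ x (ket t) s = spinRep δ x (ket t') s' := by
  have key : ∀ x, IsDiagram δ a b x → ∀ s s' : ℕ → Bool, (∀ i < b, s i = s' i) →
      (∀ k, s (b + k) = t (a + k)) → (∀ k, s' (b + k) = t' (a + k)) →
      spinRep δ x (ket t) s = spinRep δ x (ket t') s' := by
    clear hx hs h h' s s'
    intro x hx
    induction hx with
    | one =>
      intro s s' hs h h'
      rw [map_one, Module.End.one_apply, Module.End.one_apply]
      simp only [ket]
      have : s = t ↔ s' = t' := by
        constructor
        · rintro rfl
          funext n
          rcases Nat.lt_or_ge n a with hn | hn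
          · rw [← hs n hn, ht n hn]
          · obtain ⟨k, rfl⟩ := Nat.exists_eq_add_of_le hn; exact h' k
        · rintro rfl
          funext n
          rcases Nat.lt_or_ge n a with hn | hn
          · rw [hs n hn, ht n hn]
          · obtain ⟨k, rfl⟩ := Nat.exists_eq_add_of_le hn; exact h k
      by_cases h1 : s = t
      · rw [if_pos h1, if_pos (this.1 h1)]
      · rw [if_neg h1, if_neg fun h2 => h1 (this.2 h2)]
    | @cup b x i hi _ ih =>
      intro s s' hs h h'
      simp only [map_mul, Module.End.mul_apply, spinRep_cup, cupOp_apply]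
      rw [hs i (by omega), hs (i + 1) (by omega), ih (del i s) (del i s')]
      · intro n hn
        simp only [del]
        split_ifs
        · exact hs n (by omega)
        · exact hs (n + 2) (by omega)
      · intro k; rw [← h k, del_ge _ (by omega), add_right_comm]
      · intro k; rw [← h' k, del_ge _ (by omega), add_right_comm]
    | @cap b x i hi _ ih =>
      intro s s' hs h h'
      simp only [map_mul, Module.End.mul_apply, spinRep_cap, capOp_apply]
      have h1 : ∀ (u v : Bool), ∀ n < b + 2, ins i u v s n = ins i u v s' n := by
        intro u v
        refine seq_cases i (fun n hn hb => ?_) (fun _ => ?_) (fun _ => ?_) (fun n hn hb => ?_)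
        · rw [ins_lt _ _ _ hn, ins_lt _ _ _ hn, hs n (by omega)]
        · rw [ins_self, ins_self]
        · rw [ins_succ, ins_succ]
        · rw [ins_ge _ _ _ hn, ins_ge _ _ _ hn, hs n (by omega)]
      have h2 : ∀ (s : ℕ → Bool) (u v : Bool) (k : ℕ), ins i u v s (b + 2 + k) = s (b + k) := by
        intro s u v k
        rw [add_right_comm, ins_ge _ _ _ (by omega)]
      rw [ih _ _ (h1 false true) (fun k => by rw [h2, h]) (fun k => by rw [h2, h']),
        ih _ _ (h1 true false) (fun k => by rw [h2, h]) (fun k => by rw [h2, h'])]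
  refine diagrams_induction
    (p := fun x => spinRep δ x (ket t) s = spinRep δ x (ket t') s') hx
    (fun x hx => key x hx s s' hs h h') (by simp) (fun x y h h' => ?_) (fun c x h => ?_)
  · simp only [map_add, LinearMap.add_apply, Pi.add_apply, h, h']
  · simp only [map_smul, LinearMap.smul_apply, Pi.smul_apply, h]

theorem sum_range_del (h : ℕ → ℕ) {i b : ℕ} (hi : i ≤ b) :
    ∑ n ∈ Finset.range (b + 2), h n =
      ∑ n ∈ Finset.range b, h (if n < i then n else n + 2) + h i + h (i + 1) := by
  obtain ⟨c, rfl⟩ := Nat.exists_eq_add_of_le hi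
  induction c with
  | zero =>
    rw [add_zero, Finset.sum_range_succ, Finset.sum_range_succ]
    congr 2
    exact Finset.sum_congr rfl fun n hn => by rw [if_pos (Finset.mem_range.1 hn)]
  | succ c ih =>
    rw [show i + (c + 1) + 2 = i + c + 2 + 1 by ring, Finset.sum_range_succ, ih (by omega),
      show i + (c + 1) = i + c + 1 by ring, Finset.sum_range_succ, if_neg (by omega)]
    ring

/-- The number of spins that are up among the first `n`. -/
def ups (n : ℕ) (s : ℕ → Bool) : ℕ := ∑ i ∈ Finset.range n, if s i then 1 else 0

theorem ups_del {i b : ℕ} (hi : i ≤ b) (s : ℕ → Bool) (h : s i ≠ s (i + 1)) :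
    ups (b + 2) s = ups b (del i s) + 1 := by
  rw [ups, sum_range_del _ hi, ups, add_assoc]
  congr 1
  · refine Finset.sum_congr rfl fun n _ => ?_
    simp only [del]
    split_ifs <;> rfl
  · cases h1 : s i <;> cases h2 : s (i + 1) <;> simp_all

theorem ups_ins {i b : ℕ} (hi : i ≤ b) {u v : Bool} (huv : u ≠ v) (s : ℕ → Bool) :
    ups (b + 2) (ins i u v s) = ups b s + 1 := by
  rw [ups_del hi _ (by rwa [ins_self, ins_succ]), del_ins]

theorem spinRep_weight {a b : ℕ} {x : Diagram δ} (hx : x ∈ diagrams δ a b) (t : ℕ → Bool)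
    (s : ℕ → Bool) (hs : spinRep δ x (ket t) s ≠ 0) :
    2 * ups b s + a = 2 * ups a t + b := by
  have key : ∀ x, IsDiagram δ a b x → ∀ s : ℕ → Bool, ¬ (2 * ups b s + a = 2 * ups a t + b) →
      spinRep δ x (ket t) s = 0 := by
    clear hs hx s
    intro x hx
    induction hx with
    | one =>
      intro s hs
      simp only [map_one, Module.End.one_apply, ket]
      rw [if_neg]; rintro rfl; exact hs rfl
    | @cup b x i hi _ ih =>
      intro s hs
      rw [map_mul, Module.End.mul_apply, spinRep_cup, cupOp_apply]
      by_cases h : s i = s (i + 1)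
      · rw [h]; cases s (i + 1) <;> simp [cupCoeff]
      · rw [ih, mul_zero]
        rw [ups_del hi s h] at hs
        omega
    | @cap b x i hi _ ih =>
      intro s hs
      rw [map_mul, Module.End.mul_apply, spinRep_cap, capOp_apply, ih, ih, mul_zero, add_zero]
      all_goals
        first
          | rw [ups_ins hi (u := false) (v := true) (by simp)]
          | rw [ups_ins hi (u := true) (v := false) (by simp)]
        omega
  by_contra hk
  refine hs (diagrams_induction (p := fun x => spinRep δ x (ket t) s = 0) hx
    (fun x hx => key x hx s hk) (by simp) (fun x y h h' => ?_) (fun c x h => ?_))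
  · rw [map_add, LinearMap.add_apply, Pi.add_apply, h, h', add_zero]
  · rw [map_smul, LinearMap.smul_apply, Pi.smul_apply, h, smul_zero]

end spin
end TemperleyLieb

namespace TemperleyLieb

/-! ### Separation of diagrams by vacuum expectation values -/

section separation

variable {δ : ℝ}

theorem eq_zeroSeq_of_killed {T : ℕ → Spin → Spin} {α β : ℂ} (hβ : β ≠ 0)
    (hT : ∀ i v s, T i v s = α * v (ins i false true s) + β * v (ins i true false s))
    {v : Spin} {n : ℕ} (hv : ∀ s, v s ≠ 0 → ∀ i, n ≤ i → s i = false)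
    (h : ∀ i, T i v = 0) (s : ℕ → Bool) (hs : v s ≠ 0) : s = zeroSeq := by
  have key : ∀ d k, n ≤ k + d → ∀ s, v s ≠ 0 → s k = false := by
    intro d
    induction d with
    | zero => intro k hk s hs; exact hv s hs k hk
    | succ d ih =>
      intro k hk s hs
      by_contra hk1
      rw [Bool.not_eq_false] at hk1
      have hk2 := ih (k + 1) (by omega) s hs
      have h1 := congrFun (h k) (del k s)
      rw [hT] at h1
      have h2 : ins k true false (del k s) = s := by
        conv_rhs => rw [← ins_del k s, hk1, hk2]
      rw [h2] at h1
      have h3 : v (ins k false true (del k s)) ≠ 0 := by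
        intro h0
        rw [h0, mul_zero, zero_add] at h1
        exact mul_ne_zero hβ hs h1
      have := ih (k + 1) (by omega) _ h3
      rw [ins_succ] at this
      exact absurd this (by simp)
  funext k
  exact key n k (by omega) s hs

theorem exists_word_ne_zero {T : ℕ → Spin → Spin} {α β : ℂ} (hβ : β ≠ 0)
    (hT : ∀ i v s, T i v s = α * v (ins i false true s) + β * v (ins i true false s))
    (n : ℕ) (v : Spin) (hv : ∀ s, v s ≠ 0 → ∀ i, n ≤ i → s i = false) (hv0 : v ≠ 0) :
    ∃ L : List ℕ, L.foldl (fun w i => T i w) v zeroSeq ≠ 0 := by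
  induction n generalizing v with
  | zero =>
    refine ⟨[], fun h => hv0 ?_⟩
    funext s
    by_contra hs
    have : s = zeroSeq := funext fun k => hv s hs k (Nat.zero_le k)
    exact hs (this ▸ h)
  | succ n ih =>
    by_cases hz : v zeroSeq = 0
    swap
    · exact ⟨[], hz⟩
    by_cases h : ∀ i, T i v = 0
    · refine absurd ?_ hv0
      funext s
      by_contra hs
      exact hs ((eq_zeroSeq_of_killed hβ hT hv h s hs) ▸ hz)
    · push Not at h
      obtain ⟨i, hi⟩ := h
      have hbound : ∀ s, T i v s ≠ 0 → ∀ k, n ≤ k → s k = false := by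
        intro s hs k hk
        have : ∃ a b : Bool, v (ins i a b s) ≠ 0 ∧ (a = true ∨ b = true) := by
          by_contra! h0
          refine hs ?_
          rw [hT]
          have h1 : v (ins i false true s) = 0 := by
            by_contra h1; exact absurd (h0 _ _ h1).2 (by simp)
          have h2 : v (ins i true false s) = 0 := by
            by_contra h1; exact absurd (h0 _ _ h1).1 (by simp)
          rw [h1, h2]; simp
        obtain ⟨a, b, hab, h1⟩ := this
        rcases Nat.lt_or_ge k i with hki | hki
        · exfalso
          have ha := hv _ hab i (by omega)
          have hb := hv _ hab (i + 1) (by omega)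
          rw [ins_self] at ha
          rw [ins_succ] at hb
          exact absurd h1 (by simp [ha, hb])
        · rw [← ins_ge a b s hki]
          exact hv _ hab _ (by omega)
      obtain ⟨L, hL⟩ := ih (T i v) hbound hi
      exact ⟨i :: L, hL⟩

/-- The product of caps, the head of the list acting first. -/
noncomputable def capWord (δ : ℝ) : List ℕ → Diagram δ
  | [] => 1
  | i :: L => capWord δ L * cap δ i

theorem capWord_mem (L : List ℕ) : ∃ N, ∀ M, N ≤ M →
    2 * L.length ≤ M ∧ capWord δ L ∈ diagrams δ M (M - 2 * L.length) := by
  induction L with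
  | nil => exact ⟨0, fun M _ => ⟨by simp, one_mem_diagrams M⟩⟩
  | cons i L ih =>
    obtain ⟨N, hN⟩ := ih
    refine ⟨N + i + 2, fun M hM => ?_⟩
    obtain ⟨h1, h2⟩ := hN (M - 2) (by omega)
    rw [List.length_cons]
    refine ⟨by omega, ?_⟩
    rw [show M - 2 * (L.length + 1) = M - 2 - 2 * L.length by omega]
    exact mul_mem_diagrams h2 (cap_mem_diagrams (by omega) (by omega))

theorem spinRep_capWord (L : List ℕ) (v : Spin) :
    spinRep δ (capWord δ L) v = L.foldl (fun w i => capOp δ i w) v := by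
  induction L generalizing v with
  | nil => simp [capWord]
  | cons i L ih => rw [capWord, map_mul, Module.End.mul_apply, ih, spinRep_cap]; rfl

theorem dagger_capWord_cons (i : ℕ) (L : List ℕ) :
    dagger (capWord δ (i :: L)) = cup δ i * dagger (capWord δ L) := by
  rw [capWord, dagger_mul, dagger_cap]

theorem cupOp_ket (i : ℕ) (t : ℕ → Bool) : cupOp δ i (ket t) =
    loopParam δ • ket (ins i false true t) + ket (ins i true false t) := by
  funext s
  have key : ∀ a b : Bool, s = ins i a b t ↔ s i = a ∧ s (i + 1) = b ∧ del i s = t := by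
    intro a b
    constructor
    · rintro rfl; simp [ins_self, ins_succ, del_ins]
    · rintro ⟨rfl, rfl, rfl⟩; rw [ins_del]
  classical
  have key' : ∀ a b : Bool, ket (ins i a b t) s =
      if s i = a ∧ s (i + 1) = b ∧ del i s = t then 1 else 0 := by
    intro a b
    rw [ket]
    by_cases h : s = ins i a b t
    · rw [if_pos h, if_pos ((key a b).1 h)]
    · rw [if_neg h, if_neg fun h1 => h ((key a b).2 h1)]
  rw [Pi.add_apply, Pi.smul_apply, key', key', cupOp_apply, ket]
  cases s i <;> cases s (i + 1) <;> by_cases h : del i s = t <;> simp [cupCoeff, h]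

theorem foldl_row (L : List ℕ) (y : Diagram δ) :
    L.foldl (fun (w : Spin) i => (fun t => loopParam δ * w (ins i false true t) +
      1 * w (ins i true false t) : Spin)) (fun t => spinRep δ y (ket t) zeroSeq) =
    fun t => spinRep δ (y * dagger (capWord δ L)) (ket t) zeroSeq := by
  induction L generalizing y with
  | nil => simp [capWord]
  | cons i L ih =>
    rw [List.foldl_cons, dagger_capWord_cons, ← mul_assoc, ← ih (y * cup δ i)]
    congr 1
    funext t
    rw [map_mul, Module.End.mul_apply, spinRep_cup, cupOp_ket, map_add, map_smul, one_mul]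
    rfl

theorem exists_vev_ne_zero {n : ℕ} {x : Diagram δ} (hx : x ∈ diagrams δ n n) {s t : ℕ → Bool}
    (h : spinRep δ x (ket t) s ≠ 0) (ht : ∀ i, n ≤ i → t i = false) :
    ∃ N, ∀ M, N ≤ M → ∃ j, ∃ u ∈ diagrams δ M j, ∃ w ∈ diagrams δ j M,
      vev δ (u * x * w) ≠ 0 := by
  obtain ⟨L, hL⟩ := exists_word_ne_zero (T := fun i v => capOp δ i v) (α := 1)
    (β := (loopParam δ)⁻¹) (inv_ne_zero (loopParam_ne_zero δ))
    (fun i v s => by rw [capOp_apply, one_mul]) n (spinRep δ x (ket t))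
    (fun s hs i hi => by
      obtain ⟨k, rfl⟩ := Nat.exists_eq_add_of_le hi
      rw [spinRep_tail hx t s hs, ht _ hi])
    (fun h0 => h (by rw [h0]; rfl))
  rw [← spinRep_capWord, ← Module.End.mul_apply, ← map_mul] at hL
  obtain ⟨N, hN⟩ := capWord_mem (δ := δ) L
  have hmem : ∀ M, max n N ≤ M → capWord δ L * x ∈ diagrams δ M (M - 2 * L.length) := fun M hM =>
    mul_mem_diagrams (hN M (by omega)).2 (diagrams_mono hx (by omega) (by omega))
  obtain ⟨L', hL'⟩ := exists_word_ne_zero (T := fun i (w : Spin) =>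
      (fun t => loopParam δ * w (ins i false true t) + 1 * w (ins i true false t) : Spin))
    one_ne_zero (fun i v s => rfl) (max n N) (fun t => spinRep δ (capWord δ L * x) (ket t) zeroSeq)
    (fun t' ht' i hi => by
      obtain ⟨k, rfl⟩ := Nat.exists_eq_add_of_le hi
      rw [← spinRep_tail (hmem _ le_rfl) t' zeroSeq ht']; rfl)
    (fun h0 => hL (congrFun h0 t))
  rw [foldl_row] at hL'
  obtain ⟨N', hN'⟩ := capWord_mem (δ := δ) L'
  refine ⟨max (max n N) N', fun M hM => ?_⟩
  obtain ⟨h1, h2⟩ := hN M (by omega)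
  obtain ⟨h3, h4⟩ := hN' M (by omega)
  have hxM : x ∈ diagrams δ M M := diagrams_mono hx (by omega) (by omega)
  have h5 := mul_mem_diagrams (hmem M (by omega)) (dagger_mem_diagrams h4)
  have h6 : M - 2 * L.length = M - 2 * L'.length := by
    by_contra hne
    rcases Nat.lt_or_gt_of_ne hne with hlt | hlt
    · have := vev_mul_of_lt hlt 1 h5
      rw [one_mul] at this
      exact hL' this
    · have := vev_lt_mul hlt 1 h5
      rw [mul_one] at this
      exact hL' this
  exact ⟨_, _, h2, _, h6 ▸ dagger_mem_diagrams h4, hL'⟩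

end separation

/-! ### Traces on spin chains -/

section spinTrace

variable {δ : ℝ}

/-- The configuration with spins up exactly at `A`. -/
def conf (A : Finset ℕ) : ℕ → Bool := fun n => decide (n ∈ A)

theorem conf_injective : Function.Injective conf := by
  intro A B h
  ext n
  simpa [conf] using congrFun h n

theorem ups_conf {n : ℕ} {A : Finset ℕ} (hA : A ⊆ Finset.range n) : ups n (conf A) = A.card := by
  simp only [ups, conf, decide_eq_true_eq]
  rw [← Finset.sum_filter, Finset.sum_const, smul_eq_mul, mul_one, Finset.filter_mem_eq_inter,
    Finset.inter_eq_right.2 hA]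

/-- The matrix elements of a diagram in spin configurations. -/
noncomputable def mat (x : Diagram δ) (B A : Finset ℕ) : ℂ := spinRep δ x (ket (conf A)) (conf B)

theorem mat_add (x y : Diagram δ) (B A : Finset ℕ) : mat (x + y) B A = mat x B A + mat y B A := by
  simp [mat]

theorem mat_smul (c : ℂ) (x : Diagram δ) (B A : Finset ℕ) : mat (c • x) B A = c * mat x B A := by
  simp [mat]

theorem spinRep_ket_eq_sum {a b : ℕ} {x : Diagram δ} (hx : x ∈ diagrams δ a b) {A : Finset ℕ}
    (hA : A ⊆ Finset.range a) : spinRep δ x (ket (conf A)) =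
      ∑ B ∈ (Finset.range b).powerset, mat x B A • ket (conf B) := by
  funext s
  rw [Finset.sum_apply]
  by_cases h : spinRep δ x (ket (conf A)) s = 0
  · rw [h]
    refine (Finset.sum_eq_zero fun B _ => ?_).symm
    rw [Pi.smul_apply, ket]
    split_ifs with h1
    · rw [mat, ← h1, h]; simp
    · simp
  · have htail := spinRep_tail hx _ s h
    have hs : s = conf ((Finset.range b).filter fun i => s i = true) := by
      funext k
      rcases Nat.lt_or_ge k b with hk | hk
      · simp [conf, hk]
      · obtain ⟨j, rfl⟩ := Nat.exists_eq_add_of_le hk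
        rw [htail j]
        have : a + j ∉ A := fun h => by have := Finset.mem_range.1 (hA h); omega
        simp [conf, this]
    rw [Finset.sum_eq_single ((Finset.range b).filter fun i => s i = true)]
    · rw [mat, ← hs]; simp [ket]
    · intro B _ hB
      rw [Pi.smul_apply, ket, if_neg, smul_zero]
      intro h1
      exact hB (conf_injective (h1.symm.trans hs))
    · intro h1
      exact absurd (Finset.mem_powerset.2 (Finset.filter_subset _ _)) h1

theorem mat_mul {a b : ℕ} {x y : Diagram δ} (hy : y ∈ diagrams δ a b)
    {A : Finset ℕ} (hA : A ⊆ Finset.range a) (C : Finset ℕ) :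
    mat (x * y) C A = ∑ B ∈ (Finset.range b).powerset, mat x C B * mat y B A := by
  rw [mat, map_mul, Module.End.mul_apply, spinRep_ket_eq_sum hy hA, map_sum, Finset.sum_apply]
  refine Finset.sum_congr rfl fun B _ => ?_
  rw [map_smul, Pi.smul_apply, smul_eq_mul, mul_comm]; rfl

/-- The trace over the first `n` spins with weights `p` and `1 - p`. -/
noncomputable def spinTraceAux (p : ℂ) (n : ℕ) (x : Diagram δ) : ℂ :=
  ∑ A ∈ (Finset.range n).powerset, p ^ A.card * (1 - p) ^ (n - A.card) * mat x A A

theorem spinTraceAux_succ (p : ℂ) {n : ℕ} {x : Diagram δ} (hx : x ∈ diagrams δ n n) :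
    spinTraceAux p (n + 1) x = spinTraceAux p n x := by
  rw [spinTraceAux, spinTraceAux, Finset.range_add_one,
    Finset.sum_powerset_insert (by simp), ← Finset.sum_add_distrib]
  refine Finset.sum_congr rfl fun A hA => ?_
  rw [Finset.mem_powerset] at hA
  have hn : n ∉ A := fun h => by simpa using hA h
  have hc : A.card ≤ n := by simpa using Finset.card_le_card hA
  have h1 : mat x (insert n A) (insert n A) = mat x A A := by
    have h2 : ∀ i < n, conf (insert n A) i = conf A i := by
      intro i hi
      simp [conf, hi.ne]
    exact spinRep_local hx h2 h2 (fun k => rfl) (fun k => rfl)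
  rw [h1, Finset.card_insert_of_notMem hn, show n + 1 - A.card = n - A.card + 1 by omega,
    show n + 1 - (A.card + 1) = n - A.card by omega]
  ring

theorem spinTraceAux_eq (p : ℂ) {n m : ℕ} (h : n ≤ m) {x : Diagram δ}
    (hx : x ∈ diagrams δ n n) : spinTraceAux p m x = spinTraceAux p n x := by
  induction m, h using Nat.le_induction with
  | base => rfl
  | succ m h ih => rw [spinTraceAux_succ p (diagrams_mono hx h (by omega)), ih]

theorem spinTraceAux_comm (p : ℂ) {a b k : ℕ} (hk : b = a + 2 * k) {x y : Diagram δ}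
    (hx : x ∈ diagrams δ a b) (hy : y ∈ diagrams δ b a) :
    spinTraceAux p b (x * y) = (p * (1 - p)) ^ k * spinTraceAux p a (y * x) := by
  have h1 : spinTraceAux p b (x * y) = ∑ A ∈ (Finset.range b).powerset,
      ∑ B ∈ (Finset.range a).powerset,
        p ^ A.card * (1 - p) ^ (b - A.card) * (mat x A B * mat y B A) := by
    refine Finset.sum_congr rfl fun A hA => ?_
    rw [mat_mul hy (Finset.mem_powerset.1 hA), Finset.mul_sum]
  have h2 : spinTraceAux p a (y * x) = ∑ B ∈ (Finset.range a).powerset,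
      ∑ A ∈ (Finset.range b).powerset,
        p ^ B.card * (1 - p) ^ (a - B.card) * (mat x A B * mat y B A) := by
    refine Finset.sum_congr rfl fun A hA => ?_
    rw [mat_mul hx (Finset.mem_powerset.1 hA), Finset.mul_sum]
    exact Finset.sum_congr rfl fun B _ => by ring
  rw [h1, h2, Finset.sum_comm, Finset.mul_sum]
  refine Finset.sum_congr rfl fun B hB => ?_
  rw [Finset.mul_sum]
  refine Finset.sum_congr rfl fun A hA => ?_
  by_cases h0 : mat x A B = 0
  · simp [h0]
  have hw := spinRep_weight hx _ _ h0
  rw [Finset.mem_powerset] at hA hB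
  rw [ups_conf hA, ups_conf hB] at hw
  have hB' : B.card ≤ a := by simpa using Finset.card_le_card hB
  rw [show A.card = B.card + k by omega, show b - (B.card + k) = a - B.card + k by omega, mul_pow]
  ring

theorem spinTraceAux_one (p : ℂ) (n : ℕ) : spinTraceAux p n (1 : Diagram δ) = 1 := by
  rw [spinTraceAux_eq p (Nat.zero_le n) (one_mem_diagrams 0)]
  simp [spinTraceAux, mat, ket]

theorem spinTraceAux_add (p : ℂ) (n : ℕ) (x y : Diagram δ) :
    spinTraceAux p n (x + y) = spinTraceAux p n x + spinTraceAux p n y := by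
  simp only [spinTraceAux, mat_add, mul_add, Finset.sum_add_distrib]

theorem spinTraceAux_smul (p : ℂ) (n : ℕ) (c : ℂ) (x : Diagram δ) :
    spinTraceAux p n (c • x) = c * spinTraceAux p n x := by
  simp only [spinTraceAux, mat_smul, Finset.mul_sum]
  exact Finset.sum_congr rfl fun A _ => by ring

/-- A level at which an element of the Temperley-Lieb algebra lives. -/
noncomputable def TL.level (x : TL δ) : ℕ := (TL.exists_mem_fin x).choose

theorem TL.mem_level (x : TL δ) : x ∈ TL.fin δ (TL.level x) := (TL.exists_mem_fin x).choose_spec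

theorem spinTraceAux_level (p : ℂ) {n : ℕ} {x : TL δ} (hx : x ∈ TL.fin δ n) :
    spinTraceAux p (TL.level x) (toDiagram δ x) = spinTraceAux p n (toDiagram δ x) := by
  have h1 := toDiagram_mem hx
  have h2 := toDiagram_mem (TL.mem_level x)
  rw [← spinTraceAux_eq p (le_max_left _ n) h2, ← spinTraceAux_eq p (le_max_right _ n) h1]

/-- The trace on the Temperley-Lieb algebra given by a product state on spins. -/
noncomputable def spinTrace (δ : ℝ) (p : ℂ) : TL δ →ₗ[ℂ] ℂ where
  toFun x := spinTraceAux p (TL.level x) (toDiagram δ x)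
  map_add' x y := by
    have hx := TL.fin_mono (le_max_left (TL.level x) (TL.level y)) (TL.mem_level x)
    have hy := TL.fin_mono (le_max_right (TL.level x) (TL.level y)) (TL.mem_level y)
    rw [spinTraceAux_level p (add_mem hx hy), spinTraceAux_level p hx, spinTraceAux_level p hy,
      map_add, spinTraceAux_add]
  map_smul' c x := by
    rw [spinTraceAux_level p (Subalgebra.smul_mem _ (TL.mem_level x) c), map_smul,
      spinTraceAux_smul]; rfl

theorem spinTrace_apply (p : ℂ) {n : ℕ} {x : TL δ} (hx : x ∈ TL.fin δ n) :
    spinTrace δ p x = spinTraceAux p n (toDiagram δ x) := spinTraceAux_level p hx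

theorem spinTrace_normalized (p : ℂ) : IsNormalizedTrace (spinTrace δ p) := by
  refine ⟨?_, fun x y => ?_⟩
  · rw [spinTrace_apply p (one_mem (TL.fin δ 0)), map_one, spinTraceAux_one]
  · have hx := TL.fin_mono (le_max_left (TL.level x) (TL.level y)) (TL.mem_level x)
    have hy := TL.fin_mono (le_max_right (TL.level x) (TL.level y)) (TL.mem_level y)
    have := spinTraceAux_comm p (k := 0) rfl (toDiagram_mem hx) (toDiagram_mem hy)
    rw [pow_zero, one_mul] at this
    rw [spinTrace_apply p (mul_mem hx hy), spinTrace_apply p (mul_mem hy hx), map_mul, map_mul]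
    exact this

theorem mat_eq_zero_of_idempotent {n : ℕ} {x : Diagram δ} (hx : x ∈ diagrams δ n n)
    (h : x * x = x) (h0 : spinTraceAux (1 / 2) n x = 0) {B A : Finset ℕ}
    (hB : B ⊆ Finset.range n) (hA : A ⊆ Finset.range n) : mat x B A = 0 := by
  set M : Matrix (Finset.range n).powerset (Finset.range n).powerset ℂ :=
    fun B A => mat x B A with hM
  have hMM : M * M = M := by
    ext B A
    have := mat_mul (x := x) hx (Finset.mem_powerset.1 A.2) B
    rw [h] at this
    rw [Matrix.mul_apply]
    refine Eq.trans ?_ this.symm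
    rw [← Finset.sum_coe_sort (Finset.range n).powerset]
  have htr : LinearMap.trace ℂ _ (Matrix.toLin' M) = 0 := by
    rw [Matrix.trace_toLin'_eq]
    have h1 : spinTraceAux (1 / 2) n x = (1 / 2) ^ n * M.trace := by
      rw [Matrix.trace, Finset.mul_sum, spinTraceAux, ← Finset.sum_coe_sort]
      refine Finset.sum_congr rfl fun A _ => ?_
      have : (A : Finset ℕ).card ≤ n := by
        simpa using Finset.card_le_card (Finset.mem_powerset.1 A.2)
      rw [show (1 : ℂ) - 1 / 2 = 1 / 2 by norm_num, ← pow_add, Nat.add_sub_of_le this]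
      rfl
    rw [h0] at h1
    exact (mul_eq_zero.1 h1.symm).resolve_left (by norm_num)
  have hid : IsIdempotentElem (Matrix.toLin' M) := by
    rw [IsIdempotentElem, Module.End.mul_eq_comp, ← Matrix.toLin'_mul, hMM]
  have := (LinearMap.IsIdempotentElem.trace_eq_zero_iff hid).1 htr
  rw [LinearEquiv.map_eq_zero_iff] at this
  exact congrFun (congrFun this ⟨B, Finset.mem_powerset.2 hB⟩) ⟨A, Finset.mem_powerset.2 hA⟩

end spinTrace
end TemperleyLieb

namespace TemperleyLieb

/-! ### Normal forms and faithfulness of the diagram representation -/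

section normalForm

variable {δ : ℝ}

theorem TL.e_sq (i : ℕ) : TL.e δ i * TL.e δ i = (δ : ℂ) • TL.e δ i := by
  rw [Algebra.smul_def]
  simpa [TL.e] using RingQuot.mkAlgHom_rel ℂ (TLRel.sq (δ := δ) i)

theorem TL.e_up (i : ℕ) : TL.e δ i * TL.e δ (i + 1) * TL.e δ i = TL.e δ i := by
  simpa [TL.e] using RingQuot.mkAlgHom_rel ℂ (TLRel.up (δ := δ) i)

theorem TL.e_down (i : ℕ) : TL.e δ (i + 1) * TL.e δ i * TL.e δ (i + 1) = TL.e δ (i + 1) := by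
  simpa [TL.e] using RingQuot.mkAlgHom_rel ℂ (TLRel.down (δ := δ) i)

theorem TL.e_comm {i j : ℕ} (h : i + 2 ≤ j) : TL.e δ i * TL.e δ j = TL.e δ j * TL.e δ i := by
  simpa [TL.e] using RingQuot.mkAlgHom_rel ℂ (TLRel.comm (δ := δ) i j h)

/-- The product `e_{k+d-1} ⋯ e_{k+1} e_k`. -/
noncomputable def run (δ : ℝ) (k : ℕ) : ℕ → TL δ
  | 0 => 1
  | d + 1 => TL.e δ (k + d) * run δ k d

theorem run_one (k : ℕ) : run δ k 1 = TL.e δ k := by simp [run]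

theorem run_append (k c d : ℕ) : run δ (k + c) d * run δ k c = run δ k (c + d) := by
  induction d with
  | zero => simp [run]
  | succ d ih => rw [run, mul_assoc, ih, ← add_assoc, run, add_assoc]

theorem e_comm_run {i k : ℕ} (h : i + 2 ≤ k) (d : ℕ) :
    TL.e δ i * run δ k d = run δ k d * TL.e δ i := by
  induction d with
  | zero => simp [run]
  | succ d ih => rw [run, ← mul_assoc, TL.e_comm (by omega), mul_assoc, ih, mul_assoc]

theorem run_comm_run {i c k : ℕ} (h : i + c + 1 ≤ k) (d : ℕ) :
    run δ i c * run δ k d = run δ k d * run δ i c := by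
  induction c with
  | zero => simp [run]
  | succ c ih =>
    rw [run, mul_assoc, ih (by omega), ← mul_assoc, e_comm_run (by omega), mul_assoc]

/-- `e_k` times a run through `k` and `k + 1`. -/
theorem e_mul_run (j c d : ℕ) : TL.e δ (j + c) * run δ j (c + 2 + d) =
    run δ j (c + 1) * run δ (j + c + 2) d := by
  rw [← run_append, ← mul_assoc, ← add_assoc, e_comm_run le_rfl, mul_assoc]
  have : TL.e δ (j + c) * run δ j (c + 2) = run δ j (c + 1) := by
    rw [run, run, ← mul_assoc, ← mul_assoc, ← add_assoc, TL.e_up]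
  rw [this]
  exact (run_comm_run (by omega) d).symm

theorem run_mul_run (j c a d : ℕ) : run δ (j + c) (a + 1) * run δ j (c + 2 + d) =
    run δ j (c + a + 1) * run δ (j + c + 2) d := by
  have : run δ (j + c) (a + 1) = run δ (j + c + 1) a * TL.e δ (j + c) := by
    rw [← run_one, run_append, add_comm 1]
  rw [this, mul_assoc, e_mul_run, ← mul_assoc, add_assoc j c 1, run_append]
  congr 2; ring

theorem run_mul_e (j c d : ℕ) : run δ j (c + 2 + d) * TL.e δ (j + c + 1) =
    run δ j c * run δ (j + c + 1) (d + 1) := by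
  rw [← run_append]
  have : run δ j (c + 2) * TL.e δ (j + c + 1) = run δ j c * TL.e δ (j + c + 1) := by
    have h1 : run δ j c * TL.e δ (j + c + 1) = TL.e δ (j + c + 1) * run δ j c := by
      have := run_comm_run (δ := δ) (show j + c + 1 ≤ j + c + 1 by omega) 1
      rwa [run_one] at this
    rw [run, run, mul_assoc, mul_assoc, h1, ← mul_assoc, ← mul_assoc]
    rw [← add_assoc, TL.e_down]
  rw [mul_assoc, this, ← mul_assoc, ← run_comm_run (by omega), mul_assoc, ← run_one, ← add_assoc,
    show j + c + 2 = j + c + 1 + 1 by ring, run_append, add_comm 1 d]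

/-- The product of the runs of a list; the head of the list is the rightmost factor, and `(k, d)`
stands for the run `e_{k+d} ⋯ e_k`. -/
noncomputable def runWord (δ : ℝ) : List (ℕ × ℕ) → TL δ
  | [] => 1
  | p :: L => runWord δ L * run δ p.1 (p.2 + 1)

/-- Lists of runs whose starts and ends both decrease strictly. -/
def IsNormal (L : List (ℕ × ℕ)) : Prop :=
  L.Pairwise fun p p' => p'.1 < p.1 ∧ p'.1 + p'.2 < p.1 + p.2

/-- The span of the normal forms in the first `n` generators. -/
noncomputable def normalSpan (δ : ℝ) (n : ℕ) : Submodule ℂ (TL δ) :=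
  Submodule.span ℂ {x | ∃ L, IsNormal L ∧ (∀ p ∈ L, p.1 + p.2 < n) ∧ x = runWord δ L}

theorem normalSpan_mono {m n : ℕ} (h : m ≤ n) : normalSpan δ m ≤ normalSpan δ n :=
  Submodule.span_mono fun _ ⟨L, h1, h2, h3⟩ => ⟨L, h1, fun p hp => (h2 p hp).trans_le h, h3⟩

theorem run_mem_closed {S : Submodule ℂ (TL δ)} {n : ℕ}
    (hS : ∀ x ∈ S, ∀ i < n, x * TL.e δ i ∈ S) {k d : ℕ} (h : k + d ≤ n) :
    ∀ x ∈ S, x * run δ k d ∈ S := by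
  induction d with
  | zero => intro x hx; simpa [run] using hx
  | succ d ih => intro x hx; rw [run, ← mul_assoc]; exact ih (by omega) _ (hS x hx _ (by omega))

/-- Multiplication of normal forms by a run that contains a new generator. -/
theorem normalSpan_mul_run {n : ℕ}
    (ih : ∀ m ≤ n, ∀ x ∈ normalSpan δ m, ∀ i < m, x * TL.e δ i ∈ normalSpan δ m) (d : ℕ) :
    ∀ j, j + d = n → ∀ x ∈ normalSpan δ n, x * run δ j (d + 1) ∈ normalSpan δ (n + 1) := by
  induction d using Nat.strong_induction_on with
  | _ d ihd =>
    intro j hj x hx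
    induction hx using Submodule.span_induction with
    | zero => simp
    | add x y _ _ hx hy => rw [add_mul]; exact add_mem hx hy
    | smul c x _ hx => rw [smul_mul_assoc]; exact Submodule.smul_mem _ _ hx
    | mem x hx =>
      obtain ⟨L, h1, h2, rfl⟩ := hx
      by_cases hL : ∀ p ∈ L, p.1 < j
      · refine Submodule.subset_span ⟨(j, d) :: L, ?_, ?_, rfl⟩
        · refine List.pairwise_cons.2 ⟨fun p hp => ⟨hL p hp, ?_⟩, h1⟩
          have := h2 p hp
          dsimp only; omega
        · intro p hp
          rcases List.mem_cons.1 hp with rfl | hp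
          · dsimp only; omega
          · exact (h2 p hp).trans (Nat.lt_succ_self n)
      · cases L with
        | nil => simp at hL
        | cons p T =>
          obtain ⟨hpT, hT⟩ := List.pairwise_cons.1 h1
          have hp : j ≤ p.1 := by
            by_contra hlt
            refine hL fun p' hp' => ?_
            rcases List.mem_cons.1 hp' with rfl | hp'
            · omega
            · have := (hpT p' hp').1; omega
          obtain ⟨k, a⟩ := p
          obtain ⟨c, rfl⟩ := Nat.exists_eq_add_of_le hp
          have hka := h2 _ List.mem_cons_self
          dsimp only at hka hpT
          have hTm : runWord δ T * run δ j (c + a + 1) ∈ normalSpan δ n := by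
            refine run_mem_closed (ih n le_rfl) (by omega) _ (Submodule.subset_span ⟨T, hT,
              fun p hp => h2 p (List.mem_cons_of_mem _ hp), rfl⟩)
          rw [runWord, mul_assoc]
          dsimp only
          rcases Nat.lt_or_ge c.succ d with hcd | hcd
          · obtain ⟨e, rfl⟩ : ∃ e, d = c + 2 + e := ⟨d - (c + 2), by omega⟩
            rw [add_assoc (c + 2), run_mul_run, ← mul_assoc]
            exact ihd e (by omega) _ (by omega) _ hTm
          · have hd : d + 1 = c + 2 + 0 := by omega
            rw [hd, run_mul_run, run, mul_one]
            exact normalSpan_mono (Nat.le_succ n) hTm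

theorem normalSpan_mul_e (n : ℕ) :
    ∀ m ≤ n, ∀ x ∈ normalSpan δ m, ∀ i < m, x * TL.e δ i ∈ normalSpan δ m := by
  induction n with
  | zero => intro m hm x _ i hi; omega
  | succ n ih =>
    intro m hm x hx i hi
    rcases Nat.lt_or_ge n m with h | h
    swap
    · exact ih m h x hx i hi
    obtain rfl : m = n + 1 := by omega
    have hrun := normalSpan_mul_run ih
    induction hx using Submodule.span_induction with
    | zero => simp
    | add x y _ _ hx hy => rw [add_mul]; exact add_mem hx hy
    | smul c x _ hx => rw [smul_mul_assoc]; exact Submodule.smul_mem _ _ hx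
    | mem x hx =>
      obtain ⟨L, h1, h2, rfl⟩ := hx
      have low : ∀ L, IsNormal L → (∀ p ∈ L, p.1 + p.2 < n) →
          runWord δ L * TL.e δ i ∈ normalSpan δ (n + 1) := by
        intro L h1 h2
        have hL : runWord δ L ∈ normalSpan δ n := Submodule.subset_span ⟨L, h1, h2, rfl⟩
        rcases Nat.lt_or_ge i n with hin | hin
        · exact normalSpan_mono (Nat.le_succ n) (ih n le_rfl _ hL i hin)
        · obtain rfl : i = n := by omega
          rw [← run_one]
          exact hrun 0 i (by omega) _ hL
      cases L with
      | nil => exact low [] h1 (by simp)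
      | cons p T =>
        obtain ⟨hpT, hT⟩ := List.pairwise_cons.1 h1
        obtain ⟨j, d⟩ := p
        have hjd := h2 _ List.mem_cons_self
        dsimp only at hjd hpT
        rcases Nat.lt_or_ge (j + d) n with hlt | hge
        · refine low _ h1 fun p hp => ?_
          rcases List.mem_cons.1 hp with rfl | hp
          · exact hlt
          · have := (hpT p hp).2; omega
        have hTm : runWord δ T ∈ normalSpan δ n :=
          Submodule.subset_span ⟨T, hT, fun p hp => by have := (hpT p hp).2; omega, rfl⟩
        rw [runWord, mul_assoc]
        dsimp only
        rcases Nat.lt_trichotomy i j with hij | rfl | hij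
        · rcases Nat.lt_or_ge (i + 1) j with hij' | hij'
          · rw [← e_comm_run (by omega), ← mul_assoc]
            exact hrun d j (by omega) _ (ih n le_rfl _ hTm i (by omega))
          · obtain rfl : j = i + 1 := by omega
            rw [← run_one, run_append, add_comm 1]
            exact hrun (d + 1) i (by omega) _ hTm
        · have : run δ i (d + 1) * TL.e δ i = (δ : ℂ) • run δ i (d + 1) := by
            rw [add_comm, ← run_append, mul_assoc, run_one, TL.e_sq, mul_smul_comm]
          rw [this, mul_smul_comm]
          exact Submodule.smul_mem _ _ (hrun d i (by omega) _ hTm)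
        · obtain ⟨c, rfl⟩ : ∃ c, i = j + c + 1 := ⟨i - j - 1, by omega⟩
          obtain ⟨e, rfl⟩ : ∃ e, d = c + 1 + e := ⟨d - (c + 1), by omega⟩
          rw [show c + 1 + e + 1 = c + 2 + e by ring, run_mul_e, ← mul_assoc]
          exact hrun e _ (by omega) _ (run_mem_closed (ih n le_rfl) (by omega) _ hTm)

theorem mem_normalSpan (x : TL δ) : ∃ n, x ∈ normalSpan δ n := by
  obtain ⟨n, hn⟩ := TL.exists_mem_fin x
  refine ⟨n, ?_⟩
  suffices h : ∀ y ∈ normalSpan δ n, y * x ∈ normalSpan δ n by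
    have := h 1 (Submodule.subset_span ⟨[], List.Pairwise.nil, by simp, rfl⟩)
    rwa [one_mul] at this
  induction hn using Algebra.adjoin_induction with
  | mem x hx =>
    obtain ⟨i, hi, rfl⟩ := hx
    exact fun y hy => normalSpan_mul_e n n le_rfl y hy i (by omega)
  | algebraMap c =>
    intro y hy
    rw [← Algebra.commutes, ← Algebra.smul_def]
    exact Submodule.smul_mem _ _ hy
  | add x z _ _ hx hz => intro y hy; rw [mul_add]; exact add_mem (hx y hy) (hz y hy)
  | mul x z _ _ hx hz => intro y hy; rw [← mul_assoc]; exact hz _ (hx y hy)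

/-- The sum of the positions of the spins that are up. -/
def energy (A : Finset ℕ) : ℕ := ∑ i ∈ A, i

/-- The spin at `k` is moved to `k + d + 1`. -/
def moveSpin (k d : ℕ) (A : Finset ℕ) : Finset ℕ := insert (k + d + 1) (A.erase k)

/-- The spin at `k` can be moved to `k + d + 1`. -/
def Movable (k d : ℕ) (A : Finset ℕ) : Prop := k ∈ A ∧ ∀ i, k < i → i ≤ k + d + 1 → i ∉ A

theorem energy_moveSpin {k d : ℕ} {A : Finset ℕ} (h : Movable k d A) :
    energy (moveSpin k d A) = energy A + (d + 1) := by
  have h1 : k + d + 1 ∉ A.erase k := fun h' =>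
    h.2 (k + d + 1) (by omega) le_rfl (Finset.mem_of_mem_erase h')
  have h2 := Finset.add_sum_erase A (fun i => i) h.1
  rw [energy, moveSpin, Finset.sum_insert h1, energy]
  omega

theorem ins_del_conf_up {k : ℕ} {B : Finset ℕ} :
    ins k true false (del k (conf B)) = conf (insert k (B.erase (k + 1))) := by
  funext n
  revert n
  refine seq_cases k (fun n h => ?_) ?_ ?_ (fun n h => ?_)
  · rw [ins_lt _ _ _ h, del_lt _ h]
    simp [conf, show n ≠ k by omega, show n ≠ k + 1 by omega]
  · rw [ins_self]; simp [conf]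
  · rw [ins_succ]; simp [conf]
  · rw [ins_ge _ _ _ h, del_ge _ h]
    simp [conf, show n + 2 ≠ k by omega, show n + 2 ≠ k + 1 by omega]

theorem ins_del_conf_down {k : ℕ} {B : Finset ℕ} :
    ins k false true (del k (conf B)) = conf (insert (k + 1) (B.erase k)) := by
  funext n
  revert n
  refine seq_cases k (fun n h => ?_) ?_ ?_ (fun n h => ?_)
  · rw [ins_lt _ _ _ h, del_lt _ h]
    simp [conf, show n ≠ k by omega, show n ≠ k + 1 by omega]
  · rw [ins_self]; simp [conf]
  · rw [ins_succ]; simp [conf]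
  · rw [ins_ge _ _ _ h, del_ge _ h]
    simp [conf, show n + 2 ≠ k by omega, show n + 2 ≠ k + 1 by omega]

open Classical in
theorem mat_e (k : ℕ) {A B : Finset ℕ} (hE : energy A + 1 ≤ energy B) :
    mat (toDiagram δ (TL.e δ k)) B A =
      if Movable k 0 A ∧ B = moveSpin k 0 A then 1 else 0 := by
  have hz := loopParam_ne_zero δ
  have hne : A ≠ B := by rintro rfl; omega
  have hconf : ∀ C D : Finset ℕ, ket (conf C) (conf D) = if C = D then 1 else 0 := by
    intro C D
    rw [ket]
    by_cases h : C = D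
    · rw [if_pos h, if_pos (by rw [h])]
    · rw [if_neg h, if_neg fun h' => h (conf_injective h').symm]
  have hval : mat (toDiagram δ (TL.e δ k)) B A = cupCoeff δ (conf B k) (conf B (k + 1)) *
      (ket (conf A) (ins k false true (del k (conf B))) +
        (loopParam δ)⁻¹ * ket (conf A) (ins k true false (del k (conf B)))) := by
    rw [mat, toDiagram_e, map_mul, Module.End.mul_apply, spinRep_cup, spinRep_cap]; rfl
  have hmov : Movable k 0 A ↔ k ∈ A ∧ k + 1 ∉ A := by
    refine ⟨fun h => ⟨h.1, h.2 _ (by omega) (by omega)⟩, fun h => ⟨h.1, fun i h1 h2 => ?_⟩⟩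
    obtain rfl : i = k + 1 := by omega
    exact h.2
  rw [hval, hmov]
  by_cases h1 : k ∈ B <;> by_cases h2 : k + 1 ∈ B
  · have e1 : conf B k = true := by simpa [conf] using h1
    have e2 : conf B (k + 1) = true := by simpa [conf] using h2
    rw [e1, e2, if_neg]
    · simp [cupCoeff]
    · rintro ⟨_, rfl⟩; simp [moveSpin] at h1
  · have e1 : conf B k = true := by simpa [conf] using h1
    have e2 : conf B (k + 1) = false := by simpa [conf] using h2
    have e3 := ins_del k (conf B)
    rw [e1, e2] at e3
    rw [e3, e1, e2, ins_del_conf_down, hconf, hconf, if_neg hne, if_neg, if_neg]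
    · simp
    · rintro ⟨_, rfl⟩; simp [moveSpin] at h1
    · rintro rfl
      have : k + 1 ∉ B.erase k := by simp [h2]
      have h3 := Finset.add_sum_erase B (fun i => i) h1
      rw [energy, Finset.sum_insert this, energy] at hE
      omega
  · have e1 : conf B k = false := by simpa [conf] using h1
    have e2 : conf B (k + 1) = true := by simpa [conf] using h2
    have e3 := ins_del k (conf B)
    rw [e1, e2] at e3
    rw [e3, e1, e2, ins_del_conf_up, hconf, hconf, if_neg hne]
    have : A = insert k (B.erase (k + 1)) ↔ (k ∈ A ∧ k + 1 ∉ A) ∧ B = moveSpin k 0 A := by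
      constructor
      · rintro rfl
        refine ⟨⟨by simp, by simp⟩, ?_⟩
        rw [moveSpin, Finset.erase_insert (by simp [h1]), add_zero, Finset.insert_erase h2]
      · rintro ⟨⟨h3, h4⟩, rfl⟩
        rw [moveSpin, add_zero, Finset.erase_insert (by simp [h4]), Finset.insert_erase h3]
    by_cases h3 : A = insert k (B.erase (k + 1))
    · rw [if_pos h3, if_pos (this.1 h3)]; simp [cupCoeff, hz]
    · rw [if_neg h3, if_neg fun h => h3 (this.2 h)]; simp
  · have e1 : conf B k = false := by simpa [conf] using h1
    have e2 : conf B (k + 1) = false := by simpa [conf] using h2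
    rw [e1, e2, if_neg]
    · simp [cupCoeff]
    · rintro ⟨_, rfl⟩; simp [moveSpin] at h2

theorem TL.e_mem_fin {i n : ℕ} (h : i + 1 < n) : TL.e δ i ∈ TL.fin δ n :=
  Algebra.subset_adjoin ⟨i, h, rfl⟩

theorem run_mem_fin {k d n : ℕ} (h : k + d < n) : run δ k d ∈ TL.fin δ n := by
  induction d with
  | zero => exact one_mem _
  | succ d ih => exact mul_mem (TL.e_mem_fin (by omega)) (ih (by omega))

open Classical in
theorem mat_run (k d : ℕ) {n : ℕ} (hn : k + d + 1 < n) {A B : Finset ℕ}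
    (hA : A ⊆ Finset.range n) (hB : B ⊆ Finset.range n) (hE : energy A + (d + 1) ≤ energy B) :
    mat (toDiagram δ (run δ k (d + 1))) B A =
      if Movable k d A ∧ B = moveSpin k d A then 1 else 0 := by
  induction d generalizing B with
  | zero => rw [run_one]; exact mat_e k hE
  | succ d ih =>
    have hC : moveSpin k d A ⊆ Finset.range n := by
      refine Finset.insert_subset (Finset.mem_range.2 (by omega)) ?_
      exact (Finset.erase_subset _ _).trans hA
    have hmove : Movable k (d + 1) A ↔
        Movable k d A ∧ Movable (k + (d + 1)) 0 (moveSpin k d A) := by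
      simp only [Movable, moveSpin, Finset.mem_insert, Finset.mem_erase]
      constructor
      · rintro ⟨h1, h2⟩
        refine ⟨⟨h1, fun i hi hi' => h2 i hi (by omega)⟩, by left; ring, fun i hi hi' h => ?_⟩
        rcases h with h | h
        · omega
        · exact h2 i (by omega) (by omega) h.2
      · rintro ⟨⟨h1, h2⟩, _, h4⟩
        refine ⟨h1, fun i hi hi' h => ?_⟩
        rcases Nat.lt_or_ge (k + d + 1) i with h5 | h5
        · exact h4 i (by omega) (by omega) (Or.inr ⟨by omega, h⟩)
        · exact h2 i hi h5 h
    have hmv : Movable k d A →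
        moveSpin (k + (d + 1)) 0 (moveSpin k d A) = moveSpin k (d + 1) A := by
      intro h
      rw [moveSpin, moveSpin, moveSpin, add_zero, ← add_assoc, Finset.erase_insert]
      exact fun h' => h.2 _ (by omega) le_rfl (Finset.mem_of_mem_erase h')
    rw [run, map_mul, mat_mul (toDiagram_mem (run_mem_fin (by omega))) hA]
    have hterm : ∀ C ∈ (Finset.range n).powerset,
        mat (toDiagram δ (TL.e δ (k + (d + 1)))) B C * mat (toDiagram δ (run δ k (d + 1))) C A =
          if C = moveSpin k d A then (if Movable k (d + 1) A ∧ B = moveSpin k (d + 1) A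
            then 1 else 0) else 0 := by
      intro C hC'
      rw [Finset.mem_powerset] at hC'
      by_cases h1 : energy A + (d + 1) ≤ energy C
      · rw [ih (by omega) hC' h1]
        by_cases h2 : Movable k d A ∧ C = moveSpin k d A
        · obtain ⟨h2, rfl⟩ := h2
          rw [if_pos ⟨h2, rfl⟩, if_pos rfl, mul_one, mat_e _ (by rw [energy_moveSpin h2]; omega),
            hmv h2, hmove]
          simp [h2]
        · rw [if_neg h2, mul_zero]
          split_ifs with h3 h4
          · exact absurd ⟨(hmove.1 h4.1).1, h3⟩ h2
          · rfl
          · rfl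
      · rw [mat_e _ (by omega), if_neg, zero_mul, eq_comm]
        · split_ifs with h3 h4
          · have := energy_moveSpin (hmove.1 h4.1).1
            rw [← h3] at this
            omega
          · rfl
          · rfl
        · rintro ⟨h3, rfl⟩
          rw [energy_moveSpin h3] at hE
          omega
    rw [Finset.sum_congr rfl hterm, Finset.sum_ite_eq' _ (moveSpin k d A),
      if_pos (Finset.mem_powerset.2 hC)]

/-- The runs of the list can move spins, one after the other. -/
def AllMovable : List (ℕ × ℕ) → Finset ℕ → Prop
  | [], _ => True
  | p :: L, A => Movable p.1 p.2 A ∧ AllMovable L (moveSpin p.1 p.2 A)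

/-- The configuration after all moves. -/
def moveAll : List (ℕ × ℕ) → Finset ℕ → Finset ℕ
  | [], A => A
  | p :: L, A => moveAll L (moveSpin p.1 p.2 A)

/-- The number of generators in a normal form. -/
def runLength : List (ℕ × ℕ) → ℕ
  | [] => 0
  | p :: L => runLength L + (p.2 + 1)

theorem energy_moveAll {L : List (ℕ × ℕ)} {A : Finset ℕ} (h : AllMovable L A) :
    energy (moveAll L A) = energy A + runLength L := by
  induction L generalizing A with
  | nil => rfl
  | cons p L ih => rw [moveAll, ih h.2, energy_moveSpin h.1, runLength]; ring

open Classical in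
theorem mat_runWord (L : List (ℕ × ℕ)) {n : ℕ} (hn : ∀ p ∈ L, p.1 + p.2 + 1 < n)
    {A B : Finset ℕ} (hA : A ⊆ Finset.range n) (hB : B ⊆ Finset.range n)
    (hE : energy A + runLength L ≤ energy B) :
    mat (toDiagram δ (runWord δ L)) B A = if AllMovable L A ∧ B = moveAll L A then 1 else 0 := by
  induction L generalizing A with
  | nil =>
    rw [runWord, map_one, mat, map_one, Module.End.one_apply, ket]
    by_cases h : B = A
    · rw [if_pos (by rw [h]), if_pos ⟨trivial, h⟩]
    · rw [if_neg fun h' => h (conf_injective h'), if_neg fun h' => h h'.2]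
  | cons p L ih =>
    obtain ⟨k, d⟩ := p
    have hkd := hn _ List.mem_cons_self
    dsimp only at hkd
    have hC : moveSpin k d A ⊆ Finset.range n := by
      refine Finset.insert_subset (Finset.mem_range.2 (by omega)) ?_
      exact (Finset.erase_subset _ _).trans hA
    rw [runLength] at hE
    dsimp only at hE
    rw [runWord, map_mul, mat_mul (toDiagram_mem (run_mem_fin (show k + (d + 1) < n by omega))) hA]
    have hterm : ∀ C ∈ (Finset.range n).powerset,
        mat (toDiagram δ (runWord δ L)) B C * mat (toDiagram δ (run δ k (d + 1))) C A =
          if C = moveSpin k d A then (if AllMovable ((k, d) :: L) A ∧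
            B = moveAll ((k, d) :: L) A then 1 else 0) else 0 := by
      intro C hC'
      rw [Finset.mem_powerset] at hC'
      have ih' := @ih (fun p hp => hn p (List.mem_cons_of_mem _ hp)) C hC'
      by_cases h1 : energy A + (d + 1) ≤ energy C
      · rw [mat_run k d hkd hA hC' h1]
        by_cases h2 : Movable k d A ∧ C = moveSpin k d A
        · obtain ⟨h2, rfl⟩ := h2
          rw [if_pos ⟨h2, rfl⟩, if_pos rfl, mul_one, ih' (by rw [energy_moveSpin h2]; omega)]
          simp [AllMovable, moveAll, h2]
        · rw [if_neg h2, mul_zero]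
          split_ifs with h3 h4
          · exact absurd ⟨h4.1.1, h3⟩ h2
          · rfl
          · rfl
      · rw [ih' (by omega), if_neg, zero_mul, eq_comm]
        · split_ifs with h3 h4
          · have := energy_moveSpin h4.1.1
            dsimp only at this
            rw [← h3] at this
            omega
          · rfl
          · rfl
        · rintro ⟨h3, rfl⟩
          rw [energy_moveAll h3] at hE
          omega
    rw [Finset.sum_congr rfl hterm, Finset.sum_ite_eq' _ (moveSpin k d A),
      if_pos (Finset.mem_powerset.2 hC)]

/-- The starting points of the runs. -/
def startSet (L : List (ℕ × ℕ)) : Finset ℕ := (L.map fun p => p.1).toFinset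

/-- The end points of the runs. -/
def endSet (L : List (ℕ × ℕ)) : Finset ℕ := (L.map fun p => p.1 + p.2 + 1).toFinset

theorem mem_startSet {L : List (ℕ × ℕ)} {x : ℕ} : x ∈ startSet L ↔ ∃ p ∈ L, p.1 = x := by
  simp [startSet]

theorem mem_endSet {L : List (ℕ × ℕ)} {x : ℕ} :
    x ∈ endSet L ↔ ∃ p ∈ L, p.1 + p.2 + 1 = x := by
  simp [endSet]

theorem moveSpin_startSet {k d : ℕ} {L : List (ℕ × ℕ)} {S : Finset ℕ}
    (hL : IsNormal ((k, d) :: L)) (hS : ∀ s ∈ S, k + d + 1 < s) :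
    moveSpin k d (startSet ((k, d) :: L) ∪ S) = startSet L ∪ insert (k + d + 1) S := by
  have h1 := (List.pairwise_cons.1 hL).1
  ext x
  simp only [moveSpin, Finset.mem_insert, Finset.mem_erase, Finset.mem_union, mem_startSet,
    List.mem_cons]
  constructor
  · rintro (h | ⟨h, ⟨p, rfl | hp, rfl⟩ | h'⟩)
    · exact Or.inr (Or.inl h)
    · exact absurd rfl h
    · exact Or.inl ⟨p, hp, rfl⟩
    · exact Or.inr (Or.inr h')
  · rintro (⟨p, hp, rfl⟩ | h | h)
    · exact Or.inr ⟨(h1 p hp).1.ne, Or.inl ⟨p, Or.inr hp, rfl⟩⟩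
    · exact Or.inl h
    · exact Or.inr ⟨by have := hS x h; omega, Or.inr h⟩

theorem allMovable_startSet {L : List (ℕ × ℕ)} (hL : IsNormal L) {S : Finset ℕ}
    (hS : ∀ p ∈ L, ∀ s ∈ S, p.1 + p.2 + 1 < s) :
    AllMovable L (startSet L ∪ S) ∧ moveAll L (startSet L ∪ S) = endSet L ∪ S := by
  induction L generalizing S with
  | nil => exact ⟨trivial, rfl⟩
  | cons p L ih =>
    obtain ⟨k, d⟩ := p
    have h1 := (List.pairwise_cons.1 hL).1
    have hS' := hS _ List.mem_cons_self
    dsimp only at hS'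
    have h2 := moveSpin_startSet hL hS'
    obtain ⟨h3, h4⟩ := @ih (List.pairwise_cons.1 hL).2 (insert (k + d + 1) S) (by
      intro p hp s hs
      rcases Finset.mem_insert.1 hs with rfl | hs
      · have := (h1 p hp).2; dsimp only at this; omega
      · exact hS p (List.mem_cons_of_mem _ hp) s hs)
    refine ⟨⟨⟨?_, fun i hi hi' h => ?_⟩, ?_⟩, ?_⟩
    · exact Finset.mem_union_left _ (mem_startSet.2 ⟨_, List.mem_cons_self, rfl⟩)
    · dsimp only at hi hi'
      rcases Finset.mem_union.1 h with h | h
      · obtain ⟨p, hp, rfl⟩ := mem_startSet.1 h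
        rcases List.mem_cons.1 hp with rfl | hp
        · exact lt_irrefl _ hi
        · exact absurd (h1 p hp).1 (by dsimp only; omega)
      · have := hS' i h; omega
    · dsimp only; rw [h2]; exact h3
    · rw [moveAll]
      dsimp only
      rw [h2, h4]
      ext x
      simp only [Finset.mem_union, Finset.mem_insert, mem_endSet, List.mem_cons]
      constructor
      · rintro (⟨p, hp, rfl⟩ | h | h)
        · exact Or.inl ⟨p, Or.inr hp, rfl⟩
        · exact Or.inl ⟨_, Or.inl rfl, h.symm⟩
        · exact Or.inr h
      · rintro (⟨p, rfl | hp, rfl⟩ | h)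
        · exact Or.inr (Or.inl rfl)
        · exact Or.inl ⟨p, hp, rfl⟩
        · exact Or.inr (Or.inr h)

theorem mem_moveAll {L : List (ℕ × ℕ)} {A : Finset ℕ} {x : ℕ}
    (hx : ∀ p ∈ L, p.1 + p.2 + 1 < x) : x ∈ moveAll L A ↔ x ∈ A := by
  induction L generalizing A with
  | nil => rfl
  | cons p L ih =>
    rw [moveAll, ih fun p hp => hx p (List.mem_cons_of_mem _ hp)]
    have := hx p List.mem_cons_self
    simp only [moveSpin, Finset.mem_insert, Finset.mem_erase]
    constructor
    · rintro (h | h)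
      · omega
      · exact h.2
    · exact fun h => Or.inr ⟨by omega, h⟩

theorem eq_of_moveAll {L L' : List (ℕ × ℕ)} (hL : IsNormal L) (hL' : IsNormal L') {S : Finset ℕ}
    (hS : ∀ p ∈ L, ∀ s ∈ S, p.1 + p.2 + 1 < s) (hS' : ∀ p ∈ L', ∀ s ∈ S, p.1 + p.2 + 1 < s)
    (h1 : AllMovable L' (startSet L ∪ S)) (h2 : moveAll L' (startSet L ∪ S) = endSet L ∪ S) :
    L = L' := by
  have hen : runLength L = runLength L' := by
    obtain ⟨h3, h4⟩ := allMovable_startSet hL hS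
    have h5 := energy_moveAll h1
    have h6 := energy_moveAll h3
    rw [h2] at h5
    rw [h4] at h6
    omega
  induction L generalizing L' S with
  | nil =>
    cases L' with
    | nil => rfl
    | cons p L' => simp [runLength] at hen
  | cons p L ih =>
    cases L' with
    | nil => simp [runLength] at hen
    | cons p' L' =>
      obtain ⟨k₀, d₀⟩ := p
      obtain ⟨k, d⟩ := p'
      have hT := (List.pairwise_cons.1 hL).1
      have hT' := (List.pairwise_cons.1 hL').1
      have hSk := hS _ List.mem_cons_self
      have hSk' := hS' _ List.mem_cons_self
      dsimp only at hT hT' hSk hSk'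
      obtain ⟨⟨hk, hfree⟩, hrest⟩ := h1
      dsimp only at hk hfree hrest
      rw [moveAll] at h2
      dsimp only at h2
      have htop : ∀ x, k + d + 1 ≤ x → (x ∈ endSet ((k₀, d₀) :: L) ∪ S ↔
          x ∈ moveSpin k d (startSet ((k₀, d₀) :: L) ∪ S)) := by
        intro x hx
        rw [← h2, mem_moveAll]
        intro p hp
        have := (hT' p hp).2
        omega
      have hend : k₀ + d₀ + 1 ∈ endSet ((k₀, d₀) :: L) ∪ S :=
        Finset.mem_union_left _ (mem_endSet.2 ⟨_, List.mem_cons_self, rfl⟩)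
      have hstart : ∀ x ∈ startSet ((k₀, d₀) :: L), x ≤ k₀ := by
        intro x hx
        obtain ⟨p, hp, rfl⟩ := mem_startSet.1 hx
        rcases List.mem_cons.1 hp with rfl | hp
        · exact le_rfl
        · exact (hT p hp).1.le
      have hends : ∀ x ∈ endSet ((k₀, d₀) :: L), x ≤ k₀ + d₀ + 1 := by
        intro x hx
        obtain ⟨p, hp, rfl⟩ := mem_endSet.1 hx
        rcases List.mem_cons.1 hp with rfl | hp
        · exact le_rfl
        · have := (hT p hp).2; omega
      have hkeq : k₀ + d₀ + 1 < k + d + 1 ∨ k₀ + d₀ + 1 = k + d + 1 := by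
        by_contra! hcon
        have h3 := (htop _ (by omega)).1 hend
        rcases Finset.mem_insert.1 h3 with h3 | h3
        · exact hcon.2 h3
        · rcases Finset.mem_union.1 (Finset.mem_of_mem_erase h3) with h3 | h3
          · have := hstart _ h3; omega
          · have := hSk _ h3; omega
      have hend' : k + d + 1 = k₀ + d₀ + 1 := by
        have h3 := (htop _ le_rfl).2 (Finset.mem_insert_self _ _)
        rcases Finset.mem_union.1 h3 with h3 | h3
        · have := hends _ h3; omega
        · have := hSk' _ h3; omega
      have hk0 : k = k₀ := by
        have h3 : k ≤ k₀ := by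
          rcases Finset.mem_union.1 hk with h3 | h3
          · exact hstart _ h3
          · have := hSk' _ h3; omega
        by_contra hne
        exact hfree k₀ (by omega) (by omega)
          (Finset.mem_union_left _ (mem_startSet.2 ⟨_, List.mem_cons_self, rfl⟩))
      subst hk0
      obtain rfl : d₀ = d := by omega
      congr 1
      have hins : endSet ((k, d₀) :: L) ∪ S = endSet L ∪ insert (k + d₀ + 1) S := by
        ext x
        simp only [Finset.mem_union, Finset.mem_insert, mem_endSet, List.mem_cons,
          exists_eq_or_imp]
        rw [eq_comm (a := x), or_assoc, or_left_comm]
      rw [moveSpin_startSet hL hSk] at hrest h2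
      rw [hins] at h2
      have hS1 : ∀ M : List (ℕ × ℕ), (∀ p ∈ M, p.1 < k ∧ p.1 + p.2 < k + d₀) →
          (∀ p ∈ M, ∀ s ∈ S, p.1 + p.2 + 1 < s) →
          ∀ p ∈ M, ∀ s ∈ insert (k + d₀ + 1) S, p.1 + p.2 + 1 < s := by
        intro M hM hMS p hp s hs
        rcases Finset.mem_insert.1 hs with rfl | hs
        · have := (hM p hp).2; omega
        · exact hMS p hp s hs
      refine ih (List.pairwise_cons.1 hL).2 (List.pairwise_cons.1 hL').2
        (hS1 L hT fun p hp => hS p (List.mem_cons_of_mem _ hp))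
        (hS1 L' hT' fun p hp => hS' p (List.mem_cons_of_mem _ hp)) hrest h2 ?_
      simpa [runLength] using hen

/-- Nonzero elements of the Temperley-Lieb algebra act nontrivially on spins. -/
theorem exists_mat_ne_zero {x : TL δ} (hx : x ≠ 0) : ∃ A B, mat (toDiagram δ x) B A ≠ 0 := by
  classical
  obtain ⟨n, hn⟩ := mem_normalSpan x
  have hrange : {x | ∃ L, IsNormal L ∧ (∀ p ∈ L, p.1 + p.2 < n) ∧ x = runWord δ L} ⊆
      Set.range (fun L : {L // IsNormal L} => runWord δ L.1) := by
    rintro _ ⟨L, h1, -, rfl⟩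
    exact ⟨⟨L, h1⟩, rfl⟩
  obtain ⟨c, hc⟩ := Finsupp.mem_span_range_iff_exists_finsupp.1 (Submodule.span_mono hrange hn)
  have hc0 : c.support.Nonempty := by
    rw [Finsupp.support_nonempty_iff]
    rintro rfl
    exact hx (by rw [← hc]; simp)
  obtain ⟨L₀, hL₀, hmax⟩ := c.support.exists_max_image (fun L => runLength L.1) hc0
  obtain ⟨h3, h4⟩ := allMovable_startSet L₀.2 (S := ∅) (by simp)
  rw [Finset.union_empty] at h3 h4
  rw [Finset.union_empty] at h4
  have henergy := energy_moveAll h3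
  rw [h4] at henergy
  obtain ⟨N, hN⟩ : ∃ N, ∀ L ∈ c.support, ∀ p ∈ L.1, p.1 + p.2 + 1 < N := by
    refine ⟨c.support.sup (fun L => (L.1.map fun p => p.1 + p.2 + 2).sum), fun L hL p hp => ?_⟩
    have h5 := Finset.le_sup (f := fun L : {L // IsNormal L} =>
      (L.1.map fun p => p.1 + p.2 + 2).sum) hL
    have h6 := List.le_sum_of_mem (List.mem_map_of_mem (f := fun p : ℕ × ℕ => p.1 + p.2 + 2) hp)
    have h7 := h6.trans h5
    omega
  have hA : startSet L₀.1 ⊆ Finset.range N := by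
    intro x hx
    obtain ⟨p, hp, rfl⟩ := mem_startSet.1 hx
    have := hN _ hL₀ p hp
    exact Finset.mem_range.2 (by omega)
  have hB : endSet L₀.1 ⊆ Finset.range N := by
    intro x hx
    obtain ⟨p, hp, rfl⟩ := mem_endSet.1 hx
    exact Finset.mem_range.2 (hN _ hL₀ p hp)
  refine ⟨startSet L₀.1, endSet L₀.1, ?_⟩
  have hlin : ∀ s : Finset {L // IsNormal L}, mat (toDiagram δ (∑ L ∈ s, c L • runWord δ L.1))
      (endSet L₀.1) (startSet L₀.1) = ∑ L ∈ s, c L *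
        mat (toDiagram δ (runWord δ L.1)) (endSet L₀.1) (startSet L₀.1) := by
    intro s
    induction s using Finset.induction_on with
    | empty => simp [mat]
    | insert L s hL ih => rw [Finset.sum_insert hL, map_add, mat_add, ih, map_smul, mat_smul,
        Finset.sum_insert hL]
  rw [← hc, Finsupp.sum, hlin, Finset.sum_eq_single_of_mem L₀ hL₀]
  · rw [mat_runWord _ (hN _ hL₀) hA hB henergy.ge, if_pos ⟨h3, h4.symm⟩, mul_one]
    exact Finsupp.mem_support_iff.1 hL₀
  · intro L hL hne
    have h5 := hmax L hL
    rw [mat_runWord _ (hN _ hL) hA hB (by omega), if_neg, mul_zero]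
    rintro ⟨h6, h7⟩
    refine hne (Subtype.ext (eq_of_moveAll L₀.2 L.2 (S := ∅) (by simp) (by simp) ?_ ?_)).symm
    · rwa [Finset.union_empty]
    · rw [Finset.union_empty, Finset.union_empty, h7]

theorem toDiagram_injective : Function.Injective (toDiagram δ) := by
  rw [injective_iff_map_eq_zero]
  intro x hx
  by_contra h
  obtain ⟨A, B, hAB⟩ := exists_mat_ne_zero h
  rw [hx] at hAB
  simp [mat] at hAB

theorem exists_mat_ne_zero_of_mem {n : ℕ} {x : Diagram δ} (hx : x ∈ diagrams δ n n)
    (h0 : x ≠ 0) : ∃ A B, mat x B A ≠ 0 := by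
  obtain ⟨y, _, rfl⟩ := exists_toDiagram_eq hx
  exact exists_mat_ne_zero (by rintro rfl; exact h0 (map_zero _))

/-- Diagrams are separated by vacuum expectation values. -/
theorem exists_vev_ne_zero_of_mem {n : ℕ} {x : Diagram δ} (hx : x ∈ diagrams δ n n)
    (h0 : x ≠ 0) : ∃ N, ∀ M, N ≤ M → ∃ j, ∃ u ∈ diagrams δ M j, ∃ w ∈ diagrams δ j M,
      vev δ (u * x * w) ≠ 0 := by
  obtain ⟨A, B, hAB⟩ := exists_mat_ne_zero_of_mem hx h0
  obtain ⟨k, hk⟩ := A.exists_nat_subset_range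
  refine exists_vev_ne_zero (n := n + k) (diagrams_mono hx (by omega) (by omega)) hAB
    fun i hi => ?_
  simp only [conf, decide_eq_false_iff_not]
  intro h
  have := Finset.mem_range.1 (hk h)
  omega

theorem eq_zero_of_idempotent {n : ℕ} {x : Diagram δ} (hx : x ∈ diagrams δ n n)
    (h : x * x = x) (h0 : spinTraceAux (1 / 2) n x = 0) : x = 0 := by
  by_contra hne
  obtain ⟨A, B, hAB⟩ := exists_mat_ne_zero_of_mem hx hne
  obtain ⟨a, ha⟩ := A.exists_nat_subset_range
  obtain ⟨b, hb⟩ := B.exists_nat_subset_range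
  refine hAB (mat_eq_zero_of_idempotent (n := n + (a + b)) (diagrams_mono hx (by omega) (by omega))
    h ?_ (hb.trans (Finset.range_subset_range.2 (by omega)))
    (ha.trans (Finset.range_subset_range.2 (by omega))))
  rw [spinTraceAux_eq _ (by omega) hx, h0]

end normalForm
end TemperleyLieb

namespace TemperleyLieb

/-! ### Quantum integers -/

/-- The quantum integers. -/
def qn (δ : ℝ) : ℕ → ℝ
  | 0 => 0
  | 1 => 1
  | n + 2 => δ * qn δ (n + 1) - qn δ n

/-- The properties of the quantum integers at a root of unity. -/
structure QRoot (δ : ℝ) (l : ℕ) : Prop where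
  two_le : 2 ≤ l
  zero : qn δ l = 0
  ne_zero : ∀ s, 0 < s → s < l → qn δ s ≠ 0
  sq : qn δ (l - 1) ^ 2 = 1
  symm : ∀ s, s ≤ l → qn δ (l - s) = qn δ (l - 1) * qn δ s

theorem qRoot_of_isLeast {q : ℂ} {l : ℕ} (hl : 2 ≤ l)
    (hq : IsLeast {k : ℕ | 0 < k ∧ q ^ (2 * k) = 1} l)
    {δ : ℝ} (hδ : (δ : ℂ) = q + q⁻¹) : QRoot δ l := by
  obtain ⟨⟨hl0, hql⟩, hmin⟩ := hq
  have hq0 : q ≠ 0 := by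
    rintro rfl
    rw [zero_pow (by omega)] at hql
    exact zero_ne_one hql
  have hqq : q * q⁻¹ = 1 := mul_inv_cancel₀ hq0
  have hform : ∀ n, (qn δ n : ℂ) * (q - q⁻¹) = q ^ n - q⁻¹ ^ n := by
    intro n
    induction n using Nat.strong_induction_on with
    | _ n ih =>
      match n with
      | 0 => simp [qn]
      | 1 => simp [qn]
      | n + 2 =>
        have h1 := ih (n + 1) (by omega)
        have h2 := ih n (by omega)
        rw [qn]
        push_cast
        rw [hδ]
        linear_combination (q + q⁻¹) * h1 - h2 +
          (q ^ n - q⁻¹ ^ n) * hqq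
  have hd : q - q⁻¹ ≠ 0 := by
    intro h
    have h1 : q ^ (2 * 1) = 1 := by linear_combination q * h + hqq
    have := hmin ⟨one_pos, h1⟩
    omega
  have hσ : ∀ s, s ≤ l → q ^ (l - s) = q ^ l * q⁻¹ ^ s := by
    intro s hs
    rw [inv_pow, ← div_eq_mul_inv, eq_div_iff (pow_ne_zero _ hq0), ← pow_add,
      Nat.sub_add_cancel hs]
  have hσ' : ∀ s, s ≤ l → q⁻¹ ^ (l - s) = q ^ l * q ^ s := by
    intro s hs
    have h1 : q ^ l * q ^ l = 1 := by rw [← pow_add, ← two_mul, hql]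
    have h2 : q⁻¹ ^ (l - s) * q ^ (l - s) = 1 := by rw [← mul_pow, mul_comm, hqq, one_pow]
    have h3 : q ^ (l - s) * q ^ s = q ^ l := by rw [← pow_add, Nat.sub_add_cancel hs]
    linear_combination -(q⁻¹ ^ (l - s)) * h1 +
      q ^ l * q ^ s * h2 - q⁻¹ ^ (l - s) * q ^ l * h3
  have hsub : ∀ s, s ≤ l → (qn δ (l - s) : ℂ) = -(q ^ l) * qn δ s := by
    intro s hs
    refine mul_right_cancel₀ hd ?_
    rw [hform, mul_assoc, hform, hσ s hs, hσ' s hs]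
    ring
  have hone : (qn δ (l - 1) : ℂ) = -(q ^ l) := by
    rw [hsub 1 (by omega)]; simp [qn]
  refine ⟨hl, ?_, fun s hs hsl h => ?_, ?_, fun s hs => ?_⟩
  · have := hsub 0 (Nat.zero_le l)
    simp only [qn, Nat.sub_zero, Complex.ofReal_zero, mul_zero] at this
    exact_mod_cast this
  · have h1 := hform s
    rw [h, Complex.ofReal_zero, zero_mul] at h1
    have h2 : q ^ (2 * s) = 1 := by
      have h3 : q⁻¹ ^ s * q ^ s = 1 := by rw [← mul_pow, mul_comm, hqq, one_pow]
      rw [two_mul, pow_add]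
      linear_combination -(q ^ s) * h1 + h3
    have := hmin ⟨hs, h2⟩
    omega
  · have : (qn δ (l - 1) : ℂ) ^ 2 = 1 := by
      rw [hone, neg_sq, ← pow_mul, mul_comm, hql]
    exact_mod_cast this
  · have := hsub s hs
    rw [← hone] at this
    exact_mod_cast this

/-! ### Towers of idempotents -/

section ringLemmas

variable {A : Type} [Ring A]

theorem assoc_left {a b c : A} (h : a * b = c) (z : A) : a * (b * z) = c * z := by
  rw [← mul_assoc, h]

theorem step_sq {p c g d B r : A} (hp : p * p = p) (hdpc : d * p * c = B * r) (hgB : g * B = 1)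
    (hrg : r * g = g * r) (hrd : r * d = d * r) (hrp : r * p = p) :
    (p * c * g * d * p) * (p * c * g * d * p) = p * c * g * d * p := by
  calc (p * c * g * d * p) * (p * c * g * d * p) = p * c * g * (d * (p * p) * c) * g * d * p := by
        simp only [mul_assoc]
    _ = p * c * (g * B) * (r * g) * d * p := by rw [hp, hdpc]; simp only [mul_assoc]
    _ = p * c * g * (r * d) * p := by rw [hgB, hrg]; simp only [mul_assoc, mul_one]
    _ = p * c * g * d * (r * p) := by rw [hrd]; simp only [mul_assoc]
    _ = p * c * g * d * p := by rw [hrp]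

theorem step_kill {p c g d B r : A} (hdpc : d * p * c = B * r) (hBg : B * g = 1)
    (hrg : r * g = g * r) (hrd : r * d = d * r) (hrp : r * p = p) :
    d * (p - p * c * g * d * p) = 0 := by
  have : d * (p * c * g * d * p) = d * p := by
    calc d * (p * c * g * d * p) = (d * p * c) * g * d * p := by simp only [mul_assoc]
      _ = B * (r * g) * d * p := by rw [hdpc]; simp only [mul_assoc]
      _ = (B * g) * (r * d) * p := by rw [hrg]; simp only [mul_assoc]
      _ = d * (r * p) := by rw [hBg, hrd]; simp only [mul_assoc, one_mul]
      _ = d * p := by rw [hrp]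
  rw [mul_sub, this, sub_self]

theorem step_trace {p c g d C D : A} (hp : p * p = p) (hDp : D * p = p * D) (hpC : C * p = p * C)
    (hDc : D * c = 1) (hdC : d * C = 1) (hg : g * p = p * g) :
    D * (p * c * g * d * p) * C = g * p := by
  calc D * (p * c * g * d * p) * C = (D * p) * c * g * d * (p * C) := by simp only [mul_assoc]
    _ = p * (D * c) * g * (d * C) * p := by rw [hDp, ← hpC]; simp only [mul_assoc]
    _ = g * p := by rw [hDc, hdC, mul_one, mul_one, ← hg, mul_assoc, hp]

end ringLemmas

variable {δ : ℝ}

theorem smul_sub_smul (a b : ℂ) (x : Diagram δ) : a • x - b • x = (a - b) • x := by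
  simp only [Algebra.smul_def, map_sub, sub_mul]

/-- The partial traces in a tower of idempotents. -/
noncomputable def bet (y : Diagram δ) (s : ℕ) : Diagram δ :=
  ((qn δ s / qn δ (s - 1) : ℝ) : ℂ) • 1 - ((2 / qn δ (s - 1) ^ 2 : ℝ) : ℂ) • y

/-- The inverses of the partial traces in a tower of idempotents. -/
noncomputable def ibet (y : Diagram δ) (s : ℕ) : Diagram δ :=
  ((qn δ (s - 1) / qn δ s : ℝ) : ℂ) • 1 + ((2 / qn δ s ^ 2 : ℝ) : ℂ) • y

theorem bet_succ (y : Diagram δ) {s : ℕ} (hs : 0 < s) (h : qn δ s ≠ 0) :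
    bet y (s + 1) = (δ : ℂ) • 1 - ibet y s := by
  obtain ⟨s, rfl⟩ : ∃ t, s = t + 1 := ⟨s - 1, by omega⟩
  rw [bet, ibet, Nat.add_sub_cancel, Nat.add_sub_cancel, qn, sub_add_eq_sub_sub, smul_sub_smul]
  congr 2
  have h' : (qn δ (s + 1) : ℂ) ≠ 0 := by exact_mod_cast h
  push_cast
  field_simp

theorem ibet_mul_bet {y : Diagram δ} (hy : y * y = 0) {s : ℕ} (h : qn δ s ≠ 0)
    (h1 : qn δ (s - 1) ≠ 0) : ibet y s * bet y s = 1 := by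
  have h' : (qn δ s : ℂ) ≠ 0 := by exact_mod_cast h
  have h1' : (qn δ (s - 1) : ℂ) ≠ 0 := by exact_mod_cast h1
  rw [ibet, bet, add_mul, mul_sub, mul_sub]
  simp only [smul_mul_smul_comm, mul_one, one_mul, hy, smul_zero, sub_zero]
  rw [sub_add_eq_add_sub, add_sub_assoc, smul_sub_smul]
  push_cast
  rw [show (qn δ (s - 1) : ℂ) / qn δ s * (qn δ s / qn δ (s - 1)) = 1 by field_simp,
    show (2 : ℂ) / qn δ s ^ 2 * (qn δ s / qn δ (s - 1)) -
      (qn δ (s - 1) : ℂ) / qn δ s * (2 / qn δ (s - 1) ^ 2) = 0 by field_simp; ring]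
  simp

theorem Commute.bet {x y : Diagram δ} (h : x * y = y * x) (s : ℕ) : x * bet y s = bet y s * x := by
  simp only [TemperleyLieb.bet, mul_sub, sub_mul, mul_smul_comm, smul_mul_assoc, mul_one, one_mul,
    h]

theorem Commute.ibet {x y : Diagram δ} (h : x * y = y * x) (s : ℕ) :
    x * ibet y s = ibet y s * x := by
  simp only [TemperleyLieb.ibet, mul_add, add_mul, mul_smul_comm, smul_mul_assoc, mul_one,
    one_mul, h]

/-- The tower of idempotents that starts with `J` and `p₂`. -/
noncomputable def tower (M : ℕ) (J y p₂ : Diagram δ) : ℕ → Diagram δ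
  | 0 => J
  | 1 => J
  | 2 => p₂
  | s + 3 => tower M J y p₂ (s + 2) - tower M J y p₂ (s + 2) * cup δ (M + s) * ibet y (s + 2) *
      cap δ (M + s) * tower M J y p₂ (s + 2)

/-- An idempotent diagram with real coefficients, invariant under reflection, with constant
coefficient one. -/
structure IsProj (n : ℕ) (p : Diagram δ) : Prop where
  mem : p ∈ diagrams δ n n
  sq : p * p = p
  dag : dagger p = p
  real : conj p = p
  vev : vev δ p = 1

theorem IsProj.mono {n m : ℕ} {p : Diagram δ} (h : IsProj n p) (hnm : n ≤ m) : IsProj m p :=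
  { h with mem := diagrams_mono h.mem hnm (by omega) }

/-- The data at the bottom of a tower of idempotents. -/
structure TowerBase (M : ℕ) (J y p₂ : Diagram δ) : Prop where
  y_mem : y ∈ diagrams δ M M
  y_sq : y * y = 0
  y_dag : dagger y = y
  y_real : conj y = y
  J_proj : IsProj (M - 1) J
  J_y : J * y = y
  y_J : y * J = y
  p_proj : IsProj (M + 1) p₂
  J_p : J * p₂ = p₂
  p_y : p₂ * y = y * p₂
  trace : cap δ M * p₂ * cup δ M = bet y 2 * J
  kill : 0 < M → cap δ (M - 1) * p₂ = 0

namespace TowerBase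

variable {M : ℕ} {J y p₂ : Diagram δ}

theorem ibet_mem (h : TowerBase M J y p₂) (s : ℕ) : ibet y s ∈ diagrams δ M M :=
  add_mem (Submodule.smul_mem _ _ (one_mem_diagrams M)) (Submodule.smul_mem _ _ h.y_mem)

/-- One step of the tower. -/
theorem step (h : TowerBase M J y p₂) {l : ℕ} (hl : QRoot δ l) (s : ℕ) (hs : s + 2 ≤ l) :
    IsProj (M + s + 1) (tower M J y p₂ (s + 2)) ∧
    tower M J y p₂ (s + 2) * y = y * tower M J y p₂ (s + 2) ∧
    tower M J y p₂ (s + 1) * tower M J y p₂ (s + 2) = tower M J y p₂ (s + 2) ∧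
    cap δ (M + s) * tower M J y p₂ (s + 2) * cup δ (M + s) =
      bet y (s + 2) * tower M J y p₂ (s + 1) ∧
    (0 < M + s → cap δ (M + s - 1) * tower M J y p₂ (s + 2) = 0) ∧
    IsProj (M + s) (tower M J y p₂ (s + 1)) ∧
    tower M J y p₂ (s + 1) * y = y * tower M J y p₂ (s + 1) := by
  induction s with
  | zero =>
    exact ⟨h.p_proj, h.p_y, h.J_p, h.trace, h.kill, h.J_proj.mono (by omega),
      by rw [tower, h.J_y, h.y_J]⟩
  | succ s ih =>
    obtain ⟨h1, h2, h3, h4, -, h6, h7⟩ := ih (by omega)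
    set p := tower M J y p₂ (s + 2) with hp
    set r := tower M J y p₂ (s + 1) with hr
    have hq : qn δ (s + 2) ≠ 0 := hl.ne_zero _ (by omega) (by omega)
    have hq' : qn δ (s + 2 - 1) ≠ 0 := hl.ne_zero _ (by omega) (by omega)
    have hgB := ibet_mul_bet h.y_sq hq hq'
    have hBg : bet y (s + 2) * ibet y (s + 2) = 1 := by
      rw [← Commute.bet (Commute.ibet rfl (s + 2)).symm]; exact hgB
    have hrg := Commute.ibet h7 (s + 2)
    have hpg := Commute.ibet h2 (s + 2)
    have hrd : r * cap δ (M + s) = cap δ (M + s) * r := (cap_comm h6.mem le_rfl).symm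
    have hpD : cap δ (M + (s + 1)) * p = p * cap δ (M + (s + 1)) := cap_comm h1.mem (by omega)
    have hpC : cup δ (M + (s + 1)) * p = p * cup δ (M + (s + 1)) := cup_comm h1.mem (by omega)
    have hpr : p * r = p := by
      have := congrArg dagger h3
      rwa [dagger_mul, h1.dag, h6.dag] at this
    have hnew : tower M J y p₂ (s + 1 + 2) = p - p * cup δ (M + s) * ibet y (s + 2) *
        cap δ (M + s) * p := rfl
    have hcmem : p * cup δ (M + s) ∈ diagrams δ (M + s) (M + s + 2) :=
      mul_mem_diagrams (diagrams_mono h1.mem (by omega) (by omega))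
        (cup_mem_diagrams le_rfl rfl)
    have hdmem : cap δ (M + s) * p ∈ diagrams δ (M + s + 2) (M + s) :=
      mul_mem_diagrams (cap_mem_diagrams le_rfl rfl)
        (diagrams_mono h1.mem (by omega) (by omega))
    have hg_dag : dagger (ibet y (s + 2)) = ibet y (s + 2) := by
      rw [ibet, dagger_add, dagger_smul, dagger_smul, dagger_one, h.y_dag]
    have hg_real : conj (ibet y (s + 2)) = ibet y (s + 2) := by
      rw [ibet, conj_add, conj_smul, conj_smul, conj_one, h.y_real, Complex.conj_ofReal,
        Complex.conj_ofReal]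
    set X := p * cup δ (M + s) * ibet y (s + 2) * cap δ (M + s) * p with hX
    have hXX : X * X = X := step_sq h1.sq h4 hgB hrg hrd h3
    have hpX : p * X = X := by rw [hX]; simp only [← mul_assoc, h1.sq]
    have hXp : X * p = X := by rw [hX, mul_assoc, h1.sq]
    have hXmem : X ∈ diagrams δ (M + s + 2) (M + s + 2) := by
      rw [hX, mul_assoc (_ * _)]
      exact mul_mem_diagrams (mul_mem_diagrams hcmem
        (diagrams_mono (h.ibet_mem (s + 2)) (by omega) (by omega))) hdmem
    have hyX : X * y = y * X := by
      have hyc : cup δ (M + s) * y = y * cup δ (M + s) := cup_comm h.y_mem (by omega)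
      have hyd : cap δ (M + s) * y = y * cap δ (M + s) := cap_comm h.y_mem (by omega)
      have hyg : ibet y (s + 2) * y = y * ibet y (s + 2) := (Commute.ibet rfl _).symm
      rw [hX]
      simp only [mul_assoc]
      rw [h2, assoc_left hyd, mul_assoc, assoc_left hyg, mul_assoc, assoc_left hyc, mul_assoc,
        assoc_left h2, mul_assoc]
    rw [hnew]
    refine ⟨⟨?_, ?_, ?_, ?_, ?_⟩, ?_, ?_, ?_, fun _ => ?_, h1, h2⟩
    · exact sub_mem (diagrams_mono h1.mem (by omega) (by omega)) hXmem
    · rw [mul_sub, sub_mul, sub_mul, h1.sq, hpX, hXp, hXX]; simp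
    · rw [dagger_sub, h1.dag, hX]
      simp only [dagger_mul, dagger_cup, dagger_cap, h1.dag, hg_dag, mul_assoc]
    · rw [conj_sub, h1.real, hX]
      simp only [conj_mul, conj_cup, conj_cap, h1.real, hg_real]
    · rw [map_sub, h1.vev, hX, mul_assoc, mul_assoc,
        vev_lt_mul (by omega) _ hcmem, sub_zero]
    · rw [sub_mul, mul_sub, h2, hyX]
    · show p * (p - X) = p - X
      rw [mul_sub, h1.sq, hpX]
    · show _ = bet y (s + 2 + 1) * p
      rw [mul_sub, sub_mul, hpD, mul_assoc p, cap_cup_loop, ← Algebra.commutes,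
        step_trace h1.sq hpD hpC (cap_cup_zag δ (M + s)) (cap_cup_zig δ (M + s)) hpg.symm,
        bet_succ y (by omega) hq, sub_mul, Algebra.smul_def, mul_one]
    · exact step_kill h4 hBg hrg hrd h3

variable {l : ℕ}

theorem proj (h : TowerBase M J y p₂) (hl : QRoot δ l) {s : ℕ} (hs : s ≤ l) :
    IsProj (M + s - 1) (tower M J y p₂ s) := by
  match s with
  | 0 => exact h.J_proj
  | 1 => exact h.J_proj.mono (by omega)
  | s + 2 => exact (h.step hl s hs).1

theorem comm_y (h : TowerBase M J y p₂) (hl : QRoot δ l) {s : ℕ} (hs : s ≤ l) :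
    tower M J y p₂ s * y = y * tower M J y p₂ s := by
  match s with
  | 0 => rw [tower, h.J_y, h.y_J]
  | 1 => rw [tower, h.J_y, h.y_J]
  | s + 2 => exact (h.step hl s hs).2.1

theorem absorb (h : TowerBase M J y p₂) (hl : QRoot δ l) {s t : ℕ} (hst : t ≤ s) (hs : s ≤ l) :
    tower M J y p₂ t * tower M J y p₂ s = tower M J y p₂ s := by
  induction s, hst using Nat.le_induction with
  | base => exact (h.proj hl hs).sq
  | succ s hst ih =>
    have h1 : tower M J y p₂ s * tower M J y p₂ (s + 1) = tower M J y p₂ (s + 1) := by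
      match s with
      | 0 => exact h.J_proj.sq
      | s + 1 => exact (h.step hl s hs).2.2.1
    rw [← h1, ← mul_assoc, ih (by omega)]

theorem absorb' (h : TowerBase M J y p₂) (hl : QRoot δ l) {s t : ℕ} (hst : t ≤ s) (hs : s ≤ l) :
    tower M J y p₂ s * tower M J y p₂ t = tower M J y p₂ s := by
  have := congrArg dagger (h.absorb hl hst hs)
  rwa [dagger_mul, (h.proj hl hs).dag, (h.proj hl (hst.trans hs)).dag] at this

theorem trace_succ (h : TowerBase M J y p₂) (hl : QRoot δ l) {s : ℕ} (hs : s + 2 ≤ l) :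
    cap δ (M + s) * tower M J y p₂ (s + 2) * cup δ (M + s) =
      bet y (s + 2) * tower M J y p₂ (s + 1) := (h.step hl s hs).2.2.2.1

theorem cap_tower (h : TowerBase M J y p₂) (hl : QRoot δ l) {s i : ℕ} (hs : s ≤ l)
    (hi : M ≤ i + 1) (hi' : i + 3 ≤ M + s) : cap δ i * tower M J y p₂ s = 0 := by
  obtain ⟨t, ht⟩ : ∃ t, i + 1 = M + t := ⟨i + 1 - M, by omega⟩
  have h1 := (h.step hl t (by omega)).2.2.2.2.1 (by omega)
  rw [← ht, Nat.add_sub_cancel] at h1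
  rw [← h.absorb hl (show t + 2 ≤ s by omega) hs, ← mul_assoc, h1, zero_mul]

theorem tower_sub (s : ℕ) : tower M J y p₂ (s + 2) - tower M J y p₂ (s + 3) =
    tower M J y p₂ (s + 2) * cup δ (M + s) * ibet y (s + 2) *
      cap δ (M + s) * tower M J y p₂ (s + 2) := by
  rw [tower, sub_sub_cancel]

end TowerBase
end TemperleyLieb

namespace TemperleyLieb

/-! ### Nested cups -/

variable {δ : ℝ}

/-- `s` nested cups around the gap between the strands `n` and `n + 1` of the result. -/
noncomputable def nest (δ : ℝ) (n : ℕ) : ℕ → Diagram δ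
  | 0 => 1
  | s + 1 => nest δ n s * cup δ (n - s)

/-- `s` nested caps. -/
noncomputable def unnest (δ : ℝ) (n : ℕ) : ℕ → Diagram δ
  | 0 => 1
  | s + 1 => cap δ (n - s) * unnest δ n s

theorem dagger_nest (n s : ℕ) : dagger (nest δ n s) = unnest δ n s := by
  induction s with
  | zero => simp [nest, unnest]
  | succ s ih => rw [nest, unnest, dagger_mul, ih, dagger_cup]

theorem dagger_unnest (n s : ℕ) : dagger (unnest δ n s) = nest δ n s := by
  rw [← dagger_nest, dagger_dagger]

theorem conj_nest (n s : ℕ) : conj (nest δ n s) = nest δ n s := by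
  induction s with
  | zero => simp [nest]
  | succ s ih => rw [nest, conj_mul, ih, conj_cup]

theorem conj_unnest (n s : ℕ) : conj (unnest δ n s) = unnest δ n s := by
  rw [← dagger_nest, conj_dagger, conj_nest]

theorem unnest_mem {n s : ℕ} (hs : s ≤ n + 1) :
    unnest δ n s ∈ diagrams δ (n + 1 + s) (n + 1 - s) := by
  induction s with
  | zero => exact one_mem_diagrams _
  | succ s ih =>
    refine mul_mem_diagrams (b := n + 2 - s) (cap_mem_diagrams (by omega) (by omega)) ?_
    exact diagrams_mono (ih (by omega)) (by omega) (by omega)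

theorem nest_mem {n s : ℕ} (hs : s ≤ n + 1) : nest δ n s ∈ diagrams δ (n + 1 - s) (n + 1 + s) := by
  rw [← dagger_unnest]
  exact dagger_mem_diagrams (unnest_mem hs)

theorem unnest_eq_mul_cap (n s : ℕ) : ∃ W, unnest δ n (s + 1) = W * cap δ n := by
  induction s with
  | zero => exact ⟨1, by simp [unnest]⟩
  | succ s ih =>
    obtain ⟨W, hW⟩ := ih
    exact ⟨cap δ (n - (s + 1)) * W, by rw [unnest, hW, mul_assoc]⟩

theorem unnest_comm {n s k : ℕ} (hk : k + s ≤ n + 1) {x : Diagram δ} (hx : x ∈ diagrams δ k k) :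
    x * unnest δ n s = unnest δ n s * x := by
  induction s with
  | zero => simp [unnest]
  | succ s ih =>
    rw [unnest, ← mul_assoc, ← cap_comm hx (by omega), mul_assoc, ih (by omega), mul_assoc]

theorem cap_mul_unnest {n s i : ℕ} (hi : i + 1 + s ≤ n) :
    ∃ W, cap δ i * unnest δ n s = W * cap δ i := by
  induction s with
  | zero => exact ⟨1, by simp [unnest]⟩
  | succ s ih =>
    obtain ⟨W, hW⟩ := ih (by omega)
    refine ⟨cap δ (n - s - 2) * W, ?_⟩
    have := cap_cap δ (show i ≤ n - s - 2 by omega)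
    rw [show n - s - 2 + 2 = n - s by omega] at this
    rw [unnest, ← mul_assoc, ← this, mul_assoc, hW, mul_assoc]

theorem unnest_mul_cup {n s : ℕ} (hs : s ≤ n) :
    unnest δ n (s + 1) * cup δ (n + 1 + s) = unnest δ n s := by
  have := cup_mul_of_mem (unnest_mem (δ := δ) (show s ≤ n + 1 by omega)) 0
  rw [add_zero, add_zero, show n + 1 - s = n - s + 1 by omega] at this
  rw [unnest, mul_assoc, ← this, ← mul_assoc, cap_cup_zig, one_mul]

theorem unnest_mul_cap {n s : ℕ} (hs : s ≤ n + 1) :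
    unnest δ n s * cap δ (n + 1 + s) = cap δ (n + 1 - s) * unnest δ n s :=
  (cap_mul_of_mem (unnest_mem (δ := δ) hs) 0).symm

theorem bet_two (y : Diagram δ) : bet y 2 = (δ : ℂ) • 1 - (2 : ℂ) • y := by
  simp [bet, qn]

/-! ### Alcoves -/

section ringLemmas

variable {A : Type} [Ring A] [Algebra ℂ A]

theorem corner_sq {J e y : A} {c : ℂ} (hJ : J * J = J) (hyJ : y * J = y) (hJy : J * y = y)
    (hy : y * y = 0) (heJ : e * J = J * e) (heye : e * y * e = J * e) (he : e * e = c • e) :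
    (J - (e * y + y * e - c • (y * e * y))) * (J - (e * y + y * e - c • (y * e * y))) =
      J - (e * y + y * e - c • (y * e * y)) := by
  have a1 : J * (e * y) = e * y := by rw [← mul_assoc, ← heJ, mul_assoc, hJy]
  have a2 : J * (y * e) = y * e := by rw [← mul_assoc, hJy]
  have a3 : J * (y * e * y) = y * e * y := by rw [← mul_assoc, ← mul_assoc, hJy]
  have b1 : e * y * J = e * y := by rw [mul_assoc, hyJ]
  have b2 : y * e * J = y * e := by rw [mul_assoc, heJ, ← mul_assoc, hyJ]
  have b3 : y * e * y * J = y * e * y := by rw [mul_assoc, hyJ]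
  have c1 : e * y * (e * y) = e * y := by rw [← mul_assoc, heye, ← heJ, mul_assoc, hJy]
  have c2 : e * y * (y * e) = 0 := by
    rw [mul_assoc, ← mul_assoc y y, hy, zero_mul, mul_zero]
  have c3 : e * y * (y * e * y) = 0 := by
    rw [← mul_assoc, ← mul_assoc, mul_assoc e, hy, mul_zero, zero_mul, zero_mul]
  have c4 : y * e * (e * y) = c • (y * e * y) := by
    rw [mul_assoc, ← mul_assoc e e, he, smul_mul_assoc, mul_smul_comm, mul_assoc]
  have c5 : y * e * (y * e) = y * e := by
    rw [mul_assoc, ← mul_assoc e y, heye, ← mul_assoc, hyJ]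
  have c6 : y * e * (y * e * y) = y * e * y := by rw [← mul_assoc, c5]
  have c7 : y * e * y * (e * y) = y * e * y := by
    rw [mul_assoc y e y, mul_assoc y, c1]
  have c8 : y * e * y * (y * e) = 0 := by
    rw [mul_assoc, ← mul_assoc y y, hy, zero_mul, mul_zero]
  have c9 : y * e * y * (y * e * y) = 0 := by rw [← mul_assoc, c8, zero_mul]
  simp only [sub_mul, mul_sub, add_mul, mul_add, smul_mul_assoc, mul_smul_comm, a1, a2, a3, b1,
    b2, b3, c1, c2, c3, c4, c5, c6, c7, c8, c9, hJ]
  module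

end ringLemmas

/-- The nilpotent element of the next alcove. -/
noncomputable def nextY (n : ℕ) (J : Diagram δ) : Diagram δ := J * cup δ n * (cap δ n * J)

/-- The second idempotent of an alcove. -/
noncomputable def secondP (n : ℕ) (J y : Diagram δ) : Diagram δ :=
  J - (cup δ n * cap δ n * y + y * (cup δ n * cap δ n) - (δ : ℂ) • (y * (cup δ n * cap δ n) * y))

/-- The relation between an alcove with data `J₀, y₀, p₀` and the idempotent `J` at the bottom of
the next alcove. -/
structure Link (l L n : ℕ) (J₀ y₀ p₀ J : Diagram δ) (θ : ℝ) : Prop where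
  hl : QRoot δ l
  hn : n + 2 = L + l
  hL : L = 0 ∨ 2 ≤ L
  hθ : 0 < L → θ ≠ 0
  base : TowerBase L J₀ y₀ p₀
  J_proj : IsProj (n + 1) J
  kill : ∀ i, i + 1 ≤ n → cap δ i * J = 0
  ptr : cap δ n * J * cup δ n = (θ : ℂ) • (y₀ * tower L J₀ y₀ p₀ (l - 1))
  y_J : y₀ * J = 0
  top_J : tower L J₀ y₀ p₀ l * J = J
  top_eq : L = 0 → tower L J₀ y₀ p₀ l = J
  top_sub : 0 < L → ∃ B, tower L J₀ y₀ p₀ l - J = B * (cap δ (L - 2) * tower L J₀ y₀ p₀ (l - 1))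
  low_zero : L = 0 → y₀ = 0 ∧ p₀ = J₀
  low : 0 < L → p₀ = secondP (L - 1) J₀ y₀
  low_trace : 0 < L → cap δ (L - 1) * y₀ * cup δ (L - 1) = J₀

namespace Link

variable {l L n : ℕ} {J₀ y₀ p₀ J : Diagram δ} {θ : ℝ}

theorem absorb (h : Link l L n J₀ y₀ p₀ J θ) {s : ℕ} (hs : s ≤ l) :
    tower L J₀ y₀ p₀ s * J = J := by
  rw [← h.top_J, ← mul_assoc, h.base.absorb h.hl hs le_rfl]

theorem cap_nextY (h : Link l L n J₀ y₀ p₀ J θ) : cap δ n * nextY n J = 0 := by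
  have hl := h.hl.two_le
  have hn := h.hn
  have hq := (h.base.proj h.hl (show l - 1 ≤ l by omega)).mem
  have h1 : y₀ * tower L J₀ y₀ p₀ (l - 1) = tower L J₀ y₀ p₀ (l - 1) * y₀ :=
    (h.base.comm_y h.hl (by omega)).symm
  simp only [nextY, ← mul_assoc]
  rw [h.ptr, smul_mul_assoc, smul_mul_assoc, h1, mul_assoc, mul_assoc, ← mul_assoc y₀, ← cap_comm h.base.y_mem (by omega), mul_assoc, h.y_J]
  simp

theorem J_nextY (h : Link l L n J₀ y₀ p₀ J θ) : J * nextY n J = nextY n J := by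
  rw [nextY, ← mul_assoc, ← mul_assoc J, h.J_proj.sq]

theorem nextY_J (h : Link l L n J₀ y₀ p₀ J θ) : nextY n J * J = nextY n J := by
  rw [nextY, mul_assoc, mul_assoc (cap δ n), h.J_proj.sq]

theorem cap_nextY_cup (h : Link l L n J₀ y₀ p₀ J θ) :
    cap δ (n + 1) * nextY n J * cup δ (n + 1) = J := by
  have h1 := cap_comm h.J_proj.mem le_rfl
  have h2 := cup_comm h.J_proj.mem le_rfl
  rw [nextY]
  calc cap δ (n + 1) * (J * cup δ n * (cap δ n * J)) * cup δ (n + 1) =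
      (cap δ (n + 1) * J) * cup δ n * (cap δ n * (J * cup δ (n + 1))) := by
        simp only [mul_assoc]
    _ = J * (cap δ (n + 1) * cup δ n) * ((cap δ n * cup δ (n + 1)) * J) := by
        rw [h1, ← h2]; simp only [mul_assoc]
    _ = J := by rw [cap_cup_zag, cap_cup_zig, mul_one, one_mul, h.J_proj.sq]

theorem vev_nextY (h : Link l L n J₀ y₀ p₀ J θ) (x : Diagram δ) : vev δ (nextY n J * x) = 0 := by
  rw [nextY, mul_assoc]
  refine vev_lt_mul (a := n) (b := n + 2) (by omega) _ (mul_mem_diagrams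
    (diagrams_mono h.J_proj.mem (by omega) (by omega)) (cup_mem_diagrams le_rfl rfl))

theorem next_base (h : Link l L n J₀ y₀ p₀ J θ) :
    TowerBase (n + 2) J (nextY n J) (secondP (n + 1) J (nextY n J)) := by
  have hJ := h.J_proj
  have hJJ := hJ.sq
  have hyJ := h.nextY_J
  have hJy := h.J_nextY
  have hd := cap_comm hJ.mem le_rfl
  have hc := cup_comm hJ.mem le_rfl
  have htr := h.cap_nextY_cup
  have hvev := h.vev_nextY
  have hy_mem : nextY n J ∈ diagrams δ (n + 2) (n + 2) :=
    mul_mem_diagrams (mul_mem_diagrams (diagrams_mono hJ.mem (by omega) (by omega))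
      (cup_mem_diagrams le_rfl rfl)) (mul_mem_diagrams (cap_mem_diagrams le_rfl rfl)
      (diagrams_mono hJ.mem (by omega) (by omega)))
  have hy_sq : nextY n J * nextY n J = 0 := by
    conv_lhs => enter [1]; rw [nextY]
    rw [mul_assoc, mul_assoc (cap δ n), hJy, h.cap_nextY, mul_zero]
  have hy_dag : dagger (nextY n J) = nextY n J := by
    rw [nextY, dagger_mul, dagger_mul, dagger_mul, hJ.dag, dagger_cup, dagger_cap]
  have hy_real : conj (nextY n J) = nextY n J := by
    rw [nextY, conj_mul, conj_mul, conj_mul, hJ.real, conj_cup, conj_cap]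
  set y := nextY n J with hy
  set c := cup δ (n + 1) with hcdef
  set d := cap δ (n + 1) with hddef
  have hdc : d * c = algebraMap ℂ _ (δ : ℂ) := cap_cup_loop δ _
  have heJ : c * d * J = J * (c * d) := by rw [mul_assoc, hd, ← mul_assoc, hc, mul_assoc]
  have heye : c * d * y * (c * d) = J * (c * d) := by
    calc c * d * y * (c * d) = c * (d * y * c) * d := by simp only [mul_assoc]
      _ = _ := by rw [htr, hc, mul_assoc]
  have hee : c * d * (c * d) = (δ : ℂ) • (c * d) := by
    rw [mul_assoc, ← mul_assoc d, hdc, ← mul_assoc, ← Algebra.commutes, mul_assoc,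
      Algebra.smul_def]
  have he_mem : c * d ∈ diagrams δ (n + 3) (n + 3) := e_mem_diagrams (by omega)
  have hy_mem' : y ∈ diagrams δ (n + 3) (n + 3) := diagrams_mono hy_mem (by omega) (by omega)
  have hsp : secondP (n + 1) J y = J - (c * d * y + y * (c * d) - (δ : ℂ) • (y * (c * d) * y)) :=
    rfl
  have hyey : y * (c * d) * y * y = 0 := by rw [mul_assoc, hy_sq, mul_zero]
  have hyey' : y * (y * (c * d) * y) = 0 := by
    rw [← mul_assoc, ← mul_assoc, hy_sq, zero_mul, zero_mul]
  have hdcup : cap δ (n + 2) * c = 1 := cap_cup_zag δ (n + 1)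
  have hcapc : d * cup δ (n + 2) = 1 := cap_cup_zig δ (n + 1)
  have hyd := cap_comm hy_mem le_rfl
  have hyc := cup_comm hy_mem le_rfl
  refine ⟨hy_mem, hy_sq, hy_dag, hy_real, hJ, hJy, hyJ, ⟨?_, ?_, ?_, ?_, ?_⟩, ?_, ?_, ?_, ?_⟩
  · rw [hsp]
    exact sub_mem (diagrams_mono hJ.mem (by omega) (by omega)) (sub_mem (add_mem
      (mul_mem_diagrams he_mem hy_mem') (mul_mem_diagrams hy_mem' he_mem)) (Submodule.smul_mem _ _
      (mul_mem_diagrams (mul_mem_diagrams hy_mem' he_mem) hy_mem')))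
  · exact corner_sq hJJ hyJ hJy hy_sq heJ heye hee
  · have he : dagger (c * d) = c * d := by rw [dagger_mul, hddef, hcdef, dagger_cup, dagger_cap]
    rw [hsp]
    simp only [dagger_sub, dagger_add, dagger_smul, dagger_mul y, dagger_mul (c * d),
      dagger_mul (y * (c * d)) y, he, hy_dag, hJ.dag]
    rw [add_comm, mul_assoc y]
  · have he : conj (c * d) = c * d := by rw [conj_mul, hddef, hcdef, conj_cup, conj_cap]
    rw [hsp]
    simp only [conj_sub, conj_add, conj_smul, conj_mul y, conj_mul (c * d),
      conj_mul (y * (c * d)), he, hy_real, hJ.real, Complex.conj_ofReal]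
  · rw [hsp, map_sub, map_sub, map_add, map_smul, hJ.vev, mul_assoc c, vev_cup_mul, hvev,
      mul_assoc y, hvev]
    simp
  · rw [hsp, mul_sub, hJJ, mul_sub, mul_add, mul_smul_comm, ← mul_assoc J (c * d), ← heJ,
      mul_assoc (c * d), hJy, ← mul_assoc J y, hJy, ← mul_assoc J (y * (c * d)),
      ← mul_assoc J y, hJy]
  · rw [hsp, sub_mul, mul_sub, hJy, hyJ, sub_mul, mul_sub, add_mul, mul_add, smul_mul_assoc,
      mul_smul_comm, hyey, hyey', mul_assoc (c * d), hy_sq, ← mul_assoc y y, hy_sq, mul_assoc y]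
    simp
  · have t1 : cap δ (n + 2) * (c * d * y) * cup δ (n + 2) = y := by
      calc _ = (cap δ (n + 2) * c) * d * (y * cup δ (n + 2)) := by simp only [mul_assoc]
        _ = y := by rw [hdcup, one_mul, ← hyc, ← mul_assoc, hcapc, one_mul]
    have t2 : cap δ (n + 2) * (y * (c * d)) * cup δ (n + 2) = y := by
      calc _ = (cap δ (n + 2) * y) * c * (d * cup δ (n + 2)) := by simp only [mul_assoc]
        _ = y := by rw [hyd, hcapc, mul_one, mul_assoc, hdcup, mul_one]
    have t3 : cap δ (n + 2) * (y * (c * d) * y) * cup δ (n + 2) = 0 := by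
      calc _ = (cap δ (n + 2) * y) * c * d * (y * cup δ (n + 2)) := by simp only [mul_assoc]
        _ = y * (cap δ (n + 2) * c) * (d * cup δ (n + 2)) * y := by
          rw [hyd, ← hyc]; simp only [mul_assoc]
        _ = 0 := by rw [hdcup, hcapc, mul_one, mul_one, hy_sq]
    have t4 : cap δ (n + 2) * J * cup δ (n + 2) = (δ : ℂ) • J := by
      rw [cap_comm hJ.mem (by omega), mul_assoc, cap_cup_loop, ← Algebra.commutes,
        Algebra.smul_def]
    rw [hsp, mul_sub, sub_mul, mul_sub, mul_add, sub_mul, add_mul, mul_smul_comm, smul_mul_assoc,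
      t1, t2, t3, t4, bet_two, sub_mul, smul_mul_assoc, smul_mul_assoc, one_mul, hyJ, two_smul,
      smul_zero, sub_zero]
  · intro _
    show d * secondP (n + 1) J y = 0
    have t1 : d * (c * d * y) = (δ : ℂ) • (d * y) := by
      rw [mul_assoc, ← mul_assoc d, hdc, Algebra.smul_def]
    have t2 : d * (y * (c * d)) = d * J := by
      rw [← mul_assoc, ← mul_assoc, htr, hd]
    have t3 : d * (y * (c * d) * y) = d * y := by
      rw [← mul_assoc, t2, mul_assoc, hJy]
    rw [hsp, mul_sub, mul_sub, mul_add, mul_smul_comm, t1, t2, t3, add_sub_cancel_left, sub_self]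

/-- The projections of the alcove that starts with `J`. -/
noncomputable abbrev _root_.TemperleyLieb.nextP (n : ℕ) (J : Diagram δ) : ℕ → Diagram δ :=
  tower (n + 2) J (nextY n J) (secondP (n + 1) J (nextY n J))

theorem unnest_nextY (h : Link l L n J₀ y₀ p₀ J θ) (s : ℕ) :
    unnest δ n (s + 1) * nextY n J = 0 := by
  obtain ⟨W, hW⟩ := unnest_eq_mul_cap (δ := δ) n s
  rw [hW, mul_assoc, h.cap_nextY, mul_zero]

theorem J_nextP (h : Link l L n J₀ y₀ p₀ J θ) {s : ℕ} (hs : s ≤ l) :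
    J * nextP n J s = nextP n J s :=
  h.next_base.absorb h.hl (Nat.zero_le s) hs

theorem nextP_J (h : Link l L n J₀ y₀ p₀ J θ) {s : ℕ} (hs : s ≤ l) :
    nextP n J s * J = nextP n J s :=
  h.next_base.absorb' h.hl (Nat.zero_le s) hs

theorem unnest_J_cup (h : Link l L n J₀ y₀ p₀ J θ) {s : ℕ} (hs : s ≤ n) :
    unnest δ n (s + 1) * J * cup δ (n + 1 + s) = unnest δ n s * J := by
  rw [mul_assoc, ← cup_comm h.J_proj.mem (by omega), ← mul_assoc, unnest_mul_cup hs]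

theorem cap_unnest_J (h : Link l L n J₀ y₀ p₀ J θ) {s i : ℕ} (hi : i + 1 + s ≤ n) :
    cap δ i * unnest δ n s * J = 0 := by
  obtain ⟨W, hW⟩ := cap_mul_unnest (δ := δ) hi
  rw [hW, mul_assoc, h.kill i (by omega), mul_zero]

/-- Nested caps do not see the difference between the projections of an alcove. -/
theorem unnest_nextP (h : Link l L n J₀ y₀ p₀ J θ) {s : ℕ} (hs : s ≤ l) (hs' : s ≤ n + 1) :
    unnest δ n s * nextP n J s = unnest δ n s * J := by
  induction s with
  | zero => rfl
  | succ s ih =>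
    match s with
    | 0 => rfl
    | 1 =>
      have hd := cap_comm h.J_proj.mem le_rfl
      have h1 : unnest δ n 2 * (cup δ (n + 1) * cap δ (n + 1) * nextY n J) = 0 := by
        have h2 : unnest δ n 2 * cup δ (n + 1) = cap δ (n - 1) := by
          have := unnest_mul_cup (δ := δ) (n := n) (s := 0) (Nat.zero_le n)
          rw [add_zero] at this
          rw [unnest, mul_assoc, this, unnest, mul_one]
        rw [← mul_assoc, ← mul_assoc, h2, nextY, mul_assoc, ← mul_assoc (cap δ (n + 1)),
          ← mul_assoc (cap δ (n + 1)), hd, mul_assoc J, mul_assoc J, ← mul_assoc,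
          h.kill (n - 1) (by omega), zero_mul]
      have h2 := h.unnest_nextY 1
      show unnest δ n 2 * (J - (_ + _ - _)) = _
      rw [mul_sub, mul_sub, mul_add, h1, mul_smul_comm, ← mul_assoc _ (nextY n J),
        ← mul_assoc _ (nextY n J * _), ← mul_assoc _ (nextY n J), h2]
      simp
    | s + 2 =>
      have h1 := h.unnest_J_cup (show s + 1 ≤ n by omega)
      have h2 : unnest δ n (s + 3) * nextP n J (s + 2) = unnest δ n (s + 3) * J := by
        rw [unnest, mul_assoc, ih (by omega) (by omega), mul_assoc]
      have h3 : unnest δ n (s + 3) * J * cup δ (n + 2 + s) = 0 := by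
        rw [unnest, mul_assoc _ (unnest δ n (s + 2)), mul_assoc (cap δ _),
          show n + 2 + s = n + 1 + (s + 1) by ring, h1, ← mul_assoc, h.cap_unnest_J (by omega)]
      show unnest δ n (s + 3) * (nextP n J (s + 2) - nextP n J (s + 2) * cup δ (n + 2 + s) *
        ibet (nextY n J) (s + 2) * cap δ (n + 2 + s) * nextP n J (s + 2)) = _
      rw [mul_sub, h2]
      simp only [← mul_assoc]
      rw [h2, h3]
      simp

theorem unnest_nextP_of_le (h : Link l L n J₀ y₀ p₀ J θ) {s t : ℕ} (hst : s ≤ t) (hs : s ≤ l)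
    (ht : t ≤ n + 1) : unnest δ n t * nextP n J s = unnest δ n t * J := by
  induction t, hst using Nat.le_induction with
  | base => exact h.unnest_nextP hs ht
  | succ t _ ih => rw [unnest, mul_assoc, ih (by omega), mul_assoc]

theorem nextP_nest (h : Link l L n J₀ y₀ p₀ J θ) {s t : ℕ} (hst : s ≤ t) (hs : s ≤ l)
    (ht : t ≤ n + 1) : nextP n J s * nest δ n t = J * nest δ n t := by
  have := congrArg dagger (h.unnest_nextP_of_le hst hs ht)
  rwa [dagger_mul, dagger_mul, dagger_unnest, h.J_proj.dag, (h.next_base.proj h.hl hs).dag] at this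

theorem prev_nextP (h : Link l L n J₀ y₀ p₀ J θ) {s t : ℕ} (hs : s ≤ l) (ht : t ≤ l) :
    tower L J₀ y₀ p₀ s * nextP n J t = nextP n J t := by
  rw [← h.J_nextP ht, ← mul_assoc, h.absorb hs]

theorem y_nextP (h : Link l L n J₀ y₀ p₀ J θ) {s : ℕ} (hs : s ≤ l) :
    y₀ * nextP n J s = 0 := by
  rw [← h.J_nextP hs, ← mul_assoc, h.y_J, zero_mul]

theorem prev_unnest (h : Link l L n J₀ y₀ p₀ J θ) {s t : ℕ} (hs0 : 0 < s)
    (hs : s + t ≤ l) :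
    tower L J₀ y₀ p₀ s * unnest δ n t = unnest δ n t * tower L J₀ y₀ p₀ s := by
  have hl := h.hl.two_le
  have hn := h.hn
  exact unnest_comm (by omega) (h.base.proj h.hl (show s ≤ l by omega)).mem

theorem y_unnest (h : Link l L n J₀ y₀ p₀ J θ) {t : ℕ} (ht : t + 1 ≤ l) :
    y₀ * unnest δ n t = unnest δ n t * y₀ := by
  have hn := h.hn
  exact unnest_comm (by omega) h.base.y_mem

theorem qn_ratio (h : Link l L n J₀ y₀ p₀ J θ) {t : ℕ} (ht : t + 1 ≤ l) :
    qn δ (l - t - 1) / qn δ (l - t) = qn δ (t + 1) / qn δ t := by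
  have hl := h.hl
  have hl2 := hl.two_le
  rw [Nat.sub_sub, hl.symm (t + 1) ht, hl.symm t (by omega),
    mul_div_mul_left _ _ (hl.ne_zero _ (by omega) (by omega))]

theorem unnest_step (h : Link l L n J₀ y₀ p₀ J θ) {t : ℕ} (ht : t + 2 ≤ l)
    (hC : tower L J₀ y₀ p₀ (l - t + 1) * unnest δ n t * nextP n J (t + 1) = 0) :
    unnest δ n t * nextP n J (t + 1) = ((qn δ (t + 1) / qn δ t : ℝ) : ℂ) •
      (tower L J₀ y₀ p₀ (l - t) * cup δ (n - t) * unnest δ n (t + 1) * nextP n J (t + 1)) := by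
  have hn := h.hn
  obtain ⟨u, hu⟩ : ∃ u, l - t = u + 2 := ⟨l - t - 2, by omega⟩
  have hLu : L + u = n - t := by omega
  have h1 : tower L J₀ y₀ p₀ (l - t) * unnest δ n t * nextP n J (t + 1) =
      unnest δ n t * nextP n J (t + 1) := by
    rw [h.prev_unnest (by omega) (by omega), mul_assoc, h.prev_nextP (by omega) (by omega)]
  have h2 := TowerBase.tower_sub (M := L) (J := J₀) (y := y₀) (p₂ := p₀) u
  have h3 : y₀ * unnest δ n (t + 1) * nextP n J (t + 1) = 0 := by
    rw [h.y_unnest (by omega), mul_assoc, h.y_nextP (by omega), mul_zero]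
  have h4 := h.qn_ratio (t := t) (by omega)
  rw [hu] at h1 hC h4 ⊢
  rw [show u + 2 + 1 = u + 3 by rfl] at hC
  rw [show u + 2 - 1 = u + 1 by omega] at h4
  have h5 : (tower L J₀ y₀ p₀ (u + 2) - tower L J₀ y₀ p₀ (u + 3)) * unnest δ n t *
      nextP n J (t + 1) = unnest δ n t * nextP n J (t + 1) := by
    rw [sub_mul, sub_mul, h1, hC, sub_zero]
  rw [← h5, h2, hLu, mul_assoc, mul_assoc _ (tower L J₀ y₀ p₀ (u + 2)),
    ← mul_assoc (tower L J₀ y₀ p₀ (u + 2)) (unnest δ n t), h1, mul_assoc _ (cap δ (n - t)),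
    ← mul_assoc (cap δ (n - t))]
  show _ * (unnest δ n (t + 1) * _) = _
  rw [mul_assoc _ (ibet y₀ (u + 2)), ← mul_assoc (ibet y₀ (u + 2)), ibet, add_mul, add_mul,
    smul_mul_assoc, smul_mul_assoc, smul_mul_assoc, smul_mul_assoc, h3, smul_zero, add_zero,
    one_mul, mul_smul_comm, show u + 2 - 1 = u + 1 by omega, h4, mul_assoc _ (unnest δ n (t + 1))]

theorem unnest_next (h : Link l L n J₀ y₀ p₀ J θ) {t : ℕ} (ht0 : 0 < t) (ht : t + 2 ≤ l)
    (hA : unnest δ n t * nextP n J (t + 1) = ((qn δ (t + 1) / qn δ t : ℝ) : ℂ) •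
      (tower L J₀ y₀ p₀ (l - t) * cup δ (n - t) * unnest δ n (t + 1) * nextP n J (t + 1))) :
    tower L J₀ y₀ p₀ (l - t) * unnest δ n (t + 1) * nextP n J (t + 2) = 0 := by
  have hn := h.hn
  have hl2 := h.hl.two_le
  obtain ⟨v, rfl⟩ : ∃ v, t = v + 1 := ⟨t - 1, by omega⟩
  set q := tower L J₀ y₀ p₀ (l - (v + 1)) with hq
  have hqproj := h.base.proj h.hl (show l - (v + 1) ≤ l by omega)
  have hqn1 : (qn δ (v + 1) : ℂ) ≠ 0 := by exact_mod_cast h.hl.ne_zero _ (by omega) (by omega)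
  have hqn2 : (qn δ (v + 2) : ℂ) ≠ 0 := by exact_mod_cast h.hl.ne_zero _ (by omega) (by omega)
  have h1 := h.unnest_J_cup (show v + 1 ≤ n by omega)
  have h2 := h.unnest_nextP_of_le (le_refl (v + 2)) (by omega) (by omega)
  have h3 : unnest δ n (v + 1) * J * ibet (nextY n J) (v + 2) =
      ((qn δ (v + 1) / qn δ (v + 2) : ℝ) : ℂ) • (unnest δ n (v + 1) * J) := by
    rw [ibet, mul_add, mul_smul_comm, mul_smul_comm, mul_one, mul_assoc _ J, h.J_nextY,
      h.unnest_nextY, smul_zero, add_zero, show v + 2 - 1 = v + 1 by omega]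
  have h4 : unnest δ n (v + 1) * J * cap δ (n + 2 + v) * nextP n J (v + 2) =
      cap δ (n - v) * (unnest δ n (v + 1) * nextP n J (v + 2)) := by
    have h5 := unnest_mul_cap (δ := δ) (show v + 1 ≤ n + 1 by omega)
    rw [show n + 1 - (v + 1) = n - v by omega] at h5
    rw [mul_assoc _ J, ← cap_comm h.J_proj.mem (by omega), mul_assoc, mul_assoc,
      h.J_nextP (by omega), ← mul_assoc, show n + 2 + v = n + 1 + (v + 1) by ring, h5, mul_assoc]
  have h6 : unnest δ n (v + 2) * nextP n J (v + 3) = unnest δ n (v + 2) * nextP n J (v + 2) -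
      ((qn δ (v + 1) / qn δ (v + 2) : ℝ) : ℂ) •
        (cap δ (n - v) * (unnest δ n (v + 1) * nextP n J (v + 2))) := by
    show unnest δ n (v + 2) * (nextP n J (v + 2) - nextP n J (v + 2) * cup δ (n + 2 + v) *
        ibet (nextY n J) (v + 2) * cap δ (n + 2 + v) * nextP n J (v + 2)) = _
    rw [mul_sub]
    simp only [← mul_assoc]
    conv_lhs => enter [2, 1, 1, 1, 1]; rw [h2]
    rw [show n + 2 + v = n + 1 + (v + 1) by ring, h1, h3, smul_mul_assoc, smul_mul_assoc,
      show n + 1 + (v + 1) = n + 2 + v by ring, h4, mul_assoc]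
  have h7 : cap δ (n - v) * (q * cup δ (n - (v + 1)) * unnest δ n (v + 2) * nextP n J (v + 2)) =
      q * (unnest δ n (v + 2) * nextP n J (v + 2)) := by
    have h8 : cap δ (n - v) * q = q * cap δ (n - v) := cap_comm hqproj.mem (by omega)
    have h9 : cap δ (n - v) * cup δ (n - (v + 1)) = 1 := by
      rw [show n - v = n - (v + 1) + 1 by omega, cap_cup_zag]
    simp only [← mul_assoc]
    rw [h8, mul_assoc q, h9, mul_one]
  rw [mul_assoc]
  show q * (unnest δ n (v + 2) * nextP n J (v + 3)) = 0
  rw [h6, hA, mul_smul_comm, smul_smul, h7, mul_sub, mul_smul_comm, ← mul_assoc q q, hqproj.sq]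
  rw [show ((qn δ (v + 1) / qn δ (v + 2) : ℝ) : ℂ) * ((qn δ (v + 1 + 1) / qn δ (v + 1) : ℝ) : ℂ)
    = 1 by push_cast; field_simp, one_smul, sub_self]

theorem unnest_one (h : Link l L n J₀ y₀ p₀ J θ) :
    tower L J₀ y₀ p₀ l * unnest δ n 1 * nextP n J 2 = 0 := by
  have hn := h.hn
  have hl2 := h.hl.two_le
  have hu : unnest δ n 1 = cap δ n := by simp [unnest]
  have h1 : J * cap δ n * nextP n J 2 = 0 := by
    have h2 : cap δ (n + 1) * nextY n J = J * cap δ n * J := by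
      simp only [nextY, ← mul_assoc]
      rw [cap_comm h.J_proj.mem le_rfl, mul_assoc J, cap_cup_zag, mul_one]
    have h3 := h.next_base.kill (by omega)
    rw [← h.J_nextP hl2, ← mul_assoc, ← h2, mul_assoc]
    show cap δ (n + 1) * (nextY n J * nextP n J 2) = 0
    rw [← h.next_base.comm_y h.hl hl2, ← mul_assoc]
    show (cap δ (n + 2 - 1) * secondP (n + 1) J (nextY n J)) * _ = 0
    rw [h3, zero_mul]
  rw [hu]
  rcases Nat.eq_zero_or_pos L with hL0 | hL0
  · rw [h.top_eq hL0, h1]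
  · obtain ⟨B, hB⟩ := h.top_sub hL0
    rw [sub_eq_iff_eq_add] at hB
    have h2 : cap δ (L - 2) * tower L J₀ y₀ p₀ (l - 1) * cap δ n * nextP n J 2 = 0 := by
      have hL := h.hL
      have h4 := cap_cap δ (show L - 2 ≤ n - 2 by omega)
      rw [show n - 2 + 2 = n by omega] at h4
      rw [mul_assoc _ _ (cap δ n), ← cap_comm (h.base.proj h.hl (show l - 1 ≤ l by omega)).mem
        (by omega), mul_assoc, mul_assoc, h.prev_nextP (by omega) hl2, ← mul_assoc, ← h4,
        mul_assoc, ← h.J_nextP hl2, ← mul_assoc (cap δ (L - 2)), h.kill _ (by omega)]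
      simp
    rw [hB, add_mul, add_mul, h1, add_zero, mul_assoc B, mul_assoc B, h2, mul_zero]

theorem unnest_relations (h : Link l L n J₀ y₀ p₀ J θ) {t : ℕ} (ht0 : 0 < t) (ht : t + 1 ≤ l) :
    tower L J₀ y₀ p₀ (l - t + 1) * unnest δ n t * nextP n J (t + 1) = 0 := by
  induction t, ht0 using Nat.le_induction with
  | base => rw [Nat.sub_add_cancel (by omega)]; exact h.unnest_one
  | succ t ht0 ih =>
    have := h.unnest_next ht0 ht (h.unnest_step (by omega) (ih (by omega)))
    rwa [show l - (t + 1) + 1 = l - t by omega]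

theorem unnest_formula (h : Link l L n J₀ y₀ p₀ J θ) {t : ℕ} (ht0 : 0 < t) (ht : t + 2 ≤ l) :
    unnest δ n t * nextP n J (t + 1) = ((qn δ (t + 1) / qn δ t : ℝ) : ℂ) •
      (tower L J₀ y₀ p₀ (l - t) * cup δ (n - t) * unnest δ n (t + 1) * nextP n J (t + 1)) :=
  h.unnest_step ht (h.unnest_relations ht0 (by omega))

/-- The norms of the nilpotent half diagrams. -/
theorem unnest_nest (h : Link l L n J₀ y₀ p₀ J θ) {s : ℕ} (hs : s + 1 < l) :
    unnest δ n (s + 1) * J * nest δ n (s + 1) =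
      ((θ * qn δ (l - 1) / qn δ (l - (s + 1)) : ℝ) : ℂ) •
        (y₀ * tower L J₀ y₀ p₀ (l - (s + 1))) := by
  have hn := h.hn
  have hl := h.hl
  induction s with
  | zero =>
    have h1 : unnest δ n (0 + 1) = cap δ n := by simp [unnest]
    have h2 : nest δ n (0 + 1) = cup δ n := by simp [nest]
    rw [h1, h2, h.ptr, mul_div_cancel_right₀ _ (hl.ne_zero _ (by omega) (by omega))]
  | succ s ih =>
    obtain ⟨u, hu⟩ : ∃ u, l - (s + 1) = u + 2 := ⟨l - (s + 1) - 2, by omega⟩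
    have hLu : L + u = n - (s + 1) := by omega
    have h1 := h.base.trace_succ hl (show u + 2 ≤ l by omega)
    rw [hLu] at h1
    have hy := cap_comm h.base.y_mem (show L ≤ n - (s + 1) by omega)
    have hq1 : (qn δ (u + 1) : ℂ) ≠ 0 := by exact_mod_cast hl.ne_zero _ (by omega) (by omega)
    have hq2 : (qn δ (u + 2) : ℂ) ≠ 0 := by exact_mod_cast hl.ne_zero _ (by omega) (by omega)
    rw [unnest, nest]
    calc cap δ (n - (s + 1)) * unnest δ n (s + 1) * J * (nest δ n (s + 1) * cup δ (n - (s + 1))) =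
        cap δ (n - (s + 1)) * (unnest δ n (s + 1) * J * nest δ n (s + 1)) *
          cup δ (n - (s + 1)) := by simp only [mul_assoc]
      _ = ((θ * qn δ (l - 1) / qn δ (u + 2) : ℝ) : ℂ) • (y₀ * (cap δ (n - (s + 1)) *
          tower L J₀ y₀ p₀ (u + 2) * cup δ (n - (s + 1)))) := by
        rw [ih (by omega), hu, mul_smul_comm, smul_mul_assoc, ← mul_assoc, hy]
        simp only [mul_assoc]
      _ = _ := by
        rw [h1, bet, sub_mul, mul_sub, smul_mul_assoc, smul_mul_assoc, mul_smul_comm,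
          mul_smul_comm, ← mul_assoc y₀ y₀, h.base.y_sq, one_mul, zero_mul, smul_zero, sub_zero,
          smul_smul, show l - (s + 1 + 1) = u + 1 by omega, show u + 2 - 1 = u + 1 by omega]
        congr 1
        push_cast
        field_simp

theorem unnest_nest_top (h : Link l L n J₀ y₀ p₀ J θ) (hL : 0 < L) :
    unnest δ n l * J * nest δ n l = ((θ * qn δ (l - 1) : ℝ) : ℂ) • J₀ := by
  have hn := h.hn
  have hl2 := h.hl.two_le
  obtain ⟨s, rfl⟩ : ∃ s, l = s + 2 := ⟨l - 2, by omega⟩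
  have h1 := h.unnest_nest (show s + 1 < s + 2 by omega)
  have h2 : n - (s + 1) = L - 1 := by omega
  rw [show s + 2 - (s + 1) = 1 by omega, tower, h.base.y_J] at h1
  rw [unnest, nest]
  calc cap δ (n - (s + 1)) * unnest δ n (s + 1) * J * (nest δ n (s + 1) * cup δ (n - (s + 1))) =
      cap δ (n - (s + 1)) * (unnest δ n (s + 1) * J * nest δ n (s + 1)) *
        cup δ (n - (s + 1)) := by simp only [mul_assoc]
    _ = _ := by
      rw [h1, mul_smul_comm, smul_mul_assoc, h2, h.low_trace hL]
      simp [qn]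

/-- The nilpotent half diagrams and the nilpotent element. -/
theorem nest_unnest (h : Link l L n J₀ y₀ p₀ J θ) {s : ℕ} (hs : s + 1 < l) :
    J * nest δ n (s + 1) * (unnest δ n (s + 1) * J) =
      ((1 / qn δ (s + 1) : ℝ) : ℂ) • (nextY n J * nextP n J (s + 1)) := by
  have hn := h.hn
  have hl := h.hl
  induction s with
  | zero =>
    have h1 : unnest δ n (0 + 1) = cap δ n := by simp [unnest]
    have h2 : nest δ n (0 + 1) = cup δ n := by simp [nest]
    rw [h1, h2]
    show nextY n J = _ • (nextY n J * J)
    rw [h.nextY_J]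
    simp [qn]
  | succ s ih =>
    have hp := h.next_base.proj hl (show s + 2 ≤ l by omega)
    have hq1 : (qn δ (s + 1) : ℂ) ≠ 0 := by exact_mod_cast hl.ne_zero _ (by omega) (by omega)
    have hq2 : (qn δ (s + 2) : ℂ) ≠ 0 := by exact_mod_cast hl.ne_zero _ (by omega) (by omega)
    have h1 := h.unnest_formula (show 0 < s + 1 by omega) (by omega)
    have hy := h.next_base.comm_y hl (show s + 2 ≤ l by omega)
    have h2 : nextP n J (s + 2) * (J * nest δ n (s + 1) * (unnest δ n (s + 1) * J)) *
        nextP n J (s + 2) =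
        ((1 / qn δ (s + 1) : ℝ) : ℂ) • (nextY n J * nextP n J (s + 2)) := by
      rw [ih (by omega), mul_smul_comm, smul_mul_assoc, mul_assoc, mul_assoc,
        h.next_base.absorb hl (show s + 1 ≤ s + 2 by omega) (by omega), ← mul_assoc, hy, mul_assoc,
        hp.sq]
    have h3 : nextP n J (s + 2) * (J * nest δ n (s + 1) * (unnest δ n (s + 1) * J)) *
        nextP n J (s + 2) = nextP n J (s + 2) * nest δ n (s + 1) *
          (unnest δ n (s + 1) * nextP n J (s + 2)) := by
      simp only [← mul_assoc]
      rw [h.nextP_J (by omega), mul_assoc _ J, h.J_nextP (by omega)]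
    have hqn := congrArg dagger (h.prev_unnest (s := l - (s + 1)) (t := s + 1) (by omega)
      (by omega))
    rw [dagger_mul, dagger_mul, dagger_unnest, (h.base.proj hl (by omega)).dag] at hqn
    have hqp := congrArg dagger (h.prev_nextP (s := l - (s + 1)) (t := s + 2) (by omega)
      (by omega))
    rw [dagger_mul, hp.dag, (h.base.proj hl (by omega)).dag] at hqp
    have h4 : nextP n J (s + 2) * nest δ n (s + 1) * (tower L J₀ y₀ p₀ (l - (s + 1)) *
        cup δ (n - (s + 1)) * unnest δ n (s + 2) * nextP n J (s + 2)) =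
        J * nest δ n (s + 2) * (unnest δ n (s + 2) * J) := by
      calc _ = nextP n J (s + 2) * (nest δ n (s + 1) * tower L J₀ y₀ p₀ (l - (s + 1))) *
          cup δ (n - (s + 1)) * (unnest δ n (s + 2) * nextP n J (s + 2)) := by
            simp only [mul_assoc]
        _ = nextP n J (s + 2) * tower L J₀ y₀ p₀ (l - (s + 1)) *
          (nest δ n (s + 1) * cup δ (n - (s + 1))) * (unnest δ n (s + 2) * nextP n J (s + 2)) := by
            rw [hqn]; simp only [mul_assoc]
        _ = nextP n J (s + 2) * nest δ n (s + 2) * (unnest δ n (s + 2) * nextP n J (s + 2)) := by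
            rw [hqp]; rfl
        _ = _ := by
            rw [h.nextP_nest le_rfl (by omega) (by omega), h.unnest_nextP (by omega) (by omega)]
    rw [h1, mul_smul_comm, h4, h2] at h3
    show J * nest δ n (s + 2) * (unnest δ n (s + 2) * J) =
      ((1 / qn δ (s + 2) : ℝ) : ℂ) • (nextY n J * nextP n J (s + 2))
    have h5 := congrArg (fun x : Diagram δ => ((qn δ (s + 1) / qn δ (s + 2) : ℝ) : ℂ) • x) h3
    simp only [smul_smul] at h5
    rw [show ((qn δ (s + 1) / qn δ (s + 2) : ℝ) : ℂ) * ((qn δ (s + 1 + 1) / qn δ (s + 1) : ℝ) : ℂ)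
        = 1 by push_cast; field_simp,
      show ((qn δ (s + 1) / qn δ (s + 2) : ℝ) : ℂ) * ((1 / qn δ (s + 1) : ℝ) : ℂ) =
        ((1 / qn δ (s + 2) : ℝ) : ℂ) by push_cast; field_simp, one_smul] at h5
    exact h5.symm

theorem unnest_top (h : Link l L n J₀ y₀ p₀ J θ) :
    (L = 0 → unnest δ n (l - 1) * nextP n J l = 0) ∧
    (0 < L → unnest δ n (l - 1) * nextP n J l =
      y₀ * cup δ (L - 1) * unnest δ n l * nextP n J l) := by
  have hn := h.hn
  have hl2 := h.hl.two_le
  have hC := h.unnest_relations (t := l - 1) (by omega) (by omega)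
  rw [Nat.sub_add_cancel (by omega), show l - (l - 1) + 1 = 2 by omega] at hC
  have h1 : J₀ * unnest δ n (l - 1) * nextP n J l = unnest δ n (l - 1) * nextP n J l := by
    have h2 := h.prev_unnest (s := 1) (t := l - 1) one_pos (by omega)
    have h3 := h.prev_nextP (s := 1) (t := l) (by omega) le_rfl
    rw [tower] at h2 h3
    rw [h2, mul_assoc, h3]
  refine ⟨fun hL => ?_, fun hL => ?_⟩
  · rw [tower, (h.low_zero hL).2, h1] at hC
    exact hC
  · have h4 : y₀ * unnest δ n (l - 1) * nextP n J l = 0 := by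
      rw [h.y_unnest (by omega), mul_assoc, h.y_nextP le_rfl, mul_zero]
    rw [tower, h.low hL, secondP, sub_mul, sub_mul, h1, sub_eq_zero] at hC
    rw [hC]
    have h5 : ∀ x : Diagram δ, x * y₀ * unnest δ n (l - 1) * nextP n J l = 0 := by
      intro x
      rw [mul_assoc x, mul_assoc x, h4, mul_zero]
    rw [sub_mul, sub_mul, add_mul, add_mul, smul_mul_assoc, smul_mul_assoc, h5, h5, smul_zero,
      sub_zero, zero_add]
    have h6 : unnest δ n l = cap δ (L - 1) * unnest δ n (l - 1) := by
      obtain ⟨s, rfl⟩ : ∃ s, l = s + 1 := ⟨l - 1, by omega⟩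
      rw [unnest, show n - s = L - 1 by omega, Nat.add_sub_cancel]
    rw [h6]
    simp only [mul_assoc]

/-- The idempotent at the bottom of the alcove after the next one. -/
noncomputable def _root_.TemperleyLieb.nextJ (δ : ℝ) (l L n : ℕ) (J : Diagram δ) (θ : ℝ) : Diagram δ :=
  nextP n J l - ((if L = 0 then 0 else 1 / (θ * qn δ (l - 1)) : ℝ) : ℂ) •
    (J * nest δ n l * (unnest δ n l * J))

theorem nextP_nextJ (h : Link l L n J₀ y₀ p₀ J θ) {s : ℕ} (hs : s ≤ l) :
    nextP n J s * nextJ δ l L n J θ = nextJ δ l L n J θ := by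
  have hn := h.hn
  rw [nextJ, mul_sub, h.next_base.absorb h.hl hs le_rfl, mul_smul_comm]
  by_cases hL : L = 0
  · rw [if_pos hL]; simp
  · have h1 : nextP n J s * (J * nest δ n l) = J * nest δ n l := by
      rw [← mul_assoc, h.nextP_J hs, h.nextP_nest hs hs (by omega)]
    rw [← mul_assoc, h1]

theorem J_nextJ (h : Link l L n J₀ y₀ p₀ J θ) : J * nextJ δ l L n J θ = nextJ δ l L n J θ :=
  h.nextP_nextJ (Nat.zero_le l)

theorem unnest_top_nextJ (h : Link l L n J₀ y₀ p₀ J θ) (hL : 0 < L) :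
    unnest δ n l * nextJ δ l L n J θ = 0 := by
  have hn := h.hn
  have hl2 := h.hl.two_le
  have hθ : (θ : ℂ) ≠ 0 := by exact_mod_cast h.hθ hL
  have hq : (qn δ (l - 1) : ℂ) ≠ 0 := by
    exact_mod_cast h.hl.ne_zero _ (by omega) (by omega)
  have h1 := h.unnest_nest_top hL
  have h2 : J₀ * unnest δ n l = unnest δ n l * J₀ :=
    unnest_comm (k := L - 1) (by omega) h.base.J_proj.mem
  have h3 : J₀ * J = J := h.absorb (Nat.zero_le l)
  have h4 : unnest δ n l * (J * nest δ n l * (unnest δ n l * J)) =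
      ((θ * qn δ (l - 1) : ℝ) : ℂ) • (unnest δ n l * J) := by
    calc _ = (unnest δ n l * J * nest δ n l) * (unnest δ n l * J) := by simp only [mul_assoc]
      _ = _ := by rw [h1, smul_mul_assoc, ← mul_assoc, h2, mul_assoc, h3]
  rw [nextJ, mul_sub, mul_smul_comm, h4, h.unnest_nextP le_rfl (by omega), smul_smul,
    if_neg hL.ne', show ((1 / (θ * qn δ (l - 1)) : ℝ) : ℂ) * ((θ * qn δ (l - 1) : ℝ) : ℂ) = 1 by
      push_cast; field_simp, one_smul, sub_self]

theorem unnest_nextJ (h : Link l L n J₀ y₀ p₀ J θ) (t : ℕ) (ht : t + 1 < l) :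
    unnest δ n (l - 1 - t) * nextJ δ l L n J θ = 0 := by
  induction t with
  | zero =>
    rw [Nat.sub_zero, ← h.nextP_nextJ le_rfl, ← mul_assoc]
    rcases Nat.eq_zero_or_pos L with hL | hL
    · rw [h.unnest_top.1 hL, zero_mul]
    · rw [h.unnest_top.2 hL, mul_assoc, h.nextP_nextJ le_rfl, mul_assoc,
        h.unnest_top_nextJ hL, mul_zero]
  | succ t ih =>
    have h1 := h.unnest_formula (t := l - 1 - (t + 1)) (by omega) (by omega)
    rw [show l - 1 - (t + 1) + 1 = l - 1 - t by omega] at h1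
    rw [← h.nextP_nextJ (s := l - 1 - t) (by omega), ← mul_assoc, h1, smul_mul_assoc, mul_assoc,
      h.nextP_nextJ (by omega), mul_assoc, ih (by omega)]
    simp

theorem cap_nextJ (h : Link l L n J₀ y₀ p₀ J θ) : cap δ n * nextJ δ l L n J θ = 0 := by
  have hl2 := h.hl.two_le
  have h1 := h.unnest_nextJ (l - 2) (by omega)
  rw [show l - 1 - (l - 2) = 1 by omega] at h1
  simpa [unnest] using h1

theorem nextJ_proj (h : Link l L n J₀ y₀ p₀ J θ) : IsProj (n + l + 1) (nextJ δ l L n J θ) := by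
  have hn := h.hn
  have hl2 := h.hl.two_le
  have hQ := h.next_base.proj h.hl le_rfl
  rw [show n + 2 + l - 1 = n + l + 1 by omega] at hQ
  rcases Nat.eq_zero_or_pos L with hL | hL
  · have : nextJ δ l L n J θ = nextP n J l := by rw [nextJ, if_pos hL]; simp
    rw [this]
    exact hQ
  have hb : J * nest δ n l ∈ diagrams δ (n + 1 - l) (n + l + 1) := by
    refine mul_mem_diagrams (b := n + l + 1)
      (diagrams_mono h.J_proj.mem (by omega) (by omega)) ?_
    rw [add_right_comm]
    exact nest_mem (by omega)
  have hb' : dagger (J * nest δ n l) = unnest δ n l * J := by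
    rw [dagger_mul, dagger_nest, h.J_proj.dag]
  refine ⟨?_, ?_, ?_, ?_, ?_⟩
  · rw [nextJ]
    refine sub_mem hQ.mem (Submodule.smul_mem _ _ (mul_mem_diagrams hb ?_))
    rw [← hb']
    exact dagger_mem_diagrams hb
  · conv_lhs => enter [1]; rw [nextJ]
    rw [sub_mul, h.nextP_nextJ le_rfl, smul_mul_assoc, mul_assoc, mul_assoc (unnest δ n l),
      h.J_nextJ, h.unnest_top_nextJ hL]
    simp
  · rw [nextJ, dagger_sub, hQ.dag, dagger_smul, dagger_mul, hb', ← hb', dagger_dagger]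
  · rw [nextJ, conj_sub, hQ.real, conj_smul, Complex.conj_ofReal]
    simp only [conj_mul, conj_nest, conj_unnest, h.J_proj.real]
  · rw [nextJ, map_sub, hQ.vev, map_smul, vev_lt_mul (by omega) _ hb]
    simp

/-- The next alcove is related in the same way to the one after it. -/
theorem next (h : Link l L n J₀ y₀ p₀ J θ) {θ' : ℝ} (hθ' : θ' ≠ 0)
    (hθ : θ' = -2 - if L = 0 then 0 else 1 / θ) :
    Link l (n + 2) (n + l) J (nextY n J) (secondP (n + 1) J (nextY n J)) (nextJ δ l L n J θ) θ' := by
  have hn := h.hn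
  have hl := h.hl
  have hl2 := hl.two_le
  refine ⟨hl, by ring, Or.inr (by omega), fun _ => hθ', h.next_base, h.nextJ_proj, ?_, ?_, ?_,
    h.nextP_nextJ le_rfl, by omega, fun _ => ?_, by omega, fun _ => rfl, fun _ => h.cap_nextY_cup⟩
  · intro i hi
    rcases Nat.lt_trichotomy i n with hin | rfl | hin
    · rw [← h.J_nextJ, ← mul_assoc, h.kill i hin, zero_mul]
    · exact h.cap_nextJ
    · rw [← h.nextP_nextJ le_rfl, ← mul_assoc,
        h.next_base.cap_tower hl le_rfl (by omega) (by omega), zero_mul]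
  · have h1 := h.next_base.trace_succ hl (show l - 2 + 2 ≤ l by omega)
    rw [show n + 2 + (l - 2) = n + l by omega, show l - 2 + 2 = l by omega,
      show l - 2 + 1 = l - 1 by omega, bet, hl.zero, hl.sq, zero_div, Complex.ofReal_zero,
      zero_smul, sub_mul, zero_mul, smul_mul_assoc, div_one] at h1
    have h2 : cap δ (n + l) * nextP n J l * cup δ (n + l) =
        ((-2 : ℝ) : ℂ) • (nextY n J * nextP n J (l - 1)) := by
      rw [h1]
      push_cast
      module
    rw [nextJ, mul_sub, sub_mul, h2, mul_smul_comm, smul_mul_assoc]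
    rcases Nat.eq_zero_or_pos L with hL | hL
    · rw [hθ, if_pos hL, if_pos hL]; simp
    · have h3 := h.unnest_J_cup (show l - 1 ≤ n by omega)
      rw [Nat.sub_add_cancel (by omega), show n + 1 + (l - 1) = n + l by omega] at h3
      have h4 : cap δ (n + l) * (J * nest δ n l) = J * nest δ n (l - 1) := by
        have := congrArg dagger h3
        rwa [dagger_mul, dagger_mul, dagger_mul, dagger_unnest, dagger_unnest, h.J_proj.dag,
          dagger_cup] at this
      have h5 := h.nest_unnest (show l - 2 + 1 < l by omega)
      rw [show l - 2 + 1 = l - 1 by omega] at h5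
      have hθ0 := h.hθ hL
      have hq := hl.ne_zero (l - 1) (by omega) (by omega)
      have h6 : 1 / (θ * qn δ (l - 1)) * (1 / qn δ (l - 1)) = 1 / θ := by
        have := hl.sq
        field_simp
        exact this.symm
      rw [← mul_assoc (cap δ (n + l)), h4, mul_assoc, h3, h5, smul_smul, smul_sub_smul,
        if_neg hL.ne', ← Complex.ofReal_mul, h6, ← Complex.ofReal_sub, hθ, if_neg hL.ne']
  · rw [nextY, mul_assoc, mul_assoc (cap δ n), h.J_nextJ, h.cap_nextJ, mul_zero]
  · have h1 : unnest δ n l * J = unnest δ n l * nextP n J (l - 1) ∨ L = 0 := by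
      rcases Nat.eq_zero_or_pos L with hL | hL
      · exact Or.inr hL
      · exact Or.inl (h.unnest_nextP_of_le (by omega) (by omega) (by omega)).symm
    obtain ⟨W, hW⟩ := unnest_eq_mul_cap (δ := δ) n (l - 1)
    rw [Nat.sub_add_cancel (by omega)] at hW
    rw [nextJ, sub_sub_cancel, Nat.add_sub_cancel]
    rcases h1 with h1 | h1
    · refine ⟨((if L = 0 then 0 else 1 / (θ * qn δ (l - 1)) : ℝ) : ℂ) • (J * nest δ n l * W), ?_⟩
      rw [smul_mul_assoc, h1, hW]
      simp only [mul_assoc]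
    · exact ⟨0, by rw [if_pos h1]; simp⟩

end Link

/-- The link between the first two alcoves. -/
theorem link_zero {l : ℕ} (hl : QRoot δ l) : TowerBase 0 (1 : Diagram δ) 0 1 ∧
    Link l 0 (l - 2) (1 : Diagram δ) 0 1 (tower 0 1 0 1 l) 0 := by
  have hl2 := hl.two_le
  have hone : ∀ n, IsProj n (1 : Diagram δ) := fun n =>
    ⟨one_mem_diagrams n, one_mul 1, dagger_one, conj_one, vev_one⟩
  have hb : TowerBase 0 (1 : Diagram δ) 0 1 :=
    ⟨zero_mem _, zero_mul 0, dagger_zero, conj_zero, hone _, mul_zero _, zero_mul _, hone _,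
      one_mul _, by simp, by rw [bet_two, mul_one, cap_cup_loop, smul_zero, sub_zero, mul_one,
        Algebra.smul_def, mul_one], by simp⟩
  refine ⟨hb, hl, by omega, Or.inl rfl, by omega, hb, ?_, ?_, ?_, zero_mul _,
    (hb.proj hl le_rfl).sq, fun _ => rfl, by omega, fun _ => ⟨rfl, rfl⟩, by omega, by omega⟩
  · have := hb.proj hl le_rfl
    rwa [show l - 2 + 1 = 0 + l - 1 by omega]
  · intro i hi
    exact hb.cap_tower hl le_rfl (by omega) (by omega)
  · have h1 := hb.trace_succ hl (show l - 2 + 2 ≤ l by omega)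
    rw [zero_add, show l - 2 + 2 = l by omega, bet, hl.zero] at h1
    rw [h1]
    simp

end TemperleyLieb

namespace TemperleyLieb

/-! ### The idempotents for all numbers of strands -/

variable {δ : ℝ}

/-- The ratios in the partial traces at the bottoms of the alcoves. -/
noncomputable def alcTheta (k : ℕ) : ℝ := -((k : ℝ) + 1) / k

/-- The idempotents at the bottoms of the alcoves. -/
noncomputable def alcJ (δ : ℝ) (l : ℕ) : ℕ → Diagram δ
  | 0 => 1
  | 1 => tower 0 1 0 1 l
  | k + 2 => nextJ δ l (k * l) ((k + 1) * l - 2) (alcJ δ l (k + 1)) (alcTheta k)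

/-- The nilpotent elements of the alcoves. -/
noncomputable def alcY (δ : ℝ) (l : ℕ) : ℕ → Diagram δ
  | 0 => 0
  | k + 1 => nextY ((k + 1) * l - 2) (alcJ δ l (k + 1))

/-- The second idempotents of the alcoves. -/
noncomputable def alcP (δ : ℝ) (l : ℕ) : ℕ → Diagram δ
  | 0 => 1
  | k + 1 => secondP ((k + 1) * l - 2 + 1) (alcJ δ l (k + 1)) (alcY δ l (k + 1))

theorem link {l : ℕ} (hl : QRoot δ l) (k : ℕ) : Link l (k * l) ((k + 1) * l - 2) (alcJ δ l k)
    (alcY δ l k) (alcP δ l k) (alcJ δ l (k + 1)) (alcTheta k) := by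
  have hl2 := hl.two_le
  induction k with
  | zero =>
    have := (link_zero hl).2
    rw [zero_mul, zero_add, one_mul]
    simpa [alcTheta, alcJ, alcY, alcP] using this
  | succ k ih =>
    have h1 : (k + 1) * l - 2 + 2 = (k + 1) * l := by
      have := ih.hn
      rw [add_mul, one_mul] at *
      omega
    have h2 : (k + 1) * l - 2 + l = (k + 1 + 1) * l - 2 := by
      rw [add_mul (k + 1), one_mul]; omega
    have hk : ((k : ℝ) + 1) ≠ 0 := by positivity
    have := ih.next (θ' := alcTheta (k + 1)) (by
      rw [alcTheta]
      push_cast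
      refine div_ne_zero (neg_ne_zero.2 (by positivity)) hk) (by
      rw [alcTheta, alcTheta]
      push_cast
      by_cases h0 : k = 0
      · subst h0; norm_num
      · have h0' : (k : ℝ) ≠ 0 := by exact_mod_cast h0
        rw [if_neg (mul_ne_zero h0 (by omega))]
        field_simp
        ring)
    rw [h2] at this
    rw [h1] at this
    exact this

/-- The idempotents `P_m`. -/
noncomputable def proj (δ : ℝ) (l m : ℕ) : Diagram δ :=
  tower ((m + 1) / l * l) (alcJ δ l ((m + 1) / l)) (alcY δ l ((m + 1) / l))
    (alcP δ l ((m + 1) / l)) ((m + 1) % l)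

/-- The half diagrams which generate the radicals. -/
noncomputable def nil (δ : ℝ) (l m : ℕ) : Diagram δ :=
  alcJ δ l ((m + 1) / l) * nest δ ((m + 1) / l * l - 2) ((m + 1) % l)

/-- The reflection of `m` in the nearest critical line below. -/
def refl (l m : ℕ) : ℕ := m - 2 * ((m + 1) % l)

/-- The weights that are not critical and have a reflection. -/
def Nonrigid (l m : ℕ) : Prop := l ≤ m ∧ ¬ l ∣ m + 1

theorem div_mod_of_eq {l k s m : ℕ} (hs : s < l) (hm : m + 1 = k * l + s) :
    (m + 1) / l = k ∧ (m + 1) % l = s := by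
  rw [hm, add_comm, Nat.add_mul_div_right _ _ (by omega), Nat.div_eq_of_lt hs, zero_add,
    Nat.add_mul_mod_self_right, Nat.mod_eq_of_lt hs]
  exact ⟨rfl, rfl⟩

theorem proj_eq {l k s m : ℕ} (hs : s < l) (hm : m + 1 = k * l + s) :
    proj δ l m = tower (k * l) (alcJ δ l k) (alcY δ l k) (alcP δ l k) s := by
  rw [proj, (div_mod_of_eq hs hm).1, (div_mod_of_eq hs hm).2]

theorem nil_eq {l k s m : ℕ} (hs : s < l) (hm : m + 1 = k * l + s) :
    nil δ l m = alcJ δ l k * nest δ (k * l - 2) s := by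
  rw [nil, (div_mod_of_eq hs hm).1, (div_mod_of_eq hs hm).2]

variable {l : ℕ}

theorem proj_isProj (hl : QRoot δ l) (m : ℕ) : IsProj m (proj δ l m) := by
  have hl2 := hl.two_le
  have hs := Nat.mod_lt (m + 1) (show 0 < l by omega)
  have := (link hl ((m + 1) / l)).base.proj hl hs.le
  have h := Nat.div_add_mod' (m + 1) l
  rwa [show (m + 1) / l * l + (m + 1) % l - 1 = m by omega] at this

/-- The part of the alcove of a nonrigid weight: `m = n + 1 + s`. -/
structure InAlcove (δ : ℝ) (l m n s L k : ℕ) (J : Diagram δ) (θ : ℝ) : Prop where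
  link : Link l L n (alcJ δ l k) (alcY δ l k) (alcP δ l k) J θ
  hL : L = k * l
  hm : m = n + 1 + s
  hs : 0 < s
  hsl : s < l
  proj_eq : proj δ l m = nextP n J s
  nil_eq : nil δ l m = J * nest δ n s
  mod_eq : (m + 1) % l = s
  refl_eq : refl l m = n + 1 - s
  proj_refl : proj δ l (refl l m) = tower L (alcJ δ l k) (alcY δ l k) (alcP δ l k) (l - s)

theorem Nonrigid.exists_alcove (hl : QRoot δ l) {m : ℕ} (hm : Nonrigid l m) :
    ∃ n s L k J θ, InAlcove δ l m n s L k J θ := by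
  have hl2 := hl.two_le
  have hs := Nat.mod_lt (m + 1) (show 0 < l by omega)
  have hs0 : (m + 1) % l ≠ 0 := fun h => hm.2 (Nat.dvd_of_mod_eq_zero h)
  have h := Nat.div_add_mod' (m + 1) l
  have hk0 : (m + 1) / l ≠ 0 := by
    intro h0
    rw [h0, zero_mul] at h
    have := hm.1
    have := Nat.mod_lt (m + 1) (show 0 < l by omega)
    omega
  obtain ⟨k, hk⟩ := Nat.exists_eq_succ_of_ne_zero hk0
  rw [hk, Nat.succ_eq_add_one] at h
  have hlink := link hl k
  have hn := hlink.hn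
  have hmul : (k + 1) * l = k * l + l := by ring
  refine ⟨_, (m + 1) % l, _, k, _, _, hlink, rfl, by omega, by omega, hs, ?_, ?_, rfl, ?_, ?_⟩
  · rw [TemperleyLieb.proj_eq hs h.symm]
    have h2 : (k + 1) * l = (k + 1) * l - 2 + 2 := by omega
    conv_lhs => rw [h2]
    rfl
  · rw [TemperleyLieb.nil_eq hs h.symm]
  · rw [refl]; omega
  · rw [TemperleyLieb.proj_eq (k := k) (s := l - (m + 1) % l) (by omega)]
    rw [refl]; omega

section nonrigid

variable {m : ℕ}

theorem refl_lt (hl : QRoot δ l) (hm : Nonrigid l m) :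
    refl l m + 2 * ((m + 1) % l) = m ∧ 0 < (m + 1) % l ∧ (m + 1) % l < l := by
  obtain ⟨n, s, L, k, J, θ, h⟩ := hm.exists_alcove hl
  have h1 := h.link.hn
  have h2 := h.hm
  have h3 := h.hsl
  rw [h.refl_eq, h.mod_eq]
  exact ⟨by omega, h.hs, h3⟩

theorem cap_proj_of_rigid (hl : QRoot δ l) (hm : ¬ Nonrigid l m) {i : ℕ} (hi : i + 2 ≤ m) :
    cap δ i * proj δ l m = 0 := by
  have hl2 := hl.two_le
  have hs := Nat.mod_lt (m + 1) (show 0 < l by omega)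
  have h := Nat.div_add_mod' (m + 1) l
  by_cases hd : l ∣ m + 1
  · have h0 : (m + 1) % l = 0 := Nat.mod_eq_zero_of_dvd hd
    have hk0 : (m + 1) / l ≠ 0 := by intro h0'; rw [h0', h0] at h; simp at h
    obtain ⟨k, hk⟩ := Nat.exists_eq_succ_of_ne_zero hk0
    rw [hk, h0, Nat.succ_eq_add_one] at h
    rw [proj_eq (show 0 < l by omega) h.symm, tower]
    have hn := (link hl k).hn
    have hmul : (k + 1) * l = k * l + l := by ring
    exact (link hl k).kill i (by omega)
  · have hlt : m + 1 < l := by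
      by_contra hlt
      refine hm ⟨?_, hd⟩
      have : l ≠ m + 1 := fun h => hd (h ▸ dvd_rfl)
      omega
    rw [proj_eq (k := 0) hlt (by ring), zero_mul]
    have := (link hl 0).base
    rw [zero_mul] at this
    exact this.cap_tower hl hlt.le (by omega) (by omega)

theorem nil_mem (hl : QRoot δ l) (hm : Nonrigid l m) : nil δ l m ∈ diagrams δ (refl l m) m := by
  obtain ⟨n, s, L, k, J, θ, h⟩ := hm.exists_alcove hl
  have h1 := h.link.hn
  have h3 := h.hsl
  rw [h.refl_eq, h.hm, ← h.hm, h.nil_eq, h.hm]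
  exact mul_mem_diagrams (diagrams_mono h.link.J_proj.mem (by omega) (by omega))
    (nest_mem (by omega))

theorem dagger_nil_eq {n s L k : ℕ} {J : Diagram δ} {θ : ℝ} (h : InAlcove δ l m n s L k J θ) :
    dagger (nil δ l m) = unnest δ n s * J := by
  rw [h.nil_eq, dagger_mul, dagger_nest, h.link.J_proj.dag]

theorem proj_mul_nil (hl : QRoot δ l) (hm : Nonrigid l m) :
    proj δ l m * nil δ l m = nil δ l m := by
  obtain ⟨n, s, L, k, J, θ, h⟩ := hm.exists_alcove hl
  have h1 := h.link.hn
  have h3 := h.hsl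
  rw [h.nil_eq, h.proj_eq, ← mul_assoc, h.link.nextP_J h3.le,
    h.link.nextP_nest le_rfl h3.le (by omega)]

theorem nil_mul_proj (hl : QRoot δ l) (hm : Nonrigid l m) :
    nil δ l m * proj δ l (refl l m) = nil δ l m := by
  obtain ⟨n, s, L, k, J, θ, h⟩ := hm.exists_alcove hl
  have h3 := h.hsl
  have h4 := h.hs
  have h1 := h.link.prev_unnest (s := l - s) (t := s) (by omega) (by omega)
  have h2 := h.link.absorb (s := l - s) (by omega)
  have h5 : proj δ l (refl l m) * dagger (nil δ l m) = dagger (nil δ l m) := by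
    rw [dagger_nil_eq h, h.proj_refl, ← mul_assoc, h1, mul_assoc, h2]
  have := congrArg dagger h5
  rwa [dagger_mul, dagger_dagger, (proj_isProj hl _).dag] at this

theorem cap_mul_dagger_nil (hl : QRoot δ l) (hm : Nonrigid l m) {i : ℕ} (hi : i + 2 ≤ refl l m) :
    cap δ i * dagger (nil δ l m) = 0 := by
  obtain ⟨n, s, L, k, J, θ, h⟩ := hm.exists_alcove hl
  rw [h.refl_eq] at hi
  rw [dagger_nil_eq h, ← mul_assoc]
  exact h.link.cap_unnest_J (by omega)

theorem cap_mul_proj (hl : QRoot δ l) (hm : Nonrigid l m) {i : ℕ} (hi : i + 2 ≤ m) :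
    ∃ D ∈ diagrams δ (refl l m) (m - 2), cap δ i * proj δ l m = D * dagger (nil δ l m) := by
  obtain ⟨n, s, L, k, J, θ, h⟩ := hm.exists_alcove hl
  have hn := h.link.hn
  have h3 := h.hsl
  have h4 := h.hs
  have hm' := h.hm
  rw [h.refl_eq, h.proj_eq, dagger_nil_eq h]
  rcases Nat.lt_trichotomy i n with hin | rfl | hin
  · refine ⟨0, zero_mem _, ?_⟩
    rw [← h.link.J_nextP h3.le, ← mul_assoc, h.link.kill i hin, zero_mul, zero_mul]
  · have key : ∀ t, t < s → ∃ D ∈ diagrams δ (i + 1 - s) (m - 2 * (s - t)),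
        unnest δ i (s - t) * nextP i J s = D * (unnest δ i s * J) := by
      intro t
      induction t with
      | zero =>
        intro _
        refine ⟨1, ?_, ?_⟩
        · rw [show m - 2 * (s - 0) = i + 1 - s by omega]; exact one_mem_diagrams _
        · rw [Nat.sub_zero, h.link.unnest_nextP h3.le (by omega), one_mul]
      | succ t ih =>
        intro ht
        obtain ⟨D, hD, hD'⟩ := ih (by omega)
        have h5 := h.link.unnest_formula (t := s - (t + 1)) (by omega) (by omega)
        rw [show s - (t + 1) + 1 = s - t by omega] at h5
        have hq : tower L (alcJ δ l k) (alcY δ l k) (alcP δ l k) (l - (s - (t + 1))) ∈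
            diagrams δ (m - 2 * (s - (t + 1))) (m - 2 * (s - (t + 1))) :=
          diagrams_mono (h.link.base.proj hl (show l - (s - (t + 1)) ≤ l by omega)).mem
            (by omega) (by omega)
        have he : nextP i J (s - t) * nextP i J s = nextP i J s :=
          h.link.next_base.absorb hl (show s - t ≤ s by omega) h3.le
        refine ⟨((qn δ (s - t) / qn δ (s - (t + 1)) : ℝ) : ℂ) •
          (tower L (alcJ δ l k) (alcY δ l k) (alcP δ l k) (l - (s - (t + 1))) *
            cup δ (i - (s - (t + 1))) * D), Submodule.smul_mem _ _ ?_, ?_⟩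
        · exact mul_mem_diagrams (mul_mem_diagrams hq
            (cup_mem_diagrams (by omega) (by omega))) hD
        · rw [← he, ← mul_assoc, h5, smul_mul_assoc, mul_assoc _ _ (nextP i J s), he, mul_assoc,
            hD', smul_mul_assoc]
          simp only [mul_assoc]
    obtain ⟨D, hD, hD'⟩ := key (s - 1) (by omega)
    rw [show s - (s - 1) = 1 by omega] at hD hD'
    exact ⟨D, hD, by simpa [unnest] using hD'⟩
  · refine ⟨0, zero_mem _, ?_⟩
    rw [h.link.next_base.cap_tower hl h3.le (by omega) (by omega), zero_mul]

end nonrigid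
end TemperleyLieb

namespace TemperleyLieb

/-! ### Morphisms between the idempotents -/

variable {δ : ℝ} {l : ℕ}

instance (l m : ℕ) : Decidable (Nonrigid l m) := inferInstanceAs (Decidable (_ ∧ _))

/-- The nilpotent endomorphism of a nonrigid idempotent. -/
noncomputable def nilsq (δ : ℝ) (l m : ℕ) : Diagram δ :=
  if Nonrigid l m then nil δ l m * dagger (nil δ l m) else 0

theorem nilsq_eq {m : ℕ} (hm : Nonrigid l m) : nilsq δ l m = nil δ l m * dagger (nil δ l m) :=
  if_pos hm

theorem dagger_nilsq (m : ℕ) : dagger (nilsq δ l m) = nilsq δ l m := by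
  rw [nilsq]; split_ifs <;> simp [dagger_mul]

variable (hl : QRoot δ l)
include hl

theorem proj_mul_proj (m : ℕ) : proj δ l m * proj δ l m = proj δ l m := (proj_isProj hl m).sq

theorem dagger_proj (m : ℕ) : dagger (proj δ l m) = proj δ l m := (proj_isProj hl m).dag

theorem proj_mem (m : ℕ) : proj δ l m ∈ diagrams δ m m := (proj_isProj hl m).mem

theorem alcY_mul_proj {k s m : ℕ} (hs : 0 < s) (hsl : s < l) (hm : m + 1 = k * l + s) :
    alcY δ l k * proj δ l m = (qn δ s : ℂ) • nilsq δ l m := by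
  obtain _ | k := k
  · rw [nilsq, if_neg, smul_zero, alcY, zero_mul]
    intro h; have := h.1; omega
  · have hkl : (k + 1) * l = k * l + l := by ring
    have hr : Nonrigid l m := by
      refine ⟨by omega, fun hd => ?_⟩
      rw [hm] at hd
      have := Nat.le_of_dvd hs ((Nat.dvd_add_right (Dvd.intro_left _ rfl)).1 hd)
      omega
    have h2 := hl.two_le
    obtain ⟨s, rfl⟩ : ∃ t, s = t + 1 := ⟨s - 1, by omega⟩
    have h := (link hl k).nest_unnest hsl
    have hq : (qn δ (s + 1) : ℂ) ≠ 0 := by exact_mod_cast hl.ne_zero _ hs hsl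
    rw [nilsq, if_pos hr, nil_eq hsl hm, dagger_mul, dagger_nest, (link hl k).J_proj.dag, h,
      smul_smul, proj_eq hsl hm]
    push_cast
    rw [mul_one_div_cancel hq, one_smul, nextP, show (k + 1) * l - 2 + 2 = (k + 1) * l by omega]
    rfl

theorem dagger_nil_mul_nil {m : ℕ} (hm : Nonrigid l m) :
    ∃ c : ℂ, dagger (nil δ l m) * nil δ l m = c • nilsq δ l (refl l m) := by
  obtain ⟨n, s, L, k, J, θ, h⟩ := hm.exists_alcove hl
  have hn := h.link.hn
  have hL := h.hL
  obtain ⟨s, rfl⟩ : ∃ t, s = t + 1 := ⟨s - 1, by have := h.hs; omega⟩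
  have h1 := h.hsl
  refine ⟨((θ * qn δ (l - 1) / qn δ (l - (s + 1)) : ℝ) : ℂ) * qn δ (l - (s + 1)), ?_⟩
  rw [dagger_nil_eq h, h.nil_eq, mul_assoc, ← mul_assoc J, h.link.J_proj.sq, ← mul_assoc,
    h.link.unnest_nest h1, ← h.proj_refl, alcY_mul_proj hl (s := l - (s + 1)) (by omega)
    (by omega) (by rw [h.refl_eq]; omega), smul_smul]

theorem capped_mul_dagger_nil {m j : ℕ} (hm : Nonrigid l m) {x : Diagram δ}
    (hx : x ∈ capped δ (refl l m) j) : x * dagger (nil δ l m) = 0 := by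
  refine capped_induction (p := fun x => x * dagger (nil δ l m) = 0) hx
    (fun i y hi _ => by rw [mul_assoc, cap_mul_dagger_nil hl hm hi, mul_zero]) (zero_mul _)
    (fun x y h h' => by rw [add_mul, h, h', add_zero])
    (fun c x h => by rw [smul_mul_assoc, h, smul_zero])

theorem capped_mul_proj {m j : ℕ} {x : Diagram δ} (hx : x ∈ capped δ m j) :
    (x * proj δ l m = 0) ∨ (Nonrigid l m ∧
      ∃ y ∈ diagrams δ (refl l m) j, x * proj δ l m = y * dagger (nil δ l m)) := by
  by_cases hm : Nonrigid l m
  · refine Or.inr ⟨hm, ?_⟩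
    refine capped_induction (p := fun x => ∃ y ∈ diagrams δ (refl l m) j,
      x * proj δ l m = y * dagger (nil δ l m)) hx ?_ ⟨0, zero_mem _, by simp⟩ ?_ ?_
    · intro i y hi hy
      obtain ⟨D, hD, h⟩ := cap_mul_proj hl hm hi
      exact ⟨y * D, mul_mem_diagrams hy hD, by rw [mul_assoc, h, mul_assoc]⟩
    · rintro x x' ⟨y, hy, h⟩ ⟨y', hy', h'⟩
      exact ⟨y + y', add_mem hy hy', by rw [add_mul, h, h', add_mul]⟩
    · rintro c x ⟨y, hy, h⟩
      exact ⟨c • y, Submodule.smul_mem _ _ hy, by rw [smul_mul_assoc, h, smul_mul_assoc]⟩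
  · left
    refine capped_induction (p := fun x => x * proj δ l m = 0) hx
      (fun i y hi _ => by rw [mul_assoc, cap_proj_of_rigid hl hm hi, mul_zero]) (zero_mul _)
      (fun x y h h' => by rw [add_mul, h, h', add_zero])
      (fun c x h => by rw [smul_mul_assoc, h, smul_zero])

omit hl in
theorem refl_ne {m j : ℕ} (hm : refl l m + 2 * ((m + 1) % l) = m ∧ 0 < (m + 1) % l ∧
    (m + 1) % l < l) (hj : refl l j + 2 * ((j + 1) % l) = j ∧ 0 < (j + 1) % l ∧ (j + 1) % l < l)
    (h : j < m) : refl l m ≠ refl l j := by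
  intro he
  have h1 := Nat.div_add_mod' (m + 1) l
  have h2 := Nat.div_add_mod' (j + 1) l
  obtain ⟨h3, h4, h5⟩ := hm
  obtain ⟨h6, h7, h8⟩ := hj
  generalize (m + 1) % l = s at *
  generalize (j + 1) % l = t at *
  generalize (m + 1) / l = a at *
  generalize (j + 1) / l = b at *
  rcases Nat.lt_trichotomy a b with hab | rfl | hab
  · have := Nat.mul_le_mul_right l (Nat.succ_le_of_lt hab)
    rw [Nat.succ_eq_add_one, add_mul] at this
    omega
  · omega
  · have := Nat.mul_le_mul_right l (Nat.succ_le_of_lt hab)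
    rw [Nat.succ_eq_add_one, add_mul] at this
    omega

/-- There are no morphisms between different idempotents, apart from the half diagrams between
a weight and its reflection. -/
theorem hom_lt {m j : ℕ} (h : j < m) {d : Diagram δ} (hd : d ∈ diagrams δ j m) :
    proj δ l m * d * proj δ l j = 0 ∨ (Nonrigid l m ∧ j = refl l m ∧
      ∃ c : ℂ, proj δ l m * d * proj δ l j = c • nil δ l m) := by
  induction m using Nat.strong_induction_on generalizing j d with
  | _ m ih =>
  have key : proj δ l j * dagger d * proj δ l m = 0 ∨ (Nonrigid l m ∧ j = refl l m ∧
      ∃ c : ℂ, proj δ l j * dagger d * proj δ l m = c • dagger (nil δ l m)) := by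
    rcases capped_mul_proj hl (mem_capped_of_lt h (dagger_mem_diagrams hd)) with h0 | ⟨hm, y, hy, h1⟩
    · left; rw [mul_assoc, h0, mul_zero]
    · rw [mul_assoc, h1]
      rcases Nat.lt_trichotomy j (refl l m) with hj | hj | hj
      · left; rw [capped_mul_dagger_nil hl hm (mem_capped_of_lt hj hy), mul_zero]
      · right
        refine ⟨hm, hj, ?_⟩
        subst hj
        obtain ⟨c, z, hz, rfl⟩ := exists_smul_one_add_capped hy
        refine ⟨c, ?_⟩
        have h2 := congrArg dagger (nil_mul_proj hl hm)
        rw [dagger_mul, (proj_isProj hl _).dag] at h2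
        rw [add_mul, capped_mul_dagger_nil hl hm hz, add_zero, smul_mul_assoc, one_mul,
          mul_smul_comm, h2]
      · left
        have h2 := congrArg dagger (nil_mul_proj hl hm)
        rw [dagger_mul, (proj_isProj hl _).dag] at h2
        rw [← h2, ← mul_assoc, ← mul_assoc]
        rcases ih j h hj hy with h3 | ⟨hj', h3, -⟩
        · rw [h3, zero_mul]
        · exact absurd h3 (refl_ne (refl_lt hl hm) (refl_lt hl hj') h)
  have hdag : proj δ l m * d * proj δ l j = dagger (proj δ l j * dagger d * proj δ l m) := by
    rw [dagger_mul, dagger_mul, dagger_dagger, (proj_isProj hl _).dag, (proj_isProj hl _).dag,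
      mul_assoc]
  rw [hdag]
  rcases key with h0 | ⟨hm, hj, c, h1⟩
  · left; rw [h0, dagger_zero]
  · exact Or.inr ⟨hm, hj, c, by rw [h1, dagger_smul, dagger_dagger]⟩

theorem hom_gt {m j : ℕ} (h : j < m) {d : Diagram δ} (hd : d ∈ diagrams δ m j) :
    proj δ l j * d * proj δ l m = 0 ∨ (Nonrigid l m ∧ j = refl l m ∧
      ∃ c : ℂ, proj δ l j * d * proj δ l m = c • dagger (nil δ l m)) := by
  have hdag : proj δ l j * d * proj δ l m = dagger (proj δ l m * dagger d * proj δ l j) := by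
    rw [dagger_mul, dagger_mul, dagger_dagger, (proj_isProj hl _).dag, (proj_isProj hl _).dag,
      mul_assoc]
  rw [hdag]
  rcases hom_lt hl h (dagger_mem_diagrams hd) with h0 | ⟨hm, hj, c, h1⟩
  · left; rw [h0, dagger_zero]
  · exact Or.inr ⟨hm, hj, c, by rw [h1, dagger_smul]⟩

theorem nilsq_mem (m : ℕ) : nilsq δ l m ∈ diagrams δ m m := by
  rw [nilsq]
  split_ifs with hm
  · exact mul_mem_diagrams (nil_mem hl hm) (dagger_mem_diagrams (nil_mem hl hm))
  · exact zero_mem _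

theorem proj_mul_nilsq (m : ℕ) : proj δ l m * nilsq δ l m = nilsq δ l m := by
  rw [nilsq]
  split_ifs with hm
  · rw [← mul_assoc, proj_mul_nil hl hm]
  · rw [mul_zero]

theorem vev_nilsq (m : ℕ) : vev δ (nilsq δ l m) = 0 := by
  rw [nilsq]
  split_ifs with hm
  · exact vev_lt_mul (by have := refl_lt hl hm; omega) _ (nil_mem hl hm)
  · rw [map_zero]

theorem nil_mul_nil {m : ℕ} (hm : Nonrigid l m) (hm' : Nonrigid l (refl l m)) :
    nil δ l m * nil δ l (refl l m) = 0 := by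
  have h1 := refl_lt hl hm
  have h2 := refl_lt hl hm'
  have h := hom_lt hl (m := m) (j := refl l (refl l m)) (by omega)
    (mul_mem_diagrams (nil_mem hl hm) (nil_mem hl hm'))
  rw [← mul_assoc, proj_mul_nil hl hm, mul_assoc, nil_mul_proj hl hm'] at h
  rcases h with h | ⟨-, h, -⟩
  · exact h
  · omega

theorem nil_mul_nilsq {m : ℕ} (hm : Nonrigid l m) :
    nil δ l m * nilsq δ l (refl l m) = 0 := by
  rw [nilsq]
  split_ifs with h
  · rw [← mul_assoc, nil_mul_nil hl hm h, zero_mul]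
  · rw [mul_zero]

theorem nilsq_mul_nil {m : ℕ} (hm : Nonrigid l m) : nilsq δ l m * nil δ l m = 0 := by
  obtain ⟨c, hc⟩ := dagger_nil_mul_nil hl hm
  rw [nilsq_eq hm, mul_assoc, hc, mul_smul_comm, nil_mul_nilsq hl hm, smul_zero]

theorem nilsq_mul_nilsq (m : ℕ) : nilsq δ l m * nilsq δ l m = 0 := by
  by_cases hm : Nonrigid l m
  · conv_lhs => rw [nilsq_eq hm]
    have := nilsq_mul_nil hl hm
    rw [nilsq_eq hm] at this
    rw [← mul_assoc, this, zero_mul]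
  · rw [nilsq, if_neg hm, mul_zero]

/-- The endomorphisms of an idempotent. -/
theorem hom_self {m : ℕ} {d : Diagram δ} (hd : d ∈ diagrams δ m m) :
    ∃ c : ℂ, proj δ l m * d * proj δ l m = vev δ d • proj δ l m + c • nilsq δ l m := by
  obtain ⟨z, hz, h⟩ := eq_vev_add_capped hd
  have h1 : proj δ l m * d * proj δ l m = vev δ d • proj δ l m + proj δ l m * (z * proj δ l m) := by
    conv_lhs => rw [h]
    rw [mul_add, add_mul, mul_smul_comm, smul_mul_assoc, mul_one, (proj_isProj hl m).sq, mul_assoc]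
  rw [h1]
  rcases capped_mul_proj hl hz with h0 | ⟨hm, y, hy, h0⟩
  · exact ⟨0, by rw [h0, mul_zero, zero_smul]⟩
  · have h2 := congrArg dagger (nil_mul_proj hl hm)
    rw [dagger_mul, (proj_isProj hl _).dag] at h2
    have h3 := hom_lt hl (m := m) (j := refl l m) (by have := refl_lt hl hm; omega) hy
    rw [h0, ← h2, ← mul_assoc, ← mul_assoc]
    rcases h3 with h3 | ⟨-, -, c, h3⟩
    · exact ⟨0, by rw [h3, zero_mul, zero_smul]⟩
    · exact ⟨c, by rw [h3, smul_mul_assoc, nilsq_eq hm]⟩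

end TemperleyLieb

namespace TemperleyLieb

/-! ### Existence of fusion rules -/

variable {δ : ℝ} {l : ℕ}

/-- The part of `P_m ⊗ 1` that does not come from weights below. -/
noncomputable def upper (δ : ℝ) (l m : ℕ) : Diagram δ :=
  tower ((m + 1) / l * l) (alcJ δ l ((m + 1) / l)) (alcY δ l ((m + 1) / l))
    (alcP δ l ((m + 1) / l)) ((m + 1) % l + 1)

theorem exists_real_or_imaginary_sq (a : ℝ) : ∃ z : ℂ, z * z = a ∧
    (starRingEnd ℂ z = z ∨ starRingEnd ℂ z = -z) := by
  rcases le_total 0 a with h | h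
  · exact ⟨(Real.sqrt a : ℝ), by rw [← Complex.ofReal_mul, Real.mul_self_sqrt h],
      Or.inl (Complex.conj_ofReal _)⟩
  · refine ⟨Complex.I * (Real.sqrt (-a) : ℝ), ?_, Or.inr (by simp)⟩
    rw [mul_mul_mul_comm, Complex.I_mul_I, ← Complex.ofReal_mul,
      Real.mul_self_sqrt (by linarith)]
    simp

/-- The properties of the half diagrams which belong to the edges to the weight `m - 1`. -/
def IsDown (δ : ℝ) (l m : ℕ) (D : ℕ → Diagram δ) : Prop :=
  (∀ j k, j + 1 = m → k < edges l m j → D k ∈ diagrams δ j (m + 1) ∧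
    D k * proj δ l j = D k ∧ proj δ l m * D k = D k ∧ (conj (D k) = D k ∨ conj (D k) = - D k)) ∧
  (∀ j k k', j + 1 = m → k < edges l m j → k' < edges l m j →
    dagger (D k) * D k' = if k = k' then proj δ l j else 0) ∧
  (∀ j, j + 1 = m → proj δ l m - upper δ l m =
    ∑ k ∈ Finset.range (edges l m j), D k * dagger (D k))

theorem edges_down {m j : ℕ} (h : j + 1 = m) :
    edges l m j = if l ∣ m + 1 then 0 else if l ∣ m then 2 else 1 := by
  rw [edges, if_neg (by omega), if_pos h]

theorem exists_down_zero (m : ℕ) (h : (m + 1) % l = 0) : IsDown δ l m (fun _ => 0) := by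
  have h0 : ∀ j, j + 1 = m → edges l m j = 0 := fun j hj => by
    rw [edges_down hj, if_pos (Nat.dvd_of_mod_eq_zero h)]
  refine ⟨fun j k hj hk => ?_, fun j k k' hj hk => ?_, fun j hj => ?_⟩
  · rw [h0 j hj] at hk; omega
  · rw [h0 j hj] at hk; omega
  · rw [h0 j hj, proj, upper, h]
    simp [tower]

theorem exists_down_of_two_le (hl : QRoot δ l) {m k s : ℕ} (hs : s + 2 < l)
    (hm : m + 1 = k * l + (s + 2)) :
    ∃ g : Diagram δ, (∃ a b : ℂ, a * a = ((qn δ (s + 1) / qn δ (s + 2) : ℝ) : ℂ) ∧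
      g = a • 1 + b • alcY δ l k) ∧
      IsDown δ l m (fun _ => proj δ l m * cup δ (m - 1) * g * proj δ l (m - 1)) := by
  have hl2 := hl.two_le
  have hb := (link hl k).base
  have hM : m - 1 = k * l + s := by omega
  have hq1 : qn δ (s + 1) ≠ 0 := hl.ne_zero _ (by omega) (by omega)
  have hq2 : qn δ (s + 2) ≠ 0 := hl.ne_zero _ (by omega) (by omega)
  obtain ⟨a, ha, ha'⟩ := exists_real_or_imaginary_sq (qn δ (s + 1) / qn δ (s + 2))
  have ha0 : a ≠ 0 := by
    rintro rfl
    rw [mul_zero] at ha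
    exact (div_ne_zero hq1 hq2) (by exact_mod_cast ha.symm)
  set y := alcY δ l k with hy
  set b : ℂ := ((1 / qn δ (s + 2) ^ 2 : ℝ) : ℂ) / a with hb'
  have hgg : (a • (1 : Diagram δ) + b • y) * (a • 1 + b • y) = ibet y (s + 2) := by
    rw [ibet, add_mul, mul_add, mul_add]
    simp only [smul_mul_smul_comm, mul_one, one_mul, hb.y_sq, smul_zero, add_zero]
    rw [ha, add_assoc, ← add_smul, hb']
    congr 2
    push_cast
    field_simp
    norm_num
  have hP := proj_eq (δ := δ) hs hm
  have hR := proj_eq (δ := δ) (l := l) (m := m - 1) (k := k) (s := s + 1) (by omega) (by omega)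
  have hU : upper δ l m = tower (k * l) (alcJ δ l k) y (alcP δ l k) (s + 3) := by
    rw [upper, (div_mod_of_eq hs hm).1, (div_mod_of_eq hs hm).2]
  have hE : ∀ j, j + 1 = m → edges l m j = 1 := fun j hj => by
    rw [edges_down hj, if_neg, if_neg]
    · intro hd
      rw [show m = k * l + (s + 1) by omega] at hd
      have := Nat.le_of_dvd (by omega) ((Nat.dvd_add_right (Dvd.intro_left _ rfl)).1 hd)
      omega
    · intro hd
      rw [hm] at hd
      have := Nat.le_of_dvd (by omega) ((Nat.dvd_add_right (Dvd.intro_left _ rfl)).1 hd)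
      omega
  set p := proj δ l m with hp
  set r := proj δ l (m - 1) with hr
  set g : Diagram δ := a • 1 + b • y with hg
  have hpp : p * p = p := (proj_isProj hl m).sq
  have hrr : r * r = r := (proj_isProj hl (m - 1)).sq
  have hdp : dagger p = p := (proj_isProj hl m).dag
  have hdr : dagger r = r := (proj_isProj hl (m - 1)).dag
  have hcp : conj p = p := (proj_isProj hl m).real
  have hcr : conj r = r := (proj_isProj hl (m - 1)).real
  have hdg : dagger g = g := by
    rw [hg, dagger_add, dagger_smul, dagger_smul, dagger_one, hb.y_dag]
  have hry : r * y = y * r := by rw [hR]; exact hb.comm_y hl (by omega)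
  have hrg : r * g = g * r := by
    rw [hg, mul_add, add_mul]
    simp only [mul_smul_comm, smul_mul_assoc, mul_one, one_mul, hry]
  have htr : cap δ (m - 1) * p * cup δ (m - 1) = bet y (s + 2) * r := by
    rw [hM, hP, hR]; exact hb.trace_succ hl (by omega)
  have hrp : r * p = p := by rw [hP, hR]; exact hb.absorb hl (by omega) (by omega)
  have hgb : g * bet y (s + 2) * g = 1 := by
    have h1 : g * bet y (s + 2) = bet y (s + 2) * g := by
      refine Commute.bet ?_ _
      rw [hg, mul_add, add_mul]; simp
    rw [h1, mul_assoc, hgg, ← Commute.bet (Commute.ibet rfl (s + 2)).symm]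
    exact ibet_mul_bet hb.y_sq hq2 hq1
  refine ⟨g, ⟨a, b, ha, rfl⟩, fun j i hj hi => ?_, fun j i i' hj hi hi' => ?_, fun j hj => ?_⟩
  · obtain rfl : j = m - 1 := by omega
    refine ⟨?_, by rw [mul_assoc, hrr], by simp only [← hp, ← mul_assoc, hpp], ?_⟩
    · refine mul_mem_diagrams (mul_mem_diagrams (mul_mem_diagrams (diagrams_mono
        (a' := m + 1) (b' := m + 1) (proj_mem hl m) (by omega) (by omega))
        (cup_mem_diagrams (a := m - 1) le_rfl (by omega))) ?_) (proj_mem hl _)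
      exact add_mem (Submodule.smul_mem _ _ (one_mem_diagrams _))
        (Submodule.smul_mem _ _ (diagrams_mono hb.y_mem (by omega) (by omega)))
    · beta_reduce
      have h1 : conj g = starRingEnd ℂ a • 1 + starRingEnd ℂ b • y := by
        rw [hg, conj_add, conj_smul, conj_smul, conj_one, hb.y_real]
      have hbb : starRingEnd ℂ b = ((1 / qn δ (s + 2) ^ 2 : ℝ) : ℂ) / starRingEnd ℂ a := by
        rw [hb', map_div₀, Complex.conj_ofReal]
      simp only [conj_mul, conj_cup, h1, hcp, hcr, hbb]
      rcases ha' with h | h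
      · left; rw [h, ← hb', ← hg]
      · right
        rw [h, div_neg, ← hb', show (-a) • (1 : Diagram δ) + (-b) • y = (-1 : ℂ) • g by
          rw [hg]; module, mul_smul_comm, smul_mul_assoc]
        exact neg_one_smul ℂ (p * cup δ (m - 1) * g * r)
  · obtain rfl : j = m - 1 := by omega
    rw [hE _ hj] at hi hi'
    rw [if_pos (by omega)]
    simp only [dagger_mul, hdp, hdr, hdg, dagger_cup]
    calc r * (g * (cap δ (m - 1) * p)) * (p * cup δ (m - 1) * g * r)
        = r * (g * (cap δ (m - 1) * (p * p) * cup δ (m - 1)) * g) * r := by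
          simp only [mul_assoc]
      _ = r * (g * bet y (s + 2) * (r * g)) * r := by rw [hpp, htr]; simp only [mul_assoc]
      _ = r * ((g * bet y (s + 2) * g) * r) * r := by rw [hrg]; simp only [mul_assoc]
      _ = r := by rw [hgb, one_mul, hrr, hrr]
  · rw [hE _ hj, Finset.sum_range_one, hU, ← hp]
    conv_lhs => rw [hP, TowerBase.tower_sub s, ← hP, ← hM]
    simp only [dagger_mul, hdp, hdr, hdg, dagger_cup]
    have hcr : r * cap δ (m - 1) = cap δ (m - 1) * r :=
      (cap_comm (proj_mem hl (m - 1)) le_rfl).symm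
    calc p * cup δ (m - 1) * ibet y (s + 2) * cap δ (m - 1) * p
        = p * cup δ (m - 1) * (g * g) * (cap δ (m - 1) * (r * p)) := by
          rw [hgg, hrp]; simp only [mul_assoc]
      _ = p * cup δ (m - 1) * g * (g * r) * (cap δ (m - 1) * p) := by
          simp only [mul_assoc]; rw [← mul_assoc r, hcr, mul_assoc]
      _ = p * cup δ (m - 1) * g * (r * r * g) * (cap δ (m - 1) * p) := by rw [hrr, hrg]
      _ = _ := by simp only [mul_assoc]

/-- Orthonormal combinations of two vectors with Gram matrix `((δ, 1), (1, 0))`. -/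
theorem exists_down_one (hl : QRoot δ l) {m k : ℕ} (hm : m = (k + 1) * l) :
    ∃ D, IsDown δ l m D := by
  have hl2 := hl.two_le
  have hb := (link hl (k + 1)).base
  have hlow := (link hl (k + 1)).low_trace (by positivity)
  have hkl : (k + 1) * l = k * l + l := by ring
  have hP := proj_eq (δ := δ) (l := l) (m := m) (k := k + 1) (s := 1) (by omega) (by omega)
  have hR := proj_eq (δ := δ) (l := l) (m := m - 1) (k := k + 1) (s := 0) (by omega) (by omega)
  rw [show tower _ _ _ _ 1 = alcJ δ l (k + 1) from rfl] at hP
  rw [show tower _ _ _ _ 0 = alcJ δ l (k + 1) from rfl] at hR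
  rw [← hm] at hb hlow
  have hE : ∀ j, j + 1 = m → edges l m j = 2 := fun j hj => by
    rw [edges_down hj, if_neg, if_pos (hm ▸ Dvd.intro_left _ rfl)]
    intro hd
    have := Nat.le_of_dvd one_pos ((Nat.dvd_add_right (hm ▸ Dvd.intro_left _ rfl)).1 hd)
    omega
  set J := alcJ δ l (k + 1) with hJ
  set y := alcY δ l (k + 1) with hy
  have hU : upper δ l m = secondP (m - 1) J y := by
    obtain ⟨h1, h2⟩ := div_mod_of_eq (show 1 < l by omega) (congrArg (· + 1) hm)
    rw [upper, h1, h2, tower, alcP, show (k + 1) * l - 2 + 1 = m - 1 by omega]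
  set c := cup δ (m - 1) with hc
  set d := cap δ (m - 1) with hd
  have hJJ : J * J = J := hb.J_proj.sq
  have hJd : J * d = d * J := (cap_comm hb.J_proj.mem le_rfl).symm
  have hJc : J * c = c * J := (cup_comm hb.J_proj.mem le_rfl).symm
  have hdc : d * c = algebraMap ℂ _ (δ : ℂ) := cap_cup_loop δ _
  have hJy : J * y = y := hb.J_y
  have hyJ : y * J = y := hb.y_J
  have hyy : y * y = 0 := hb.y_sq
  have hyd : dagger y = y := hb.y_dag
  have hJdag : dagger J = J := hb.J_proj.dag
  set G := J * c with hG
  set H := y * c with hH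
  have hdG : dagger G = d * J := by rw [hG, dagger_mul, dagger_cup, hJdag]
  have hdH : dagger H = d * y := by rw [hH, dagger_mul, dagger_cup, hyd]
  have hGJ : G * J = G := by rw [hG, mul_assoc, ← hJc, ← mul_assoc, hJJ]
  have hHJ : H * J = H := by rw [hH, mul_assoc, ← hJc, ← mul_assoc, hyJ]
  have hJG : J * G = G := by rw [hG, ← mul_assoc, hJJ]
  have hJH : J * H = H := by rw [hH, ← mul_assoc, hJy]
  have hGG : dagger G * G = (δ : ℂ) • J := by
    rw [hdG, mul_assoc, hJG, hJc, ← mul_assoc, hdc, Algebra.smul_def]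
  have hGH : dagger G * H = J := by
    rw [hdG, hH, mul_assoc, ← mul_assoc J, hJy, ← mul_assoc, hlow]
  have hHG : dagger H * G = J := by
    rw [hdH, hG, mul_assoc, ← mul_assoc y, hyJ, ← mul_assoc, hlow]
  have hHH : dagger H * H = 0 := by
    rw [hdH, hH, mul_assoc, ← mul_assoc y, hyy, zero_mul, mul_zero]
  have hGmem : G ∈ diagrams δ (m - 1) (m + 1) :=
    mul_mem_diagrams (diagrams_mono (a' := m + 1) (b' := m + 1) hb.J_proj.mem (by omega) (by omega))
      (cup_mem_diagrams (a := m - 1) le_rfl (by omega))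
  have hHmem : H ∈ diagrams δ (m - 1) (m + 1) :=
    mul_mem_diagrams (diagrams_mono (a' := m + 1) (b' := m + 1) hb.y_mem (by omega) (by omega))
      (cup_mem_diagrams (a := m - 1) le_rfl (by omega))
  have hGc : conj G = G := by rw [hG, conj_mul, conj_cup, hb.J_proj.real]
  have hHc : conj H = H := by rw [hH, conj_mul, conj_cup, hb.y_real]
  set a : ℂ := (((1 - δ) / 2 : ℝ) : ℂ) with ha
  set b : ℂ := ((-(1 + δ) / 2 : ℝ) : ℂ) with hb'
  refine ⟨fun i => if i = 0 then G + a • H else Complex.I • (G + b • H), fun j i hj hi => ?_,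
    fun j i i' hj hi hi' => ?_, fun j hj => ?_⟩
  · obtain rfl : j = m - 1 := by omega
    rw [hP, hR]
    beta_reduce
    split_ifs
    · refine ⟨add_mem hGmem (Submodule.smul_mem _ _ hHmem), ?_, ?_, Or.inl ?_⟩
      · rw [add_mul, smul_mul_assoc, hGJ, hHJ]
      · rw [mul_add, mul_smul_comm, hJG, hJH]
      · rw [conj_add, conj_smul, hGc, hHc, ha, Complex.conj_ofReal]
    · refine ⟨Submodule.smul_mem _ _ (add_mem hGmem (Submodule.smul_mem _ _ hHmem)), ?_, ?_,
        Or.inr ?_⟩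
      · rw [smul_mul_assoc, add_mul, smul_mul_assoc, hGJ, hHJ]
      · rw [mul_smul_comm, mul_add, mul_smul_comm, hJG, hJH]
      · rw [conj_smul, conj_add, conj_smul, hGc, hHc, hb', Complex.conj_ofReal, Complex.conj_I]
        module
  · obtain rfl : j = m - 1 := by omega
    rw [hE _ hj] at hi hi'
    rw [hR]
    have key : ∀ u v : ℂ, dagger (G + u • H) * (G + v • H) = (δ + u + v : ℂ) • J := by
      intro u v
      rw [dagger_add, dagger_smul, add_mul, mul_add, mul_add]
      simp only [smul_mul_assoc, mul_smul_comm, hGG, hGH, hHG, hHH, smul_zero, add_zero]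
      module
    have hI : Complex.I * Complex.I = -1 := Complex.I_mul_I
    interval_cases i <;> interval_cases i' <;>
      simp only [if_true, one_ne_zero, if_false, dagger_smul, smul_mul_assoc, mul_smul_comm, key,
        smul_smul, zero_ne_one]
    · rw [ha]; push_cast; ring_nf; simp
    · rw [ha, hb']; push_cast; ring_nf; simp
    · rw [ha, hb']; push_cast; ring_nf; simp
    · rw [← mul_assoc, hI, hb']; push_cast; ring_nf; simp
  · rw [hE _ hj, hP, hU, secondP, sub_sub_cancel, Finset.sum_range_succ, Finset.sum_range_one]
    have hII : ∀ X Y : Diagram δ, (Complex.I • X) * (Complex.I • Y) = (-1 : ℂ) • (X * Y) :=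
      fun X Y => by rw [smul_mul_smul_comm, Complex.I_mul_I]
    simp only [if_true, one_ne_zero, if_false, dagger_smul, hII]
    simp only [dagger_smul, dagger_add, hdG, hdH]
    have e1 : G * (d * y) = c * d * y := by
      rw [hJc, mul_assoc, ← mul_assoc J, hJd, mul_assoc, hJy, mul_assoc]
    have e2 : H * (d * J) = y * (c * d) := by
      rw [hH, mul_assoc, ← hJd, ← mul_assoc c, ← hJc, mul_assoc J, ← mul_assoc, hyJ]
    have e3 : H * (d * y) = y * (c * d) * y := by rw [hH]; simp only [mul_assoc]
    simp only [mul_add, add_mul, smul_mul_assoc, mul_smul_comm, smul_add, smul_smul, e1, e2, e3]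
    rw [ha, hb']
    push_cast
    module

theorem exists_down (hl : QRoot δ l) (m : ℕ) : ∃ D, IsDown δ l m D := by
  have hl2 := hl.two_le
  have h1 := Nat.div_add_mod' (m + 1) l
  have h2 := Nat.mod_lt (m + 1) (show 0 < l by omega)
  rcases h3 : (m + 1) % l with _ | _ | s
  · exact ⟨_, exists_down_zero m h3⟩
  · rcases Nat.eq_zero_or_pos m with rfl | hm
    · refine ⟨fun _ => 0, fun j _ h => ?_, fun j _ _ h => ?_, fun j h => ?_⟩ <;> omega
    · have h4 : m = (m + 1) / l * l := by omega
      obtain ⟨k, hk⟩ := Nat.exists_eq_succ_of_ne_zero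
        (show (m + 1) / l ≠ 0 from fun h => by rw [h, zero_mul] at h4; omega)
      rw [hk] at h4
      exact exists_down_one hl h4
  · obtain ⟨g, -, h⟩ := exists_down_of_two_le (m := m) (k := (m + 1) / l) (s := s) hl (by omega)
      (by omega)
    exact ⟨_, h⟩

theorem exists_third (hl : QRoot δ l) {m j : ℕ} (h : j + 2 * l = m + 1) (hj : l ∣ j + 1) :
    ∃ K ∈ diagrams δ j (m + 1), K * proj δ l j = K ∧ proj δ l m * K = K ∧
      dagger K * K = proj δ l j ∧ (conj K = K ∨ conj K = -K) ∧ upper δ l m * K = K ∧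
      upper δ l m - proj δ l (m + 1) = K * dagger K := by
  have hl2 := hl.two_le
  obtain ⟨k, hk⟩ := hj
  rw [mul_comm] at hk
  obtain ⟨k, rfl⟩ := Nat.exists_eq_succ_of_ne_zero
    (show k ≠ 0 by rintro rfl; rw [zero_mul] at hk; omega)
  rw [Nat.succ_eq_add_one] at hk
  have hln := link hl (k + 1)
  have h1 : (k + 1 + 1) * l = (k + 1) * l + l := by ring
  have h2 : (k + 1 + 1 + 1) * l = (k + 1) * l + l + l := by ring
  have hPj := proj_eq (δ := δ) (l := l) (m := j) (k := k + 1) (s := 0) (by omega) (by omega)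
  rw [show tower _ _ _ _ 0 = alcJ δ l (k + 1) from rfl] at hPj
  have hPm := proj_eq (δ := δ) (l := l) (m := m) (k := k + 1 + 1) (s := l - 1) (by omega)
    (by omega)
  have hPm' : proj δ l (m + 1) = nextJ δ l ((k + 1) * l) ((k + 1 + 1) * l - 2)
      (alcJ δ l (k + 1 + 1)) (alcTheta (k + 1)) :=
    proj_eq (δ := δ) (l := l) (m := m + 1) (k := k + 1 + 1 + 1) (s := 0) (by omega) (by omega)
  rw [nextJ, if_neg (by omega)] at hPm'
  obtain ⟨hd, hm'⟩ := div_mod_of_eq (m := m) (k := k + 1 + 1) (s := l - 1) (l := l) (by omega)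
    (by omega)
  have hn2 : (k + 1 + 1) * l - 2 + 2 = (k + 1 + 1) * l := by omega
  have hPm2 : proj δ l m = nextP ((k + 1 + 1) * l - 2) (alcJ δ l (k + 1 + 1)) (l - 1) := by
    rw [hPm, nextP, hn2]; rfl
  have hU : upper δ l m = nextP ((k + 1 + 1) * l - 2) (alcJ δ l (k + 1 + 1)) l := by
    rw [upper, hd, hm', nextP, hn2, show l - 1 + 1 = l by omega]; rfl
  set n := (k + 1 + 1) * l - 2 with hn
  set J := alcJ δ l (k + 1 + 1) with hJ
  set ζ : ℝ := alcTheta (k + 1) * qn δ (l - 1) with hζ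
  have hζ0 : ζ ≠ 0 := mul_ne_zero (hln.hθ (by omega)) (hl.ne_zero _ (by omega) (by omega))
  have htop : unnest δ n l * J * nest δ n l = (ζ : ℂ) • proj δ l j := by
    rw [hPj]; exact hln.unnest_nest_top (by omega)
  have hJJ := hln.J_proj.sq
  obtain ⟨z, hz, hz'⟩ := exists_real_or_imaginary_sq (1 / ζ)
  have hdK : dagger (J * nest δ n l) = unnest δ n l * J := by
    rw [dagger_mul, dagger_nest, hln.J_proj.dag]
  have hUK : upper δ l m * (J * nest δ n l) = J * nest δ n l := by
    rw [hU, ← mul_assoc, hln.nextP_J le_rfl, hln.nextP_nest le_rfl le_rfl (by omega)]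
  have hmK : proj δ l m * (J * nest δ n l) = J * nest δ n l := by
    rw [← hUK, hU, ← mul_assoc, hPm2, nextP, hln.next_base.absorb hl (by omega) le_rfl]
  have hKJ : J * nest δ n l * proj δ l j = J * nest δ n l := by
    have h3 : proj δ l j * (unnest δ n l * J) = unnest δ n l * J := by
      have h6 : proj δ l j * unnest δ n l = unnest δ n l * proj δ l j := by
        exact (unnest_comm (k := j) (s := l) (n := n) (by omega) (proj_mem hl j))
      rw [← mul_assoc, h6, mul_assoc, hPj]
      congr 1
      have := hln.absorb (s := 0) (by omega)
      exact this
    have := congrArg dagger h3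
    rwa [dagger_mul, dagger_mul, dagger_unnest, hln.J_proj.dag, (proj_isProj hl j).dag] at this
  refine ⟨z • (J * nest δ n l), ?_, by rw [smul_mul_assoc, hKJ], by rw [mul_smul_comm, hmK], ?_, ?_,
    by rw [mul_smul_comm, hUK], ?_⟩
  · refine Submodule.smul_mem _ _ (mul_mem_diagrams (diagrams_mono (a' := m + 1) (b' := m + 1)
      hln.J_proj.mem (by omega) (by omega)) ?_)
    have := nest_mem (δ := δ) (n := n) (s := l) (by omega)
    rwa [show n + 1 - l = j by omega, show n + 1 + l = m + 1 by omega] at this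
  · rw [dagger_smul, hdK, smul_mul_smul_comm, hz, mul_assoc, ← mul_assoc J, hJJ, ← mul_assoc, htop,
      smul_smul, ← Complex.ofReal_mul, one_div_mul_cancel hζ0, Complex.ofReal_one, one_smul]
  · rw [conj_smul, conj_mul, conj_nest, hln.J_proj.real]
    rcases hz' with h3 | h3
    · left; rw [h3]
    · right; rw [h3]; exact neg_smul z (J * nest δ n l)
  · rw [dagger_smul, hdK, smul_mul_smul_comm, hz, hU, hPm', sub_sub_cancel]

theorem upper_eq (hl : QRoot δ l) {m : ℕ} (h : ¬ (2 * l ≤ m + 1 ∧ l ∣ m + 2)) :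
    upper δ l m = proj δ l (m + 1) := by
  have hl2 := hl.two_le
  have h1 := Nat.div_add_mod' (m + 1) l
  have h2 := Nat.mod_lt (m + 1) (show 0 < l by omega)
  rcases Nat.lt_or_ge ((m + 1) % l + 1) l with h3 | h3
  · rw [upper, ← proj_eq (m := m + 1) (k := (m + 1) / l) h3 (by omega)]
  · have h4 : (m + 1) % l = l - 1 := by omega
    have hd : l ∣ m + 2 := by
      refine ⟨(m + 1) / l + 1, ?_⟩
      rw [mul_comm, add_mul]; omega
    have h5 : (m + 1) / l < 2 := by
      by_contra h5
      have := Nat.mul_le_mul_right l (not_lt.1 h5)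
      exact h ⟨by omega, hd⟩
    have h6 := Nat.div_mul_le_self (m + 1) l
    have hP := proj_eq (δ := δ) (l := l) (m := m + 1) (k := (m + 1) / l + 1) (s := 0) (by omega)
      (by rw [add_mul]; omega)
    rw [show tower _ _ _ _ 0 = alcJ δ l ((m + 1) / l + 1) from rfl] at hP
    rw [hP, upper, h4, show l - 1 + 1 = l by omega]
    interval_cases h7 : (m + 1) / l
    · rw [zero_mul]; rfl
    · change _ = nextJ δ l (0 * l) ((0 + 1) * l - 2) (alcJ δ l (0 + 1)) (alcTheta 0)
      rw [nextJ, if_pos (by omega), nextP]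
      simp only [Complex.ofReal_zero, zero_smul, sub_zero]
      rw [show (0 + 1) * l - 2 + 2 = 1 * l by omega]
      rfl

theorem dvd_reflect {m : ℕ} (h : 2 * l ≤ m + 1 ∧ l ∣ m + 2) : l ∣ m + 1 - 2 * l + 1 := by
  have := h.2
  rw [show m + 2 = m + 1 - 2 * l + 1 + l * 2 by omega] at this
  exact (Nat.dvd_add_left (dvd_mul_right l 2)).1 this

theorem sum_range_edges {M : Type*} [AddCommMonoid M] (hl : 2 ≤ l) (m : ℕ) (g : ℕ → M)
    (hg : ∀ j, edges l m j = 0 → g j = 0) :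
    ∑ j ∈ Finset.range (m + 2), g j = g (m + 1) + (if m = 0 then 0 else g (m - 1)) +
      (if 2 * l ≤ m + 1 ∧ l ∣ m + 2 then g (m + 1 - 2 * l) else 0) := by
  have key : ∀ j ∈ Finset.range (m + 2), g j = (if j = m + 1 then g j else 0) +
      (if j = m - 1 then (if m = 0 then 0 else g j) else 0) +
      (if j = m + 1 - 2 * l then (if 2 * l ≤ m + 1 ∧ l ∣ m + 2 then g j else 0) else 0) := by
    intro j hj
    have hj' := Finset.mem_range.1 hj
    rcases eq_or_ne j (m + 1) with h1 | h1
    · rw [if_pos h1, if_neg (by omega), if_neg (by omega)]; simp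
    rw [if_neg h1, zero_add]
    by_cases h2 : j = m - 1 ∧ m ≠ 0
    · rw [if_pos h2.1, if_neg h2.2]
      by_cases h3 : j = m + 1 - 2 * l
      · rw [if_pos h3, if_neg (by omega), add_zero]
      · rw [if_neg h3, add_zero]
    have h2' : (if j = m - 1 then (if m = 0 then (0 : M) else g j) else 0) = 0 := by
      split_ifs <;> first | rfl | omega
    rw [h2', zero_add]
    by_cases h3 : j = m + 1 - 2 * l ∧ 2 * l ≤ m + 1 ∧ l ∣ m + 2
    · rw [if_pos h3.1, if_pos h3.2]
    have h3' : (if j = m + 1 - 2 * l then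
        (if 2 * l ≤ m + 1 ∧ l ∣ m + 2 then g j else 0) else 0) = 0 := by
      split_ifs with h4 h5
      · exact absurd ⟨h4, h5⟩ h3
      · rfl
      · rfl
    rw [h3']
    apply hg
    rw [edges, if_neg h1, if_neg (by omega), if_neg]
    rintro ⟨h4, h5⟩
    refine h3 ⟨by omega, by omega, ?_⟩
    rw [show m + 2 = j + 1 + l * 2 by omega]
    exact (Nat.dvd_add_right h5).2 (dvd_mul_right l 2)
  rw [Finset.sum_congr rfl key, Finset.sum_add_distrib, Finset.sum_add_distrib,
    Finset.sum_ite_eq', Finset.sum_ite_eq', Finset.sum_ite_eq']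
  simp only [Finset.mem_range]
  rw [if_pos (show m + 1 < m + 2 by omega), if_pos (show m - 1 < m + 2 by omega),
    if_pos (show m + 1 - 2 * l < m + 2 by omega)]

theorem edges_cases {m j : ℕ} (k : Fin (edges l m j)) : j = m + 1 ∨ j + 1 = m ∨
    (j ≠ m + 1 ∧ j + 1 ≠ m ∧ j + 2 * l = m + 1 ∧ l ∣ j + 1) := by
  have : 0 < edges l m j := k.pos
  rw [edges] at this
  split_ifs at this with h1 h2 h3 h4 h5 <;> omega

theorem edges_le_one {m j : ℕ} (h : j + 1 ≠ m) (k k' : Fin (edges l m j)) : k = k' := by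
  have h1 := k.2
  have h2 := k'.2
  have : edges l m j ≤ 1 := by rw [edges, if_neg h]; split_ifs <;> simp
  exact Fin.ext (by omega)

theorem dagger_upper (hl : QRoot δ l) (m : ℕ) : dagger (upper δ l m) = upper δ l m := by
  have hl2 := hl.two_le
  have := Nat.mod_lt (m + 1) (show 0 < l by omega)
  exact ((link hl ((m + 1) / l)).base.proj hl (by omega)).dag

theorem exists_fusion_step (hl : QRoot δ l) (m : ℕ) :
    ∃ F : (j : ℕ) → Fin (edges l m j) → Diagram δ, (∀ j k, F j k ∈ diagrams δ j (m + 1)) ∧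
      (∀ k, F (m + 1) k = proj δ l (m + 1)) ∧ (∀ j k, F j k * proj δ l j = F j k) ∧
      (∀ j k, dagger (F j k) * F j k = proj δ l j) ∧
      (∀ j j' k k', (⟨j, k⟩ : Σ i, Fin (edges l m i)) ≠ ⟨j', k'⟩ →
        dagger (F j k) * F j' k' = 0) ∧
      (∑ j ∈ Finset.range (m + 2), ∑ k, F j k * dagger (F j k) = proj δ l m) ∧
      (∀ j k, conj (F j k) = F j k ∨ conj (F j k) = -F j k) := by
  have hl2 := hl.two_le
  obtain ⟨D, hD, hDD, hDU⟩ := exists_down hl m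
  obtain ⟨K, hK⟩ : ∃ K, ∀ j, j ≠ m + 1 → j + 1 ≠ m → j + 2 * l = m + 1 → l ∣ j + 1 →
      (K ∈ diagrams δ j (m + 1) ∧ K * proj δ l j = K ∧ proj δ l m * K = K ∧
      dagger K * K = proj δ l j ∧ (conj K = K ∨ conj K = -K) ∧ upper δ l m * K = K ∧
      upper δ l m - proj δ l (m + 1) = K * dagger K) := by
    by_cases h : 2 * l ≤ m + 1 ∧ l ∣ m + 1 - 2 * l + 1
    · obtain ⟨K, h1, h2⟩ := exists_third hl (m := m) (j := m + 1 - 2 * l) (by omega) h.2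
      refine ⟨K, fun j _ _ h3 _ => ?_⟩
      obtain rfl : j = m + 1 - 2 * l := by omega
      exact ⟨h1, h2⟩
    · refine ⟨0, fun j _ _ h3 h4 => absurd ⟨by omega, ?_⟩ h⟩
      rwa [show m + 1 - 2 * l + 1 = j + 1 by omega]
  set F : (j : ℕ) → Fin (edges l m j) → Diagram δ := fun j k =>
    if j = m + 1 then proj δ l (m + 1) else if j + 1 = m then D k else K with hF
  have hF1 : ∀ j k, j = m + 1 → F j k = proj δ l (m + 1) := fun j k h => if_pos h
  have hF2 : ∀ j k, j + 1 = m → F j k = D k := fun j k h => by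
    simp only [hF]; rw [if_neg (by omega), if_pos h]
  have hF3 : ∀ j k, j ≠ m + 1 → j + 1 ≠ m → F j k = K := fun j k h h' => by
    simp only [hF]; rw [if_neg h, if_neg h']
  have hPd := fun i => (proj_isProj hl i).dag
  have hUD : ∀ j k, j + 1 = m → k < edges l m j → upper δ l m * D k = 0 := by
    intro j k hj hk
    rw [← sub_sub_cancel (proj δ l m) (upper δ l m), hDU j hj, sub_mul, (hD j k hj hk).2.2.1,
      Finset.sum_mul, Finset.sum_eq_single k, mul_assoc, hDD j k k hj hk hk, if_pos rfl,
      (hD j k hj hk).2.1, sub_self]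
    · intro k' hk' hne
      rw [mul_assoc, hDD j k' k hj (Finset.mem_range.1 hk') hk, if_neg hne, mul_zero]
    · exact fun h => absurd (Finset.mem_range.2 hk) h
  have hPD : ∀ j k, j + 1 = m → k < edges l m j → proj δ l (m + 1) * D k = 0 := by
    intro j k hj hk
    by_cases h : 2 * l ≤ m + 1 ∧ l ∣ m + 2
    · have h' := dvd_reflect h
      obtain ⟨-, -, -, -, -, h2, h3⟩ := hK (m + 1 - 2 * l) (by omega) (by omega) (by omega) h'
      have hu := dagger_upper hl m
      have h4 : dagger K * upper δ l m = dagger K := by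
        have := congrArg dagger h2
        rwa [dagger_mul, hu] at this
      rw [← sub_sub_cancel (upper δ l m) (proj δ l (m + 1)), h3, sub_mul, hUD j k hj hk, ← h4,
        mul_assoc, mul_assoc, hUD j k hj hk]
      simp
    · rw [← upper_eq hl h, hUD j k hj hk]
  have hPK : ∀ j, j ≠ m + 1 → j + 1 ≠ m → j + 2 * l = m + 1 → l ∣ j + 1 →
      proj δ l (m + 1) * K = 0 := by
    intro j h1 h2 h3 h4
    obtain ⟨-, h5, -, h6, -, h7, h8⟩ := hK j h1 h2 h3 h4
    rw [← sub_sub_cancel (upper δ l m) (proj δ l (m + 1)), h8, sub_mul, h7, mul_assoc, h6, h5,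
      sub_self]
  have hDK : ∀ j k j', j + 1 = m → k < edges l m j → j' ≠ m + 1 → j' + 1 ≠ m →
      j' + 2 * l = m + 1 → l ∣ j' + 1 → dagger K * D k = 0 := by
    intro j k j' hj hk h1 h2 h3 h4
    obtain ⟨-, -, -, -, -, h7, -⟩ := hK j' h1 h2 h3 h4
    have := congrArg dagger h7
    rw [dagger_mul, dagger_upper hl] at this
    rw [← this, mul_assoc, hUD j k hj hk, mul_zero]
  have hflip : ∀ x y : Diagram δ, dagger x * y = 0 → dagger y * x = 0 := fun x y h => by
    have := congrArg dagger h
    rwa [dagger_mul, dagger_dagger, dagger_zero] at this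
  refine ⟨F, fun j k => ?_, fun k => hF1 _ k rfl, fun j k => ?_, fun j k => ?_,
    fun j j' k k' hne => ?_, ?_, fun j k => ?_⟩
  · rcases edges_cases k with rfl | h | ⟨h1, h2, h3, h4⟩
    · rw [hF1 _ k rfl]; exact proj_mem hl _
    · rw [hF2 j k h]; exact (hD j k h k.2).1
    · rw [hF3 j k h1 h2]; exact (hK j h1 h2 h3 h4).1
  · rcases edges_cases k with rfl | h | ⟨h1, h2, h3, h4⟩
    · rw [hF1 _ k rfl]; exact proj_mul_proj hl _
    · rw [hF2 j k h]; exact (hD j k h k.2).2.1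
    · rw [hF3 j k h1 h2]; exact (hK j h1 h2 h3 h4).2.1
  · rcases edges_cases k with rfl | h | ⟨h1, h2, h3, h4⟩
    · rw [hF1 _ k rfl, hPd]; exact proj_mul_proj hl _
    · rw [hF2 j k h, hDD j k k h k.2 k.2, if_pos rfl]
    · rw [hF3 j k h1 h2]; exact (hK j h1 h2 h3 h4).2.2.2.1
  · rcases edges_cases k with rfl | h | ⟨h1, h2, h3, h4⟩ <;>
      rcases edges_cases k' with rfl | h' | ⟨h1', h2', h3', h4'⟩
    · exact absurd (by rw [edges_le_one (by omega) k k']) hne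
    · rw [hF1 _ k rfl, hF2 _ k' h', hPd]; exact hPD j' k' h' k'.2
    · rw [hF1 _ k rfl, hF3 _ k' h1' h2', hPd]; exact hPK j' h1' h2' h3' h4'
    · rw [hF1 _ k' rfl, hF2 _ k h]; exact hflip _ _ (by rw [hPd]; exact hPD j k h k.2)
    · obtain rfl : j = j' := by omega
      rw [hF2 _ k h, hF2 _ k' h, hDD j k k' h k.2 k'.2, if_neg]
      intro he
      exact hne (by rw [Fin.ext he])
    · rw [hF2 _ k h, hF3 _ k' h1' h2']
      exact hflip _ _ (hDK j k j' h k.2 h1' h2' h3' h4')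
    · rw [hF1 _ k' rfl, hF3 _ k h1 h2]
      exact hflip _ _ (by rw [hPd]; exact hPK j h1 h2 h3 h4)
    · rw [hF2 _ k' h', hF3 _ k h1 h2]
      exact hDK j' k' j h' k'.2 h1 h2 h3 h4
    · obtain rfl : j = j' := by omega
      exact absurd (by rw [edges_le_one h2 k k']) hne
  · rw [sum_range_edges hl2]
    · have e1 : ∑ k, F (m + 1) k * dagger (F (m + 1) k) = proj δ l (m + 1) := by
        have : edges l m (m + 1) = 1 := if_pos rfl
        rw [Finset.sum_congr rfl fun k _ => by rw [hF1 _ k rfl, hPd, proj_mul_proj hl]]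
        rw [Finset.sum_const, Finset.card_univ, Fintype.card_fin, this, one_smul]
      have e2 : (if m = 0 then (0 : Diagram δ) else ∑ k, F (m - 1) k * dagger (F (m - 1) k)) =
          proj δ l m - upper δ l m := by
        split_ifs with h0
        · subst h0
          obtain ⟨h1, h2⟩ := div_mod_of_eq (m := 0) (k := 0) (s := 1) (l := l) (by omega) (by omega)
          rw [proj, upper, h1, h2]
          exact (sub_self (1 : Diagram δ)).symm
        · rw [hDU (m - 1) (by omega), ← Fin.sum_univ_eq_sum_range
            (fun k => D k * dagger (D k))]
          exact Finset.sum_congr rfl fun k _ => by rw [hF2 _ k (by omega)]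
      have e3 : (if 2 * l ≤ m + 1 ∧ l ∣ m + 2 then
          ∑ k, F (m + 1 - 2 * l) k * dagger (F (m + 1 - 2 * l) k) else 0) =
          upper δ l m - proj δ l (m + 1) := by
        split_ifs with h
        · have h' := dvd_reflect h
          have : edges l m (m + 1 - 2 * l) = 1 := by
            rw [edges, if_neg (by omega), if_neg (by omega), if_pos ⟨by omega, h'⟩]
          rw [Finset.sum_congr rfl fun k _ => by rw [hF3 _ k (by omega) (by omega)],
            Finset.sum_const, Finset.card_univ, Fintype.card_fin, this, one_smul,
            (hK _ (by omega) (by omega) (by omega) h').2.2.2.2.2.2]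
        · rw [upper_eq hl h, sub_self]
      rw [e1, e2, e3]
      abel
    · intro j hj
      exact Finset.sum_eq_zero fun k _ => by have := k.2; omega
  · rcases edges_cases k with rfl | h | ⟨h1, h2, h3, h4⟩
    · rw [hF1 _ k rfl]; exact Or.inl (proj_isProj hl _).real
    · rw [hF2 j k h]; exact (hD j k h k.2).2.2.2
    · rw [hF3 j k h1 h2]; exact (hK j h1 h2 h3 h4).2.2.2.2.1

theorem proj_zero (hl : QRoot δ l) : proj δ l 0 = 1 :=
  proj_eq (δ := δ) (l := l) (m := 0) (k := 0) (s := 1) (by have := hl.two_le; omega) (by omega)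

theorem proj_one (hl : QRoot δ l) : proj δ l 1 = 1 := by
  rcases Nat.lt_or_ge 2 l with h | h
  · exact proj_eq (δ := δ) (l := l) (m := 1) (k := 0) (s := 2) h (by omega)
  · obtain rfl : l = 2 := le_antisymm h hl.two_le
    exact proj_eq (δ := δ) (l := 2) (m := 1) (k := 1) (s := 0) (by omega) (by omega)

theorem exists_fusionRules (hl : QRoot δ l) : ∃ R : FusionRules δ l, R.P = proj δ l := by
  choose F h1 h2 h3 h4 h5 h6 h7 using exists_fusion_step hl
  exact ⟨⟨proj δ l, F, proj_zero hl, proj_one hl, h1, h2, h3, h4, h5, h6, h7⟩, rfl⟩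

end TemperleyLieb

namespace TemperleyLieb
namespace FusionRules

/-! ### General properties of fusion rules -/

variable {δ : ℝ} {l : ℕ} (R : FusionRules δ l)

theorem P_mul_P (m : ℕ) : R.P m * R.P m = R.P m := by
  match m with
  | 0 => rw [R.P_zero, one_mul]
  | m + 1 =>
    have h := R.F_mul_P m (m + 1) ⟨0, by simp [edges]⟩
    rwa [R.F_up] at h

theorem dagger_P (m : ℕ) : dagger (R.P m) = R.P m := by
  match m with
  | 0 => rw [R.P_zero, dagger_one]
  | m + 1 =>
    have h := R.F_norm m (m + 1) ⟨0, by simp [edges]⟩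
    rw [R.F_up] at h
    rw [← h, dagger_mul, dagger_dagger]

theorem P_mul_F (m j : ℕ) (k : Fin (edges l m j)) : R.P m * R.F m j k = R.F m j k := by
  have hj : j ∈ Finset.range (m + 2) := by
    rw [Finset.mem_range]
    rcases edges_cases k with h | h | h <;> omega
  rw [← R.F_sum m, Finset.sum_mul, Finset.sum_eq_single j, Finset.sum_mul,
    Finset.sum_eq_single k, mul_assoc, R.F_norm, R.F_mul_P]
  · intro k' _ hne
    rw [mul_assoc, R.F_orth, mul_zero]
    intro h
    exact hne (eq_of_heq (Sigma.mk.inj h).2)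
  · exact fun h => absurd (Finset.mem_univ k) h
  · intro j' _ hne
    rw [Finset.sum_mul]
    refine Finset.sum_eq_zero fun k' _ => ?_
    rw [mul_assoc, R.F_orth, mul_zero]
    exact fun h => hne (Sigma.mk.inj h).1
  · exact fun h => absurd hj h

theorem P_mul_P_succ (m : ℕ) : R.P m * R.P (m + 1) = R.P (m + 1) := by
  have := R.P_mul_F m (m + 1) ⟨0, by simp [edges]⟩
  rwa [R.F_up] at this

theorem spinTraceAux_F (p : ℂ) (m j : ℕ) (k : Fin (edges l m j)) :
    spinTraceAux p (m + 1) (R.F m j k * dagger (R.F m j k)) =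
      (p * (1 - p)) ^ ((m + 1 - j) / 2) * spinTraceAux p j (R.P j) := by
  have h : m + 1 = j + 2 * ((m + 1 - j) / 2) := by
    rcases edges_cases k with h | h | h <;> omega
  rw [spinTraceAux_comm p h (R.F_mem m j k) (dagger_mem_diagrams (R.F_mem m j k)), R.F_norm]

theorem spinTraceAux_P (p : ℂ) (m : ℕ) : spinTraceAux p (m + 1) (R.P m) =
    (∑ j ∈ Finset.range (m + 1), edges l m j * ((p * (1 - p)) ^ ((m + 1 - j) / 2) *
      spinTraceAux p j (R.P j))) + spinTraceAux p (m + 1) (R.P (m + 1)) := by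
  set f : Diagram δ →ₗ[ℂ] ℂ :=
    { toFun := spinTraceAux p (m + 1)
      map_add' := spinTraceAux_add p (m + 1)
      map_smul' := spinTraceAux_smul p (m + 1) } with hf
  have h : ∀ x, spinTraceAux p (m + 1) x = f x := fun _ => rfl
  rw [h, ← R.F_sum m, map_sum, Finset.sum_range_succ]
  congr 1
  · refine Finset.sum_congr rfl fun j _ => ?_
    rw [map_sum, Finset.sum_congr rfl fun k _ => (h _).symm.trans (R.spinTraceAux_F p m j k)]
    simp
  · have : edges l m (m + 1) = 1 := if_pos rfl
    rw [Finset.sum_congr rfl fun k _ => by rw [R.F_up, R.dagger_P, R.P_mul_P]]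
    simp [this, hf]

theorem P_eq (hl : QRoot δ l) (m : ℕ) : R.P m = proj δ l m := by
  have hl2 := hl.two_le
  obtain ⟨R', hR'⟩ := exists_fusionRules hl
  induction m using Nat.strong_induction_on with
  | _ m ih =>
  obtain _ | m := m
  · rw [R.P_zero, proj_zero hl]
  have hm := ih m (by omega)
  have hdag := dagger_proj hl (m + 1)
  have hpp := proj_mul_proj hl (m + 1)
  have htr := R.spinTraceAux_P (1 / 2) m
  have htr' := R'.spinTraceAux_P (1 / 2) m
  have hle := R'.P_mul_P_succ m
  rw [hR'] at htr' hle
  rw [hm, htr', Finset.sum_congr rfl fun j hj => by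
    rw [← ih j (by have := Finset.mem_range.1 hj; omega)]] at htr
  have htr := add_left_cancel htr
  have hkill : ∀ j k, j ≠ m + 1 → proj δ l (m + 1) * R.F m j k = 0 := by
    intro j k hj
    have hjm : j < m + 1 := by rcases edges_cases k with h | h | h <;> omega
    have h := hom_lt hl hjm (R.F_mem m j k)
    rw [mul_assoc, ← ih j hjm, R.F_mul_P] at h
    rcases h with h | ⟨h1, h2, -⟩
    · exact h
    · have h3 := refl_lt hl h1
      rw [← h2] at h3
      rcases edges_cases k with h | h | h
      · omega
      · have hpos := k.pos
        have hd : (m + 2) % l = 1 := by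
          rw [show m + 2 = m + 1 + 1 by rfl]; omega
        rw [edges_down h, if_pos] at hpos
        · omega
        · rw [show m + 1 = l * ((m + 2) / l) by have := Nat.mod_add_div (m + 2) l; omega]
          exact dvd_mul_right _ _
      · omega
  have h1 : proj δ l (m + 1) * R.P (m + 1) = proj δ l (m + 1) := by
    have h2 := congrArg dagger hle
    rw [dagger_mul, hdag, dagger_proj hl] at h2
    conv_rhs => rw [← h2, ← hm, ← R.F_sum m, Finset.sum_range_succ, mul_add]
    rw [Finset.mul_sum, Finset.sum_eq_zero, zero_add]
    · have : edges l m (m + 1) = 1 := if_pos rfl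
      rw [Finset.sum_congr rfl fun k _ => by rw [R.F_up, R.dagger_P, R.P_mul_P]]
      simp [this]
    · intro j hj
      rw [Finset.mul_sum]
      refine Finset.sum_eq_zero fun k _ => ?_
      rw [← mul_assoc, hkill j k (by have := Finset.mem_range.1 hj; omega), zero_mul]
  have h2 : R.P (m + 1) * proj δ l (m + 1) = proj δ l (m + 1) := by
    have := congrArg dagger h1
    rwa [dagger_mul, hdag, R.dagger_P] at this
  refine sub_eq_zero.1 (eq_zero_of_idempotent (n := m + 1) (sub_mem ?_ (proj_mem hl _)) ?_ ?_)
  · have := R.F_mem m (m + 1) ⟨0, by simp [edges]⟩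
    rwa [R.F_up] at this
  · rw [mul_sub, sub_mul, sub_mul, R.P_mul_P, h1, h2, hpp]; simp
  · have h3 : R.P (m + 1) - proj δ l (m + 1) = R.P (m + 1) + (-1 : ℂ) • proj δ l (m + 1) := by
      module
    rw [h3, spinTraceAux_add, spinTraceAux_smul, htr]
    ring

end FusionRules
end TemperleyLieb

namespace TemperleyLieb

/-! ### Paths -/

variable {δ : ℝ} {l : ℕ}

/-- The edges which leave a vertex. -/
abbrev Edge (l m : ℕ) : Type := Σ j, Fin (edges l m j)

/-- The paths to some vertex of a level. -/
abbrev LPath (l n : ℕ) : Type := Σ m, Path l n m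

theorem Edge.lt {m : ℕ} (e : Edge l m) : e.1 < m + 2 := by
  rcases edges_cases e.2 with h | h | h <;> omega

/-- The edges as a finite union. -/
def edgeEquiv (l m : ℕ) : (Σ j : Fin (m + 2), Fin (edges l m j)) ≃ Edge l m where
  toFun x := ⟨x.1, x.2⟩
  invFun e := ⟨⟨e.1, e.lt⟩, e.2⟩
  left_inv _ := rfl
  right_inv _ := rfl

instance (l m : ℕ) : Fintype (Edge l m) := Fintype.ofEquiv _ (edgeEquiv l m)

theorem sum_edge {M : Type*} [AddCommMonoid M] (m : ℕ) (f : Edge l m → M) :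
    ∑ e, f e = ∑ j ∈ Finset.range (m + 2), ∑ k, f ⟨j, k⟩ := by
  rw [← (edgeEquiv l m).sum_comp, Fintype.sum_sigma, Finset.sum_range]
  rfl

/-- A path is a shorter path with an edge. -/
def stepEquiv (l n : ℕ) : (Σ π : LPath l (n + 1), Edge l π.1) ≃ LPath l (n + 2) where
  toFun x := ⟨x.2.1, x.1.2.step x.2.1 x.2.2⟩
  invFun
    | ⟨_, .step (m := m) π j k⟩ => ⟨⟨m, π⟩, ⟨j, k⟩⟩
  left_inv _ := rfl
  right_inv
    | ⟨_, .step _ _ _⟩ => rfl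

/-- The only path of level one. -/
def baseEquiv (l : ℕ) : Unit ≃ LPath l 1 where
  toFun _ := ⟨1, .base⟩
  invFun _ := ()
  left_inv _ := rfl
  right_inv
    | ⟨_, .base⟩ => rfl

instance (l : ℕ) : IsEmpty (LPath l 0) := ⟨fun ⟨_, π⟩ => nomatch π⟩

instance fintypeLPath (l : ℕ) : (n : ℕ) → Fintype (LPath l n)
  | 0 => Fintype.ofIsEmpty
  | 1 => Fintype.ofEquiv _ (baseEquiv l)
  | n + 2 =>
    let _ := fintypeLPath l (n + 1)
    Fintype.ofEquiv _ (stepEquiv l n)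

theorem sum_path_one {M : Type*} [AddCommMonoid M] (f : LPath l 1 → M) :
    ∑ π, f π = f ⟨1, .base⟩ := by
  rw [← (baseEquiv l).sum_comp]; simp [baseEquiv]

theorem sum_path_succ {M : Type*} [AddCommMonoid M] {n : ℕ} (hn : 0 < n)
    (f : LPath l (n + 1) → M) :
    ∑ π, f π = ∑ π : LPath l n, ∑ e : Edge l π.1, f ⟨e.1, π.2.step e.1 e.2⟩ := by
  obtain ⟨n, rfl⟩ : ∃ k, n = k + 1 := ⟨n - 1, by omega⟩
  rw [← (stepEquiv l n).sum_comp, Fintype.sum_sigma]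
  rfl

theorem Path.level_pos {n m : ℕ} (π : Path l n m) : 0 < n := by
  induction π <;> omega

theorem Path.parity {n m : ℕ} (π : Path l n m) : n = m + 2 * ((n - m) / 2) := by
  induction π with
  | base => rfl
  | step π j k ih => rcases edges_cases k with h | h | h <;> omega

namespace FusionRules

variable (R : FusionRules δ l)

theorem vec_mem {n m : ℕ} (π : Path l n m) : R.vec π ∈ diagrams δ m n := by
  induction π with
  | base => exact one_mem_diagrams 1
  | step π j k ih =>
    exact mul_mem_diagrams (diagrams_mono ih (by omega) (by omega)) (R.F_mem _ j k)

theorem vec_mul_P {n m : ℕ} (π : Path l n m) : R.vec π * R.P m = R.vec π := by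
  cases π with
  | base => rw [R.P_one, mul_one]
  | step π j k => rw [vec, mul_assoc, R.F_mul_P]

theorem vec_norm {n m : ℕ} (π : Path l n m) : dagger (R.vec π) * R.vec π = R.P m := by
  induction π with
  | base => rw [vec, dagger_one, one_mul, R.P_one]
  | step π j k ih =>
    rw [vec, dagger_mul, mul_assoc, ← mul_assoc _ (R.vec π), ih, R.P_mul_F, R.F_norm]

theorem vec_orth {n m m' : ℕ} (π : Path l n m) (σ : Path l n m')
    (h : (⟨m, π⟩ : LPath l n) ≠ ⟨m', σ⟩) : dagger (R.vec π) * R.vec σ = 0 := by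
  induction π generalizing m' with
  | base =>
    cases σ with
    | base => exact absurd rfl h
    | step σ => exact absurd σ.level_pos (lt_irrefl 0)
  | @step n m π j k ih =>
    cases σ with
    | base => exact absurd π.level_pos (lt_irrefl 0)
    | @step _ m₁ σ _ k' =>
      rw [vec, vec, dagger_mul, mul_assoc, ← mul_assoc _ (R.vec σ)]
      by_cases he : (⟨m, π⟩ : LPath l n) = ⟨m₁, σ⟩
      · cases he
        rw [R.vec_norm, R.P_mul_F, R.F_orth]
        rintro he
        cases he
        exact h rfl
      · rw [ih σ he, zero_mul, mul_zero]

theorem vec_conj {n m : ℕ} (π : Path l n m) :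
    conj (R.vec π) = R.vec π ∨ conj (R.vec π) = (-1 : ℂ) • R.vec π := by
  induction π with
  | base => exact Or.inl conj_one
  | step π j k ih =>
    rw [vec, conj_mul]
    have hk : conj (R.F _ j k) = R.F _ j k ∨ conj (R.F _ j k) = (-1 : ℂ) • R.F _ j k := by
      rw [show ∀ x : Diagram δ, (-1 : ℂ) • x = -x from fun x => neg_one_smul ℂ x]
      exact R.F_conj _ j k
    rcases ih with h | h <;> rcases hk with h' | h' <;> rw [h, h']
    · left; rfl
    · right; rw [mul_smul_comm]
    · right; rw [smul_mul_assoc]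
    · left; rw [smul_mul_smul_comm]; norm_num

theorem sum_F (m : ℕ) : ∑ e : Edge l m, R.F m e.1 e.2 * dagger (R.F m e.1 e.2) = R.P m := by
  rw [sum_edge, R.F_sum]

theorem sum_vec {n : ℕ} (hn : 0 < n) :
    ∑ π : LPath l n, R.vec π.2 * dagger (R.vec π.2) = 1 := by
  induction n, hn using Nat.le_induction with
  | base => rw [sum_path_one, vec, dagger_one, one_mul]
  | succ n hn ih =>
    rw [sum_path_succ hn, ← ih]
    refine Finset.sum_congr rfl fun π _ => ?_
    conv_rhs => rw [← R.vec_mul_P π.2, dagger_mul, R.dagger_P, mul_assoc, ← mul_assoc (R.P π.1),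
      R.P_mul_P, ← R.sum_F, Finset.sum_mul, Finset.mul_sum]
    refine Finset.sum_congr rfl fun e _ => ?_
    rw [vec, dagger_mul]
    simp only [mul_assoc]

end FusionRules
end TemperleyLieb

namespace TemperleyLieb

/-! ### The radical -/

variable {δ : ℝ} {l : ℕ}

/-- The elements of `TL_n` whose products with half diagrams have vanishing constant
coefficients. -/
def negl (δ : ℝ) (n : ℕ) : Submodule ℂ (Diagram δ) where
  carrier := {x | x ∈ diagrams δ n n ∧ ∀ (j : ℕ), ∀ u ∈ diagrams δ j n, ∀ w ∈ diagrams δ n j,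
    vev δ (w * x * u) = 0}
  zero_mem' := ⟨zero_mem _, fun j u _ w _ => by simp⟩
  add_mem' h h' := ⟨add_mem h.1 h'.1, fun j u hu w hw => by
    rw [mul_add, add_mul, map_add, h.2 j u hu w hw, h'.2 j u hu w hw, add_zero]⟩
  smul_mem' c x h := ⟨Submodule.smul_mem _ _ h.1, fun j u hu w hw => by
    rw [mul_smul_comm, smul_mul_assoc, map_smul, h.2 j u hu w hw, smul_zero]⟩

theorem mul_mem_negl {n : ℕ} {x y : Diagram δ} (hx : x ∈ diagrams δ n n) (hy : y ∈ negl δ n) :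
    x * y ∈ negl δ n :=
  ⟨mul_mem_diagrams hx hy.1, fun j u hu w hw => by
    rw [← mul_assoc w]; exact hy.2 j u hu _ (mul_mem_diagrams hw hx)⟩

/-- The span of the diagrams with less than `j` through strands. -/
def through (δ : ℝ) (n j : ℕ) : Submodule ℂ (Diagram δ) :=
  Submodule.span ℂ {x | ∃ i < j, ∃ u ∈ diagrams δ i n, ∃ w ∈ diagrams δ n i, x = u * w}

theorem mul_mul_mem_through {n j : ℕ} {x y z : Diagram δ} (hx : x ∈ through δ n (j + 1))
    (hy : y ∈ negl δ n) (hz : z ∈ through δ n (j + 1)) : x * y * z ∈ through δ n j := by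
  induction hx using Submodule.span_induction with
  | zero => simp
  | add x x' _ _ h h' => rw [add_mul, add_mul]; exact add_mem h h'
  | smul c x _ h => rw [smul_mul_assoc, smul_mul_assoc]; exact Submodule.smul_mem _ _ h
  | mem x hx =>
    obtain ⟨i, hi, u, hu, w, hw, rfl⟩ := hx
    induction hz using Submodule.span_induction with
    | zero => simp
    | add x x' _ _ h h' => rw [mul_add]; exact add_mem h h'
    | smul c x _ h => rw [mul_smul_comm]; exact Submodule.smul_mem _ _ h
    | mem z hz =>
      obtain ⟨i', hi', u', hu', w', hw', rfl⟩ := hz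
      have hm : w * y * u' ∈ diagrams δ i' i := mul_mem_diagrams (mul_mem_diagrams hw hy.1) hu'
      have e : u * w * y * (u' * w') = u * (w * y * u') * w' := by simp only [mul_assoc]
      rw [e]
      rcases Nat.lt_or_ge i j with h | h
      · rw [mul_assoc]
        exact Submodule.subset_span ⟨i, h, u, hu, _, mul_mem_diagrams hm hw', rfl⟩
      rcases Nat.lt_or_ge i' j with h' | h'
      · exact Submodule.subset_span ⟨i', h', _, mul_mem_diagrams hu hm, w', hw', rfl⟩
      obtain rfl : i = j := by omega
      obtain rfl : i' = i := by omega
      obtain ⟨v, hv, h3⟩ := eq_vev_add_capped hm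
      rw [hy.2 _ u' hu' w hw, zero_smul, zero_add] at h3
      rw [h3]
      refine capped_induction (p := fun v => u * v * w' ∈ through δ n i') hv ?_ (by simp)
        (fun a b h h' => by rw [mul_add, add_mul]; exact add_mem h h')
        (fun c a h => by rw [mul_smul_comm, smul_mul_assoc]; exact Submodule.smul_mem _ _ h)
      intro k a hk ha
      rw [← mul_assoc u, mul_assoc _ (cap δ k)]
      have hc : cap δ k ∈ diagrams δ i' (i' - 2) := cap_mem_diagrams (by omega) (by omega)
      exact Submodule.subset_span ⟨i' - 2, by omega, _, mul_mem_diagrams hu ha, cap δ k * w',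
        mul_mem_diagrams hc hw', by simp only [mul_assoc]⟩

theorem isNilpotent_of_mem_negl {n : ℕ} {x : Diagram δ} (hx : x ∈ negl δ n) : IsNilpotent x := by
  have key : ∀ j, ∀ x ∈ negl δ n, x ∈ through δ n j → IsNilpotent x := by
    intro j
    induction j with
    | zero =>
      intro x _ hx
      have : through δ n 0 = ⊥ := by
        rw [through, Submodule.span_eq_bot]
        rintro _ ⟨i, hi, -⟩
        omega
      rw [this, Submodule.mem_bot] at hx
      exact hx ▸ IsNilpotent.zero
    | succ j ih =>
      intro x hx hx'
      have := ih (x * x * x) (mul_mem_negl (mul_mem_diagrams hx.1 hx.1) hx)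
        (mul_mul_mem_through hx' hx hx')
      rw [show x * x * x = x ^ 3 by rw [pow_succ, pow_two]] at this
      obtain ⟨k, hk⟩ := this
      exact ⟨3 * k, by rw [pow_mul, hk]⟩
  exact key (n + 1) x hx (Submodule.subset_span ⟨n, Nat.lt_succ_self n, 1, one_mem_diagrams n, x,
    hx.1, (one_mul x).symm⟩)

theorem mem_jacobson_of_nilpotent {A : Type*} [Ring A] {x : A}
    (h : ∀ y : A, ∃ k : ℕ, (y * x) ^ k = 0) : x ∈ Ring.jacobson A := by
  rw [← Ideal.jacobson_bot, Ideal.mem_jacobson_iff]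
  intro y
  obtain ⟨u, hu⟩ := IsNilpotent.isUnit_one_add (h y)
  refine ⟨↑u⁻¹, ?_⟩
  have : (↑u⁻¹ : A) * u = 1 := u.inv_mul
  rw [hu, mul_add, mul_one] at this
  rw [Ideal.mem_bot, sub_eq_zero, mul_assoc, add_comm]
  exact this

theorem eq_zero_of_idempotent_mem_jacobson {A : Type*} [Ring A] {e : A}
    (h : e ∈ Ring.jacobson A) (he : e * e = e) : e = 0 := by
  rw [← Ideal.jacobson_bot, Ideal.mem_jacobson_iff] at h
  obtain ⟨z, hz⟩ := h (-1)
  rw [Ideal.mem_bot, sub_eq_zero] at hz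
  have h3 := congrArg (fun x => x * e) hz
  simp only [add_mul, one_mul, mul_neg, mul_one, neg_mul, mul_assoc, he] at h3
  rw [neg_add_cancel] at h3
  exact h3.symm

theorem mem_rad_of_mem_negl {n : ℕ} {x : TL δ} (hx : x ∈ TL.fin δ n)
    (h : toDiagram δ x ∈ negl δ n) : x ∈ TL.rad δ n := by
  refine ⟨hx, mem_jacobson_of_nilpotent fun y => ?_⟩
  obtain ⟨k, hk⟩ := isNilpotent_of_mem_negl (mul_mem_negl (toDiagram_mem y.2) h)
  refine ⟨k, Subtype.ext (toDiagram_injective ?_)⟩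
  rw [← map_mul, ← map_pow] at hk
  exact hk.trans (map_zero (toDiagram δ)).symm

theorem eq_zero_of_idempotent_mem_rad {n : ℕ} {e : TL δ} (h : e ∈ TL.rad δ n)
    (he : e * e = e) : e = 0 := by
  obtain ⟨hm, h⟩ := h
  exact congrArg Subtype.val (eq_zero_of_idempotent_mem_jacobson h (Subtype.ext he))

theorem mul_mem_rad {n : ℕ} {x y : TL δ} (hx : x ∈ TL.fin δ n) (hy : y ∈ TL.rad δ n) :
    x * y ∈ TL.rad δ n :=
  ⟨mul_mem hx hy.1, Ideal.mul_mem_left _ (⟨x, hx⟩ : TL.fin δ n) hy.2⟩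

theorem mul_mem_rad' {n : ℕ} {x y : TL δ} (hx : x ∈ TL.rad δ n) (hy : y ∈ TL.fin δ n) :
    x * y ∈ TL.rad δ n :=
  ⟨mul_mem hx.1 hy, Ideal.mul_mem_right (⟨y, hy⟩ : TL.fin δ n) _ hx.2⟩

theorem sub_mem_rad {n : ℕ} {x y : TL δ} (hx : x ∈ TL.rad δ n) (hy : y ∈ TL.rad δ n) :
    x - y ∈ TL.rad δ n :=
  ⟨sub_mem hx.1 hy.1, sub_mem hx.2 hy.2⟩

/-! ### The nilpotent morphisms -/

/-- The morphisms between idempotents with vanishing constant coefficient. -/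
def radHom (δ : ℝ) (l m m' : ℕ) : Submodule ℂ (Diagram δ) :=
  Submodule.span ℂ {c | (m = m' ∧ c = nilsq δ l m) ∨
    (Nonrigid l m ∧ m' = refl l m ∧ c = nil δ l m) ∨
    (Nonrigid l m' ∧ m = refl l m' ∧ c = dagger (nil δ l m'))}

theorem exists_radHom (hl : QRoot δ l) {m m' : ℕ} {d : Diagram δ} (hd : d ∈ diagrams δ m' m) :
    (m = m' → ∃ c ∈ radHom δ l m m', proj δ l m * d * proj δ l m' = vev δ d • proj δ l m + c) ∧
    (m ≠ m' → proj δ l m * d * proj δ l m' ∈ radHom δ l m m') := by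
  constructor
  · rintro rfl
    obtain ⟨c, hc⟩ := hom_self hl hd
    exact ⟨c • nilsq δ l m, Submodule.smul_mem _ _ (Submodule.subset_span (Or.inl ⟨rfl, rfl⟩)), hc⟩
  · intro hne
    rcases Nat.lt_or_gt_of_ne hne with h | h
    · rcases hom_gt hl h hd with h' | ⟨h1, h2, c, h3⟩
      · rw [h']; exact zero_mem _
      · rw [h3]
        exact Submodule.smul_mem _ _ (Submodule.subset_span (Or.inr (Or.inr ⟨h1, h2, rfl⟩)))
    · rcases hom_lt hl h hd with h' | ⟨h1, h2, c, h3⟩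
      · rw [h']; exact zero_mem _
      · rw [h3]
        exact Submodule.smul_mem _ _ (Submodule.subset_span (Or.inr (Or.inl ⟨h1, h2, rfl⟩)))

theorem vev_mul_nil_mul (hl : QRoot δ l) {m j : ℕ} (hm : Nonrigid l m) {a b : Diagram δ}
    (ha : a ∈ diagrams δ m j) (hb : b ∈ diagrams δ j (refl l m)) :
    vev δ (a * nil δ l m * b) = 0 := by
  have hr := refl_lt hl hm
  rcases Nat.lt_trichotomy j (refl l m) with h | h | h
  · have h1 : nil δ l m * b = 0 := by
      have h2 := capped_mul_dagger_nil hl hm (mem_capped_of_lt h (dagger_mem_diagrams hb))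
      have := congrArg dagger h2
      rwa [dagger_mul, dagger_dagger, dagger_dagger, dagger_zero] at this
    rw [mul_assoc, h1, mul_zero, map_zero]
  · subst h
    rw [vev_mul _ hb]
    suffices vev δ (a * nil δ l m) = 0 by rw [this, zero_mul]
    obtain h1 | ⟨-, y, hy, h1⟩ := capped_mul_proj hl (mem_capped_of_lt (by omega) ha)
    · rw [← proj_mul_nil hl hm, ← mul_assoc, h1, zero_mul, map_zero]
    · obtain ⟨c, hc⟩ := dagger_nil_mul_nil hl hm
      rw [← proj_mul_nil hl hm, ← mul_assoc, h1, mul_assoc, hc, mul_smul_comm, map_smul,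
        vev_mul _ (nilsq_mem hl _), vev_nilsq hl, mul_zero, smul_zero]
  · exact vev_mul_of_lt h _ hb

theorem vev_radHom (hl : QRoot δ l) {m m' j : ℕ} {a b c : Diagram δ} (hc : c ∈ radHom δ l m m')
    (ha : a ∈ diagrams δ m j) (hb : b ∈ diagrams δ j m') : vev δ (a * c * b) = 0 := by
  induction hc using Submodule.span_induction with
  | zero => simp
  | add x y _ _ h h' => rw [mul_add, add_mul, map_add, h, h', add_zero]
  | smul k x _ h => rw [mul_smul_comm, smul_mul_assoc, map_smul, h, smul_zero]
  | mem c hc =>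
    rcases hc with ⟨rfl, rfl⟩ | ⟨hm, rfl, rfl⟩ | ⟨hm, rfl, rfl⟩
    · by_cases hm : Nonrigid l m
      · rw [nilsq_eq hm, ← mul_assoc, mul_assoc _ _ b]
        exact vev_mul_nil_mul hl hm ha (mul_mem_diagrams (dagger_mem_diagrams (nil_mem hl hm)) hb)
      · rw [nilsq, if_neg hm, mul_zero, zero_mul, map_zero]
    · exact vev_mul_nil_mul hl hm ha hb
    · have h := vev_mul_nil_mul hl hm (dagger_mem_diagrams hb) (dagger_mem_diagrams ha)
      have hmem : a * dagger (nil δ l m') * b ∈ diagrams δ j j :=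
        mul_mem_diagrams (mul_mem_diagrams ha (dagger_mem_diagrams (nil_mem hl hm))) hb
      rwa [← vev_dagger hmem, dagger_mul, dagger_mul, dagger_dagger, ← mul_assoc]

theorem radHom_mem (hl : QRoot δ l) {m m' : ℕ} {c : Diagram δ} (hc : c ∈ radHom δ l m m') :
    c ∈ diagrams δ m' m := by
  refine Submodule.span_le.2 ?_ hc
  rintro c (⟨rfl, rfl⟩ | ⟨hm, rfl, rfl⟩ | ⟨hm, rfl, rfl⟩)
  · exact nilsq_mem hl _
  · exact nil_mem hl hm
  · exact dagger_mem_diagrams (nil_mem hl hm)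

end TemperleyLieb

namespace TemperleyLieb

/-! ### The decomposition of `TL_n` -/

variable {δ : ℝ} {l : ℕ}

/-- The pairs of paths of level `n` with the same end. -/
abbrev PathPair (l n : ℕ) : Type := Σ m, Path l n m × Path l n m

/-- A pair of paths with the same end as a pair of paths. -/
def PathPair.pair {n : ℕ} (i : PathPair l n) : LPath l n × LPath l n :=
  (⟨i.1, i.2.1⟩, ⟨i.1, i.2.2⟩)

theorem PathPair.pair_injective {n : ℕ} :
    Function.Injective (PathPair.pair : PathPair l n → LPath l n × LPath l n) := by
  rintro ⟨m, π, σ⟩ ⟨m', π', σ'⟩ h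
  simp only [pair, Prod.mk.injEq] at h
  obtain ⟨h1, h2⟩ := h
  cases h1
  cases h2
  rfl

noncomputable instance (l n : ℕ) : Fintype (PathPair l n) :=
  Fintype.ofInjective _ PathPair.pair_injective

theorem PathPair.sum_eq {M : Type*} [AddCommMonoid M] {n : ℕ} (f : LPath l n → LPath l n → M)
    (hf : ∀ π σ, π.1 ≠ σ.1 → f π σ = 0) :
    ∑ i : PathPair l n, f ⟨i.1, i.2.1⟩ ⟨i.1, i.2.2⟩ = ∑ π, ∑ σ, f π σ := by
  rw [← Fintype.sum_prod_type']
  refine Fintype.sum_of_injective PathPair.pair PathPair.pair_injective _ _ ?_ fun _ => rfl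
  rintro ⟨⟨m, π⟩, ⟨m', σ⟩⟩ h
  refine hf _ _ fun he => ?_
  obtain rfl : m = m' := he
  exact h ⟨⟨m, π, σ⟩, rfl⟩

namespace FusionRules

variable (R : FusionRules δ l)

theorem exists_unit {n m : ℕ} (π σ : Path l n m) :
    ∃ y ∈ TL.fin δ n, toDiagram δ y = R.vec π * dagger (R.vec σ) :=
  exists_toDiagram_eq (mul_mem_diagrams (R.vec_mem π) (dagger_mem_diagrams (R.vec_mem σ)))

theorem toDiagram_unit {n m : ℕ} (π σ : Path l n m) :
    toDiagram δ (R.unit π σ) = R.vec π * dagger (R.vec σ) := by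
  obtain ⟨y, -, hy⟩ := R.exists_unit π σ
  exact Function.invFun_eq ⟨y, hy⟩

theorem unit_mem_fin {n m : ℕ} (π σ : Path l n m) : R.unit π σ ∈ TL.fin δ n := by
  obtain ⟨y, hy, h⟩ := R.exists_unit π σ
  rwa [toDiagram_injective ((R.toDiagram_unit π σ).trans h.symm)]

theorem unit_mul_same {n m : ℕ} (π σ τ : Path l n m) :
    R.unit π σ * R.unit σ τ = R.unit π τ := by
  apply toDiagram_injective
  rw [map_mul, R.toDiagram_unit, R.toDiagram_unit, R.toDiagram_unit, mul_assoc,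
    ← mul_assoc _ (R.vec σ), R.vec_norm, ← mul_assoc, R.vec_mul_P]

theorem unit_mul_ne {n m m' : ℕ} (π σ : Path l n m) (σ' τ : Path l n m')
    (h : (⟨m, σ⟩ : LPath l n) ≠ ⟨m', σ'⟩) : R.unit π σ * R.unit σ' τ = 0 := by
  apply toDiagram_injective
  rw [map_mul, R.toDiagram_unit, R.toDiagram_unit, mul_assoc, ← mul_assoc _ (R.vec σ'),
    R.vec_orth σ σ' h, zero_mul, mul_zero, map_zero]

/-- The coefficients of an element with respect to the matrix units. -/
noncomputable def coef {n m : ℕ} (π σ : Path l n m) : TL δ →ₗ[ℂ] ℂ where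
  toFun x := vev δ (dagger (R.vec π) * toDiagram δ x * R.vec σ)
  map_add' x y := by rw [map_add, mul_add, add_mul, map_add]
  map_smul' c x := by rw [map_smul, mul_smul_comm, smul_mul_assoc, map_smul]; rfl

theorem coef_apply {n m : ℕ} (π σ : Path l n m) (x : TL δ) :
    R.coef π σ x = vev δ (dagger (R.vec π) * toDiagram δ x * R.vec σ) := rfl

/-- The component of an element in the span of the matrix units. -/
noncomputable def comp (n : ℕ) : TL δ →ₗ[ℂ] TL δ where
  toFun x := ∑ i : PathPair l n, R.coef i.2.1 i.2.2 x • R.unit i.2.1 i.2.2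
  map_add' x y := by simp only [map_add, add_smul, Finset.sum_add_distrib]
  map_smul' c x := by simp only [map_smul, smul_assoc, ← Finset.smul_sum]; rfl

theorem comp_apply (n : ℕ) (x : TL δ) :
    R.comp n x = ∑ i : PathPair l n, R.coef i.2.1 i.2.2 x • R.unit i.2.1 i.2.2 := rfl

theorem comp_mem (n : ℕ) (x : TL δ) : R.comp n x ∈ R.semisimple n :=
  sum_mem fun i _ => Subalgebra.smul_mem (R.semisimple n)
    (Algebra.subset_adjoin ⟨i.1, i.2.1, i.2.2, rfl⟩) _

variable (hl : QRoot δ l)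
include hl

theorem vev_P (m : ℕ) : vev δ (R.P m) = 1 := by rw [R.P_eq hl]; exact (proj_isProj hl m).vev

theorem coef_unit_same {n m : ℕ} (π σ : Path l n m) : R.coef π σ (R.unit π σ) = 1 := by
  rw [coef_apply, R.toDiagram_unit, ← mul_assoc, R.vec_norm, mul_assoc, R.vec_norm, R.P_mul_P,
    R.vev_P hl]

omit hl in
theorem coef_unit_ne {n : ℕ} {i j : PathPair l n} (h : i ≠ j) :
    R.coef i.2.1 i.2.2 (R.unit j.2.1 j.2.2) = 0 := by
  rw [coef_apply, R.toDiagram_unit, ← mul_assoc, mul_assoc]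
  by_cases h1 : (⟨i.1, i.2.1⟩ : LPath l n) = ⟨j.1, j.2.1⟩
  · by_cases h2 : (⟨j.1, j.2.2⟩ : LPath l n) = ⟨i.1, i.2.2⟩
    · exact absurd (PathPair.pair_injective (Prod.ext h1 h2.symm)) h
    · rw [R.vec_orth _ _ h2, mul_zero, map_zero]
  · rw [R.vec_orth _ _ h1, zero_mul, map_zero]

theorem linearIndependent (n : ℕ) :
    LinearIndependent ℂ (fun i : PathPair l n => R.unit i.2.1 i.2.2) := by
  rw [Fintype.linearIndependent_iff]
  intro g hg i
  have := congrArg (R.coef i.2.1 i.2.2) hg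
  rw [map_sum, map_zero, Finset.sum_eq_single i, map_smul, R.coef_unit_same hl] at this
  · simpa using this
  · intro j _ hj
    rw [map_smul, R.coef_unit_ne hj.symm, smul_zero]
  · exact fun h => absurd (Finset.mem_univ i) h

theorem comp_unit {n m : ℕ} (π σ : Path l n m) : R.comp n (R.unit π σ) = R.unit π σ := by
  rw [comp_apply, Finset.sum_eq_single ⟨m, π, σ⟩, R.coef_unit_same hl, one_smul]
  · intro j _ hj
    rw [R.coef_unit_ne (j := ⟨m, π, σ⟩) hj, zero_smul]
  · exact fun h => absurd (Finset.mem_univ _) h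

omit hl in
theorem sum_unit {n : ℕ} (hn : 0 < n) : ∑ π : LPath l n, R.unit π.2 π.2 = 1 := by
  apply toDiagram_injective
  rw [map_sum, map_one, ← R.sum_vec hn]
  exact Finset.sum_congr rfl fun π _ => R.toDiagram_unit _ _

omit hl in
theorem semisimple_eq_span {n : ℕ} (hn : 0 < n) : Subalgebra.toSubmodule (R.semisimple n) =
    Submodule.span ℂ {x | ∃ (m : ℕ) (π σ : Path l n m), x = R.unit π σ} := by
  refine le_antisymm ?_ (Submodule.span_le.2 fun x hx => Algebra.subset_adjoin hx)
  intro x hx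
  change x ∈ Algebra.adjoin ℂ _ at hx
  have h1 : (1 : TL δ) ∈ Submodule.span ℂ {x | ∃ (m : ℕ) (π σ : Path l n m), x = R.unit π σ} := by
    rw [← R.sum_unit hn]
    exact sum_mem fun π _ => Submodule.subset_span ⟨_, _, _, rfl⟩
  induction hx using Algebra.adjoin_induction with
  | mem x hx => exact Submodule.subset_span hx
  | algebraMap c => rw [Algebra.algebraMap_eq_smul_one]; exact Submodule.smul_mem _ _ h1
  | add x y _ _ h h' => exact add_mem h h'
  | mul x y hx hy h h' =>
    clear h1 hx hy
    induction h using Submodule.span_induction with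
    | zero => simp
    | add x x' _ _ h h' => rw [add_mul]; exact add_mem h h'
    | smul c x _ h => rw [smul_mul_assoc]; exact Submodule.smul_mem _ _ h
    | mem x hx =>
      induction h' using Submodule.span_induction with
      | zero => simp
      | add x x' _ _ h h' => rw [mul_add]; exact add_mem h h'
      | smul c x _ h => rw [mul_smul_comm]; exact Submodule.smul_mem _ _ h
      | mem y hy =>
        obtain ⟨m, π, σ, rfl⟩ := hx
        obtain ⟨m', σ', τ, rfl⟩ := hy
        by_cases h : (⟨m, σ⟩ : LPath l n) = ⟨m', σ'⟩
        · cases h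
          rw [R.unit_mul_same]; exact Submodule.subset_span ⟨_, _, _, rfl⟩
        · rw [R.unit_mul_ne _ _ _ _ h]; exact zero_mem _

omit hl in
theorem semisimple_induction {n : ℕ} (hn : 0 < n) {p : TL δ → Prop} {x : TL δ}
    (hx : x ∈ R.semisimple n) (unit : ∀ {m : ℕ} (π σ : Path l n m), p (R.unit π σ))
    (zero : p 0) (add : ∀ x y, p x → p y → p (x + y)) (smul : ∀ (c : ℂ) x, p x → p (c • x)) :
    p x := by
  have h : x ∈ Submodule.span ℂ {x | ∃ (m : ℕ) (π σ : Path l n m), x = R.unit π σ} := by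
    rw [← R.semisimple_eq_span hn]; exact hx
  induction h using Submodule.span_induction with
  | zero => exact zero
  | add x y hx' hy' h h' =>
    rw [← R.semisimple_eq_span hn] at hx' hy'
    exact add _ _ (h hx') (h' hy')
  | smul c x hx' h => rw [← R.semisimple_eq_span hn] at hx'; exact smul _ _ (h hx')
  | mem x hx' => obtain ⟨m, π, σ, rfl⟩ := hx'; exact unit π σ

omit hl in
theorem semisimple_le_fin (n : ℕ) : R.semisimple n ≤ TL.fin δ n :=
  Algebra.adjoin_le fun _ ⟨_, π, σ, h⟩ => h ▸ R.unit_mem_fin π σ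

theorem comp_of_mem {n : ℕ} (hn : 0 < n) {s : TL δ} (hs : s ∈ R.semisimple n) :
    R.comp n s = s := by
  refine R.semisimple_induction (p := fun s => R.comp n s = s) hn hs (R.comp_unit hl) (map_zero _) ?_ ?_
  · intro x y h h'; rw [map_add, h, h']
  · intro c x h; rw [map_smul, h]

theorem exists_entry {n : ℕ} {x : Diagram δ} (hx : x ∈ diagrams δ n n) (π σ : LPath l n) :
    ∃ c ∈ radHom δ l π.1 σ.1, dagger (R.vec π.2) * x * R.vec σ.2 =
      (if π.1 = σ.1 then vev δ (dagger (R.vec π.2) * x * R.vec σ.2) • R.P π.1 else 0) + c := by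
  obtain ⟨m, π⟩ := π
  obtain ⟨m', σ⟩ := σ
  set d := dagger (R.vec π) * x * R.vec σ with hd
  have hmem : d ∈ diagrams δ m' m :=
    mul_mem_diagrams (mul_mem_diagrams (dagger_mem_diagrams (R.vec_mem π)) hx) (R.vec_mem σ)
  have h1 : R.P m * d * R.P m' = d := by
    have := congrArg dagger (R.vec_mul_P π)
    rw [dagger_mul, R.dagger_P] at this
    rw [hd, ← mul_assoc, ← mul_assoc, this, mul_assoc _ (R.vec σ), R.vec_mul_P]
  rw [R.P_eq hl, R.P_eq hl] at h1
  obtain ⟨h2, h3⟩ := exists_radHom hl hmem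
  rw [h1] at h2 h3
  by_cases h : m = m'
  · obtain ⟨c, hc, h4⟩ := h2 h
    exact ⟨c, hc, by rw [if_pos h, R.P_eq hl]; exact h4⟩
  · exact ⟨d, h3 h, by rw [if_neg h, zero_add]⟩

theorem exists_sub_comp {n : ℕ} (hn : 0 < n) {x : TL δ} (hx : x ∈ TL.fin δ n) :
    ∃ c : LPath l n → LPath l n → Diagram δ, (∀ π σ, c π σ ∈ radHom δ l π.1 σ.1) ∧
      toDiagram δ (x - R.comp n x) = ∑ π, ∑ σ, R.vec π.2 * c π σ * dagger (R.vec σ.2) := by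
  choose c hc hc' using R.exists_entry hl (toDiagram_mem hx)
  refine ⟨c, hc, ?_⟩
  have h1 : toDiagram δ (R.comp n x) = ∑ π : LPath l n, ∑ σ : LPath l n,
      (if π.1 = σ.1 then vev δ (dagger (R.vec π.2) * toDiagram δ x * R.vec σ.2) •
        (R.vec π.2 * dagger (R.vec σ.2)) else 0) := by
    rw [comp_apply, map_sum, ← PathPair.sum_eq]
    · refine Finset.sum_congr rfl fun i _ => ?_
      rw [if_pos rfl, map_smul, R.toDiagram_unit]; rfl
    · intro π σ h; rw [if_neg h]
  have h2 : toDiagram δ x = ∑ π : LPath l n, ∑ σ : LPath l n,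
      R.vec π.2 * (dagger (R.vec π.2) * toDiagram δ x * R.vec σ.2) * dagger (R.vec σ.2) := by
    conv_lhs => rw [← one_mul (toDiagram δ x), ← mul_one (1 * _), ← R.sum_vec hn, Finset.sum_mul,
      Finset.sum_mul_sum]
    simp only [mul_assoc]
  rw [map_sub, h1]
  conv_lhs => enter [1]; rw [h2]
  rw [← Finset.sum_sub_distrib]
  refine Finset.sum_congr rfl fun π _ => ?_
  rw [← Finset.sum_sub_distrib]
  refine Finset.sum_congr rfl fun σ _ => ?_
  conv_lhs => enter [1]; rw [hc' π σ]
  rw [mul_add, add_mul]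
  split_ifs with h
  · rw [mul_smul_comm, smul_mul_assoc, R.vec_mul_P, add_sub_cancel_left]
  · rw [mul_zero, zero_mul, zero_add, sub_zero]

theorem sub_comp_mem_negl {n : ℕ} (hn : 0 < n) {x : TL δ} (hx : x ∈ TL.fin δ n) :
    toDiagram δ (x - R.comp n x) ∈ negl δ n := by
  obtain ⟨c, hc, h⟩ := R.exists_sub_comp hl hn hx
  rw [h]
  refine sum_mem fun π _ => sum_mem fun σ _ => ⟨?_, fun j u hu w hw => ?_⟩
  · exact mul_mem_diagrams (mul_mem_diagrams (R.vec_mem _) (radHom_mem hl (hc π σ)))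
      (dagger_mem_diagrams (R.vec_mem _))
  · have := vev_radHom hl (hc π σ) (mul_mem_diagrams hw (R.vec_mem π.2))
      (mul_mem_diagrams (dagger_mem_diagrams (R.vec_mem σ.2)) hu)
    simpa only [mul_assoc] using this

theorem sub_comp_mem_rad {n : ℕ} (hn : 0 < n) {x : TL δ} (hx : x ∈ TL.fin δ n) :
    x - R.comp n x ∈ TL.rad δ n :=
  mem_rad_of_mem_negl (sub_mem hx (R.semisimple_le_fin n (R.comp_mem n x)))
    (R.sub_comp_mem_negl hl hn hx)

theorem comp_eq_zero {n : ℕ} (hn : 0 < n) {x : TL δ} (hx : x ∈ TL.rad δ n) :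
    R.comp n x = 0 := by
  have h1 : R.comp n x ∈ TL.rad δ n := by
    have := sub_mem_rad hx (R.sub_comp_mem_rad hl hn hx.1)
    rwa [sub_sub_cancel] at this
  have key : ∀ i : PathPair l n, R.coef i.2.1 i.2.2 x = 0 := by
    rintro ⟨m, π, σ⟩
    by_contra h0
    change R.coef π σ x ≠ 0 at h0
    have h2 : R.unit π π * R.comp n x * R.unit σ π = R.coef π σ x • R.unit π π := by
      rw [comp_apply, Finset.mul_sum, Finset.sum_mul, Finset.sum_eq_single ⟨m, π, σ⟩]
      · rw [mul_smul_comm, smul_mul_assoc, R.unit_mul_same, R.unit_mul_same]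
      · rintro ⟨m', π', σ'⟩ _ hne
        rw [mul_smul_comm, smul_mul_assoc]
        by_cases h3 : (⟨m, π⟩ : LPath l n) = ⟨m', π'⟩
        · by_cases h4 : (⟨m', σ'⟩ : LPath l n) = ⟨m, σ⟩
          · exact absurd (PathPair.pair_injective (Prod.ext h3.symm h4)) hne
          · rw [mul_assoc, R.unit_mul_ne _ _ _ _ h4, mul_zero, smul_zero]
        · rw [R.unit_mul_ne _ _ _ _ h3, zero_mul, smul_zero]
      · exact fun h => absurd (Finset.mem_univ _) h
    have h3 : R.unit π π ∈ TL.rad δ n := by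
      have h4 := mul_mem_rad' (mul_mem_rad (R.unit_mem_fin π π) h1) (R.unit_mem_fin σ π)
      rw [h2] at h4
      have h5 := mul_mem_rad ((TL.fin δ n).smul_mem (one_mem _) (R.coef π σ x)⁻¹) h4
      rwa [smul_mul_assoc, one_mul, smul_smul, inv_mul_cancel₀ h0, one_smul] at h5
    have h4 := R.coef_unit_same hl π π
    rw [eq_zero_of_idempotent_mem_rad h3 (R.unit_mul_same π π π), map_zero] at h4
    exact zero_ne_one h4
  rw [comp_apply]
  exact Finset.sum_eq_zero fun i _ => by rw [key i, zero_smul]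

theorem complement {n : ℕ} (hn : 0 < n) {x s : TL δ} (hs : s ∈ R.semisimple n)
    (hxs : x - s ∈ TL.rad δ n) : s = R.comp n x := by
  have := R.comp_eq_zero hl hn hxs
  rw [map_sub, R.comp_of_mem hl hn hs, sub_eq_zero] at this
  exact this.symm

theorem part_eq {n : ℕ} (hn : 0 < n) {x : TL δ} (hx : x ∈ TL.fin δ n) :
    (R.part n x : TL δ) = R.comp n x := by
  have h : ∃ s : R.union, (s : TL δ) ∈ R.semisimple n ∧ x - (s : TL δ) ∈ TL.rad δ n :=
    ⟨⟨R.comp n x, (le_iSup R.semisimple n) (R.comp_mem n x)⟩, R.comp_mem n x,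
      R.sub_comp_mem_rad hl hn hx⟩
  rw [part, dif_pos h]
  exact R.complement hl hn h.choose_spec.1 h.choose_spec.2

omit hl in
theorem unit_eq_sum {n m : ℕ} (π σ : Path l n m) : R.unit π σ =
    ∑ e : Edge l m, R.unit (π.step e.1 e.2) (σ.step e.1 e.2) := by
  apply toDiagram_injective
  rw [map_sum, R.toDiagram_unit, ← R.vec_mul_P, ← R.sum_F, Finset.mul_sum, Finset.sum_mul]
  refine Finset.sum_congr rfl fun e _ => ?_
  rw [R.toDiagram_unit, vec, vec, dagger_mul]
  simp only [mul_assoc]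

omit hl in
theorem semisimple_zero : R.semisimple 0 = ⊥ := by
  refine le_antisymm (Algebra.adjoin_le ?_) bot_le
  rintro x ⟨m, π, -⟩
  exact isEmptyElim (⟨m, π⟩ : LPath l 0)

omit hl in
theorem semisimple_le_succ (n : ℕ) : R.semisimple n ≤ R.semisimple (n + 1) := by
  refine Algebra.adjoin_le ?_
  rintro _ ⟨m, π, σ, rfl⟩
  rw [R.unit_eq_sum]
  exact sum_mem fun e _ => Algebra.subset_adjoin ⟨_, _, _, rfl⟩

omit hl in
theorem semisimple_mono : Monotone R.semisimple := monotone_nat_of_le_succ R.semisimple_le_succ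

omit hl in
theorem mem_union {x : TL δ} : x ∈ R.union ↔ ∃ n, 0 < n ∧ x ∈ R.semisimple n := by
  constructor
  · intro hx
    have : x ∈ ((⨆ n, R.semisimple n : Subalgebra ℂ (TL δ)) : Set (TL δ)) := hx
    rw [Subalgebra.coe_iSup_of_directed R.semisimple_mono.directed_le, Set.mem_iUnion] at this
    obtain ⟨n, hn⟩ := this
    exact ⟨n + 1, Nat.succ_pos n, R.semisimple_le_succ n hn⟩
  · rintro ⟨n, -, hn⟩
    exact (le_iSup R.semisimple n) hn

theorem isMatrixDecomposition : R.IsMatrixDecomposition where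
  toDiagram_unit := R.toDiagram_unit
  linearIndependent := R.linearIndependent hl
  span n hn := R.semisimple_eq_span hn
  unit_mul_same := R.unit_mul_same
  unit_mul_ne := R.unit_mul_ne
  le_fin := R.semisimple_le_fin
  le_succ := R.semisimple_le_succ
  complement n x hx := by
    rcases Nat.eq_zero_or_pos n with rfl | hn
    · have h1 : TL.fin δ 0 = ⊥ := by
        refine le_antisymm (Algebra.adjoin_le ?_) bot_le
        rintro x ⟨i, hi, -⟩
        omega
      rw [R.semisimple_zero]
      rw [h1] at hx
      refine ⟨x, ⟨hx, by rw [sub_self]; exact ⟨zero_mem _, zero_mem _⟩⟩, ?_⟩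
      rintro s ⟨hs, hs'⟩
      obtain ⟨c, hc⟩ := Algebra.mem_bot.1 (sub_mem hx hs)
      by_contra hne
      have hc0 : c ≠ 0 := by
        rintro rfl
        rw [map_zero] at hc
        exact hne (sub_eq_zero.1 hc.symm).symm
      rw [← hc, Algebra.algebraMap_eq_smul_one] at hs'
      have h5 := mul_mem_rad ((TL.fin δ 0).smul_mem (one_mem _) c⁻¹) hs'
      rw [smul_mul_assoc, one_mul, smul_smul, inv_mul_cancel₀ hc0, one_smul] at h5
      have h6 := congrArg (fun x => vev δ (toDiagram δ x))
        (eq_zero_of_idempotent_mem_rad h5 (mul_one 1))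
      simp at h6
    · exact ⟨R.comp n x, ⟨R.comp_mem n x, R.sub_comp_mem_rad hl hn hx⟩,
        fun s hs => R.complement hl hn hs.1 hs.2⟩
  star_unit π σ := by
    rw [R.toDiagram_unit, R.toDiagram_unit, adjoint, conj_mul, conj_dagger, dagger_mul,
      dagger_dagger, show -(R.vec σ * dagger (R.vec π)) = (-1 : ℂ) • (R.vec σ * dagger (R.vec π))
      from (neg_one_smul ℂ (R.vec σ * dagger (R.vec π))).symm]
    rcases R.vec_conj π with h | h <;> rcases R.vec_conj σ with h' | h' <;> rw [h, h']
    · left; rfl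
    · right; rw [smul_mul_assoc]
    · right; rw [dagger_smul, mul_smul_comm]
    · left; rw [dagger_smul, smul_mul_smul_comm]; norm_num

end FusionRules
end TemperleyLieb

namespace TemperleyLieb

/-! ### The coefficients of the traces -/

theorem genericCoeff_succ (γ : ℝ) {m : ℕ} (hm : 0 < m) :
    genericCoeff γ m = genericCoeff γ (m + 1) + γ * genericCoeff γ (m - 1) := by
  obtain ⟨m, rfl⟩ : ∃ k, m = k + 1 := ⟨m - 1, by omega⟩
  rw [Nat.add_sub_cancel, genericCoeff]
  ring

theorem rootCoeff_of_dvd {l m : ℕ} (γ : ℝ) (h : l ∣ m + 1) :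
    rootCoeff l γ m = genericCoeff γ m := if_pos h

theorem not_dvd_of_eq {l k s m : ℕ} (hs : 0 < s) (hsl : s < l) (hm : m + 1 = k * l + s) :
    ¬ l ∣ m + 1 := by
  rw [hm]
  intro h
  have := Nat.le_of_dvd hs ((Nat.dvd_add_right (Dvd.intro_left _ rfl)).1 h)
  omega

theorem rootCoeff_of_eq {l k s m : ℕ} (γ : ℝ) (hs : 0 < s) (hsl : s < l) (hm : m + 1 = k * l + s) :
    rootCoeff l γ m = genericCoeff γ m +
      if 2 * s ≤ m then γ ^ s * genericCoeff γ (m - 2 * s) else 0 := by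
  rw [rootCoeff, if_neg (not_dvd_of_eq hs hsl hm), (div_mod_of_eq hsl hm).2]

theorem rootCoeff_zero {l : ℕ} (hl : 2 ≤ l) (γ : ℝ) : rootCoeff l γ 0 = 1 := by
  rw [rootCoeff_of_eq (k := 0) (s := 1) γ one_pos (by omega) (by omega)]
  simp [genericCoeff]

theorem rootCoeff_one {l : ℕ} (hl : 2 ≤ l) (γ : ℝ) : rootCoeff l γ 1 = 1 := by
  rcases Nat.lt_or_ge 2 l with h | h
  · rw [rootCoeff_of_eq (k := 0) (s := 2) γ two_pos h (by omega)]
    simp [genericCoeff]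
  · rw [rootCoeff_of_dvd γ (by rw [show l = 1 + 1 by omega]), genericCoeff]

theorem rootCoeff_recursion {l : ℕ} (hl : 2 ≤ l) (γ : ℝ) (m : ℕ) :
    rootCoeff l γ m = rootCoeff l γ (m + 1) +
      (if m = 0 then 0 else edges l m (m - 1) * (γ * rootCoeff l γ (m - 1))) +
      (if 2 * l ≤ m + 1 ∧ l ∣ m + 2 then γ ^ l * rootCoeff l γ (m + 1 - 2 * l) else 0) := by
  rcases Nat.eq_zero_or_pos m with rfl | hm0
  · rw [rootCoeff_zero hl, rootCoeff_one hl, if_pos rfl, if_neg (by omega)]; norm_num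
  rw [if_neg (show m ≠ 0 by omega), edges_down (show m - 1 + 1 = m by omega)]
  have h1 := Nat.div_add_mod' (m + 1) l
  have h2 := Nat.mod_lt (m + 1) (show 0 < l by omega)
  generalize (m + 1) / l = k at h1
  generalize (m + 1) % l = s at h1 h2
  have hkl : k = 0 ∨ l ≤ k * l := by
    rcases Nat.eq_zero_or_pos k with h | h
    · exact Or.inl h
    · exact Or.inr (Nat.le_mul_of_pos_left l h)
  have hg := genericCoeff_succ γ hm0
  have up : (rootCoeff l γ (m + 1) = genericCoeff γ (m + 1) +
      if 2 * s + 1 ≤ m ∧ s + 1 < l then γ ^ (s + 1) * genericCoeff γ (m - 2 * s - 1) else 0) := by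
    rcases Nat.lt_or_ge (s + 1) l with h | h
    · rw [rootCoeff_of_eq (k := k) (s := s + 1) γ (by omega) h (by omega)]
      congr 1
      split_ifs with h3 h4 h4
      · rw [show m + 1 - 2 * (s + 1) = m - 2 * s - 1 by omega]
      · omega
      · omega
      · rfl
    · rw [rootCoeff_of_dvd, if_neg (by omega), add_zero]
      exact ⟨k + 1, by rw [mul_comm, add_mul]; omega⟩
  have tot : rootCoeff l γ (m + 1) + (if 2 * l ≤ m + 1 ∧ l ∣ m + 2 then
      γ ^ l * rootCoeff l γ (m + 1 - 2 * l) else 0) = genericCoeff γ (m + 1) +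
      if 2 * s + 1 ≤ m then γ ^ (s + 1) * genericCoeff γ (m - 2 * s - 1) else 0 := by
    rw [up, add_assoc]
    congr 1
    rcases Nat.lt_or_ge (s + 1) l with h | h
    · have h3 := not_dvd_of_eq (m := m + 1) (k := k) (s := s + 1) (by omega) h (by omega)
      rw [if_neg (show ¬ (2 * l ≤ m + 1 ∧ l ∣ m + 2) from fun h' => h3 h'.2), add_zero]
      simp only [h, and_true]
    · rw [if_neg (by omega), zero_add]
      by_cases h3 : 2 * l ≤ m + 1
      · have h4 : l ∣ m + 2 := ⟨k + 1, by rw [mul_comm, add_mul]; omega⟩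
        rw [if_pos ⟨h3, h4⟩, if_pos (show 2 * s + 1 ≤ m by omega),
          rootCoeff_of_dvd γ (dvd_reflect ⟨h3, h4⟩), show s + 1 = l by omega, show m - 2 * s - 1 = m + 1 - 2 * l by omega]
      · rw [if_neg (fun h' => h3 h'.1), if_neg (show ¬ 2 * s + 1 ≤ m by omega)]
  rw [add_right_comm, tot]
  rcases s with _ | _ | s
  · have hd : l ∣ m + 1 := ⟨k, by rw [mul_comm]; omega⟩
    rw [if_pos hd, rootCoeff_of_dvd γ hd, if_pos (show 2 * 0 + 1 ≤ m by omega), hg]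
    simp
  · have hd : ¬ l ∣ m + 1 := not_dvd_of_eq (k := k) (s := 1) one_pos (by omega) (by omega)
    have hd' : l ∣ m := ⟨k, by rw [mul_comm]; omega⟩
    have hm2 : 2 ≤ m := by rcases hkl with rfl | h <;> omega
    rw [if_neg hd, if_pos hd', rootCoeff_of_eq (k := k) (s := 1) γ one_pos (by omega) (by omega),
      if_pos (show 2 * (0 + 1) ≤ m by omega), rootCoeff_of_dvd γ (show l ∣ m - 1 + 1 by
        rwa [show m - 1 + 1 = m by omega]), hg]
    have hg2 := genericCoeff_succ γ (show 0 < m - 1 by omega)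
    rw [show m - 1 + 1 = m by omega, show m - 1 - 1 = m - 2 * (0 + 1) by omega] at hg2
    push_cast
    split_ifs with h3
    · have hg3 := genericCoeff_succ γ (show 0 < m - 2 by omega)
      rw [show m - 2 + 1 = m - 1 by omega, show m - 2 - 1 = m - 2 * (0 + 1) - 1 by omega] at hg3
      linear_combination γ * hg3
    · obtain rfl : m = 2 := by omega
      norm_num [genericCoeff]; ring
  · have hd : ¬ l ∣ m + 1 := not_dvd_of_eq (k := k) (s := s + 2) (by omega) (by omega) (by omega)
    have hd' : ¬ l ∣ m := by
      have := not_dvd_of_eq (l := l) (m := m - 1) (k := k) (s := s + 1) (by omega) (by omega)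
        (by omega)
      rwa [show m - 1 + 1 = m by omega] at this
    rw [if_neg hd, if_neg hd', rootCoeff_of_eq (k := k) (s := s + 2) γ (by omega) h2 (by omega),
      rootCoeff_of_eq (m := m - 1) (k := k) (s := s + 1) γ (by omega) (by omega) (by omega), hg]
    rcases Nat.lt_or_ge m (2 * (s + 2)) with h3 | h3
    · rw [if_neg (show ¬ 2 * (s + 1 + 1) + 1 ≤ m by omega), if_neg (show ¬ 2 * (s + 2) ≤ m by omega),
        if_neg]
      · simp
      · intro h4
        rcases hkl with rfl | h5 <;> omega
    · rw [if_pos h3, if_pos (show 2 * (s + 1) ≤ m - 1 by omega),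
        show m - 1 - 2 * (s + 1) = m - 2 * (s + 2) + 1 by omega]
      split_ifs with h4
      · have hg3 := genericCoeff_succ γ (show 0 < m - 2 * (s + 2) by omega)
        push_cast
        linear_combination γ ^ (s + 2) * hg3
      · rw [show m - 2 * (s + 2) = 0 by omega]
        norm_num [genericCoeff]; ring

end TemperleyLieb

namespace TemperleyLieb

/-! ### Traces on diagrams -/

variable {δ : ℝ} {l : ℕ} (χ : TL δ →ₗ[ℂ] ℂ)

theorem exists_ofDiagram (δ : ℝ) :
    ∃ g : Diagram δ →ₗ[ℂ] TL δ, g ∘ₗ (toDiagram δ).toLinearMap = LinearMap.id :=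
  LinearMap.exists_leftInverse_of_injective _ (LinearMap.ker_eq_bot.2 toDiagram_injective)

/-- The extension of a functional on `TL_∞` to diagrams. -/
noncomputable def diagTrace : Diagram δ →ₗ[ℂ] ℂ := χ ∘ₗ (exists_ofDiagram δ).choose

theorem diagTrace_toDiagram (x : TL δ) : diagTrace χ (toDiagram δ x) = χ x :=
  congrArg χ (LinearMap.congr_fun (exists_ofDiagram δ).choose_spec x)

/-- The functional `x ↦ χ (∪^k x ∩^k)`. -/
noncomputable def shiftTrace (k : ℕ) : Diagram δ →ₗ[ℂ] ℂ :=
  diagTrace χ ∘ₗ LinearMap.mulRight ℂ (cap δ 1 ^ k) ∘ₗ LinearMap.mulLeft ℂ (cup δ 0 ^ k)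

theorem shiftTrace_apply (k : ℕ) (x : Diagram δ) :
    shiftTrace χ k x = diagTrace χ (cup δ 0 ^ k * x * cap δ 1 ^ k) := rfl

theorem cap_pow_mul_cup_pow (k : ℕ) : cap δ 1 ^ k * cup δ 0 ^ k = 1 := by
  induction k with
  | zero => simp
  | succ k ih =>
    rw [pow_succ, pow_succ', mul_assoc, ← mul_assoc (cap δ 1), cap_cup_zag, one_mul, ih]

theorem cup_pow_mem (a k : ℕ) : cup δ 0 ^ k ∈ diagrams δ a (a + 2 * k) := by
  induction k with
  | zero => rw [pow_zero]; exact one_mem_diagrams a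
  | succ k ih =>
    rw [pow_succ']; exact mul_mem_diagrams (cup_mem_diagrams (Nat.zero_le (a + 2 * k)) rfl) ih

theorem cap_pow_mem {a : ℕ} (ha : 1 ≤ a) (k : ℕ) : cap δ 1 ^ k ∈ diagrams δ (a + 2 * k) a := by
  induction k with
  | zero => rw [pow_zero]; exact one_mem_diagrams a
  | succ k ih =>
    rw [pow_succ]
    exact mul_mem_diagrams ih (cap_mem_diagrams (a := a + 2 * k) (by omega) rfl)

variable {χ}

theorem diagTrace_comm (hχ : IsNormalizedTrace χ) {n : ℕ} {x y : Diagram δ}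
    (hx : x ∈ diagrams δ n n) (hy : y ∈ diagrams δ n n) :
    diagTrace χ (x * y) = diagTrace χ (y * x) := by
  obtain ⟨x, -, rfl⟩ := exists_toDiagram_eq hx
  obtain ⟨y, -, rfl⟩ := exists_toDiagram_eq hy
  rw [← map_mul, ← map_mul, diagTrace_toDiagram, diagTrace_toDiagram, hχ.2]

theorem shiftTrace_comm (hχ : IsNormalizedTrace χ) {a b k : ℕ} (hk : b = a + 2 * k)
    {x y : Diagram δ} (hx : x ∈ diagrams δ a b) (hy : y ∈ diagrams δ b a) (j : ℕ) :
    shiftTrace χ j (x * y) = shiftTrace χ (j + k) (y * x) := by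
  have hx' := mul_mem_diagrams (mul_mem_diagrams (cup_pow_mem (b + 1) j)
    (diagrams_mono (a' := a + 1) (b' := b + 1) hx (by omega) (by omega)))
    (cap_pow_mem (by omega) (j + k))
  have hy' := mul_mem_diagrams (mul_mem_diagrams (cup_pow_mem (a + 1) (j + k))
    (diagrams_mono (a' := b + 1) (b' := a + 1) hy (by omega) (by omega)))
    (cap_pow_mem (by omega) j)
  rw [show a + 1 + 2 * (j + k) = b + 1 + 2 * j by omega] at hx' hy'
  have key : ∀ (i i' : ℕ) (u v : Diagram δ), cup δ 0 ^ i * (u * v) * cap δ 1 ^ i =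
      cup δ 0 ^ i * u * cap δ 1 ^ i' * (cup δ 0 ^ i' * v * cap δ 1 ^ i) := fun i i' u v => by
    simp only [mul_assoc]
    rw [← mul_assoc (cap δ 1 ^ i'), cap_pow_mul_cup_pow, one_mul]
  rw [shiftTrace_apply, shiftTrace_apply, key j (j + k), key (j + k) j, diagTrace_comm hχ hx' hy']

theorem trace_toDiagram (x : TL δ) : shiftTrace χ 0 (toDiagram δ x) = χ x := by
  rw [shiftTrace_apply, pow_zero, pow_zero, one_mul, mul_one, diagTrace_toDiagram]

theorem shiftTrace_nilsq (hl : QRoot δ l) (hχ : IsNormalizedTrace χ) (p m : ℕ) :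
    shiftTrace χ p (nilsq δ l m) = 0 := by
  induction m using Nat.strong_induction_on generalizing p with
  | _ m ih =>
  by_cases hm : Nonrigid l m
  · have h := refl_lt hl hm
    obtain ⟨c, hc⟩ := dagger_nil_mul_nil hl hm
    rw [nilsq_eq hm, shiftTrace_comm hχ (k := (m + 1) % l) h.1.symm (nil_mem hl hm)
      (dagger_mem_diagrams (nil_mem hl hm)), hc, map_smul, ih _ (by omega), smul_zero]
  · rw [nilsq, if_neg hm, map_zero]

theorem spinTrace_shift (p : ℂ) (k : ℕ) :
    shiftTrace (spinTrace δ p) k 1 = (p * (1 - p)) ^ k := by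
  have h1 := cup_pow_mem (δ := δ) 1 k
  have h2 := cap_pow_mem (δ := δ) (a := 1) le_rfl k
  obtain ⟨x, hx, hx'⟩ := exists_toDiagram_eq (mul_mem_diagrams h1 h2)
  rw [shiftTrace_apply, mul_one, ← hx', diagTrace_toDiagram, spinTrace_apply p hx, hx',
    spinTraceAux_comm p rfl h1 h2, cap_pow_mul_cup_pow, spinTraceAux_one, mul_one]

namespace FusionRules

variable (R : FusionRules δ l)

/-- The value of a trace on the minimal idempotents with `m` through strands. -/
noncomputable def weight (χ : TL δ →ₗ[ℂ] ℂ) (p m : ℕ) : ℂ := shiftTrace χ p (R.P m)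

theorem weight_eq_sum (hχ : IsNormalizedTrace χ) (p m : ℕ) : R.weight χ p m =
    ∑ e : Edge l m, R.weight χ (p + (m + 1 - e.1) / 2) e.1 := by
  rw [weight, ← R.sum_F, map_sum]
  refine Finset.sum_congr rfl fun e _ => ?_
  rw [shiftTrace_comm hχ (k := (m + 1 - e.1) / 2) (by
    rcases edges_cases e.2 with h | h | h <;> omega) (R.F_mem _ _ _)
    (dagger_mem_diagrams (R.F_mem _ _ _)), R.F_norm, weight]

theorem trace_vec (hχ : IsNormalizedTrace χ) {n m m' : ℕ} (π : Path l n m) (σ : Path l n m')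
    {c : Diagram δ} (hc : c ∈ diagrams δ m' m) :
    shiftTrace χ 0 (R.vec π * c * dagger (R.vec σ)) =
      shiftTrace χ ((n - m') / 2) (dagger (R.vec σ) * R.vec π * c) := by
  rw [shiftTrace_comm hχ (k := (n - m') / 2) σ.parity (mul_mem_diagrams (R.vec_mem π) hc)
    (dagger_mem_diagrams (R.vec_mem σ)), zero_add, mul_assoc]

theorem trace_unit (hχ : IsNormalizedTrace χ) {n m : ℕ} (π σ : Path l n m) [Decidable (π = σ)] :
    χ (R.unit π σ) = if π = σ then R.weight χ ((n - m) / 2) m else 0 := by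
  rw [← trace_toDiagram, R.toDiagram_unit, ← mul_one (R.vec π),
    R.trace_vec hχ π σ (one_mem_diagrams m), mul_one]
  split_ifs with h
  · rw [h, R.vec_norm, weight]
  · rw [R.vec_orth σ π (fun he => h (by cases he; rfl)), map_zero]

theorem trace_rad (R : FusionRules δ l) (hl : QRoot δ l) (hχ : IsNormalizedTrace χ) {n : ℕ} (hn : 0 < n) {x : TL δ}
    (hx : x ∈ TL.rad δ n) : χ x = 0 := by
  obtain ⟨c, hc, h⟩ := R.exists_sub_comp hl hn hx.1
  rw [R.comp_eq_zero hl hn hx, sub_zero] at h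
  rw [← trace_toDiagram, h, map_sum]
  refine Finset.sum_eq_zero fun π _ => ?_
  rw [map_sum]
  refine Finset.sum_eq_zero fun σ _ => ?_
  rw [R.trace_vec hχ _ _ (radHom_mem hl (hc π σ))]
  by_cases he : σ = π
  · subst he
    rw [R.vec_norm, R.P_eq hl]
    have hd := hc σ σ
    generalize c σ σ = d at hd ⊢
    induction hd using Submodule.span_induction with
    | zero => rw [mul_zero, map_zero]
    | add x y _ _ h h' => rw [mul_add, map_add, h, h', add_zero]
    | smul k x _ h => rw [mul_smul_comm, map_smul, h, smul_zero]
    | mem c hc =>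
      rcases hc with ⟨-, rfl⟩ | ⟨h1, h2, -⟩ | ⟨h1, h2, -⟩
      · rw [proj_mul_nilsq hl, shiftTrace_nilsq hl hχ]
      · have := refl_lt hl h1; omega
      · have := refl_lt hl h1; omega
  · rw [R.vec_orth _ _ he, zero_mul, map_zero]

theorem trace_comp (R : FusionRules δ l) (hl : QRoot δ l) (hχ : IsNormalizedTrace χ) {n : ℕ} (hn : 0 < n) {x : TL δ}
    (hx : x ∈ TL.fin δ n) : χ (R.comp n x) = χ x := by
  rw [eq_comm, ← sub_eq_zero, ← map_sub, R.trace_rad hl hχ hn (R.sub_comp_mem_rad hl hn hx)]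

theorem weight_zero (p : ℕ) : R.weight χ p 0 = shiftTrace χ p 1 := by rw [weight, R.P_zero]

theorem weight_one (p : ℕ) : R.weight χ p 1 = shiftTrace χ p 1 := by rw [weight, R.P_one]

theorem weight_recursion (hl : 2 ≤ l) (hχ : IsNormalizedTrace χ) (p m : ℕ) : R.weight χ p m =
    R.weight χ p (m + 1) + (if m = 0 then 0 else
      edges l m (m - 1) * R.weight χ (p + 1) (m - 1)) +
      (if 2 * l ≤ m + 1 ∧ l ∣ m + 2 then R.weight χ (p + l) (m + 1 - 2 * l) else 0) := by
  rw [R.weight_eq_sum hχ, sum_edge]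
  simp only [Finset.sum_const, Finset.card_univ, Fintype.card_fin, nsmul_eq_mul]
  rw [sum_range_edges hl m (fun j => (edges l m j : ℂ) * R.weight χ (p + (m + 1 - j) / 2) j)
    (fun j h => by rw [h]; simp)]
  congr 1
  · congr 1
    · rw [edges, if_pos rfl, Nat.sub_self]; simp
    · split_ifs with h
      · rfl
      · rw [show (m + 1 - (m - 1)) / 2 = 1 by omega]
  · split_ifs with h
    · rw [show (m + 1 - (m + 1 - 2 * l)) / 2 = l by omega]
      have : edges l m (m + 1 - 2 * l) = 1 := by
        have hd := h.2
        rw [show m + 2 = m + 1 - 2 * l + 1 + l * 2 by omega] at hd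
        rw [edges, if_neg (show m + 1 - 2 * l ≠ m + 1 by omega),
          if_neg (show m + 1 - 2 * l + 1 ≠ m by omega),
          if_pos ⟨by omega, (Nat.dvd_add_left (dvd_mul_right l 2)).1 hd⟩]
      rw [this]; simp
    · rfl

theorem weight_eq (hl : 2 ≤ l) (hχ : IsNormalizedTrace χ) {γ : ℝ}
    (h : ∀ k, shiftTrace χ k 1 = (γ : ℂ) ^ k) (p m : ℕ) :
    R.weight χ p m = ((γ ^ p * rootCoeff l γ m : ℝ) : ℂ) := by
  induction m using Nat.strong_induction_on generalizing p with
  | _ m ih =>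
  obtain _ | m := m
  · rw [R.weight_zero, h, rootCoeff_zero hl]; simp
  have h1 := R.weight_recursion hl hχ p m
  have h2 := congrArg (fun x : ℝ => (x : ℂ)) (rootCoeff_recursion hl γ m)
  rw [ih m (by omega)] at h1
  have h3 : (if m = 0 then 0 else (edges l m (m - 1) : ℂ) * R.weight χ (p + 1) (m - 1)) =
      γ ^ p * (if m = 0 then 0 else (edges l m (m - 1) : ℂ) * (γ * rootCoeff l γ (m - 1))) := by
    split_ifs
    · rw [mul_zero]
    · rw [ih _ (by omega)]; push_cast; ring
  have h4 : (if 2 * l ≤ m + 1 ∧ l ∣ m + 2 then R.weight χ (p + l) (m + 1 - 2 * l) else 0) =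
      γ ^ p * (if 2 * l ≤ m + 1 ∧ l ∣ m + 2 then (γ : ℂ) ^ l * rootCoeff l γ (m + 1 - 2 * l)
        else 0) := by
    split_ifs
    · rw [ih _ (by omega)]; push_cast; ring
    · rw [mul_zero]
  rw [h3, h4] at h1
  simp only [apply_ite Complex.ofReal, Complex.ofReal_add, Complex.ofReal_mul, Complex.ofReal_pow,
    Complex.ofReal_zero, Complex.ofReal_natCast] at h1 h2 ⊢
  linear_combination (γ : ℂ) ^ p * h2 - h1

theorem weight_congr (hl : 2 ≤ l) {χ' : TL δ →ₗ[ℂ] ℂ} (hχ : IsNormalizedTrace χ)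
    (hχ' : IsNormalizedTrace χ') (h : ∀ k, shiftTrace χ k 1 = shiftTrace χ' k 1) (p m : ℕ) :
    R.weight χ p m = R.weight χ' p m := by
  induction m using Nat.strong_induction_on generalizing p with
  | _ m ih =>
  obtain _ | m := m
  · rw [R.weight_zero, R.weight_zero, h]
  have h1 := R.weight_recursion hl hχ p m
  have h2 := R.weight_recursion hl hχ' p m
  rw [ih m (by omega), h2, add_assoc, add_assoc] at h1
  have h3 : (if m = 0 then 0 else (edges l m (m - 1) : ℂ) * R.weight χ (p + 1) (m - 1)) =
      (if m = 0 then 0 else (edges l m (m - 1) : ℂ) * R.weight χ' (p + 1) (m - 1)) := by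
    rw [ih _ (by omega)]
  have h4 : (if 2 * l ≤ m + 1 ∧ l ∣ m + 2 then R.weight χ (p + l) (m + 1 - 2 * l) else 0) =
      (if 2 * l ≤ m + 1 ∧ l ∣ m + 2 then R.weight χ' (p + l) (m + 1 - 2 * l) else 0) := by
    rw [ih _ (by omega)]
  rw [h3, h4] at h1
  exact (add_right_cancel h1).symm

theorem trace_ext (R : FusionRules δ l) (hl : QRoot δ l) {χ' : TL δ →ₗ[ℂ] ℂ} (hχ : IsNormalizedTrace χ)
    (hχ' : IsNormalizedTrace χ') (h : ∀ k, shiftTrace χ k 1 = shiftTrace χ' k 1) : χ = χ' := by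
  classical
  ext x
  obtain ⟨n, hx⟩ := TL.exists_mem_fin x
  have hx' := TL.fin_mono (Nat.le_succ n) hx
  rw [← R.trace_comp hl hχ n.succ_pos hx', ← R.trace_comp hl hχ' n.succ_pos hx', comp_apply,
    map_sum, map_sum]
  refine Finset.sum_congr rfl fun i _ => ?_
  rw [map_smul, map_smul, R.trace_unit hχ, R.trace_unit hχ', R.weight_congr hl.two_le hχ hχ' h]

theorem exists_path_one (hl : 2 ≤ l) (k : ℕ) : Nonempty (Path l (2 * k + 1) 1) := by
  induction k with
  | zero => exact ⟨.base⟩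
  | succ k ih =>
    obtain ⟨π⟩ := ih
    rcases eq_or_ne l 3 with rfl | h
    · exact ⟨(π.step 0 ⟨0, by simp [edges]⟩).step 1 ⟨0, by simp [edges]⟩⟩
    · refine ⟨(π.step 2 ⟨0, by simp [edges]⟩).step 1 ⟨0, ?_⟩⟩
      rw [edges_down rfl, if_neg (fun hd => ?_)]
      · split_ifs <;> norm_num
      · have := Nat.le_of_dvd (by norm_num) hd
        interval_cases l <;> omega

theorem hasParameter_iff (hl : QRoot δ l) (hχ : IsNormalizedTrace χ) (γ : ℝ) :
    R.HasParameter γ χ ↔ ∀ k, shiftTrace χ k 1 = (γ : ℂ) ^ k := by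
  classical
  constructor
  · intro h k
    obtain ⟨π⟩ := exists_path_one hl.two_le k
    have h1 := h π
    rw [R.trace_unit hχ, if_pos rfl, rootCoeff_one hl.two_le, R.weight_one,
      show (2 * k + 1 - 1) / 2 = k by omega] at h1
    rw [h1]; push_cast; ring
  · intro h n m π
    rw [R.trace_unit hχ, if_pos rfl, R.weight_eq hl.two_le hχ h]

theorem existsUnique_trace (hl : QRoot δ l) (γ : ℝ) :
    ∃! χ : TL δ →ₗ[ℂ] ℂ, IsNormalizedTrace χ ∧ R.HasParameter γ χ := by
  obtain ⟨s, hs⟩ := IsAlgClosed.exists_pow_nat_eq (1 - 4 * γ : ℂ) two_pos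
  have hp : (1 + s) / 2 * (1 - (1 + s) / 2) = (γ : ℂ) := by linear_combination -hs / 4
  refine ⟨spinTrace δ ((1 + s) / 2), ⟨spinTrace_normalized _, ?_⟩, fun χ hχ => ?_⟩
  · exact (R.hasParameter_iff hl (spinTrace_normalized _) γ).2 fun k => by
      rw [spinTrace_shift, hp]
  · exact R.trace_ext hl hχ.1 (spinTrace_normalized _) fun k => by
      rw [(R.hasParameter_iff hl hχ.1 γ).1 hχ.2, spinTrace_shift, hp]

end FusionRules
end TemperleyLieb

namespace TemperleyLieb

/-! ### Matrix entries of the radical -/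

variable {δ : ℝ} {l : ℕ}

theorem QRoot.abs_symm (hl : QRoot δ l) {s : ℕ} (hs : s ≤ l) : |qn δ (l - s)| = |qn δ s| := by
  rw [hl.symm s hs, abs_mul, show |qn δ (l - 1)| = 1 from
    (pow_eq_one_iff_of_nonneg (abs_nonneg _) two_ne_zero).1 (by rw [sq_abs, hl.sq]), one_mul]

theorem QRoot.nonrigid (_hl : QRoot δ l) {k s m : ℕ} (hs : 0 < s) (hsl : s < l)
    (hm : m + 1 = (k + 1) * l + s) :
    Nonrigid l m ∧ refl l m + 1 + s = (k + 1) * l ∧ refl l m + 1 = k * l + (l - s) := by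
  have h := div_mod_of_eq hsl hm
  have h1 : (k + 1) * l = k * l + l := by ring
  refine ⟨⟨by omega, not_dvd_of_eq hs hsl hm⟩, ?_, ?_⟩ <;> rw [refl, h.2] <;> omega

theorem nil_succ {k s m : ℕ} (hsl : s + 1 < l) (hm : m + 1 = (k + 1) * l + s) :
    nil δ l (m + 1) = nil δ l m * cup δ ((k + 1) * l - 2 - s) := by
  rw [nil_eq (k := k + 1) hsl (by omega), nil_eq (show s < l by omega) hm, nest, mul_assoc]

theorem cap_mul_nil (hl : QRoot δ l) {k s m : ℕ} (hsl : s + 1 < l) (hm : m + 1 = (k + 1) * l + s) :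
    cap δ m * nil δ l (m + 1) = nil δ l m := by
  have h := link hl k
  have h1 : (k + 1) * l = k * l + l := by ring
  have h2 := congrArg dagger (h.unnest_J_cup (s := s) (by omega))
  rw [dagger_mul, dagger_mul, dagger_mul, dagger_unnest, dagger_unnest, h.J_proj.dag, dagger_cup,
    show (k + 1) * l - 2 + 1 + s = m by omega] at h2
  rw [nil_eq hsl (show m + 1 + 1 = (k + 1) * l + (s + 1) by omega), nil_eq (by omega) hm, h2]

namespace FusionRules

variable (R : FusionRules δ l)

theorem F_down (hl : QRoot δ l) {k s j : ℕ} (hs : s + 2 < l) (hj : j + 2 = k * l + (s + 2))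
    (i : Fin (edges l (j + 1) j)) : ∃ a b : ℂ, ‖a‖ ^ 2 * |qn δ (s + 2)| = |qn δ (s + 1)| ∧
      R.F (j + 1) j i = proj δ l (j + 1) * cup δ j * (a • proj δ l j + b • nilsq δ l j) := by
  obtain ⟨g, ⟨a, b, ha, hg⟩, h1, -, h3⟩ := exists_down_of_two_le (m := j + 1) hl hs hj
  have hq2 : qn δ (s + 2) ≠ 0 := hl.ne_zero _ (by omega) (by omega)
  have hE : edges l (j + 1) j = 1 := by
    rw [edges_down rfl, if_neg (not_dvd_of_eq (s := s + 2) (by omega) hs hj),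
      if_neg (not_dvd_of_eq (m := j) (k := k) (s := s + 1) (by omega) (by omega) (by omega))]
  obtain ⟨hmem, hDP, hPD, -⟩ := h1 j 0 rfl (by omega)
  have h3 := h3 j rfl
  rw [hE, Finset.sum_range_one] at h3
  rw [Nat.add_sub_cancel] at h3 hDP hPD hmem
  set D := proj δ l (j + 1) * cup δ j * g * proj δ l j with hD
  set G := R.F (j + 1) j i with hG
  have hGm : G ∈ diagrams δ j (j + 2) := R.F_mem _ _ _
  have hGP : G * proj δ l j = G := by rw [← R.P_eq hl]; exact R.F_mul_P _ _ _
  have hPG : proj δ l (j + 1) * G = G := by rw [← R.P_eq hl]; exact R.P_mul_F _ _ _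
  have hup : proj δ l (j + 2) * G = 0 := by
    have := R.F_orth (j + 1) (j + 2) j ⟨0, by simp [edges]⟩ i (by simp)
    rwa [R.F_up, R.dagger_P, R.P_eq hl] at this
  have hU : upper δ l (j + 1) * G = 0 := by
    by_cases h : 2 * l ≤ j + 1 + 1 ∧ l ∣ j + 1 + 2
    · have hd := h.2
      rw [show j + 1 + 2 = j + 2 - 2 * l + 1 + l * 2 by omega] at hd
      obtain ⟨K, hK, hKP, -, -, -, -, hKK⟩ := exists_third hl (m := j + 1) (j := j + 2 - 2 * l)
        (by omega) ((Nat.dvd_add_left (dvd_mul_right l 2)).1 hd)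
      have hKG : dagger K * G = 0 := by
        have hKP' : proj δ l (j + 2 - 2 * l) * dagger K = dagger K := by
          rw [← dagger_proj hl, ← dagger_mul, hKP]
        have := hom_gt hl (m := j) (j := j + 2 - 2 * l) (by omega)
          (mul_mem_diagrams (dagger_mem_diagrams hK) hGm)
        rw [mul_assoc, mul_assoc, hGP, ← mul_assoc, hKP'] at this
        rcases this with h | ⟨-, h', -⟩
        · exact h
        · have := (div_mod_of_eq (l := l) (m := j) (k := k) (s := s + 1) (by omega) (by omega)).2
          rw [refl, this] at h'
          omega
      rw [sub_eq_iff_eq_add.1 hKK, add_mul, mul_assoc, hKG, mul_zero, zero_add, hup]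
    · rw [upper_eq hl h, hup]
  have hGD : G = D * (dagger D * G) := by
    conv_rhs => rw [← mul_assoc, ← h3, sub_mul, hU, sub_zero, hPG]
  have hdD : proj δ l j * dagger D = dagger D := by
    rw [← dagger_proj hl, ← dagger_mul, hDP]
  have hd : dagger D * G ∈ diagrams δ j j := mul_mem_diagrams (dagger_mem_diagrams hmem) hGm
  obtain ⟨c, hc⟩ := hom_self hl hd
  rw [mul_assoc, mul_assoc, hGP, ← mul_assoc, hdD] at hc
  set x := vev δ (dagger D * G) with hx
  have hxx : x * x = 1 := by
    have h5 : dagger (dagger D * G) * (dagger D * G) = proj δ l j := by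
      conv_lhs => rw [dagger_mul, dagger_dagger, mul_assoc, ← hGD]
      rw [← R.P_eq hl]
      exact R.F_norm _ _ _
    have h6 := congrArg (vev δ) h5
    rwa [vev_mul _ hd, vev_dagger hd, (proj_isProj hl j).vev] at h6
  have hYP : alcY δ l k * proj δ l j = ((qn δ (s + 1) : ℝ) : ℂ) • nilsq δ l j :=
    alcY_mul_proj hl (by omega) (by omega) (by omega)
  have hYN : alcY δ l k * nilsq δ l j = 0 := by
    rw [← proj_mul_nilsq hl, ← mul_assoc, hYP, smul_mul_assoc, nilsq_mul_nilsq hl, smul_zero]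
  refine ⟨a * x, a * c + b * qn δ (s + 1) * x, ?_, ?_⟩
  · have : ‖a * x‖ ^ 2 = |qn δ (s + 1)| / |qn δ (s + 2)| := by
      rw [← norm_pow, show (a * x) ^ 2 = a * a * (x * x) by ring, ha, hxx, mul_one,
        Complex.norm_real, Real.norm_eq_abs, abs_div]
    rw [this, div_mul_cancel₀ _ (abs_ne_zero.2 hq2)]
  · have hgx : g * (x • proj δ l j + c • nilsq δ l j) =
        (a * x) • proj δ l j + (a * c + b * qn δ (s + 1) * x) • nilsq δ l j := by
      rw [hg, add_mul, smul_mul_assoc, smul_mul_assoc, one_mul, mul_add (alcY δ l k), mul_smul_comm,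
        mul_smul_comm, hYP, hYN]
      module
    conv_lhs => rw [hGD, hc, hD]
    rw [mul_assoc _ (proj δ l j), mul_add, mul_smul_comm, mul_smul_comm, proj_mul_proj hl,
      proj_mul_nilsq hl, mul_assoc _ g, hgx]

variable {k s m : ℕ}

theorem entry_up_down (hl : QRoot δ l) (hs : 0 < s) (hsl : s + 1 < l)
    (hm : m + 1 = (k + 1) * l + s) {j : ℕ} (hj : j + 1 = refl l m)
    (i : Fin (edges l (refl l m) j)) : ∃ a : ℂ, ‖a‖ ^ 2 * |qn δ s| = |qn δ (s + 1)| ∧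
      R.P (m + 1) * nil δ l m * R.F (refl l m) j i = a • nil δ l (m + 1) := by
  obtain ⟨hnr, h1, h2⟩ := hl.nonrigid hs (by omega) hm
  obtain ⟨hnr', h3, -⟩ := hl.nonrigid (m := m + 1) (k := k) (s := s + 1) (by omega) hsl (by omega)
  obtain ⟨t, ht⟩ : ∃ t, l - s = t + 2 := ⟨l - s - 2, by omega⟩
  have hrm := proj_mul_nil hl hnr'
  have hrm' := nil_mul_proj hl hnr'
  have hN := nil_mul_nilsq hl hnr'
  have hnp := nil_mul_proj hl hnr
  rw [show refl l (m + 1) = j by omega] at hrm' hN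
  have hsucc : nil δ l m * cup δ j = nil δ l (m + 1) := by
    rw [nil_succ hsl hm]; congr 2; omega
  clear hnr
  generalize refl l m = r at *
  subst hj
  obtain ⟨a, b, ha, hF⟩ := R.F_down hl (s := t) (k := k) (by omega) (by omega) i
  refine ⟨a, ?_, ?_⟩
  · rw [← hl.abs_symm (s := s) (by omega), ← hl.abs_symm (s := s + 1) (by omega), ht, show l - (s + 1) = t + 1 by omega]
    exact ha
  · rw [hF, R.P_eq hl, mul_assoc, mul_assoc (proj δ l (j + 1)), ← mul_assoc (nil δ l m), hnp,
      ← mul_assoc (nil δ l m), hsucc, mul_add, mul_smul_comm, mul_smul_comm, hrm', hN, smul_zero,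
      add_zero, mul_smul_comm, hrm]

theorem entry_down_up (hl : QRoot δ l) (hs : 0 < s) (hsl : s + 1 < l)
    (hm : m + 1 = (k + 1) * l + s) (i : Fin (edges l (m + 1) m)) :
    ∃ a : ℂ, ‖a‖ ^ 2 * |qn δ (s + 1)| = |qn δ s| ∧
      dagger (R.F (m + 1) m i) * nil δ l (m + 1) * R.P (refl l m) = a • nil δ l m := by
  obtain ⟨hnr, -, -⟩ := hl.nonrigid hs (by omega) hm
  obtain ⟨hnr', -, -⟩ := hl.nonrigid (m := m + 1) (k := k) (s := s + 1) (by omega) hsl (by omega)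
  obtain ⟨t, rfl⟩ : ∃ t, s = t + 1 := ⟨s - 1, by omega⟩
  obtain ⟨a, b, ha, hF⟩ := R.F_down hl (s := t) (k := k + 1) (by omega) (by omega) i
  refine ⟨a, ha, ?_⟩
  rw [hF, R.P_eq hl, dagger_mul, dagger_mul, dagger_cup, dagger_proj hl, dagger_add, dagger_smul,
    dagger_smul, dagger_proj hl, dagger_nilsq, mul_assoc, mul_assoc, mul_assoc,
    ← mul_assoc (proj δ l (m + 1)), proj_mul_nil hl hnr', ← mul_assoc (cap δ m),
    cap_mul_nil hl hsl hm, nil_mul_proj hl hnr, add_mul, smul_mul_assoc, smul_mul_assoc,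
    proj_mul_nil hl hnr, nilsq_mul_nil hl hnr, smul_zero, add_zero]

end FusionRules
end TemperleyLieb

namespace TemperleyLieb
namespace FusionRules

variable {δ : ℝ} {l : ℕ} (R : FusionRules δ l) {k s m : ℕ}

theorem nil_entry (hl : QRoot δ l) (hs : 0 < s) (hsl : s < l) (hm : m + 1 = (k + 1) * l + s)
    (e : Edge l m) (f : Edge l (refl l m)) :
    dagger (R.F m e.1 e.2) * nil δ l m * R.F (refl l m) f.1 f.2 = 0 ∨
    (e.1 = f.1 ∧ ∃ x : ℂ,
      dagger (R.F m e.1 e.2) * nil δ l m * R.F (refl l m) f.1 f.2 = x • R.P e.1) ∨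
    (e.1 = m + 1 ∧ f.1 + 1 = refl l m ∧ s + 1 < l ∧ ∃ a : ℂ, ‖a‖ ^ 2 * |qn δ s| = |qn δ (s + 1)| ∧
      dagger (R.F m e.1 e.2) * nil δ l m * R.F (refl l m) f.1 f.2 = a • nil δ l (m + 1)) ∨
    (e.1 + 1 = m ∧ f.1 = refl l m + 1 ∧ 1 < s ∧ ∃ a : ℂ, ‖a‖ ^ 2 * |qn δ s| = |qn δ (s - 1)| ∧
      dagger (R.F m e.1 e.2) * nil δ l m * R.F (refl l m) f.1 f.2 = a • nil δ l (m - 1)) := by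
  have hl2 := hl.two_le
  obtain ⟨hnr, h1, h2⟩ := hl.nonrigid hs hsl hm
  have hkl : (k + 1) * l = k * l + l := by ring
  have hA : s + 1 < l → refl l (m + 1) + 1 = refl l m := fun h => by
    have := (hl.nonrigid (m := m + 1) (k := k) (s := s + 1) (by omega) h (by omega)).2.1
    omega
  have hB : s + 1 = l → ¬ Nonrigid l (m + 1) := fun h hn =>
    hn.2 ⟨k + 2, by rw [mul_comm l, add_mul k]; omega⟩
  have hC : 1 < s → refl l (m - 1) = refl l m + 1 := fun h => by
    have := (hl.nonrigid (m := m - 1) (k := k) (s := s - 1) (by omega) (by omega) (by omega)).2.1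
    omega
  have hD : s = 1 → ¬ Nonrigid l (m - 1) := fun h hn => hn.2 ⟨k + 1, by rw [mul_comm l]; omega⟩
  have hT : ∀ p, p + 2 * l = m + 1 → l ∣ p + 1 → s + 1 = l := fun p hp hd => by
    by_contra h
    refine not_dvd_of_eq (l := l) (m := m + 1) (k := k + 1) (s := s + 1) (by omega) (by omega)
      (by omega) ?_
    rw [show m + 1 + 1 = p + 1 + l * 2 by omega]
    exact (Nat.dvd_add_left (dvd_mul_right l 2)).2 hd
  obtain ⟨p, i⟩ := e
  obtain ⟨j, i'⟩ := f
  dsimp only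
  set d := dagger (R.F m p i) * nil δ l m * R.F (refl l m) j i' with hd
  have hmem : d ∈ diagrams δ j p := mul_mem_diagrams (mul_mem_diagrams
    (dagger_mem_diagrams (R.F_mem m p i)) (diagrams_mono (a' := refl l m + 1) (b' := m + 1)
      (nil_mem hl hnr) (by omega) (by omega))) (R.F_mem _ _ _)
  have hPd : proj δ l p * d * proj δ l j = d := by
    have := congrArg dagger (R.F_mul_P m p i)
    rw [dagger_mul, R.dagger_P] at this
    rw [hd, ← R.P_eq hl, ← R.P_eq hl, ← mul_assoc, ← mul_assoc, this, mul_assoc, R.F_mul_P]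
  have hself : p = j → ¬ Nonrigid l p → ∃ x : ℂ, d = x • R.P p := by
    rintro rfl hn
    obtain ⟨c, hc⟩ := hom_self hl hmem
    rw [hPd, nilsq, if_neg hn, smul_zero, add_zero] at hc
    exact ⟨_, by rw [R.P_eq hl]; exact hc⟩
  rcases Nat.lt_trichotomy j p with hlt | heq | hgt
  · have := hom_lt hl hlt hmem
    rw [hPd] at this
    rcases this with h | ⟨hn, hj, -⟩
    · exact Or.inl h
    · rcases edges_cases i with hp | hp | ⟨-, -, hp, hp'⟩
      · rw [hp] at hn hj
        have h3 : s + 1 < l := by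
          by_contra h
          exact hB (by omega) hn
        have h4 : j + 1 = refl l m := by have := hA h3; omega
        obtain ⟨a, ha, ha'⟩ := R.entry_up_down hl hs h3 hm h4 i'
        refine Or.inr (Or.inr (Or.inl ⟨hp, h4, h3, a, ha, ?_⟩))
        subst hp
        rw [hd, R.F_up, R.dagger_P, ha']
      · obtain rfl : p = m - 1 := by omega
        have h3 : 1 < s := by
          by_contra h
          exact hD (by omega) hn
        have h4 := hC h3
        obtain ⟨t, rfl⟩ : ∃ t, s = t + 1 := ⟨s - 1, by omega⟩
        obtain ⟨n, rfl⟩ : ∃ n, m = n + 1 := ⟨m - 1, by omega⟩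
        obtain ⟨a, ha, ha'⟩ := R.entry_down_up hl (s := t) (k := k) (by omega) (by omega)
          (by omega) i
        refine Or.inr (Or.inr (Or.inr ⟨hp, by omega, h3, a, ha, ?_⟩))
        obtain rfl : j = refl l (n + 1) + 1 := by omega
        have h5 : refl l n = refl l (n + 1) + 1 := h4
        rw [h5] at ha'
        rw [hd, R.F_up]
        exact ha'
      · exact absurd hp' hn.2
  · have hn : ¬ Nonrigid l p := by
      rcases edges_cases i with hp | hp | ⟨-, -, hp, hp'⟩
      · rcases edges_cases i' with h | h | h <;> omega
      · obtain rfl : p = m - 1 := by omega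
        refine hD ?_
        rcases edges_cases i' with h | h | h <;> omega
      · exact fun hn => hn.2 hp'
    exact Or.inr (Or.inl ⟨heq.symm, hself heq.symm hn⟩)
  · have := hom_gt hl hgt hmem
    rw [hPd] at this
    rcases this with h | ⟨hn, hj, -⟩
    · exact Or.inl h
    · exfalso
      rcases edges_cases i with hp | hp | ⟨-, -, hp, hp'⟩
      · rcases edges_cases i' with h | h | h <;> omega
      · rcases edges_cases i' with h | h | h <;> omega
      · have h3 := hT p hp hp'
        have h4 : j = refl l m + 1 := by rcases edges_cases i' with h | h | h <;> omega
        have h5 := refl_lt hl hn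
        rcases Nat.lt_or_ge 2 l with h6 | h6
        · have h7 := (div_mod_of_eq (l := l) (m := j) (k := k) h6 (by omega)).2
          omega
        · exact hn.2 ⟨k + 1, by rw [mul_comm l]; omega⟩

theorem nilsq_eq_sum (hl : QRoot δ l) (hn : Nonrigid l m) (a b : Diagram δ) :
    a * nilsq δ l m * b = ∑ f : Edge l (refl l m),
      (a * nil δ l m * R.F (refl l m) f.1 f.2) *
        dagger (dagger b * nil δ l m * R.F (refl l m) f.1 f.2) := by
  have h := nil_mul_proj hl hn
  rw [← R.P_eq hl] at h
  calc a * nilsq δ l m * b = a * (nil δ l m * R.P (refl l m) * dagger (nil δ l m)) * b := by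
        rw [h, nilsq_eq hn]
    _ = _ := by
        rw [← R.sum_F, Finset.mul_sum, Finset.sum_mul, Finset.mul_sum, Finset.sum_mul]
        refine Finset.sum_congr rfl fun f _ => ?_
        simp only [dagger_mul, dagger_dagger, mul_assoc]

theorem nilsq_entry (hl : QRoot δ l) (hs : 0 < s) (hsl : s < l) (hm : m + 1 = (k + 1) * l + s)
    (e e' : Edge l m) :
    dagger (R.F m e.1 e.2) * nilsq δ l m * R.F m e'.1 e'.2 = 0 ∨
    (e.1 = e'.1 ∧ ∃ x : ℂ, dagger (R.F m e.1 e.2) * nilsq δ l m * R.F m e'.1 e'.2 = x • R.P e.1) ∨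
    (e.1 = m + 1 ∧ e'.1 = m + 1 ∧ s + 1 < l ∧
      ∃ a : ℂ, ‖a‖ ^ 2 * |qn δ s| ^ 2 = |qn δ (s + 1)| ^ 2 ∧
      dagger (R.F m e.1 e.2) * nilsq δ l m * R.F m e'.1 e'.2 = a • nilsq δ l (m + 1)) ∨
    (e.1 + 1 = m ∧ e'.1 + 1 = m ∧ 1 < s ∧
      ∃ a : ℂ, ‖a‖ ^ 2 * |qn δ s| ^ 2 = |qn δ (s - 1)| ^ 2 ∧
      dagger (R.F m e.1 e.2) * nilsq δ l m * R.F m e'.1 e'.2 = a • nilsq δ l (m - 1)) := by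
  have hl2 := hl.two_le
  obtain ⟨hnr, h1, h2⟩ := hl.nonrigid hs hsl hm
  have hkl : (k + 1) * l = k * l + l := by ring
  have hd := R.nilsq_eq_sum hl hnr (dagger (R.F m e.1 e.2)) (R.F m e'.1 e'.2)
  rw [hd]
  set T : Edge l (refl l m) → Diagram δ := fun f =>
    (dagger (R.F m e.1 e.2) * nil δ l m * R.F (refl l m) f.1 f.2) *
      dagger (dagger (R.F m e'.1 e'.2) * nil δ l m * R.F (refl l m) f.1 f.2) with hT
  have key : ∀ f, T f = 0 ∨ (e.1 = e'.1 ∧ e.1 = f.1 ∧ ∃ x : ℂ, T f = x • R.P e.1) ∨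
      (e.1 = m + 1 ∧ e'.1 = m + 1 ∧ f.1 + 1 = refl l m ∧ s + 1 < l ∧
        ∃ a : ℂ, ‖a‖ ^ 2 * |qn δ s| ^ 2 = |qn δ (s + 1)| ^ 2 ∧ T f = a • nilsq δ l (m + 1)) ∨
      (e.1 + 1 = m ∧ e'.1 + 1 = m ∧ f.1 = refl l m + 1 ∧ 1 < s ∧
        ∃ a : ℂ, ‖a‖ ^ 2 * |qn δ s| ^ 2 = |qn δ (s - 1)| ^ 2 ∧ T f = a • nilsq δ l (m - 1)) := by
    intro f
    have he := edges_cases e.2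
    have he' := edges_cases e'.2
    rcases R.nil_entry hl hs hsl hm e f with h | ⟨h, x, hx⟩ | ⟨h3, h4, h5, a, ha, hx⟩ |
        ⟨h3, h4, h5, a, ha, hx⟩ <;>
      rcases R.nil_entry hl hs hsl hm e' f with h' | ⟨h', y, hy⟩ | ⟨h3', h4', h5', b, hb, hy⟩ |
        ⟨h3', h4', h5', b, hb, hy⟩
    all_goals first
      | (left; simp only [hT]; rw [h, zero_mul])
      | (left; simp only [hT]; rw [h', dagger_zero, mul_zero])
      | (exfalso; omega)
      | skip
    · refine Or.inr (Or.inl ⟨by omega, h, x * y, ?_⟩)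
      simp only [hT]
      rw [hx, hy, dagger_smul, R.dagger_P, smul_mul_smul_comm, show e'.1 = e.1 by omega, R.P_mul_P]
    · refine Or.inr (Or.inr (Or.inl ⟨h3, h3', h4, h5, a * b, ?_, ?_⟩))
      · rw [norm_mul, sq (|qn δ (s + 1)|)]; nth_rw 1 [← ha]; rw [← hb]; ring
      · simp only [hT]
        rw [hx, hy, dagger_smul, smul_mul_smul_comm, nilsq_eq (hl.nonrigid (m := m + 1) (k := k)
          (s := s + 1) (by omega) h5 (by omega)).1]
    · refine Or.inr (Or.inr (Or.inr ⟨h3, h3', h4, h5, a * b, ?_, ?_⟩))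
      · rw [norm_mul, sq (|qn δ (s - 1)|)]; nth_rw 1 [← ha]; rw [← hb]; ring
      · simp only [hT]
        rw [hx, hy, dagger_smul, smul_mul_smul_comm, nilsq_eq (hl.nonrigid (m := m - 1) (k := k)
          (s := s - 1) (by omega) (by omega) (by omega)).1]
  by_cases h3 : e.1 = m + 1 ∧ e'.1 = m + 1 ∧ s + 1 < l
  · obtain ⟨h3, h3', h4⟩ := h3
    have hE : edges l (refl l m) (refl l m - 1) = 1 := by
      have h5 : refl l m - 1 + 1 = refl l m := by omega
      rw [edges_down h5, if_neg (not_dvd_of_eq (s := l - s) (by omega) (by omega) h2), ← h5,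
        if_neg (not_dvd_of_eq (k := k) (s := l - s - 1) (by omega) (by omega) (by omega))]
    rw [Finset.sum_eq_single (⟨refl l m - 1, ⟨0, by omega⟩⟩ : Edge l (refl l m))]
    · rcases key ⟨refl l m - 1, ⟨0, by omega⟩⟩ with h | ⟨-, h, -⟩ | ⟨-, -, -, -, h⟩ | ⟨h, -⟩
      · exact Or.inl h
      · dsimp only at h; omega
      · exact Or.inr (Or.inr (Or.inl ⟨h3, h3', h4, h⟩))
      · omega
    · rintro ⟨j, i⟩ - hne
      rcases key ⟨j, i⟩ with h | ⟨-, h, -⟩ | ⟨-, -, h, -⟩ | ⟨h, -⟩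
      · exact h
      · have := edges_cases i; dsimp only at h; omega
      · exfalso
        dsimp only at h
        obtain rfl : j = refl l m - 1 := by omega
        refine hne ?_
        rw [show i = ⟨0, by omega⟩ from Fin.ext (by have := i.2; simp only; omega)]
      · omega
    · exact fun h => absurd (Finset.mem_univ _) h
  by_cases h4 : e.1 + 1 = m ∧ e'.1 + 1 = m ∧ 1 < s
  · obtain ⟨h4, h4', h5⟩ := h4
    have hE : edges l (refl l m) (refl l m + 1) = 1 := if_pos rfl
    rw [Finset.sum_eq_single (⟨refl l m + 1, ⟨0, by omega⟩⟩ : Edge l (refl l m))]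
    · rcases key ⟨refl l m + 1, ⟨0, by omega⟩⟩ with h | ⟨-, h, -⟩ | ⟨h, -⟩ | ⟨-, -, -, -, h⟩
      · exact Or.inl h
      · dsimp only at h; omega
      · omega
      · exact Or.inr (Or.inr (Or.inr ⟨h4, h4', h5, h⟩))
    · rintro ⟨j, i⟩ - hne
      rcases key ⟨j, i⟩ with h | ⟨-, h, -⟩ | ⟨h, -⟩ | ⟨-, -, h, -⟩
      · exact h
      · have := edges_cases i; dsimp only at h; omega
      · omega
      · exfalso
        dsimp only at h
        subst h
        refine hne ?_
        rw [show i = ⟨0, by omega⟩ from Fin.ext (by have := i.2; simp only; omega)]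
    · exact fun h => absurd (Finset.mem_univ _) h
  by_cases h5 : e.1 = e'.1
  · refine Or.inr (Or.inl ⟨h5, ?_⟩)
    have : ∀ f, ∃ x : ℂ, T f = x • R.P e.1 := fun f => by
      rcases key f with h | ⟨-, -, h⟩ | ⟨h, h', -, h'', -⟩ | ⟨h, h', -, h'', -⟩
      · exact ⟨0, by rw [h, zero_smul]⟩
      · exact h
      · exact absurd ⟨h, h', h''⟩ h3
      · exact absurd ⟨h, h', h''⟩ h4
    choose x hx using this
    exact ⟨∑ f, x f, by rw [Finset.sum_smul]; exact Finset.sum_congr rfl fun f _ => hx f⟩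
  · left
    refine Finset.sum_eq_zero fun f _ => ?_
    rcases key f with h | ⟨h, -⟩ | ⟨h, h', -⟩ | ⟨h, h', -⟩
    · exact h
    · exact absurd h h5
    · omega
    · omega

end FusionRules
end TemperleyLieb

namespace TemperleyLieb

/-! ### Growth of the matrix entries -/

theorem genericCoeff_pos {γ : ℝ} (h : γ ≤ 1 / 4) (m : ℕ) :
    0 < genericCoeff γ m ∧ genericCoeff γ m ≤ 2 * genericCoeff γ (m + 1) := by
  induction m with
  | zero => norm_num [genericCoeff]
  | succ m ih =>
    obtain ⟨h1, h2⟩ := ih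
    have h3 : 0 < genericCoeff γ (m + 1) := by linarith
    refine ⟨h3, ?_⟩
    rw [genericCoeff]
    nlinarith

theorem rootCoeff_pos {γ : ℝ} (h0 : 0 < γ) (h : γ ≤ 1 / 4) (l m : ℕ) : 0 < rootCoeff l γ m := by
  have h1 := fun m => (genericCoeff_pos h m).1
  rw [rootCoeff]
  split_ifs
  · exact h1 m
  · exact add_pos (h1 m) (mul_pos (pow_pos h0 _) (h1 _))
  · rw [add_zero]; exact h1 m

/-- The coefficients of the traces in the normalization which makes them harmonic. -/
noncomputable def mass (l : ℕ) (r : ℝ) (m : ℕ) : ℝ := rootCoeff l (r ^ 2) m / r ^ m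

theorem mass_pos {r : ℝ} (hr : 0 < r) (hr' : r ≤ 1 / 2) (l m : ℕ) : 0 < mass l r m :=
  div_pos (rootCoeff_pos (pow_pos hr 2) (by nlinarith) l m) (pow_pos hr m)

theorem exists_edge {l m j : ℕ} (h : edges l m j = 1) :
    ∃ e₀ : Edge l m, ∀ e : Edge l m, e.1 = j ↔ e = e₀ := by
  refine ⟨⟨j, ⟨0, by omega⟩⟩, fun e => ⟨?_, fun h => by rw [h]⟩⟩
  obtain ⟨j', i⟩ := e
  intro h'
  obtain rfl : j' = j := h'
  exact Sigma.ext rfl (heq_of_eq (Fin.ext (by have := i.2; simp only; omega)))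

theorem edges_down_eq_one {l k s j : ℕ} (hs : 0 < s) (hsl : s + 1 < l) (hj : j + 1 = k * l + s) :
    edges l (j + 1) j = 1 := by
  rw [edges_down rfl, if_neg (not_dvd_of_eq (k := k) (s := s + 1) (by omega) hsl (by omega)),
    if_neg (not_dvd_of_eq hs (by omega) hj)]

namespace FusionRules

variable {δ : ℝ} {l : ℕ} (R : FusionRules δ l) {r : ℝ}

theorem mass_eq_sum (R : FusionRules δ l) (hl : QRoot δ l) (hr : 0 < r) (m : ℕ) :
    mass l r m = r * ∑ e : Edge l m, mass l r e.1 := by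
  obtain ⟨χ, hχ, -⟩ := R.existsUnique_trace hl (r ^ 2)
  have h := R.weight_eq_sum hχ.1 0 m
  have hw := R.weight_eq hl.two_le hχ.1 ((R.hasParameter_iff hl hχ.1 _).1 hχ.2)
  simp only [hw] at h
  have h := Complex.ofReal_injective (h.trans (Complex.ofReal_sum _ _).symm)
  rw [pow_zero, one_mul] at h
  rw [mass, h, Finset.sum_div, Finset.mul_sum]
  refine Finset.sum_congr rfl fun e _ => ?_
  have h2 : m + 1 = e.1 + 2 * ((m + 1 - e.1) / 2) := by
    rcases edges_cases e.2 with h | h | h <;> omega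
  rw [mass, zero_add, ← pow_mul, mul_div_assoc', div_eq_div_iff (pow_pos hr _).ne' (pow_pos hr _).ne']
  calc _ = rootCoeff l (r ^ 2) e.1 * (r ^ (e.1 + 2 * ((m + 1 - e.1) / 2))) := by ring
    _ = _ := by rw [← h2]; ring

/-- The sum of the weighted squares of the matrix entries of a half diagram which are reached by
`k` further steps. -/
noncomputable def energy (r : ℝ) : ℕ → ℕ → ℕ → Diagram δ → ℝ
  | 0, m, m', c => if m = m' then mass l r m * ‖vev δ c‖ ^ 2 else 0
  | k + 1, m, m', c => r * ∑ e : Edge l m, ∑ f : Edge l m',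
      energy r k e.1 f.1 (dagger (R.F m e.1 e.2) * c * R.F m' f.1 f.2)

section
variable (hr : 0 < r) (hr' : r ≤ 1 / 2)
include hr hr'

theorem energy_nonneg (k m m' : ℕ) (c : Diagram δ) : 0 ≤ R.energy r k m m' c := by
  induction k generalizing m m' c with
  | zero =>
    rw [energy]
    split_ifs
    · exact mul_nonneg (mass_pos hr hr' l m).le (sq_nonneg _)
    · exact le_rfl
  | succ k ih =>
    rw [energy]
    exact mul_nonneg hr.le (Finset.sum_nonneg fun e _ => Finset.sum_nonneg fun f _ => ih _ _ _)

theorem energy_add_le (k m m' : ℕ) (c c' : Diagram δ) :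
    R.energy r k m m' (c + c') ≤ 2 * R.energy r k m m' c + 2 * R.energy r k m m' c' := by
  induction k generalizing m m' c c' with
  | zero =>
    simp only [energy]
    split_ifs
    · have h1 := norm_add_le (vev δ c) (vev δ c')
      have h2 : ‖vev δ (c + c')‖ ^ 2 ≤ 2 * ‖vev δ c‖ ^ 2 + 2 * ‖vev δ c'‖ ^ 2 := by
        rw [map_add]
        nlinarith [norm_nonneg (vev δ c + vev δ c'), sq_nonneg (‖vev δ c‖ - ‖vev δ c'‖)]
      have := mul_le_mul_of_nonneg_left h2 (mass_pos hr hr' l m).le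
      linarith
    · norm_num
  | succ k ih =>
    simp only [energy, mul_add, add_mul]
    rw [mul_left_comm, mul_left_comm 2, ← mul_add]
    refine mul_le_mul_of_nonneg_left ?_ hr.le
    simp only [Finset.mul_sum, ← Finset.sum_add_distrib]
    exact Finset.sum_le_sum fun e _ => Finset.sum_le_sum fun f _ => ih _ _ _ _

end

theorem energy_smul (k m m' : ℕ) (x : ℂ) (c : Diagram δ) :
    R.energy r k m m' (x • c) = ‖x‖ ^ 2 * R.energy r k m m' c := by
  induction k generalizing m m' c with
  | zero =>
    simp only [energy]
    split_ifs
    · rw [map_smul, smul_eq_mul, norm_mul]; ring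
    · rw [mul_zero]
  | succ k ih =>
    simp only [energy, mul_smul_comm, smul_mul_assoc, ih, ← Finset.mul_sum]
    ring

theorem energy_zero (k m m' : ℕ) : R.energy r k m m' 0 = 0 := by
  have := R.energy_smul (r := r) k m m' 0 0
  rwa [smul_zero, norm_zero, zero_pow two_ne_zero, zero_mul] at this

theorem energy_dagger (k : ℕ) {m m' : ℕ} {c : Diagram δ} (hc : c ∈ diagrams δ m' m) :
    R.energy r k m' m (dagger c) = R.energy r k m m' c := by
  induction k generalizing m m' c with
  | zero =>
    simp only [energy]
    by_cases h : m = m'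
    · subst h; rw [if_pos rfl, if_pos rfl, vev_dagger hc]
    · rw [if_neg h, if_neg (Ne.symm h)]
  | succ k ih =>
    simp only [energy]
    rw [Finset.sum_comm]
    refine congrArg _ (Finset.sum_congr rfl fun e _ => Finset.sum_congr rfl fun f _ => ?_)
    rw [← ih (mul_mem_diagrams (mul_mem_diagrams (dagger_mem_diagrams (R.F_mem _ _ _))
      (diagrams_mono (a' := m' + 1) (b' := m + 1) hc (by omega) (by omega))) (R.F_mem _ _ _))]
    simp only [dagger_mul, dagger_dagger, mul_assoc]

theorem energy_P (hl : QRoot δ l) (hr : 0 < r) (k m : ℕ) :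
    R.energy r k m m (R.P m) = mass l r m := by
  induction k generalizing m with
  | zero => rw [energy, if_pos rfl, R.vev_P hl, norm_one, one_pow, mul_one]
  | succ k ih =>
    rw [energy, R.mass_eq_sum hl hr]
    refine congrArg _ (Finset.sum_congr rfl fun e _ => ?_)
    rw [Finset.sum_eq_single e]
    · rw [mul_assoc, R.P_mul_F, R.F_norm, ih]
    · intro f _ h
      rw [mul_assoc, R.P_mul_F, R.F_orth _ _ _ _ _ (fun h' => h h'.symm), energy_zero]
    · exact fun h => absurd (Finset.mem_univ _) h

theorem energy_ladder (hl : QRoot δ l) (hr : 0 < r) (hr' : r ≤ 1 / 2) (a b : ℕ → ℕ)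
    (C : ℕ → Diagram δ) (β : ℕ → ℝ) (hβ : ∀ s, 0 < s → s < l → 0 < β s)
    (hE : ∀ s t, 0 < s → s < l → 0 < t → t < l → (t = s + 1 ∨ t + 1 = s) →
      edges l (a s) (a t) = 1 ∧ edges l (b s) (b t) = 1)
    (H : ∀ s, 0 < s → s < l → ∀ (e : Edge l (a s)) (f : Edge l (b s)),
      dagger (R.F _ e.1 e.2) * C s * R.F _ f.1 f.2 = 0 ∨
      (e.1 = f.1 ∧ ∃ x : ℂ, dagger (R.F _ e.1 e.2) * C s * R.F _ f.1 f.2 = x • R.P e.1) ∨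
      ∃ t, 0 < t ∧ t < l ∧ (t = s + 1 ∨ t + 1 = s) ∧ e.1 = a t ∧ f.1 = b t ∧
        ∃ x : ℂ, ‖x‖ ^ 2 * β s = β t ∧ dagger (R.F _ e.1 e.2) * C s * R.F _ f.1 f.2 = x • C t)
    (s : ℕ) (hs : 0 < s) (hsl : s < l) : ∃ A, ∀ k, R.energy r k (a s) (b s) (C s) ≤ A := by
  set v : ℕ → ℕ → ℝ := fun k s =>
    if 0 < s ∧ s < l then β s * R.energy r k (a s) (b s) (C s) else 0 with hv
  have hv0 : ∀ k s, 0 ≤ v k s := fun k s => by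
    simp only [hv]
    split_ifs with h
    · exact mul_nonneg (hβ s h.1 h.2).le (R.energy_nonneg hr hr' _ _ _ _)
    · exact le_rfl
  have hvs : ∀ k {s}, 0 < s → s < l → v k s = β s * R.energy r k (a s) (b s) (C s) :=
    fun k s h h' => if_pos ⟨h, h'⟩
  have hK : ∀ s, ∃ K, 0 ≤ K ∧ (0 < s → s < l → ∀ k, v (k + 1) s ≤
      r * (K + v k (s + 1) + v k (s - 1))) := by
    intro s
    by_cases hs : 0 < s ∧ s < l
    swap
    · exact ⟨0, le_rfl, fun h h' => absurd ⟨h, h'⟩ hs⟩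
    obtain ⟨hs, hsl⟩ := hs
    have hentry : ∀ (e : Edge l (a s)) (f : Edge l (b s)), ∃ K, 0 ≤ K ∧ ∀ k,
        β s * R.energy r k e.1 f.1 (dagger (R.F _ e.1 e.2) * C s * R.F _ f.1 f.2) ≤
          K + (if e.1 = a (s + 1) ∧ f.1 = b (s + 1) then v k (s + 1) else 0) +
            (if e.1 = a (s - 1) ∧ f.1 = b (s - 1) then v k (s - 1) else 0) := by
      intro e f
      have hi1 : ∀ k, 0 ≤ (if e.1 = a (s + 1) ∧ f.1 = b (s + 1) then v k (s + 1) else 0) :=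
        fun k => by split_ifs <;> simp [hv0]
      have hi2 : ∀ k, 0 ≤ (if e.1 = a (s - 1) ∧ f.1 = b (s - 1) then v k (s - 1) else 0) :=
        fun k => by split_ifs <;> simp [hv0]
      rcases H s hs hsl e f with h | ⟨h, x, hx⟩ | ⟨t, ht, htl, hts, h1, h2, x, hx, hx'⟩
      · exact ⟨0, le_rfl, fun k => by
          rw [h, energy_zero]; linarith [hi1 k, hi2 k]⟩
      · refine ⟨β s * (‖x‖ ^ 2 * mass l r e.1), ?_, fun k => ?_⟩
        · have := mass_pos hr hr' l e.1
          have := hβ s hs hsl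
          positivity
        · have h6 : R.energy r k e.1 f.1 (x • R.P e.1) = ‖x‖ ^ 2 * mass l r e.1 := by
            rw [energy_smul, ← h, R.energy_P hl hr]
          rw [hx, h6]
          linarith [hi1 k, hi2 k]
      · refine ⟨0, le_rfl, fun k => ?_⟩
        rw [hx', energy_smul, h1, h2, ← mul_assoc, mul_comm (β s), hx, ← hvs k ht htl, zero_add]
        rcases hts with rfl | h
        · rw [if_pos ⟨rfl, rfl⟩]
          have := hi2 k
          rw [h1, h2] at this
          linarith
        · obtain rfl : t = s - 1 := by omega
          rw [if_pos (show a (s - 1) = a (s - 1) ∧ b (s - 1) = b (s - 1) from ⟨rfl, rfl⟩)]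
          have := hi1 k
          rw [h1, h2] at this
          linarith
    choose K hK0 hK using hentry
    refine ⟨∑ e, ∑ f, K e f, Finset.sum_nonneg fun e _ => Finset.sum_nonneg fun f _ => hK0 e f,
      fun _ _ k => ?_⟩
    have hsum : ∀ t, (t = s + 1 ∨ t = s - 1) → ∑ e : Edge l (a s), ∑ f : Edge l (b s),
        (if e.1 = a t ∧ f.1 = b t then v k t else 0) ≤ v k t := by
      intro t ht
      by_cases ht' : 0 < t ∧ t < l
      · obtain ⟨h1, h2⟩ := hE s t hs hsl ht'.1 ht'.2 (by omega)
        obtain ⟨e₀, he⟩ := exists_edge h1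
        obtain ⟨f₀, hf⟩ := exists_edge h2
        simp only [he, hf, ite_and]
        simp
      · have : v k t = 0 := if_neg ht'
        rw [this]; simp
    rw [hvs _ hs hsl, energy, mul_left_comm]
    refine mul_le_mul_of_nonneg_left ?_ hr.le
    rw [Finset.mul_sum]
    calc _ ≤ ∑ e : Edge l (a s), ∑ f : Edge l (b s), (K e f +
            (if e.1 = a (s + 1) ∧ f.1 = b (s + 1) then v k (s + 1) else 0) +
            (if e.1 = a (s - 1) ∧ f.1 = b (s - 1) then v k (s - 1) else 0)) :=
          Finset.sum_le_sum fun e _ => by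
            rw [Finset.mul_sum]; exact Finset.sum_le_sum fun f _ => hK e f k
      _ ≤ _ := by
          simp only [Finset.sum_add_distrib]
          exact add_le_add (add_le_add le_rfl (hsum _ (Or.inl rfl))) (hsum _ (Or.inr rfl))
  choose K hK0 hK using hK
  set A := ∑ s ∈ Finset.range l, (K s + v 0 s) with hA
  have hAs : ∀ s < l, K s + v 0 s ≤ A := fun s h =>
    Finset.single_le_sum (f := fun s => K s + v 0 s)
      (fun s _ => add_nonneg (hK0 s) (hv0 0 s)) (Finset.mem_range.2 h)
  have hmain : ∀ k s, s ≤ l → v k s ≤ A * (s * ((l : ℝ) - s)) := by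
    intro k
    induction k with
    | zero =>
      intro s hs
      by_cases h : 0 < s ∧ s < l
      · have h1 : (1 : ℝ) ≤ s := by exact_mod_cast h.1
        have h2 : (s : ℝ) + 1 ≤ l := by exact_mod_cast h.2
        have h3 : (1 : ℝ) ≤ s * (l - s) := by nlinarith
        have h4 := hAs s h.2
        have h5 := hK0 s
        have h6 := hv0 0 s
        nlinarith
      · have h1 : v 0 s = 0 := if_neg h
        rw [h1]
        have h2 : (s : ℝ) ≤ l := by exact_mod_cast hs
        have h4 := hAs 0 (by have := hl.two_le; omega)
        have h5 := hK0 0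
        have h6 := hv0 0 0
        have : (0 : ℝ) ≤ s := Nat.cast_nonneg s
        exact mul_nonneg (by linarith) (mul_nonneg this (by linarith))
    | succ k ih =>
      intro s hs
      by_cases h : 0 < s ∧ s < l
      · obtain ⟨t, rfl⟩ : ∃ t, s = t + 1 := ⟨s - 1, by omega⟩
        have h1 := hK (t + 1) h.1 h.2 k
        have h2 := ih (t + 1 + 1) (by omega)
        have h3 := ih t (by omega)
        have h4 := hAs (t + 1) h.2
        have h5 := hK0 (t + 1)
        have h6 := hv0 0 (t + 1)
        rw [Nat.add_sub_cancel] at h1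
        have h7 : r * (K (t + 1) + v k (t + 1 + 1) + v k t) ≤
            1 / 2 * (K (t + 1) + v k (t + 1 + 1) + v k t) :=
          mul_le_mul_of_nonneg_right hr' (by linarith [hv0 k (t + 1 + 1), hv0 k t])
        push_cast at h2 h3 ⊢
        nlinarith
      · have h1 : v (k + 1) s = 0 := if_neg h
        rw [h1]
        exact (hv0 k s).trans (ih s hs)
  refine ⟨A * (s * ((l : ℝ) - s)) / β s, fun k => ?_⟩
  rw [le_div_iff₀ (hβ s hs hsl), mul_comm, ← hvs k hs hsl]
  exact hmain k s hsl.le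

end FusionRules
end TemperleyLieb

namespace TemperleyLieb
namespace FusionRules

variable {δ : ℝ} {l : ℕ} (R : FusionRules δ l) {r : ℝ}

theorem energy_nil_bounded (hl : QRoot δ l) (hr : 0 < r) (hr' : r ≤ 1 / 2) {m : ℕ}
    (hm : Nonrigid l m) : (∃ A, ∀ k, R.energy r k m (refl l m) (nil δ l m) ≤ A) ∧
      ∃ A, ∀ k, R.energy r k m m (nilsq δ l m) ≤ A := by
  have hl2 := hl.two_le
  obtain ⟨-, hs, hsl⟩ := refl_lt hl hm
  have hdiv := Nat.div_add_mod' (m + 1) l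
  obtain ⟨k, hk⟩ := Nat.exists_eq_succ_of_ne_zero (show (m + 1) / l ≠ 0 from fun h => by
    rw [h, zero_mul, zero_add, Nat.mod_eq_iff_lt (by omega)] at hdiv
    have := hm.1; omega)
  rw [hk, Nat.succ_eq_add_one] at hdiv
  generalize (m + 1) % l = s at *
  have hkl : (k + 1) * l = k * l + l := by ring
  have ha : ∀ t, (k + 1) * l - 1 + t + 1 = (k + 1) * l + t := fun t => by omega
  have hb : ∀ t, 0 < t → t < l → refl l ((k + 1) * l - 1 + t) + 1 + t = (k + 1) * l :=
    fun t h h' => (hl.nonrigid h h' (ha t)).2.1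
  have hup : ∀ m j, j = m + 1 → edges l m j = 1 := fun m j h => by rw [edges, if_pos h]
  have hE1 : ∀ s t, 0 < s → s < l → 0 < t → t < l → (t = s + 1 ∨ t + 1 = s) →
      edges l ((k + 1) * l - 1 + s) ((k + 1) * l - 1 + t) = 1 := by
    rintro s t hs hsl ht htl (rfl | rfl)
    · exact hup _ _ (by omega)
    · exact edges_down_eq_one (k := k + 1) (s := t) (j := (k + 1) * l - 1 + t) ht hsl (by omega)
  have hE2 : ∀ s t, 0 < s → s < l → 0 < t → t < l → (t = s + 1 ∨ t + 1 = s) →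
      edges l (refl l ((k + 1) * l - 1 + s)) (refl l ((k + 1) * l - 1 + t)) = 1 := by
    intro s t hs hsl ht htl h
    have h1 := hb s hs hsl
    have h2 := hb t ht htl
    rcases h with rfl | rfl
    · rw [show refl l ((k + 1) * l - 1 + s) = refl l ((k + 1) * l - 1 + (s + 1)) + 1 by omega]
      exact edges_down_eq_one (k := k) (s := l - s - 1) (by omega) (by omega) (by omega)
    · exact hup _ _ (by omega)
  have hq : ∀ s, 0 < s → s < l → 0 < |qn δ s| := fun s h h' => abs_pos.2 (hl.ne_zero s h h')
  obtain rfl : (k + 1) * l - 1 + s = m := by omega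
  constructor
  · refine R.energy_ladder hl hr hr' (fun s => (k + 1) * l - 1 + s)
      (fun s => refl l ((k + 1) * l - 1 + s)) (fun s => nil δ l ((k + 1) * l - 1 + s))
      (fun s => |qn δ s|) hq (fun s t h1 h2 h3 h4 h5 => ⟨hE1 s t h1 h2 h3 h4 h5,
        hE2 s t h1 h2 h3 h4 h5⟩) (fun s hs hsl e f => ?_) s hs hsl
    have h1 := hb s hs hsl
    rcases R.nil_entry hl hs hsl (ha s) e f with h | h | ⟨h2, h3, h4, h⟩ | ⟨h2, h3, h4, h⟩
    · exact Or.inl h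
    · exact Or.inr (Or.inl h)
    · have := hb (s + 1) (by omega) h4
      exact Or.inr (Or.inr ⟨s + 1, by omega, h4, Or.inl rfl, h2, by omega, h⟩)
    · have := hb (s - 1) (by omega) (by omega)
      refine Or.inr (Or.inr ⟨s - 1, by omega, by omega, Or.inr (by omega), by omega,
        by omega, ?_⟩)
      rwa [show (k + 1) * l - 1 + s - 1 = (k + 1) * l - 1 + (s - 1) by omega] at h
  · refine R.energy_ladder hl hr hr' (fun s => (k + 1) * l - 1 + s)
      (fun s => (k + 1) * l - 1 + s) (fun s => nilsq δ l ((k + 1) * l - 1 + s))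
      (fun s => |qn δ s| ^ 2) (fun s h h' => pow_pos (hq s h h') 2)
      (fun s t h1 h2 h3 h4 h5 => ⟨hE1 s t h1 h2 h3 h4 h5,
        hE1 s t h1 h2 h3 h4 h5⟩) (fun s hs hsl e f => ?_) s hs hsl
    rcases R.nilsq_entry hl hs hsl (ha s) e f with h | h | ⟨h2, h3, h4, h⟩ | ⟨h2, h3, h4, h⟩
    · exact Or.inl h
    · exact Or.inr (Or.inl h)
    · exact Or.inr (Or.inr ⟨s + 1, by omega, h4, Or.inl rfl, h2, h3, h⟩)
    · refine Or.inr (Or.inr ⟨s - 1, by omega, by omega, Or.inr (by omega), by omega,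
        by omega, ?_⟩)
      rwa [show (k + 1) * l - 1 + s - 1 = (k + 1) * l - 1 + (s - 1) by omega] at h

theorem energy_radHom_bounded (hl : QRoot δ l) (hr : 0 < r) (hr' : r ≤ 1 / 2) {m m' : ℕ}
    {c : Diagram δ} (hc : c ∈ radHom δ l m m') : ∃ A, ∀ k, R.energy r k m m' c ≤ A := by
  induction hc using Submodule.span_induction with
  | zero => exact ⟨0, fun k => (R.energy_zero k m m').le⟩
  | add x y _ _ h h' =>
    obtain ⟨A, hA⟩ := h
    obtain ⟨B, hB⟩ := h'
    exact ⟨2 * A + 2 * B, fun k => (R.energy_add_le hr hr' _ _ _ _ _).trans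
      (by linarith [hA k, hB k])⟩
  | smul a x _ h =>
    obtain ⟨A, hA⟩ := h
    exact ⟨‖a‖ ^ 2 * A, fun k => by
      rw [energy_smul]; exact mul_le_mul_of_nonneg_left (hA k) (sq_nonneg _)⟩
  | mem c hc =>
    rcases hc with ⟨rfl, rfl⟩ | ⟨h1, rfl, rfl⟩ | ⟨h1, rfl, rfl⟩
    · by_cases h : Nonrigid l m
      · exact (R.energy_nil_bounded hl hr hr' h).2
      · rw [nilsq, if_neg h]
        exact ⟨0, fun k => (R.energy_zero k m m).le⟩
    · exact (R.energy_nil_bounded hl hr hr' h1).1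
    · obtain ⟨A, hA⟩ := (R.energy_nil_bounded hl hr hr' h1).1
      exact ⟨A, fun k => by rw [R.energy_dagger k (nil_mem hl h1)]; exact hA k⟩

/-- The weighted sum of the squares of the coefficients of level `n`. -/
noncomputable def normSq (w : ℕ → ℕ → ℝ) (n : ℕ) (x : TL δ) : ℝ :=
  ∑ i : PathPair l n, ‖R.coef i.2.1 i.2.2 x‖ ^ 2 * w ((n - i.1) / 2) i.1

theorem normSq_eq_energy (hr : 0 < r) (x : TL δ) (k : ℕ) {n : ℕ} (hn : 0 < n) :
    R.normSq (fun p m => (r ^ 2) ^ p * rootCoeff l (r ^ 2) m) (n + k) x =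
      r ^ n * ∑ π : LPath l n, ∑ σ : LPath l n,
        R.energy r k π.1 σ.1 (dagger (R.vec π.2) * toDiagram δ x * R.vec σ.2) := by
  induction k generalizing n with
  | zero =>
    change R.normSq _ n x = _
    rw [← PathPair.sum_eq _ (fun π σ h => by rw [energy, if_neg h]), normSq, Finset.mul_sum]
    refine Finset.sum_congr rfl fun i _ => ?_
    have h := i.2.1.parity
    rw [energy, if_pos rfl, ← coef_apply, mass]
    have h1 : (r ^ 2) ^ ((n - i.1) / 2) = r ^ n / r ^ i.1 := by
      rw [← pow_mul, eq_div_iff (pow_pos hr _).ne', ← pow_add, add_comm, ← h]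
    dsimp only
    rw [h1]
    ring
  | succ k ih =>
    rw [show n + (k + 1) = n + 1 + k by ring, ih n.succ_pos, pow_succ, mul_assoc]
    congr 1
    rw [sum_path_succ hn, Finset.mul_sum]
    refine Finset.sum_congr rfl fun π _ => ?_
    rw [Finset.mul_sum, Finset.sum_congr rfl fun e _ => by rw [sum_path_succ hn, Finset.mul_sum],
      Finset.sum_comm]
    refine Finset.sum_congr rfl fun σ _ => ?_
    rw [energy, Finset.mul_sum]
    refine Finset.sum_congr rfl fun e _ => ?_
    congr 1
    refine Finset.sum_congr rfl fun f _ => ?_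
    simp only [vec, dagger_mul, mul_assoc]

theorem normSq_bounded (hl : QRoot δ l) {γ : ℝ} (h0 : 0 < γ) (h : γ ≤ 1 / 4) {n : ℕ} (hn : 0 < n)
    {x : TL δ} (hx : x ∈ TL.fin δ n) :
    ∃ A, ∀ k, R.normSq (fun p m => γ ^ p * rootCoeff l γ m) (n + k) x ≤ A := by
  obtain ⟨r, hr, rfl⟩ : ∃ r : ℝ, 0 < r ∧ γ = r ^ 2 :=
    ⟨√γ, Real.sqrt_pos.2 h0, (Real.sq_sqrt h0.le).symm⟩
  have hr' : r ≤ 1 / 2 := by nlinarith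
  have key : ∀ π σ : LPath l n, ∃ A, ∀ k,
      R.energy r k π.1 σ.1 (dagger (R.vec π.2) * toDiagram δ x * R.vec σ.2) ≤ A := by
    intro π σ
    obtain ⟨c, hc, h'⟩ := R.exists_entry hl (toDiagram_mem hx) π σ
    obtain ⟨A, hA⟩ := R.energy_radHom_bounded hl hr hr' hc
    rw [h']
    obtain ⟨m, π⟩ := π
    obtain ⟨m', σ⟩ := σ
    split_ifs with hm
    · obtain rfl : m = m' := hm
      exact ⟨_, fun k => (R.energy_add_le hr hr' _ _ _ _ _).trans (add_le_add
        (mul_le_mul_of_nonneg_left (by rw [energy_smul, R.energy_P hl hr]) zero_le_two)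
        (mul_le_mul_of_nonneg_left (hA k) zero_le_two))⟩
    · exact ⟨A, fun k => by rw [zero_add]; exact hA k⟩
  choose A hA using key
  refine ⟨r ^ n * ∑ π, ∑ σ, A π σ, fun k => ?_⟩
  rw [R.normSq_eq_energy hr x k hn]
  exact mul_le_mul_of_nonneg_left (Finset.sum_le_sum fun π _ => Finset.sum_le_sum fun σ _ =>
    hA π σ k) (pow_pos hr n).le

end FusionRules
end TemperleyLieb

namespace TemperleyLieb
namespace FusionRules

/-! ### The involution `◇` -/

variable {δ : ℝ} {l : ℕ} (R : FusionRules δ l)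

/-- The conjugate linear map which transposes the component of level `n`. -/
noncomputable def transp (n : ℕ) : TL δ →ₗ⋆[ℂ] TL δ where
  toFun x := ∑ i : PathPair l n, starRingEnd ℂ (R.coef i.2.1 i.2.2 x) • R.unit i.2.2 i.2.1
  map_add' x y := by simp only [map_add, add_smul, Finset.sum_add_distrib]
  map_smul' c x := by
    simp only [map_smul, smul_eq_mul, map_mul, mul_smul, Finset.smul_sum]

theorem transp_apply (n : ℕ) (x : TL δ) : R.transp n x =
    ∑ i : PathPair l n, starRingEnd ℂ (R.coef i.2.1 i.2.2 x) • R.unit i.2.2 i.2.1 := rfl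

theorem transp_mem (n : ℕ) (x : TL δ) : R.transp n x ∈ R.semisimple n :=
  sum_mem fun i _ => Subalgebra.smul_mem (R.semisimple n)
    (Algebra.subset_adjoin ⟨i.1, i.2.2, i.2.1, rfl⟩) _

theorem mem_union_of_mem {n : ℕ} {x : TL δ} (hx : x ∈ R.semisimple n) : x ∈ R.union :=
  (le_iSup R.semisimple n) hx

variable (hl : QRoot δ l)
include hl

theorem coef_comp {n m : ℕ} (π σ : Path l n m) (x : TL δ) :
    R.coef π σ (R.comp n x) = R.coef π σ x := by
  rw [comp_apply, map_sum, Finset.sum_eq_single (⟨m, π, σ⟩ : PathPair l n)]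
  · rw [map_smul, R.coef_unit_same hl, smul_eq_mul, mul_one]
  · intro j _ h
    rw [map_smul, R.coef_unit_ne (i := ⟨m, π, σ⟩) h.symm, smul_zero]
  · exact fun h => absurd (Finset.mem_univ _) h

theorem transp_comp (n : ℕ) (x : TL δ) : R.transp n (R.comp n x) = R.transp n x := by
  simp only [transp_apply, R.coef_comp hl]

theorem transp_unit {n m : ℕ} (π σ : Path l n m) : R.transp n (R.unit π σ) = R.unit σ π := by
  rw [transp_apply, Finset.sum_eq_single (⟨m, π, σ⟩ : PathPair l n)]
  · rw [R.coef_unit_same hl, map_one, one_smul]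
  · intro j _ h
    rw [R.coef_unit_ne (j := ⟨m, π, σ⟩) h, map_zero, zero_smul]
  · exact fun h => absurd (Finset.mem_univ _) h

section
variable {n : ℕ} (hn : 0 < n) {s : TL δ} (hs : s ∈ R.semisimple n)
include hn hs

theorem transp_transp : R.transp n (R.transp n s) = s := by
  refine R.semisimple_induction (p := fun s => R.transp n (R.transp n s) = s) hn hs
    (fun π σ => by rw [R.transp_unit hl, R.transp_unit hl]) (by simp) ?_ ?_
  · intro x y h h'; rw [map_add, map_add, h, h']
  · intro c x h; rw [LinearMap.map_smulₛₗ, LinearMap.map_smulₛₗ, h, Complex.conj_conj]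

theorem transp_mul {t : TL δ} (ht : t ∈ R.semisimple n) :
    R.transp n (s * t) = R.transp n t * R.transp n s := by
  refine R.semisimple_induction (p := fun s => R.transp n (s * t) = R.transp n t * R.transp n s)
    hn hs (fun {m} π σ => ?_) (by simp) ?_ ?_
  · refine R.semisimple_induction
      (p := fun t => R.transp n (R.unit π σ * t) = R.transp n t * R.transp n (R.unit π σ))
      hn ht (fun {m'} σ' τ => ?_) (by simp) ?_ ?_
    · rw [R.transp_unit hl, R.transp_unit hl]
      by_cases h : (⟨m, σ⟩ : LPath l n) = ⟨m', σ'⟩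
      · cases h
        rw [R.unit_mul_same, R.unit_mul_same, R.transp_unit hl]
      · rw [R.unit_mul_ne _ _ _ _ h, R.unit_mul_ne _ _ _ _ (Ne.symm h), map_zero]
    · intro x y h h'; rw [mul_add, map_add, map_add, add_mul, h, h']
    · intro c x h
      rw [mul_smul_comm, LinearMap.map_smulₛₗ, LinearMap.map_smulₛₗ, smul_mul_assoc, h]
  · intro x y h h'; rw [add_mul, map_add, map_add, mul_add, h, h']
  · intro c x h
    rw [smul_mul_assoc, LinearMap.map_smulₛₗ, LinearMap.map_smulₛₗ, mul_smul_comm, h]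

theorem transp_of_le {N : ℕ} (hN : n ≤ N) : R.transp N s = R.transp n s := by
  induction N, hN using Nat.le_induction with
  | base => rfl
  | succ N hN ih =>
    rw [← ih]
    have hs' := R.semisimple_mono hN hs
    refine R.semisimple_induction (p := fun s => R.transp (N + 1) s = R.transp N s) (by omega) hs'
      (fun π σ => ?_) (by simp) ?_ ?_
    · rw [R.transp_unit hl, R.unit_eq_sum, map_sum, R.unit_eq_sum σ π]
      exact Finset.sum_congr rfl fun e _ => R.transp_unit hl _ _
    · intro x y h h'; rw [map_add, map_add, h, h']
    · intro c x h; rw [LinearMap.map_smulₛₗ, LinearMap.map_smulₛₗ, h]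

end

theorem IsDiamond.apply {R : FusionRules δ l} {D : R.union →ₗ⋆[ℂ] R.union} (hD : R.IsDiamond D)
    {n : ℕ} (hn : 0 < n) {s : R.union} (hs : (s : TL δ) ∈ R.semisimple n) :
    (D s : TL δ) = R.transp n s := by
  obtain ⟨x, hx⟩ := s
  suffices h : ∃ hx : x ∈ R.union, (D ⟨x, hx⟩ : TL δ) = R.transp n x from h.choose_spec
  refine R.semisimple_induction
    (p := fun x => ∃ hx : x ∈ R.union, (D ⟨x, hx⟩ : TL δ) = R.transp n x) hn hs ?_ ?_ ?_ ?_
  · exact fun π σ => ⟨R.unit_mem π σ, by rw [hD, R.transp_unit hl]⟩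
  · exact ⟨zero_mem _, by
      rw [map_zero, show (⟨0, _⟩ : R.union) = 0 from rfl, map_zero]; rfl⟩
  · rintro x y ⟨h1, h2⟩ ⟨h3, h4⟩
    refine ⟨add_mem h1 h3, ?_⟩
    rw [show (⟨x + y, _⟩ : R.union) = ⟨x, h1⟩ + ⟨y, h3⟩ from rfl, map_add, map_add, ← h2, ← h4]
    rfl
  · rintro c x ⟨h1, h2⟩
    refine ⟨Subalgebra.smul_mem _ h1 c, ?_⟩
    rw [show (⟨c • x, _⟩ : R.union) = c • ⟨x, h1⟩ from rfl, LinearMap.map_smulₛₗ,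
      LinearMap.map_smulₛₗ, ← h2]
    rfl

theorem existsUnique_diamond : ∃! D : R.union →ₗ⋆[ℂ] R.union, R.IsDiamond D := by
  have hex : ∀ s : R.union, ∃ n, 0 < n ∧ (s : TL δ) ∈ R.semisimple n := fun s =>
    R.mem_union.1 s.2
  choose N hN hN' using hex
  have key : ∀ (s : R.union) (n : ℕ), 0 < n → (s : TL δ) ∈ R.semisimple n →
      R.transp (N s) s = R.transp n s := fun s n hn hs => by
    rw [← R.transp_of_le hl (hN s) (hN' s) (le_max_left (N s) n),
      R.transp_of_le hl hn hs (le_max_right (N s) n)]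
  refine ⟨{ toFun := fun s => ⟨R.transp (N s) s, R.mem_union_of_mem (R.transp_mem _ _)⟩
            map_add' := fun s t => Subtype.ext ?_
            map_smul' := fun c s => Subtype.ext ?_ }, fun {n m} π σ => Subtype.ext ?_,
    fun D hD => LinearMap.ext fun s => Subtype.ext (hD.apply hl (hN s) (hN' s))⟩
  · have h1 := R.semisimple_mono (le_max_left (N s) (N t)) (hN' s)
    have h2 := R.semisimple_mono (le_max_right (N s) (N t)) (hN' t)
    have h0 : 0 < max (N s) (N t) := lt_max_of_lt_left (hN s)
    change R.transp (N (s + t)) ((s + t : R.union) : TL δ) = R.transp (N s) s + R.transp (N t) t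
    rw [key _ _ h0 h1, key _ _ h0 h2, key _ _ h0 (add_mem h1 h2 : (s : TL δ) + t ∈ _), ← map_add]
    rfl
  · change R.transp (N (c • s)) ((c • s : R.union) : TL δ) = starRingEnd ℂ c • R.transp (N s) s
    rw [key _ _ (hN s) (Subalgebra.smul_mem _ (hN' s) c : c • (s : TL δ) ∈ _),
      ← LinearMap.map_smulₛₗ]
    rfl
  · exact (key _ n π.level_pos (Algebra.subset_adjoin ⟨m, π, σ, rfl⟩)).trans (R.transp_unit hl π σ)

theorem IsDiamond.involutive {R : FusionRules δ l} {D : R.union →ₗ⋆[ℂ] R.union}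
    (hD : R.IsDiamond D) (s : R.union) : D (D s) = s := by
  obtain ⟨n, hn, hs⟩ := R.mem_union.1 s.2
  have h := hD.apply hl hn hs
  apply Subtype.ext
  rw [hD.apply hl hn (h ▸ R.transp_mem n _), h, R.transp_transp hl hn hs]

theorem IsDiamond.mul {R : FusionRules δ l} {D : R.union →ₗ⋆[ℂ] R.union}
    (hD : R.IsDiamond D) (s t : R.union) : D (s * t) = D t * D s := by
  obtain ⟨n, hn, hs⟩ := R.mem_union.1 s.2
  obtain ⟨m, -, ht⟩ := R.mem_union.1 t.2
  have hs' := R.semisimple_mono (le_max_left n m) hs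
  have ht' := R.semisimple_mono (le_max_right n m) ht
  have h0 : 0 < max n m := lt_max_of_lt_left hn
  apply Subtype.ext
  rw [hD.apply hl h0 (mul_mem hs' ht' : (s : TL δ) * t ∈ _)]
  exact (R.transp_mul hl h0 hs' ht').trans
    (by rw [MulMemClass.coe_mul, hD.apply hl h0 hs', hD.apply hl h0 ht'])

theorem union_eq_top (h2 : l = 2) : R.union = ⊤ := by
  subst h2
  refine eq_top_iff.2 fun x _ => ?_
  obtain ⟨n, hx⟩ := TL.exists_mem_fin x
  have hx' := TL.fin_mono (show n ≤ 2 * n + 1 by omega) hx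
  obtain ⟨c, hc, h⟩ := R.exists_sub_comp hl (by omega) hx'
  have hodd : ∀ π : LPath 2 (2 * n + 1), ¬ Nonrigid 2 π.1 := fun π hn => hn.2 (by
    have := π.2.parity; omega)
  have hc0 : ∀ π σ, c π σ = 0 := by
    intro π σ
    have hle : radHom δ 2 π.1 σ.1 ≤ ⊥ := by
      refine Submodule.span_le.2 ?_
      rintro y (⟨-, rfl⟩ | ⟨h, -⟩ | ⟨h, -⟩)
      · rw [nilsq, if_neg (hodd π)]; exact zero_mem _
      · exact absurd h (hodd π)
      · exact absurd h (hodd σ)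
    exact (Submodule.mem_bot ℂ).1 (hle (hc π σ))
  simp only [hc0, mul_zero, zero_mul, Finset.sum_const_zero] at h
  have h := toDiagram_injective (h.trans (map_zero _).symm)
  rw [sub_eq_zero.1 h]
  exact R.mem_union_of_mem (R.comp_mem _ _)

end FusionRules
end TemperleyLieb

namespace TemperleyLieb
namespace FusionRules

/-! ### Positive traces -/

variable {δ : ℝ} {l : ℕ} (R : FusionRules δ l)

/-- The values of a trace on the minimal idempotents are positive, and given by `w`. -/
def HasWeight (χ : TL δ →ₗ[ℂ] ℂ) (w : ℕ → ℕ → ℝ) : Prop :=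
  ∀ n m, Path l n m → R.weight χ ((n - m) / 2) m = w ((n - m) / 2) m ∧ 0 < w ((n - m) / 2) m

/-- All elements have bounded matrix entries. -/
def IsBounded (w : ℕ → ℕ → ℝ) : Prop :=
  ∀ n, 0 < n → ∀ x ∈ TL.fin δ n, ∃ A, ∀ k, R.normSq w (n + k) x ≤ A

variable {χ : TL δ →ₗ[ℂ] ℂ} {w : ℕ → ℕ → ℝ} (hl : QRoot δ l) (hχ : IsNormalizedTrace χ)

section
include hl hχ

theorem trace_mul_transp {n : ℕ} (hn : 0 < n) {x : TL δ} (hx : x ∈ TL.fin δ n) (y : TL δ) :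
    χ (x * R.transp n y) = ∑ i : PathPair l n, R.coef i.2.1 i.2.2 x *
      starRingEnd ℂ (R.coef i.2.1 i.2.2 y) * R.weight χ ((n - i.1) / 2) i.1 := by
  classical
  rw [transp_apply, Finset.mul_sum, map_sum]
  refine Finset.sum_congr rfl fun i _ => ?_
  obtain ⟨m, π, σ⟩ := i
  dsimp only
  rw [mul_smul_comm, map_smul, smul_eq_mul, mul_comm (R.coef π σ x), mul_assoc]
  congr 1
  have h1 : χ (x * R.unit σ π) = χ (R.comp n x * R.unit σ π) := by
    rw [← sub_eq_zero, ← map_sub, ← sub_mul]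
    exact R.trace_rad hl hχ hn (mul_mem_rad' (R.sub_comp_mem_rad hl hn hx) (R.unit_mem_fin σ π))
  rw [h1, comp_apply, Finset.sum_mul, map_sum, Finset.sum_eq_single (⟨m, π, σ⟩ : PathPair l n)]
  · rw [smul_mul_assoc, map_smul, R.unit_mul_same, R.trace_unit hχ, if_pos rfl, smul_eq_mul]
  · rintro ⟨m', π', σ'⟩ - h
    dsimp only
    rw [smul_mul_assoc, map_smul]
    by_cases h2 : (⟨m', σ'⟩ : LPath l n) = ⟨m, σ⟩
    · cases h2
      rw [R.unit_mul_same, R.trace_unit hχ, if_neg (fun h3 => h (by rw [h3])), smul_zero]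
    · rw [R.unit_mul_ne _ _ _ _ h2, map_zero, smul_zero]
  · exact fun h => absurd (Finset.mem_univ _) h

variable (hw : R.HasWeight χ w)
include hw

theorem trace_mul_transp_self {n : ℕ} (hn : 0 < n) {x : TL δ} (hx : x ∈ TL.fin δ n) :
    χ (x * R.transp n x) = R.normSq w n x := by
  rw [R.trace_mul_transp hl hχ hn hx, normSq, Complex.ofReal_sum]
  refine Finset.sum_congr rfl fun i _ => ?_
  rw [Complex.mul_conj, Complex.normSq_eq_norm_sq, (hw _ _ i.2.1).1]
  push_cast
  rfl

theorem trace_mul_transp_conj {n : ℕ} (hn : 0 < n) {x y : TL δ} (hx : x ∈ TL.fin δ n)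
    (hy : y ∈ TL.fin δ n) : starRingEnd ℂ (χ (x * R.transp n y)) = χ (y * R.transp n x) := by
  rw [R.trace_mul_transp hl hχ hn hx, R.trace_mul_transp hl hχ hn hy, map_sum]
  refine Finset.sum_congr rfl fun i _ => ?_
  rw [map_mul, map_mul, Complex.conj_conj, (hw _ _ i.2.1).1, Complex.conj_ofReal]
  ring

/-- The components are orthogonal projections. -/
theorem normSq_sub_comp {n N : ℕ} (hn : 0 < n) (hN : n ≤ N) {x : TL δ} (hx : x ∈ TL.fin δ n) :
    R.normSq w N (x - R.comp n x) = R.normSq w N x - R.normSq w n x := by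
  have hN0 : 0 < N := by omega
  have hs := R.comp_mem n x
  have hsf := R.semisimple_le_fin n hs
  have hx' := TL.fin_mono hN hx
  have hs' := TL.fin_mono hN hsf
  have h1 := R.transp_of_le hl hn hs hN
  rw [R.transp_comp hl] at h1
  have h2 : χ (x * R.transp n x) = R.normSq w n x := R.trace_mul_transp_self hl hχ hw hn hx
  have h3 : χ (R.comp n x * R.transp n x) = R.normSq w n x := by
    rw [R.trace_mul_transp hl hχ hn hsf, ← h2, R.trace_mul_transp hl hχ hn hx]
    simp only [R.coef_comp hl]
  have h4 : χ (R.comp n x * R.transp N x) = R.normSq w n x := by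
    rw [← R.trace_mul_transp_conj hl hχ hw hN0 hx' hs', h1, h2, Complex.conj_ofReal]
  have h5 := R.trace_mul_transp_self hl hχ hw hN0 (sub_mem hx' hs')
  rw [map_sub, h1, mul_sub, sub_mul, sub_mul, map_sub, map_sub, map_sub, h2, h3, h4,
    R.trace_mul_transp_self hl hχ hw hN0 hx'] at h5
  have h6 : ((R.normSq w N x - R.normSq w n x : ℝ) : ℂ) = R.normSq w N (x - R.comp n x) := by
    rw [← h5]; push_cast; ring
  exact (Complex.ofReal_injective h6).symm

omit hl hχ in
theorem normSq_nonneg (n : ℕ) (x : TL δ) : 0 ≤ R.normSq w n x :=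
  Finset.sum_nonneg fun i _ => mul_nonneg (sq_nonneg _) (hw _ _ i.2.1).2.le

theorem normSq_mono {n N : ℕ} (hn : 0 < n) (hN : n ≤ N) {x : TL δ} (hx : x ∈ TL.fin δ n) :
    R.normSq w n x ≤ R.normSq w N x := by
  have := R.normSq_nonneg hw N (x - R.comp n x)
  rw [R.normSq_sub_comp hl hχ hw hn hN hx] at this
  linarith

omit hχ in
theorem exists_normSq_pos {n : ℕ} (hn : 0 < n) {x : TL δ} (hx : x ∈ TL.fin δ n) (h0 : x ≠ 0) :
    ∃ N, n ≤ N ∧ 0 < R.normSq w N x := by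
  obtain ⟨N, hN⟩ := exists_vev_ne_zero_of_mem (toDiagram_mem hx)
    (fun h => h0 (toDiagram_injective (h.trans (map_zero _).symm)))
  obtain ⟨j, u, hu, v, hv, h⟩ := hN (max n N) (le_max_right _ _)
  refine ⟨max n N, le_max_left _ _, lt_of_le_of_ne (R.normSq_nonneg hw _ x) fun h1 => h ?_⟩
  have h2 := (Finset.sum_eq_zero_iff_of_nonneg fun i _ =>
    mul_nonneg (sq_nonneg _) (hw _ _ i.2.1).2.le).1 h1.symm
  have h3 : R.comp (max n N) x = 0 := Finset.sum_eq_zero fun i hi => by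
    rw [norm_eq_zero.1 (pow_eq_zero_iff two_ne_zero |>.1
      ((mul_eq_zero.1 (h2 i hi)).resolve_right (hw _ _ i.2.1).2.ne')), zero_smul]
  have h4 := R.sub_comp_mem_negl hl (lt_max_of_lt_left hn) (TL.fin_mono (le_max_left n N) hx)
  rw [h3, sub_zero] at h4
  exact h4.2 j v hv u hu

theorem tendsto_normSq (hb : R.IsBounded w) {n : ℕ} (hn : 0 < n) {x : TL δ} (hx : x ∈ TL.fin δ n) :
    ∃ r, Tendsto (fun N => R.normSq w N x) atTop (𝓝 r) ∧ ∀ N, n ≤ N → R.normSq w N x ≤ r := by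
  obtain ⟨A, hA⟩ := hb n hn x hx
  have hmono : Monotone fun k => R.normSq w (k + n) x := fun a b h =>
    R.normSq_mono hl hχ hw (by omega) (by omega) (TL.fin_mono (by omega) hx)
  have hbd : BddAbove (Set.range fun k => R.normSq w (k + n) x) :=
    ⟨A, by rintro _ ⟨k, rfl⟩; simpa only [add_comm k n] using hA k⟩
  refine ⟨_, (tendsto_add_atTop_iff_nat n).1 (tendsto_atTop_ciSup hmono hbd), fun N hN => ?_⟩
  have := le_ciSup hbd (N - n)
  rwa [show N - n + n = N by omega] at this

end

variable {D : R.union →ₗ⋆[ℂ] R.union} (hD : R.IsDiamond D)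
include hD hl

theorem diamond_part {n : ℕ} (hn : 0 < n) {x : TL δ} (hx : x ∈ TL.fin δ n) :
    (D (R.part n x) : TL δ) = R.transp n x := by
  have h := R.part_eq hl hn hx
  rw [hD.apply hl hn (h ▸ R.comp_mem n x), h, R.transp_comp hl]

include hχ

theorem isPositive_iff : R.IsPositive D χ ↔ ∃ w, R.HasWeight χ w ∧ R.IsBounded w := by
  classical
  constructor
  · intro h
    have key : ∀ {n m : ℕ} (_ : Path l n m),
        ∃ r : ℝ, 0 < r ∧ R.weight χ ((n - m) / 2) m = r := by
      intro n m π
      have hne : R.unit π π ≠ 0 := fun h0 => by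
        have := R.coef_unit_same hl π π
        rw [h0, map_zero] at this
        exact zero_ne_one this
      obtain ⟨r, hr, h1⟩ := h _ hne
      refine ⟨r, hr, tendsto_nhds_unique (tendsto_const_nhds.congr' ?_) h1⟩
      filter_upwards [eventually_ge_atTop n] with N hN
      have hs : R.unit π π ∈ R.semisimple n := Algebra.subset_adjoin ⟨m, π, π, rfl⟩
      have hn := π.level_pos
      rw [R.diamond_part hl hD (by omega) (TL.fin_mono hN (R.unit_mem_fin π π)),
        R.transp_of_le hl hn hs hN, R.transp_unit hl, R.unit_mul_same, R.trace_unit hχ, if_pos rfl]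
    have hw : R.HasWeight χ fun p m => (R.weight χ p m).re := fun n m π => by
      obtain ⟨r, hr, h1⟩ := key π
      simp [h1, hr]
    refine ⟨_, hw, fun n hn x hx => ?_⟩
    by_cases h0 : x = 0
    · exact ⟨0, fun k => by simp [h0, normSq]⟩
    obtain ⟨r, -, h1⟩ := h x h0
    refine ⟨r, fun k => ge_of_tendsto ((Complex.continuous_re.tendsto _).comp h1) ?_⟩
    filter_upwards [eventually_ge_atTop (n + k)] with N hN
    have hx' := TL.fin_mono (show n ≤ N by omega) hx
    rw [Function.comp_apply, R.diamond_part hl hD (by omega) hx',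
      R.trace_mul_transp_self hl hχ hw (by omega) hx']
    exact R.normSq_mono hl hχ hw (by omega) hN (TL.fin_mono (by omega) hx)
  · rintro ⟨w, hw, hb⟩ x h0
    obtain ⟨n, hx⟩ := TL.exists_mem_fin x
    have hx := TL.fin_mono n.le_succ hx
    obtain ⟨r, hr, h1⟩ := R.tendsto_normSq hl hχ hw hb n.succ_pos hx
    obtain ⟨N, hN, hpos⟩ := R.exists_normSq_pos hl hw n.succ_pos hx h0
    refine ⟨r, hpos.trans_le (h1 N hN), ((Complex.continuous_ofReal.tendsto _).comp hr).congr' ?_⟩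
    filter_upwards [eventually_ge_atTop (n + 1)] with M hM
    have hx' := TL.fin_mono hM hx
    rw [R.diamond_part hl hD (by omega) hx', R.trace_mul_transp_self hl hχ hw (by omega) hx']
    rfl

end FusionRules
end TemperleyLieb

namespace TemperleyLieb

/-! ### The positive extremal traces -/

theorem exists_sin_nonpos (x : ℝ) : ∃ k : ℕ, 0 < k ∧ Real.sin (k * x) ≤ 0 := by
  by_contra! h
  have hcos : ∀ k : ℕ, 0 < k → 0 < Real.cos (k * x) := fun k hk => by
    have h1 := h (2 * k) (by omega)
    rw [Nat.cast_mul, Nat.cast_ofNat, mul_assoc, Real.sin_two_mul] at h1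
    nlinarith [h k hk]
  have h2 : ∀ j : ℕ, 2 ^ j * (1 - Real.cos x) ≤ 1 - Real.cos ((2 ^ j : ℕ) * x) := by
    intro j
    induction j with
    | zero => simp
    | succ j ih =>
      have h3 := hcos (2 ^ j) (by positivity)
      have h4 := Real.cos_le_one ((2 ^ j : ℕ) * x)
      rw [pow_succ', pow_succ', Nat.cast_mul, Nat.cast_ofNat, mul_assoc (2 : ℝ) (_ : ℝ) x,
        Real.cos_two_mul]
      nlinarith
  have h1 := h 1 one_pos
  rw [Nat.cast_one, one_mul] at h1
  have h5 : 0 < 1 - Real.cos x := by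
    nlinarith [Real.sin_sq_add_cos_sq x, Real.cos_le_one x, Real.neg_one_le_cos x]
  obtain ⟨j, hj⟩ := pow_unbounded_of_one_lt (1 / (1 - Real.cos x)) (one_lt_two (α := ℝ))
  rw [div_lt_iff₀ h5] at hj
  linarith [h2 j, hcos (2 ^ j) (by positivity)]

theorem exists_genericCoeff_nonpos {l : ℕ} (hl : 0 < l) {γ : ℝ} (h : 1 / 4 < γ) :
    ∃ k, 0 < k ∧ genericCoeff γ (k * l - 1) ≤ 0 := by
  obtain ⟨r, hr, rfl⟩ : ∃ r : ℝ, 0 < r ∧ γ = r ^ 2 :=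
    ⟨√γ, Real.sqrt_pos.2 (by linarith), (Real.sq_sqrt (by linarith)).symm⟩
  have hr' : 1 / 2 < r := by nlinarith
  have hr0 : 0 < 1 / (2 * r) := by positivity
  have hr1 : 1 / (2 * r) < 1 := by rw [div_lt_one (by positivity)]; linarith
  obtain ⟨x, hx, hsin⟩ : ∃ x, Real.cos x = 1 / (2 * r) ∧ 0 < Real.sin x :=
    ⟨_, Real.cos_arccos (by linarith) hr1.le, by
      rw [Real.sin_arccos]; exact Real.sqrt_pos.2 (by nlinarith)⟩
  have hx' : 2 * r * Real.cos x = 1 := by rw [hx]; field_simp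
  have key : ∀ m, genericCoeff (r ^ 2) m * Real.sin x = r ^ m * Real.sin ((m + 1) * x) ∧
      genericCoeff (r ^ 2) (m + 1) * Real.sin x = r ^ (m + 1) * Real.sin ((m + 1) * x + x) := by
    intro m
    induction m with
    | zero =>
      refine ⟨by simp [genericCoeff], ?_⟩
      rw [Nat.cast_zero, zero_add, zero_add, one_mul, ← two_mul, Real.sin_two_mul, genericCoeff]
      linear_combination -Real.sin x * hx'
    | succ m ih =>
      have e : ((m + 1 : ℕ) + 1 : ℝ) * x = (m + 1) * x + x := by push_cast; ring
      refine ⟨by rw [e]; exact ih.2, ?_⟩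
      rw [e, genericCoeff, sub_mul, mul_assoc, ih.1, ih.2, Real.sin_add (_ + x), Real.sin_add,
        Real.cos_add]
      linear_combination (-(r ^ (m + 1) * (Real.sin ((m + 1) * x) * Real.cos x +
        Real.cos ((m + 1) * x) * Real.sin x))) * hx' + r ^ (m + 2) * Real.sin ((m + 1) * x) *
          Real.sin_sq_add_cos_sq x
  obtain ⟨k, hk, hk'⟩ := exists_sin_nonpos (l * x)
  refine ⟨k, hk, nonpos_of_mul_nonpos_left ?_ hsin⟩
  have hkl : k * l - 1 + 1 = k * l := Nat.sub_add_cancel (Nat.mul_pos hk hl)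
  have h1 : (((k * l - 1 : ℕ) : ℝ) + 1) * x = k * (l * x) := by
    rw [← mul_assoc, ← Nat.cast_mul, ← hkl]; push_cast; rfl
  rw [(key _).1, h1]
  exact mul_nonpos_of_nonneg_of_nonpos (pow_pos hr _).le hk'

namespace FusionRules

variable {δ : ℝ} {l : ℕ} (R : FusionRules δ l) {χ : TL δ →ₗ[ℂ] ℂ} {w : ℕ → ℕ → ℝ}

theorem exists_path_up (n : ℕ) : Nonempty (Path l (n + 1) (n + 1)) := by
  induction n with
  | zero => exact ⟨.base⟩
  | succ n ih => exact ih.map fun π => π.step (n + 2) ⟨0, by simp [edges]⟩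

theorem isPositive_iff_of_hasParameter (hl : QRoot δ l) (hχ : IsNormalizedTrace χ)
    {D : R.union →ₗ⋆[ℂ] R.union} (hD : R.IsDiamond D) {γ : ℝ} (h : R.HasParameter γ χ) :
    R.IsPositive D χ ↔ 0 < γ ∧ γ ≤ 1 / 4 := by
  have hl2 := hl.two_le
  have hwt := R.weight_eq hl2 hχ ((R.hasParameter_iff hl hχ γ).1 h)
  rw [R.isPositive_iff hl hχ hD]
  constructor
  · rintro ⟨w, hw, -⟩
    have key : ∀ {n m : ℕ}, Path l n m → 0 < γ ^ ((n - m) / 2) * rootCoeff l γ m := fun π => by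
      obtain ⟨h1, h2⟩ := hw _ _ π
      rw [hwt] at h1
      rwa [Complex.ofReal_injective h1]
    constructor
    · obtain ⟨π⟩ := exists_path_one hl2 1
      have := key π
      rw [rootCoeff_one hl2] at this
      simpa using this
    · by_contra! h
      obtain ⟨k, hk, hk'⟩ := exists_genericCoeff_nonpos (l := l) (by omega) h
      have h1 : l ≤ k * l := Nat.le_mul_of_pos_left l hk
      obtain ⟨π⟩ := exists_path_up (l := l) (k * l - 2)
      have := key π
      rw [Nat.sub_self, Nat.zero_div, pow_zero, one_mul, show k * l - 2 + 1 = k * l - 1 by omega,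
        rootCoeff_of_dvd γ (by rw [Nat.sub_add_cancel (by omega)]; exact dvd_mul_left l k)] at this
      linarith
  · rintro ⟨h0, h1⟩
    exact ⟨_, fun n m _ => ⟨hwt _ _, mul_pos (pow_pos h0 _) (rootCoeff_pos h0 h1 l m)⟩,
      fun n hn x hx => R.normSq_bounded hl h0 h1 hn hx⟩

/-! ### Harmonic functions -/

/-- Nonnegative harmonic functions on the Bratteli diagram, as functions of the number of cups
and of the number of through strands. -/
def IsHarmonic (l : ℕ) (f : ℕ → ℕ → ℝ) : Prop := ∀ n m, Path l n m → 0 ≤ f ((n - m) / 2) m ∧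
  f ((n - m) / 2) m = ∑ e : Edge l m, f ((n - m) / 2 + (m + 1 - e.1) / 2) e.1

theorem HasWeight.isHarmonic {R : FusionRules δ l} (hχ : IsNormalizedTrace χ)
    (hw : R.HasWeight χ w) : IsHarmonic l w := fun n m π => by
  refine ⟨(hw n m π).2.le, Complex.ofReal_injective ?_⟩
  rw [← (hw n m π).1, R.weight_eq_sum hχ, Complex.ofReal_sum]
  refine Finset.sum_congr rfl fun e _ => ?_
  have h1 := (hw _ _ (π.step e.1 e.2)).1
  have h2 := π.parity
  rwa [show (n + 1 - e.1) / 2 = (n - m) / 2 + (m + 1 - e.1) / 2 by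
    rcases edges_cases e.2 with h | h | h <;> omega] at h1

variable {f : ℕ → ℕ → ℝ}

theorem exists_return (hl : 2 ≤ l) {n m : ℕ} (π : Path l n m) :
    ∃ j, (j = m + 1 ∨ j + 1 = m) ∧ 0 < edges l m j ∧ 0 < edges l j m := by
  by_cases h : l ∣ m + 2
  · have hm : m ≠ 0 := by
      rintro rfl
      obtain rfl : l = 2 := le_antisymm (Nat.le_of_dvd two_pos h) hl
      rcases π with _ | ⟨π, -, k⟩
      rename_i m
      have h1 := k.pos
      rcases edges_cases k with h | h | h
      · omega
      · rw [edges_down h, ← h] at h1; simp at h1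
      · omega
    have h1 : m - 1 + 1 = m := by omega
    refine ⟨m - 1, Or.inr h1, ?_, ?_⟩
    · rw [edges_down h1, if_neg]
      · split_ifs <;> omega
      · intro h2
        have := Nat.le_of_dvd one_pos ((Nat.dvd_add_right h2).1 h)
        omega
    · rw [edges, if_pos h1.symm]; exact one_pos
  · refine ⟨m + 1, Or.inl rfl, by rw [edges, if_pos rfl]; exact one_pos, ?_⟩
    rw [edges_down rfl, if_neg h]
    split_ifs <;> omega

theorem IsHarmonic.shift_le (hl : 2 ≤ l) (hf : IsHarmonic l f) {n m : ℕ} (π : Path l n m) :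
    Nonempty (Path l (n + 2) m) ∧ f ((n - m) / 2 + 1) m ≤ f ((n - m) / 2) m := by
  obtain ⟨j, hj, h1, h2⟩ := exists_return hl π
  have step : ∀ {n m j : ℕ} (π : Path l n m) (h : 0 < edges l m j),
      f ((n + 1 - j) / 2) j ≤ f ((n - m) / 2) m := by
    intro n m j π h
    rw [(hf n m π).2]
    have hp : ∀ e : Edge l m, (n + 1 - e.1) / 2 = (n - m) / 2 + (m + 1 - e.1) / 2 := fun e => by
      have := π.parity
      rcases edges_cases e.2 with h | h | h <;> omega
    simp only [← hp]
    exact Finset.single_le_sum (f := fun e : Edge l m => f ((n + 1 - e.1) / 2) e.1)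
      (fun e _ => (hf _ _ (π.step e.1 e.2)).1) (Finset.mem_univ ⟨j, ⟨0, h⟩⟩)
  have h3 := (step (π.step j ⟨0, h1⟩) h2).trans (step π h1)
  rw [show (n + 1 + 1 - m) / 2 = (n - m) / 2 + 1 by have := π.parity; omega] at h3
  exact ⟨⟨(π.step j ⟨0, h1⟩).step m ⟨0, h2⟩⟩, h3⟩

theorem IsHarmonic.shift (hl : 2 ≤ l) (hf : IsHarmonic l f) :
    IsHarmonic l (fun p m => f (p + 1) m) := fun n m π => by
  obtain ⟨⟨π'⟩, -⟩ := hf.shift_le hl π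
  have h := hf _ _ π'
  rw [show (n + 2 - m) / 2 = (n - m) / 2 + 1 by have := π.parity; omega] at h
  simp only [add_right_comm _ _ 1]
  exact h

theorem IsHarmonic.sub_shift (hl : 2 ≤ l) (hf : IsHarmonic l f) :
    IsHarmonic l (fun p m => f p m - f (p + 1) m) := fun n m π =>
  ⟨sub_nonneg.2 (hf.shift_le hl π).2, by
    beta_reduce
    rw [Finset.sum_sub_distrib]
    exact congrArg₂ (· - ·) (hf n m π).2 (hf.shift hl n m π).2⟩

theorem IsHarmonic.sum_nonneg (hl : 2 ≤ l) (n : ℕ) (hf : IsHarmonic l f) (a : ℝ) :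
    0 ≤ n * (n - 1) * f 2 1 + (1 - 2 * a) * n * f 1 1 + a ^ 2 * f 0 1 := by
  induction n generalizing f a with
  | zero =>
    have := (hf 1 1 .base).1
    simp only [Nat.cast_zero, zero_mul, mul_zero, zero_add]
    exact mul_nonneg (sq_nonneg a) this
  | succ n ih =>
    have h1 := ih (hf.shift hl) (a - 1)
    have h2 := ih (hf.sub_shift hl) a
    push_cast
    linarith

theorem IsHarmonic.sq_nonneg (hl : 2 ≤ l) (hf : IsHarmonic l f) (a : ℝ) :
    0 ≤ f 2 1 - 2 * a * f 1 1 + a ^ 2 * f 0 1 := by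
  by_contra! h
  obtain ⟨n, hn⟩ := exists_nat_gt ((f 1 1 - f 2 1) / -(f 2 1 - 2 * a * f 1 1 + a ^ 2 * f 0 1))
  rw [div_lt_iff₀ (by linarith)] at hn
  have h1 := hf.sum_nonneg hl (n + 1) ((n + 1) * a)
  have h2 : (0 : ℝ) ≤ n := Nat.cast_nonneg n
  push_cast at h1
  nlinarith

theorem IsHarmonic.eq_mul {g : ℕ → ℕ → ℝ} (hl : 2 ≤ l) (hf : IsHarmonic l f)
    (hg : IsHarmonic l g) {a b c γ : ℝ} (ha : 0 < a) (hb : 0 < b)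
    (h : ∀ k, a * f k 1 + b * g k 1 = c * γ ^ k) : f 1 1 = γ * f 0 1 := by
  have h0 := h 0
  have h1 := h 1
  have h2 := h 2
  have hg0 := hg.sq_nonneg hl γ
  have hf0 : f 2 1 - 2 * γ * f 1 1 + γ ^ 2 * f 0 1 ≤ 0 := by
    have : a * (f 2 1 - 2 * γ * f 1 1 + γ ^ 2 * f 0 1) =
        -(b * (g 2 1 - 2 * γ * g 1 1 + γ ^ 2 * g 0 1)) := by
      linear_combination h2 - 2 * γ * h1 + γ ^ 2 * h0
    by_contra! h
    nlinarith [mul_pos ha h, mul_nonneg hb.le hg0]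
  have ht := (hf 1 1 .base).1
  norm_num at ht
  set A := f 1 1 - γ * f 0 1 with hA
  have h3 := hf.sq_nonneg hl (γ + A / (f 0 1 + 1))
  have h4 : 0 ≤ -(2 * (A / (f 0 1 + 1)) * A) + (A / (f 0 1 + 1)) ^ 2 * f 0 1 := by nlinarith
  have h5 : -(2 * (A / (f 0 1 + 1)) * A) + (A / (f 0 1 + 1)) ^ 2 * f 0 1 =
      -(A ^ 2 * (f 0 1 + 2)) / (f 0 1 + 1) ^ 2 := by field_simp; ring
  rw [h5, le_div_iff₀ (by positivity)] at h4
  have h6 : A ^ 2 = 0 := by nlinarith [_root_.sq_nonneg A]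
  have := pow_eq_zero_iff two_ne_zero |>.1 h6
  linarith

end FusionRules
end TemperleyLieb

namespace TemperleyLieb

variable {δ : ℝ} {l : ℕ}

/-- The trace `x ↦ χ (∪ x ∩)`. -/
noncomputable def shifted (χ : TL δ →ₗ[ℂ] ℂ) : TL δ →ₗ[ℂ] ℂ :=
  shiftTrace χ 1 ∘ₗ (toDiagram δ).toLinearMap

theorem shifted_apply (χ : TL δ →ₗ[ℂ] ℂ) (x : TL δ) :
    shifted χ x = shiftTrace χ 1 (toDiagram δ x) := rfl

theorem shiftTrace_shifted (χ : TL δ →ₗ[ℂ] ℂ) {n : ℕ} {x : Diagram δ} (hx : x ∈ diagrams δ n n)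
    (p : ℕ) : shiftTrace (shifted χ) p x = shiftTrace χ (p + 1) x := by
  obtain ⟨y, -, hy⟩ := exists_toDiagram_eq (mul_mem_diagrams (mul_mem_diagrams
    (cup_pow_mem (n + 1) p) (diagrams_mono (a' := n + 1) (b' := n + 1) hx (by omega) (by omega)))
    (cap_pow_mem (by omega) p))
  rw [shiftTrace_apply, ← hy, diagTrace_toDiagram, shifted_apply, hy, shiftTrace_apply,
    shiftTrace_apply, pow_one, pow_one, pow_succ', pow_succ]
  simp only [mul_assoc]

variable {χ : TL δ →ₗ[ℂ] ℂ}

theorem shifted_comm (hχ : IsNormalizedTrace χ) (x y : TL δ) :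
    shifted χ (x * y) = shifted χ (y * x) := by
  obtain ⟨n, hx⟩ := TL.exists_mem_fin x
  obtain ⟨m, hy⟩ := TL.exists_mem_fin y
  rw [shifted_apply, shifted_apply, map_mul (toDiagram δ), map_mul (toDiagram δ)]
  exact shiftTrace_comm hχ (k := 0) (a := max n m) rfl
    (toDiagram_mem (TL.fin_mono (le_max_left n m) hx))
    (toDiagram_mem (TL.fin_mono (le_max_right n m) hy)) 1

namespace FusionRules

variable (R : FusionRules δ l) {w : ℕ → ℕ → ℝ} {D : R.union →ₗ⋆[ℂ] R.union}

theorem isPositive_combination (hl : QRoot δ l) (hχ : IsNormalizedTrace χ) (hD : R.IsDiamond D)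
    (hw : R.HasWeight χ w) (hb : R.IsBounded w) {a b : ℝ} (h1 : a + b * w 1 1 = 1)
    (h : ∀ u v : ℝ, 0 < v → v ≤ u → 0 < a * u + b * v ∧ a * u + b * v ≤ 2 * u) :
    IsNormalizedTrace ((a : ℂ) • χ + (b : ℂ) • shifted χ) ∧
      R.IsPositive D ((a : ℂ) • χ + (b : ℂ) • shifted χ) := by
  have hf := hw.isHarmonic hχ
  obtain ⟨⟨π⟩, -⟩ := hf.shift_le hl.two_le .base
  have ht : shiftTrace χ 1 1 = w 1 1 := by
    rw [← R.weight_one]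
    exact (hw _ _ π).1
  have hnorm : IsNormalizedTrace ((a : ℂ) • χ + (b : ℂ) • shifted χ) := by
    constructor
    · rw [LinearMap.add_apply, LinearMap.smul_apply, LinearMap.smul_apply, hχ.1, shifted_apply,
        map_one, ht, smul_eq_mul, mul_one, smul_eq_mul, ← Complex.ofReal_mul, ← Complex.ofReal_add,
        h1, Complex.ofReal_one]
    · intro x y
      simp only [LinearMap.add_apply, LinearMap.smul_apply]
      rw [hχ.2, shifted_comm hχ]
  have hwt : R.HasWeight ((a : ℂ) • χ + (b : ℂ) • shifted χ)
      (fun p m => a * w p m + b * w (p + 1) m) := fun n m π => by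
    obtain ⟨⟨π'⟩, h2⟩ := hf.shift_le hl.two_le π
    obtain ⟨h3, h4⟩ := hw _ _ π'
    rw [show (n + 2 - m) / 2 = (n - m) / 2 + 1 by have := π.parity; omega] at h3 h4
    refine ⟨?_, (h _ _ h4 h2).1⟩
    have : R.weight ((a : ℂ) • χ + (b : ℂ) • shifted χ) ((n - m) / 2) m =
      (a : ℂ) * R.weight χ ((n - m) / 2) m + (b : ℂ) * R.weight (shifted χ) ((n - m) / 2) m := rfl
    rw [this, (hw _ _ π).1, weight, shiftTrace_shifted χ (by rw [R.P_eq hl]; exact proj_mem hl m),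
      ← weight, h3]
    push_cast
    rfl
  refine ⟨hnorm, (R.isPositive_iff hl hnorm hD).2 ⟨_, hwt, fun n hn x hx => ?_⟩⟩
  obtain ⟨A, hA⟩ := hb n hn x hx
  refine ⟨2 * A, fun k => le_trans ?_ (mul_le_mul_of_nonneg_left (hA k) zero_le_two)⟩
  rw [normSq, normSq, Finset.mul_sum]
  refine Finset.sum_le_sum fun i _ => ?_
  obtain ⟨⟨π'⟩, h2⟩ := hf.shift_le hl.two_le i.2.1
  have h4 := (hw _ _ π').2
  rw [show (n + k + 2 - i.1) / 2 = (n + k - i.1) / 2 + 1 by have := i.2.1.parity; omega] at h4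
  rw [mul_left_comm]
  exact mul_le_mul_of_nonneg_left (h _ _ h4 h2).2 (sq_nonneg _)

theorem exists_parameter_of_extreme (hl : QRoot δ l) (hD : R.IsDiamond D)
    (h : χ ∈ Set.extremePoints ℝ {χ : TL δ →ₗ[ℂ] ℂ | IsNormalizedTrace χ ∧ R.IsPositive D χ}) :
    ∃ γ : ℝ, R.HasParameter γ χ := by
  obtain ⟨⟨hχ, hpos⟩, hext⟩ := mem_extremePoints_iff_left.1 h
  obtain ⟨w, hw, hb⟩ := (R.isPositive_iff hl hχ hD).1 hpos
  have hf := hw.isHarmonic hχ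
  have h01 : w 0 1 = 1 := by
    have h1 := (hw _ _ .base).1
    rw [R.weight_one, Nat.sub_self, Nat.zero_div, ← map_one (toDiagram δ), trace_toDiagram,
      hχ.1] at h1
    exact (Complex.ofReal_injective (Complex.ofReal_one.trans h1)).symm
  obtain ⟨⟨π⟩, hc1⟩ := hf.shift_le hl.two_le .base
  have hc0 : 0 < w 1 1 := (hw _ _ π).2
  rw [Nat.sub_self, Nat.zero_div, zero_add, h01] at hc1
  set c := w 1 1 with hc
  have hp := R.isPositive_combination hl hχ hD hw hb (a := 1 - c / 2) (b := 1 / 2)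
    (by rw [← hc]; ring) (fun u v hv hvu => ⟨by nlinarith, by nlinarith⟩)
  have hm := R.isPositive_combination hl hχ hD hw hb (a := 1 + c / 2) (b := -(1 / 2))
    (by rw [← hc]; ring) (fun u v hv hvu => ⟨by nlinarith, by nlinarith⟩)
  have heq := hext _ hp _ hm ⟨1 / 2, 1 / 2, by norm_num, by norm_num, by norm_num, by
    ext x
    simp only [LinearMap.add_apply, LinearMap.smul_apply, smul_eq_mul, Complex.real_smul]
    push_cast
    ring⟩
  have hsh : shifted χ = (c : ℂ) • χ := by
    ext x
    have := LinearMap.congr_fun heq x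
    simp only [LinearMap.add_apply, LinearMap.smul_apply, smul_eq_mul] at this ⊢
    push_cast at this
    linear_combination 2 * this
  refine ⟨c, (R.hasParameter_iff hl hχ c).2 fun k => ?_⟩
  induction k with
  | zero => rw [← map_one (toDiagram δ), trace_toDiagram, hχ.1, pow_zero]
  | succ k ih =>
    rw [← shiftTrace_shifted χ (one_mem_diagrams 0), hsh, pow_succ', ← ih]
    rfl

theorem extremePoints_eq (hl : QRoot δ l) (hD : R.IsDiamond D) :
    Set.extremePoints ℝ {χ : TL δ →ₗ[ℂ] ℂ | IsNormalizedTrace χ ∧ R.IsPositive D χ} =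
      {χ | IsNormalizedTrace χ ∧ ∃ γ : ℝ, 0 < γ ∧ γ ≤ 1 / 4 ∧ R.HasParameter γ χ} := by
  ext χ
  constructor
  · intro h
    obtain ⟨γ, hγ⟩ := R.exists_parameter_of_extreme hl hD h
    have h1 := (R.isPositive_iff_of_hasParameter hl h.1.1 hD hγ).1 h.1.2
    exact ⟨h.1.1, γ, h1.1, h1.2, hγ⟩
  · rintro ⟨hχ, γ, h0, h1, hγ⟩
    refine mem_extremePoints_iff_left.2
      ⟨⟨hχ, (R.isPositive_iff_of_hasParameter hl hχ hD hγ).2 ⟨h0, h1⟩⟩, ?_⟩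
    rintro y ⟨hy, hyp⟩ z ⟨hz, hzp⟩ ⟨a, b, ha, hb, hab, rfl⟩
    obtain ⟨f, hf, -⟩ := (R.isPositive_iff hl hy hD).1 hyp
    obtain ⟨g, hg, -⟩ := (R.isPositive_iff hl hz hD).1 hzp
    have hp := (R.hasParameter_iff hl hχ γ).1 hγ
    have hk : ∀ k, shiftTrace y k 1 = f k 1 ∧ shiftTrace z k 1 = g k 1 := fun k => by
      obtain ⟨π⟩ := exists_path_one hl.two_le k
      have h2 := (hf _ _ π).1
      have h3 := (hg _ _ π).1
      rw [R.weight_one, show (2 * k + 1 - 1) / 2 = k by omega] at h2 h3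
      exact ⟨h2, h3⟩
    have hsum : ∀ k, a * f k 1 + b * g k 1 = γ ^ k := fun k => by
      have h2 : shiftTrace (a • y + b • z) k 1 = a • shiftTrace y k 1 + b • shiftTrace z k 1 := rfl
      rw [hp, (hk k).1, (hk k).2] at h2
      simp only [Complex.real_smul] at h2
      exact_mod_cast h2.symm
    have hF : ∀ j, IsHarmonic l (fun p m => f (p + j) m) ∧ IsHarmonic l (fun p m => g (p + j) m) := by
      intro j
      induction j with
      | zero => exact ⟨hf.isHarmonic hy, hg.isHarmonic hz⟩
      | succ j ih =>
        have := And.intro (ih.1.shift hl.two_le) (ih.2.shift hl.two_le)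
        simpa only [add_right_comm _ 1, add_assoc] using this
    have hpow : ∀ k, f k 1 = γ ^ k := by
      intro k
      induction k with
      | zero =>
        have := (hk 0).1
        rw [← map_one (toDiagram δ), trace_toDiagram, hy.1] at this
        rw [pow_zero]
        exact_mod_cast this.symm
      | succ k ih =>
        have := (hF k).1.eq_mul hl.two_le (hF k).2 ha hb (c := γ ^ k) (γ := γ)
          (fun i => by rw [hsum, pow_add, mul_comm])
        rw [zero_add, add_comm, ih] at this
        rw [this, pow_succ']
    exact R.trace_ext hl hy hχ fun k => by rw [hp, (hk k).1, hpow]; push_cast; rfl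

end FusionRules
end TemperleyLieb

namespace TemperleyLieb

/-! ### Hilbert spaces -/

open scoped ComplexConjugate in
theorem exists_hilbert {V : Type} [AddCommGroup V] [Module ℂ V] (c : InnerProductSpace.Core ℂ V) :
    ∃ (𝓗 : Type) (_ : NormedAddCommGroup 𝓗) (_ : InnerProductSpace ℂ 𝓗) (_ : CompleteSpace 𝓗)
      (Λ : V →ₗ[ℂ] 𝓗), Function.Injective Λ ∧ DenseRange Λ ∧
      ∀ x y, inner ℂ (Λ x) (Λ y) = c.inner x y := by
  let _ := c.toNormedAddCommGroup
  let _ := InnerProductSpace.ofCore c.toCore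
  exact ⟨UniformSpace.Completion V, inferInstance, inferInstance, inferInstance,
    (UniformSpace.Completion.toComplₗᵢ (𝕜 := ℂ) (E := V)).toLinearMap,
    UniformSpace.Completion.coe_injective V, UniformSpace.Completion.denseRange_coe,
    fun x y => UniformSpace.Completion.inner_coe x y⟩

section
variable {E : Type*} [NormedAddCommGroup E] [InnerProductSpace ℂ E]

theorem hasSum_of_orthogonal {v : ℕ → E} {x : E} (h : ∀ i j, i < j → inner ℂ (v i) (v j) = 0)
    (h' : ∀ i, inner ℂ (v i) x = inner ℂ (v i) (v i))
    (hx : Tendsto (fun k => ∑ i ∈ Finset.range k, v i) atTop (𝓝 x)) : HasSum v x := by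
  have horth : ∀ i j, i ≠ j → inner ℂ (v i) (v j) = 0 := fun i j hij => by
    rcases hij.lt_or_gt with h1 | h1
    · exact h i j h1
    · rw [← inner_conj_symm, h j i h1, map_zero]
  have key : ∀ s : Finset ℕ, ‖∑ i ∈ s, v i - x‖ ^ 2 = ‖x‖ ^ 2 - ∑ i ∈ s, ‖v i‖ ^ 2 := fun s => by
    have h1 : inner ℂ (∑ i ∈ s, v i) x = ((∑ i ∈ s, ‖v i‖ ^ 2 : ℝ) : ℂ) := by
      rw [sum_inner, Complex.ofReal_sum]
      exact Finset.sum_congr rfl fun i _ => by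
        rw [h', inner_self_eq_norm_sq_to_K]; norm_cast
    have h2 : inner ℂ (∑ i ∈ s, v i) (∑ i ∈ s, v i) = ((∑ i ∈ s, ‖v i‖ ^ 2 : ℝ) : ℂ) := by
      rw [← h1, sum_inner, sum_inner]
      refine Finset.sum_congr rfl fun i hi => ?_
      rw [inner_sum, Finset.sum_eq_single_of_mem i hi fun j _ hj => horth i j hj.symm, h']
    have h3 := norm_sub_sq (𝕜 := ℂ) (∑ i ∈ s, v i) x
    rw [inner_self_eq_norm_sq_to_K] at h2
    have h2' : ‖∑ i ∈ s, v i‖ ^ 2 = ∑ i ∈ s, ‖v i‖ ^ 2 :=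
      Complex.ofReal_injective (by rw [← h2]; exact Complex.ofReal_pow _ 2)
    rw [h3, h1, h2']
    simp only [RCLike.re_to_complex, Complex.ofReal_re]
    ring
  have hsq : ∀ {F : Type} {f : Filter F} (g : F → Finset ℕ),
      Tendsto (fun k => ∑ i ∈ g k, v i) f (𝓝 x) ↔
        Tendsto (fun k => ∑ i ∈ g k, ‖v i‖ ^ 2) f (𝓝 (‖x‖ ^ 2)) := fun {F f} g => by
    rw [tendsto_iff_norm_sub_tendsto_zero]
    constructor
    · intro h1
      have h2 := (h1.pow 2).const_sub (‖x‖ ^ 2)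
      simpa [key] using h2
    · intro h1
      have h2 := (h1.const_sub (‖x‖ ^ 2)).sqrt
      simp only [← key, Real.sqrt_sq (norm_nonneg _), sub_self, Real.sqrt_zero] at h2
      exact h2
  refine (hsq id).2 ?_
  exact (hasSum_iff_tendsto_nat_of_nonneg (fun i => sq_nonneg _) _).2 ((hsq Finset.range).1 hx)

theorem exists_involution [CompleteSpace E] {B : Type*} [Ring B] [Algebra ℂ B]
    {A : Subalgebra ℂ B} {Λ : B →ₗ[ℂ] E} (hd : DenseRange fun s : A => Λ s) {D : A →ₗ⋆[ℂ] A}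
    (h : ∀ s, ‖Λ (D s)‖ = ‖Λ s‖) (h' : ∀ s, D (D s) = s) :
    ∃ D' : E →ₗ⋆[ℂ] E, Isometry D' ∧ Function.Involutive D' ∧ ∀ s : A, D' (Λ s) = Λ (D s) := by
  set e : A →ₗ[ℂ] E := Λ ∘ₗ A.val.toLinearMap
  replace hd : DenseRange e := hd
  replace h : ∀ s, ‖e (D s)‖ = ‖e s‖ := h
  obtain ⟨g, hext⟩ : ∃ g : E →SL[starRingEnd ℂ] E, ∀ s, g (e s) = e (D s) :=
    ⟨(e.comp D).extendOfNorm e, fun s =>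
      LinearMap.extendOfNorm_eq hd ⟨1, fun s => by rw [one_mul]; exact (h s).le⟩ s⟩
  refine ⟨g.toLinearMap, AddMonoidHomClass.isometry_of_norm g fun x => ?_, fun x => ?_, hext⟩
  · exact hd.induction_on (p := fun x => ‖g x‖ = ‖x‖) x
      (isClosed_eq g.continuous.norm continuous_norm) fun s => by rw [hext, h]
  · exact hd.induction_on (p := fun x => g (g x) = x) x
      (isClosed_eq (g.continuous.comp g.continuous) continuous_id) fun s => by
        rw [hext, hext, h']

end

namespace FusionRules

variable {δ : ℝ} {l : ℕ} (R : FusionRules δ l) {χ : TL δ →ₗ[ℂ] ℂ} {w : ℕ → ℕ → ℝ}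
  (hl : QRoot δ l) (hχ : IsNormalizedTrace χ) (hw : R.HasWeight χ w)

include hl hχ hw in
theorem exists_tendsto_trace (hb : R.IsBounded w) (x y : TL δ) :
    ∃ a, Tendsto (fun n => χ (x * R.transp n y)) atTop (𝓝 a) := by
  have key : ∀ z : TL δ, ∃ a, Tendsto (fun n => χ (z * R.transp n z)) atTop (𝓝 a) := fun z => by
    obtain ⟨n, hz⟩ := TL.exists_mem_fin z
    obtain ⟨r, hr, -⟩ := R.tendsto_normSq hl hχ hw hb n.succ_pos (TL.fin_mono n.le_succ hz)
    refine ⟨r, ((Complex.continuous_ofReal.tendsto _).comp hr).congr' ?_⟩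
    filter_upwards [eventually_ge_atTop (n + 1)] with N hN
    exact (R.trace_mul_transp_self hl hχ hw (by omega) (TL.fin_mono (by omega) hz)).symm
  obtain ⟨a, ha⟩ := key (x + y)
  obtain ⟨b, hb⟩ := key (x - y)
  obtain ⟨c, hc⟩ := key (x + Complex.I • y)
  obtain ⟨d, hd⟩ := key (x - Complex.I • y)
  refine ⟨_, ((ha.sub hb).add ((hc.sub hd).const_mul Complex.I)).const_mul (1 / 4) |>.congr
    fun n => ?_⟩
  simp only [map_add, map_sub, LinearMap.map_smulₛₗ, mul_add, add_mul, mul_sub, sub_mul,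
    smul_mul_assoc, mul_smul_comm, Complex.conj_I, smul_eq_mul, RingHom.id_apply]
  linear_combination (-(1 : ℂ) / 2 * χ (x * R.transp n y) + 1 / 2 * χ (y * R.transp n x)) *
    Complex.I_sq

include hl hχ hw in
theorem exists_core (hb : R.IsBounded w) : ∃ c : InnerProductSpace.Core ℂ (TL δ),
    ∀ x y, Tendsto (fun n => χ (x * R.transp n y)) atTop (𝓝 (c.inner y x)) := by
  choose f hf using R.exists_tendsto_trace hl hχ hw hb
  have hself : ∀ (x : TL δ) (n : ℕ), x ∈ TL.fin δ n → ∃ r : ℝ, f x x = r ∧ 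
      ∀ N, n + 1 ≤ N → R.normSq w N x ≤ r := fun x n hx => by
    obtain ⟨r, hr, h1⟩ := R.tendsto_normSq hl hχ hw hb n.succ_pos (TL.fin_mono n.le_succ hx)
    refine ⟨r, tendsto_nhds_unique (hf x x)
      (((Complex.continuous_ofReal.tendsto _).comp hr).congr' ?_), h1⟩
    filter_upwards [eventually_ge_atTop (n + 1)] with N hN
    exact (R.trace_mul_transp_self hl hχ hw (by omega) (TL.fin_mono (by omega) hx)).symm
  refine ⟨{ inner := fun y x => f x y, conj_inner_symm := ?_, re_inner_nonneg := ?_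
            add_left := ?_, smul_left := ?_, definite := ?_ }, hf⟩
  · intro x y
    obtain ⟨n, hx⟩ := TL.exists_mem_fin x
    obtain ⟨m, hy⟩ := TL.exists_mem_fin y
    refine tendsto_nhds_unique (((Complex.continuous_conj.tendsto _).comp (hf x y)).congr' ?_)
      (hf y x)
    filter_upwards [eventually_ge_atTop (n + m + 1)] with N hN
    exact R.trace_mul_transp_conj hl hχ hw (by omega) (TL.fin_mono (by omega) hx)
      (TL.fin_mono (by omega) hy)
  · intro x
    obtain ⟨n, hx⟩ := TL.exists_mem_fin x
    obtain ⟨r, hr, h1⟩ := hself x n hx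
    change 0 ≤ (f x x).re
    rw [hr, Complex.ofReal_re]
    exact (R.normSq_nonneg hw _ x).trans (h1 _ le_rfl)
  · intro x y z
    refine tendsto_nhds_unique (hf z (x + y)) (((hf z x).add (hf z y)).congr fun n => ?_)
    rw [map_add, mul_add, map_add]
  · intro x y c
    refine tendsto_nhds_unique (hf y (c • x)) (((hf y x).const_mul _).congr fun n => ?_)
    rw [LinearMap.map_smulₛₗ, mul_smul_comm, map_smul, smul_eq_mul]
  · intro x h0
    by_contra hne
    obtain ⟨n, hx⟩ := TL.exists_mem_fin x
    obtain ⟨N, hN, hpos⟩ := R.exists_normSq_pos hl hw n.succ_pos (TL.fin_mono n.le_succ hx) hne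
    obtain ⟨r, hr, h1⟩ := hself x n hx
    have h2 := hpos.trans_le (h1 N hN)
    rw [show f x x = 0 from h0] at hr
    exact h2.ne (Complex.ofReal_injective hr)

section

variable {𝓗 : Type} [NormedAddCommGroup 𝓗] [InnerProductSpace ℂ 𝓗] {Λ : TL δ →ₗ[ℂ] 𝓗}
  (hΛ : ∀ x y, Tendsto (fun n => χ (x * R.transp n y)) atTop (𝓝 (inner ℂ (Λ y) (Λ x))))
include hl hΛ

theorem inner_semisimple {n : ℕ} (hn : 0 < n) {s : TL δ} (hs : s ∈ R.semisimple n) (x : TL δ) :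
    inner ℂ (Λ s) (Λ x) = χ (x * R.transp n s) := by
  refine tendsto_nhds_unique (hΛ x s) (tendsto_const_nhds.congr' ?_)
  filter_upwards [eventually_ge_atTop n] with N hN
  rw [R.transp_of_le hl hn hs hN]

include hχ

theorem inner_sub_comp {n N : ℕ} (hn : 0 < n) (hN : n ≤ N) {s : TL δ} (hs : s ∈ R.semisimple n)
    {x : TL δ} (hx : x ∈ TL.fin δ N) : inner ℂ (Λ s) (Λ (x - R.comp N x)) = 0 := by
  rw [R.inner_semisimple hl hΛ (hn.trans_le hN) (R.semisimple_mono hN hs)]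
  exact R.trace_rad hl hχ (by omega) (mul_mem_rad' (R.sub_comp_mem_rad hl (by omega) hx)
    (R.semisimple_le_fin N (R.transp_mem N s)))

theorem norm_transp {n : ℕ} (hn : 0 < n) {s : TL δ} (hs : s ∈ R.semisimple n) :
    ‖Λ (R.transp n s)‖ = ‖Λ s‖ := by
  have h1 := R.inner_semisimple hl hΛ hn hs s
  have h2 := R.inner_semisimple hl hΛ hn (R.transp_mem n s) (R.transp n s)
  rw [R.transp_transp hl hn hs, hχ.2, ← h1, inner_self_eq_norm_sq_to_K,
    inner_self_eq_norm_sq_to_K] at h2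
  exact (pow_left_inj₀ (norm_nonneg _) (norm_nonneg _) two_ne_zero).1 (by exact_mod_cast h2)

include hw

theorem tendsto_comp (hb : R.IsBounded w) (x : TL δ) :
    Tendsto (fun n => Λ (R.comp n x)) atTop (𝓝 (Λ x)) := by
  obtain ⟨m, hx⟩ := TL.exists_mem_fin x
  obtain ⟨r, hr, -⟩ := R.tendsto_normSq hl hχ hw hb m.succ_pos (TL.fin_mono m.le_succ hx)
  have key : ∀ n, m + 1 ≤ n → ‖Λ (R.comp n x) - Λ x‖ ^ 2 = r - R.normSq w n x := fun n hn => by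
    have h1 : x ∈ TL.fin δ n := TL.fin_mono (by omega) hx
    have h2 := hΛ (x - R.comp n x) (x - R.comp n x)
    have h3 := (Complex.continuous_ofReal.tendsto _).comp (hr.sub_const (R.normSq w n x))
    have h4 := tendsto_nhds_unique h2 (h3.congr' (by
      filter_upwards [eventually_ge_atTop n] with N hN
      have h5 := sub_mem h1 (R.semisimple_le_fin n (R.comp_mem n x))
      rw [R.trace_mul_transp_self hl hχ hw (by omega) (TL.fin_mono hN h5),
        R.normSq_sub_comp hl hχ hw (by omega) hN h1]
      rfl))
    rw [inner_self_eq_norm_sq_to_K] at h4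
    rw [← norm_neg, neg_sub, ← map_sub]
    exact Complex.ofReal_injective ((Complex.ofReal_pow _ 2).trans h4)
  rw [tendsto_iff_norm_sub_tendsto_zero]
  have h1 := (hr.const_sub r).sqrt
  rw [sub_self, Real.sqrt_zero] at h1
  refine h1.congr' ?_
  filter_upwards [eventually_ge_atTop (m + 1)] with n hn
  rw [← key n hn, Real.sqrt_sq (norm_nonneg _)]

theorem denseRange_union (hb : R.IsBounded w) (hd : DenseRange Λ) :
    DenseRange fun s : R.union => Λ s := by
  refine dense_iff_closure_eq.2 (Set.eq_univ_of_univ_subset ?_)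
  rw [← hd.closure_eq]
  refine closure_minimal ?_ isClosed_closure
  rintro _ ⟨x, rfl⟩
  exact mem_closure_of_tendsto (R.tendsto_comp hl hχ hw hΛ hb x) (Eventually.of_forall fun n =>
    ⟨⟨_, R.mem_union_of_mem (R.comp_mem n x)⟩, rfl⟩)

theorem exists_expansion (hb : R.IsBounded w) {n : ℕ} {x : TL δ} (hx : x ∈ TL.rad δ n) :
    ∃ u : ℕ → R.union, (∀ k, (u k : TL δ) ∈ R.semisimple (n + k + 1)) ∧
      (∀ k, x - ∑ i ∈ Finset.range k, (u i : TL δ) ∈ TL.rad δ (n + k)) ∧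
      HasSum (fun k => Λ (u k)) (Λ x) := by
  set p : ℕ → TL δ := fun k => if k = 0 then 0 else R.comp (n + k) x with hp
  have hxf : ∀ k, x ∈ TL.fin δ (n + k) := fun k => TL.fin_mono (by omega) hx.1
  have hmem : ∀ k j, k ≤ j → p k ∈ R.semisimple (n + j) := fun k j hkj => by
    rw [hp]; dsimp only
    split_ifs
    · exact zero_mem _
    · exact R.semisimple_mono (by omega) (R.comp_mem _ x)
  have hu : ∀ k, p (k + 1) - p k ∈ R.semisimple (n + k + 1) := fun k =>
    sub_mem (hmem (k + 1) (k + 1) le_rfl) (hmem k (k + 1) k.le_succ)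
  have hsum : ∀ k, ∑ i ∈ Finset.range k, (p (i + 1) - p i) = p k := fun k => by
    rw [Finset.sum_range_sub, show p 0 = 0 from if_pos rfl, sub_zero]
  have hortho : ∀ k j, k + 1 ≤ j →
      inner ℂ (Λ (p (k + 1) - p k)) (Λ x) = inner ℂ (Λ (p (k + 1) - p k)) (Λ (p j)) := by
    intro k j hkj
    rw [← sub_eq_zero, ← inner_sub_right, ← map_sub,
      show p j = R.comp (n + j) x from if_neg (by omega)]
    exact R.inner_sub_comp hl hχ hΛ (by omega) (by omega) (hu k) (hxf j)
  refine ⟨fun k => ⟨_, R.mem_union_of_mem (hu k)⟩, hu, fun k => ?_, ?_⟩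
  · rw [hsum k]
    by_cases hk : k = 0
    · subst hk; rw [show p 0 = 0 from if_pos rfl, sub_zero]; exact hx
    · rw [show p k = R.comp (n + k) x from if_neg hk]
      exact R.sub_comp_mem_rad hl (by omega) (hxf k)
  · have h0 : ∀ k, inner ℂ (Λ (p (k + 1) - p k)) (Λ (p k)) = 0 := fun k => by
      by_cases hk : k = 0
      · subst hk; rw [show p 0 = 0 from if_pos rfl, map_zero, inner_zero_right]
      rw [← inner_conj_symm, map_sub, inner_sub_right]
      have h1 := R.inner_sub_comp hl hχ hΛ (show 0 < n + k by omega) le_rfl (hmem k k le_rfl) (hxf k)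
      have h2 := R.inner_sub_comp hl hχ hΛ (show 0 < n + k by omega)
        (show n + k ≤ n + (k + 1) by omega) (hmem k k le_rfl) (hxf (k + 1))
      rw [map_sub, inner_sub_right] at h1 h2
      rw [show p (k + 1) = R.comp (n + (k + 1)) x from if_neg (by omega)]
      rw [show p k = R.comp (n + k) x from if_neg hk] at *
      rw [← sub_eq_zero.1 h1, ← sub_eq_zero.1 h2, sub_self, map_zero]
    refine hasSum_of_orthogonal (fun i j hij => ?_) (fun i => ?_) ?_
    · dsimp only
      rw [map_sub Λ (p (j + 1)), inner_sub_right, ← hortho i j hij, ← hortho i (j + 1) (by omega),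
        sub_self]
    · dsimp only
      rw [map_sub Λ, inner_sub_right, ← map_sub Λ, h0, sub_zero, hortho i (i + 1) le_rfl]
    · refine ((tendsto_add_atTop_iff_nat n).2 (R.tendsto_comp hl hχ hw hΛ hb x)).congr' ?_
      filter_upwards [eventually_ge_atTop 1] with k hk
      rw [← map_sum, hsum k, show p k = R.comp (n + k) x from if_neg (by omega), add_comm]

end

end FusionRules
end TemperleyLieb

open TemperleyLieb in
theorem mainTheorem1 (q : ℂ) (l : ℕ) (hl : 2 ≤ l)
    (hq : IsLeast {k : ℕ | 0 < k ∧ q ^ (2 * k) = 1} l)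
    (δ : ℝ) (hδ : (δ : ℂ) = q + q⁻¹) (hδ0 : 0 ≤ δ) :
    Nonempty (FusionRules δ l) ∧
    ∀ R : FusionRules δ l,
      R.IsMatrixDecomposition ∧
      (∃! D : R.union →ₗ⋆[ℂ] R.union, R.IsDiamond D) ∧
      (l = 2 → R.union = ⊤) ∧
      ∀ D : R.union →ₗ⋆[ℂ] R.union, R.IsDiamond D →
        -- `◇` is an involution on the union of the semisimplifications
        (∀ s, D (D s) = s) ∧ (∀ s t, D (s * t) = D t * D s) ∧
        -- the positive extremal traces
        Set.extremePoints ℝ {χ : TL δ →ₗ[ℂ] ℂ | IsNormalizedTrace χ ∧ R.IsPositive D χ} =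
          {χ | IsNormalizedTrace χ ∧ ∃ γ : ℝ, 0 < γ ∧ γ ≤ 1 / 4 ∧ R.HasParameter γ χ} ∧
        (∀ γ : ℝ, ∃! χ : TL δ →ₗ[ℂ] ℂ, IsNormalizedTrace χ ∧ R.HasParameter γ χ) ∧
        (∀ (γ : ℝ) (χ : TL δ →ₗ[ℂ] ℂ), IsNormalizedTrace χ → R.HasParameter γ χ →
          (R.IsPositive D χ ↔ 0 < γ ∧ γ ≤ 1 / 4)) ∧
        -- the Hilbert space, the extension of `◇`, and the expansion of radical elements
        (∀ (γ : ℝ) (χ : TL δ →ₗ[ℂ] ℂ), 0 < γ → γ ≤ 1 / 4 → IsNormalizedTrace χ →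
          R.HasParameter γ χ →
          ∃ (𝓗 : Type) (_ : NormedAddCommGroup 𝓗) (_ : InnerProductSpace ℂ 𝓗)
            (_ : CompleteSpace 𝓗) (Λ : TL δ →ₗ[ℂ] 𝓗) (D' : 𝓗 →ₗ⋆[ℂ] 𝓗),
            Function.Injective Λ ∧ DenseRange Λ ∧
            (∀ x y : TL δ, Tendsto (fun n => χ (x * (D (R.part n y) : TL δ))) atTop
              (𝓝 (inner ℂ (Λ y) (Λ x)))) ∧
            Isometry D' ∧ Function.Involutive D' ∧
            (∀ s : R.union, D' (Λ s) = Λ (D s)) ∧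
            (∀ (n : ℕ) (x : TL δ), x ∈ TL.rad δ n →
              ∃ u : ℕ → R.union,
                (∀ k, (u k : TL δ) ∈ R.semisimple (n + k + 1)) ∧
                (∀ k, x - ∑ i ∈ Finset.range k, (u i : TL δ) ∈ TL.rad δ (n + k)) ∧
                HasSum (fun k => Λ (u k)) (Λ x) ∧
                HasSum (fun k => Λ (D (u k))) (D' (Λ x)))) := by
  have hl' := qRoot_of_isLeast hl hq hδ
  obtain ⟨R₀, -⟩ := exists_fusionRules hl'
  refine ⟨⟨R₀⟩, fun R => ⟨R.isMatrixDecomposition hl', R.existsUnique_diamond hl',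
    R.union_eq_top hl', fun D hD => ⟨hD.involutive hl', hD.mul hl', R.extremePoints_eq hl' hD,
    R.existsUnique_trace hl', fun γ χ hχ h => R.isPositive_iff_of_hasParameter hl' hχ hD h,
    fun γ χ h0 h1 hχ h => ?_⟩⟩⟩
  obtain ⟨w, hw, hb⟩ := (R.isPositive_iff hl' hχ hD).1
    ((R.isPositive_iff_of_hasParameter hl' hχ hD h).2 ⟨h0, h1⟩)
  obtain ⟨c, hc⟩ := R.exists_core hl' hχ hw hb
  obtain ⟨𝓗, i1, i2, i3, Λ, hinj, hdense, hinner⟩ := exists_hilbert c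
  have hΛ : ∀ x y, Tendsto (fun n => χ (x * R.transp n y)) atTop (𝓝 (inner ℂ (Λ y) (Λ x))) :=
    fun x y => (hinner y x).symm ▸ hc x y
  obtain ⟨D', h1, h2, h3⟩ := exists_involution (R.denseRange_union hl' hχ hw hΛ hb hdense)
    (fun s => by
      obtain ⟨n, hn, hs⟩ := R.mem_union.1 s.2
      rw [hD.apply hl' hn hs, R.norm_transp hl' hχ hΛ hn hs]) (hD.involutive hl')
  refine ⟨𝓗, i1, i2, i3, Λ, D', hinj, hdense, fun x y => ?_, h1, h2, h3, fun n x hx => ?_⟩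
  · obtain ⟨n, hy⟩ := TL.exists_mem_fin y
    refine (hΛ x y).congr' ?_
    filter_upwards [eventually_ge_atTop (n + 1)] with N hN
    rw [R.diamond_part hl' hD (by omega) (TL.fin_mono (by omega) hy)]
  · obtain ⟨u, h4, h5, h6⟩ := R.exists_expansion hl' hχ hw hΛ hb hx
    refine ⟨u, h4, h5, h6, ?_⟩
    have h7 := h6.map D' h1.continuous
    simpa only [Function.comp_def, h3] using h7
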